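/- Let $X$ be a closed smooth manifold of dimension $n$. Let $\mathbb{P}_+T^*X=(T^*X\setminus Z)/\mathbb{R}_+$ be the space of cooriented contact elements of $X$, where $Z$ is the zero section, $\mathbb{R}_+$ acts by $(p,q)\mapsto(cp,q)$, and $\tau:T^*X\setminus Z\to\mathbb{P}_+T^*X$ is the projection. Its canonical cooriented contact structure at $\tau(p,q)$ is the cooriented kernel of $p$, regarded as a covector on $\mathbb{P}_+T^*X$ at $\tau(p,q)$ through the projection to $X$. A contact form is a smooth 1-form whose cooriented kernel is this contact structure. Let $\Gamma$ be the group of coorientation preserving contactomorphisms of $\mathbb{P}_+T^*X$ with the $C^\infty$ topology, $\Gamma_0$ its identity component, $G=\Gamma/\Gamma_0$, and let $W$ be the space of contact forms modulo $\Gamma_0$; $G$ acts on $W$ by $[f][\lambda]=[(f^*)^{-1}\lambda]$. Let $K=\mathrm{Diff}(X)/\mathrm{Diff}_0(X)$, where $\mathrm{Diff}_0(X)$ is the identity component of $\mathrm{Diff}(X)$ in the $C^\infty$ topology. Let $j:K\to G$ send the class of a diffeomorphism to the class of its canonical lift to $\mathbb{P}_+T^*X$, and let $I$ send the class of a diffeomorphism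 $e$ to the inverse of the automorphism $e^*$ of $H^1(X,\mathbb{R})$. Let $\mathcal{L}_0$ be the set of embedded Lagrangian submanifolds $L\subset T^*X$ (for $\Omega=dp\wedge dq$) that are diffeomorphic to $X$, are Lagrangian isotopic to the zero section, and for which the projection $L\to X$ induces an isomorphism $i_L:H^1(X,\mathbb{R})\to H^1(L,\mathbb{R})$. For $L\in\mathcal{L}_0$ let $a(L)=i_L^{-1}[p\,dq|_L]\in H^1(X,\mathbb{R})$, and for $U\subset T^*X$ put $\mathrm{Shape}(U)=\{a(L)\mid L\in\mathcal{L}_0,\ L\subset U\}$. For a contact form $\lambda$ put $U_\lambda=\{(p,q)\in T^*X\setminus Z\mid p/\lambda<1\}\cup Z$, where $p/\lambda$ is the ratio, at $\tau(p,q)$, of $p$ regarded as a covector on $\mathbb{P}_+T^*X$ and $\lambda$. Then the maps $j$, $I$ and the action of $G$ on $W$ are well defined, $\mathrm{Shape}(U_\lambda)$ depends only on the class $a\in W$ of $\lambda$ (and is denoted $\mathrm{Shape}(a)$), and for every $u\in K$ and $a\in W$ $$\mathrm{Shape}(j(u)\,a)=I(u)\,\mathrm{Shape}(a).$$ -/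

import Mathlib

open Set Bundle
open scoped Manifold ContDiff Topology

noncomputable section

namespace SymplecticShape

universe u

/-! ## Smooth 1-forms and the first de Rham cohomology -/

section Forms

variable {E H : Type*} [NormedAddCommGroup E] [NormedSpace ℝ E] [TopologicalSpace H]
  {I : ModelWithCorners ℝ E H} {M : Type*} [TopologicalSpace M] [ChartedSpace H M]
  {E' H' : Type*} [NormedAddCommGroup E'] [NormedSpace ℝ E'] [TopologicalSpace H']
  {J : ModelWithCorners ℝ E' H'} {N : Type*} [TopologicalSpace N] [ChartedSpace H' N]

/-- Differential 1-forms on `M` (no regularity is imposed here). -/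
def OneForm (I : ModelWithCorners ℝ E H) (M : Type*) [TopologicalSpace M]
    [ChartedSpace H M] := ∀ x : M, TangentSpace I x →L[ℝ] ℝ

instance : AddCommGroup (OneForm I M) :=
  inferInstanceAs (AddCommGroup (∀ x : M, TangentSpace I x →L[ℝ] ℝ))

instance : Module ℝ (OneForm I M) :=
  inferInstanceAs (Module ℝ (∀ x : M, TangentSpace I x →L[ℝ] ℝ))

namespace OneForm

/-- A 1-form is smooth if it is a smooth function on the tangent bundle. -/
def IsSmooth [IsManifold I ∞ M] (η : OneForm I M) : Prop :=
  ContMDiff I.tangent 𝓘(ℝ, ℝ) ∞ (fun v : TangentBundle I M => η v.1 v.2)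

/-- The pullback `g^* η`. -/
def pullback (g : M → N) (η : OneForm J N) : OneForm I M :=
  fun x => (η (g x)).comp (mfderiv I J g x)

/-- The expression of `η` in the preferred chart at `x₀`: its pullback to the model space under
the inverse of the chart. -/
def chartRep (η : OneForm I M) (x₀ : M) (y : E) : E →L[ℝ] ℝ :=
  (η ((extChartAt I x₀).symm y)).comp (mfderiv 𝓘(ℝ, E) I (extChartAt I x₀).symm y)

/-- The exterior derivative at `x`, computed in the preferred chart at `x`:
`dη(v, w) = ∂_v (η(w)) - ∂_w (η(v))` for constant coordinate vector fields `v`, `w`. -/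
def extDerivCoord (η : OneForm I M) (x : M) (v w : E) : ℝ :=
  fderiv ℝ (fun y => η.chartRep x y w) (extChartAt I x x) v -
    fderiv ℝ (fun y => η.chartRep x y v) (extChartAt I x x) w

/-- The exterior derivative `dη` at `x` as a function of two tangent vectors at `x`. (The tangent
space at `x` is identified with the model space by the preferred chart at `x`.) -/
def extDeriv (η : OneForm I M) (x : M) (v w : TangentSpace I x) : ℝ :=
  η.extDerivCoord x v w

/-- The differential of a function. -/
def differential (f : M → ℝ) : OneForm I M := fun x => mfderiv I 𝓘(ℝ, ℝ) f x

theorem IsSmooth.pullback [IsManifold I ∞ M] [IsManifold J ∞ N] {η : OneForm J N}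
    (h : η.IsSmooth) {g : M → N} (hg : ContMDiff I J ∞ g) :
    (OneForm.pullback g η : OneForm I M).IsSmooth :=
  h.comp (hg.contMDiff_tangentMap le_rfl)

section
variable [I.Boundaryless] [IsManifold I ∞ M]  [FiniteDimensional ℝ E] 

theorem contDiffOn_chartRep {η : OneForm I M} (h : η.IsSmooth) (x₀ : M) :
    ContDiffOn ℝ ∞ (η.chartRep x₀) (extChartAt I x₀).target := by
  rw [contDiffOn_clm_apply]
  intro w
  have ho := isOpen_extChartAt_target (I := I) x₀
  have h1 := (contMDiffOn_extChartAt_symm (I := I) (n := ∞) x₀).contMDiffOn_tangentMapWithin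
    (m := ∞) le_rfl ho.uniqueMDiffOn
  have h2 : ContMDiffOn 𝓘(ℝ, E) 𝓘(ℝ, E).tangent ∞ (fun y : E => (⟨y, w⟩ : TangentBundle 𝓘(ℝ, E) E))
      (extChartAt I x₀).target := by
    apply ContMDiff.contMDiffOn
    intro y
    rw [contMDiffAt_totalSpace]
    refine ⟨contMDiffAt_id, ?_⟩
    simpa using contMDiffAt_const
  have h3 := h.comp_contMDiffOn (h1.comp h2 (fun y hy => hy))
  rw [contMDiffOn_iff_contDiffOn] at h3
  refine h3.congr fun y hy => ?_
  simp only [Function.comp, tangentMapWithin, chartRep]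
  rw [mfderivWithin_of_isOpen ho hy]
  rfl


theorem extDeriv_add {η θ : OneForm I M} (h : η.IsSmooth) (h' : θ.IsSmooth) (x : M)
    (v w : E) :
    (η + θ).extDerivCoord x v w = η.extDerivCoord x v w + θ.extDerivCoord x v w := by
  have hm := extChartAt_target_mem_nhds (I := I) x
  have key : ∀ {η : OneForm I M}, η.IsSmooth → ∀ w : E, DifferentiableAt ℝ
      (fun y => η.chartRep x y w) (extChartAt I x x) := fun h w =>
    (((contDiffOn_chartRep h x).contDiffAt hm).differentiableAt (by simp)).clm_apply
      (differentiableAt_const w)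
  have e : ∀ w : E, fderiv ℝ (fun y => (η + θ).chartRep x y w) (extChartAt I x x) =
      fderiv ℝ (fun y => η.chartRep x y w) (extChartAt I x x) +
      fderiv ℝ (fun y => θ.chartRep x y w) (extChartAt I x x) := fun w =>
    fderiv_add (key h w) (key h' w)
  unfold extDerivCoord
  rw [e, e, add_apply, add_apply]
  ring

theorem extDeriv_smul {η : OneForm I M} (c : ℝ) (h : η.IsSmooth) (x : M)
    (v w : E) : (c • η).extDerivCoord x v w = c * η.extDerivCoord x v w := by
  have hm := extChartAt_target_mem_nhds (I := I) x
  have key : ∀ w : E, DifferentiableAt ℝ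
      (fun y => η.chartRep x y w) (extChartAt I x x) := fun w =>
    (((contDiffOn_chartRep h x).contDiffAt hm).differentiableAt (by simp)).clm_apply
      (differentiableAt_const w)
  have e : ∀ w : E, fderiv ℝ (fun y => (c • η).chartRep x y w) (extChartAt I x x) =
      c • fderiv ℝ (fun y => η.chartRep x y w) (extChartAt I x x) := fun w =>
    fderiv_const_smul (key w) c
  unfold extDerivCoord
  rw [e, e, smul_apply, smul_apply, smul_eq_mul, smul_eq_mul]
  ring

variable [J.Boundaryless] [IsManifold J ∞ N] [FiniteDimensional ℝ E']

theorem extDeriv_pullback {η : OneForm J N} (h : η.IsSmooth) {g : M → N}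
    (hg : ContMDiff I J ∞ g) (x : M) (v w : E) {D : E →L[ℝ] E'} (hD : mfderiv I J g x = D) :
    (OneForm.pullback g η : OneForm I M).extDerivCoord x v w =
      η.extDerivCoord (g x) (D v) (D w) := by
  set G : E → E' := writtenInExtChartAt I J x g with hG
  set y₀ := extChartAt I x x with hy₀
  have hG0 : G y₀ = extChartAt J (g x) (g x) := by
    simp [hG, writtenInExtChartAt, hy₀]
  have hGs : ContDiffAt ℝ ∞ G y₀ := by
    have := ((contMDiffAt_iff (I := I) (I' := J)).1 (hg x)).2
    rwa [I.range_eq_univ, contDiffWithinAt_univ] at this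
  have hd : fderiv ℝ G y₀ = D := by
    have h1 := ((hg x).mdifferentiableAt (by simp)).mfderiv
    rw [I.range_eq_univ, fderivWithin_univ] at h1
    exact h1.symm.trans hD
  -- local expression of the pullback
  have hloc : ∀ᶠ y in 𝓝 y₀, (OneForm.pullback g η : OneForm I M).chartRep x y =
      (η.chartRep (g x) (G y)).comp (fderiv ℝ G y) := by
    have hc : ContinuousAt (fun y => g ((extChartAt I x).symm y)) y₀ := by
      refine ContinuousAt.comp (g := g) ?_ (continuousAt_extChartAt_symm x)
      exact hg.continuous.continuousAt
    have hs : ∀ᶠ y in 𝓝 y₀, g ((extChartAt I x).symm y) ∈ (extChartAt J (g x)).source := by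
      refine hc.eventually_mem ?_
      rw [hy₀, extChartAt_to_inv]
      exact extChartAt_source_mem_nhds (g x)
    have ht : ∀ᶠ y in 𝓝 y₀, y ∈ (extChartAt I x).target := extChartAt_target_mem_nhds x
    filter_upwards [hs.eventually_nhds, ht] with y hy hyt
    have hφ : MDifferentiableAt 𝓘(ℝ, E) I (extChartAt I x).symm y :=
      ((contMDiffOn_extChartAt_symm (I := I) (n := ∞) x).contMDiffAt
        ((isOpen_extChartAt_target x).mem_nhds hyt)).mdifferentiableAt (by simp)
    have hgd : MDifferentiableAt I J g ((extChartAt I x).symm y) :=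
      (hg _).mdifferentiableAt (by simp)
    have hψ : MDifferentiableAt J 𝓘(ℝ, E') (extChartAt J (g x)) (g ((extChartAt I x).symm y)) :=
      (contMDiffAt_extChartAt' (I := J) (n := ∞)
        (by simpa using hy.self_of_nhds)).mdifferentiableAt (by simp)
    have hGy : MDifferentiableAt 𝓘(ℝ, E) 𝓘(ℝ, E') G y :=
      hψ.comp y (hgd.comp y hφ)
    have hψs : MDifferentiableAt 𝓘(ℝ, E') J (extChartAt J (g x)).symm (G y) :=
      ((contMDiffOn_extChartAt_symm (I := J) (n := ∞) (g x)).contMDiffAt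
        ((isOpen_extChartAt_target (g x)).mem_nhds
          ((extChartAt J (g x)).map_source hy.self_of_nhds))).mdifferentiableAt (by simp)
    have heq : (extChartAt J (g x)).symm ∘ G =ᶠ[𝓝 y] g ∘ (extChartAt I x).symm :=
      hy.mono fun y' hy' => (extChartAt J (g x)).left_inv hy'
    have hder : mfderiv 𝓘(ℝ, E) J ((extChartAt J (g x)).symm ∘ G) y =
        mfderiv 𝓘(ℝ, E) J (g ∘ (extChartAt I x).symm) y := heq.mfderiv_eq
    have h1 := mfderiv_comp y hψs hGy
    have h2 := mfderiv_comp y hgd hφ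
    have h3 : ∀ {a b : N} (_ : a = b) (L L' : E →L[ℝ] E') (_ : L = L'),
        ContinuousLinearMap.comp (show E' →L[ℝ] ℝ from η a) L =
        ContinuousLinearMap.comp (show E' →L[ℝ] ℝ from η b) L' := by
      rintro a _ rfl L _ rfl
      rfl
    have h4 := h3 heq.self_of_nhds _ _ hder
    have h5 : ContinuousLinearMap.comp (show E' →L[ℝ] ℝ from η (g ((extChartAt I x).symm y)))
        (show E →L[ℝ] E' from mfderiv 𝓘(ℝ, E) J (g ∘ (extChartAt I x).symm) y) =
        (OneForm.pullback g η : OneForm I M).chartRep x y :=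
      h3 rfl _ _ h2
    have h6 : ContinuousLinearMap.comp
        (show E' →L[ℝ] ℝ from η ((extChartAt J (g x)).symm (G y)))
        (show E →L[ℝ] E' from mfderiv 𝓘(ℝ, E) J ((extChartAt J (g x)).symm ∘ G) y) =
        (η.chartRep (g x) (G y)).comp (mfderiv 𝓘(ℝ, E) 𝓘(ℝ, E') G y) :=
      h3 rfl _ _ h1
    rw [mfderiv_eq_fderiv] at h6
    exact h5.symm.trans (h4.symm.trans h6)
  have e : ∀ w : E, fderiv ℝ (fun y => (OneForm.pullback g η : OneForm I M).chartRep x y w) y₀ =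
      fderiv ℝ (fun y => η.chartRep (g x) (G y) (fderiv ℝ G y w)) y₀ := fun w =>
    Filter.EventuallyEq.fderiv_eq (hloc.mono fun y hy => by
      dsimp only; rw [hy]; rfl)
  have hW : DifferentiableAt ℝ (η.chartRep (g x)) (G y₀) := by
    rw [hG0]
    exact ((contDiffOn_chartRep h (g x)).contDiffAt
      (extChartAt_target_mem_nhds (I := J) (g x))).differentiableAt (by simp)
  have hG1 : DifferentiableAt ℝ G y₀ := hGs.differentiableAt (by simp)
  have hG2 : DifferentiableAt ℝ (fderiv ℝ G) y₀ :=
    (hGs.fderiv_right (m := ∞) le_rfl).differentiableAt (by simp)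
  have hsymm : IsSymmSndFDerivAt ℝ G y₀ := hGs.isSymmSndFDerivAt (by simpa using ENat.LEInfty.out)
  have e2 : ∀ v w : E, fderiv ℝ (fun y => η.chartRep (g x) (G y) (fderiv ℝ G y w)) y₀ v =
      fderiv ℝ (η.chartRep (g x)) (G y₀) (fderiv ℝ G y₀ v) (fderiv ℝ G y₀ w) +
      η.chartRep (g x) (G y₀) (fderiv ℝ (fderiv ℝ G) y₀ v w) := by
    intro v w
    have h1 : HasFDerivAt (fun y => η.chartRep (g x) (G y))
        ((fderiv ℝ (η.chartRep (g x)) (G y₀)).comp (fderiv ℝ G y₀)) y₀ :=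
      hW.hasFDerivAt.comp y₀ hG1.hasFDerivAt
    have h2 := hG2.hasFDerivAt.clm_apply (hasFDerivAt_const w y₀)
    rw [(h1.clm_apply h2).fderiv]
    simp [add_comm]
  have e3 : ∀ v w : E', fderiv ℝ (fun y => η.chartRep (g x) y w) (G y₀) v =
      fderiv ℝ (η.chartRep (g x)) (G y₀) v w := by
    intro v w
    rw [(hW.hasFDerivAt.clm_apply (hasFDerivAt_const w _)).fderiv]
    simp
  unfold extDerivCoord
  rw [← hG0, ← hy₀, e, e, e2, e2, e3, e3, hd, hsymm v w]
  ring

end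

section DeRham

variable [I.Boundaryless] [IsManifold I ∞ M] [FiniteDimensional ℝ E]
  [J.Boundaryless] [IsManifold J ∞ N] [FiniteDimensional ℝ E']

theorem IsSmooth.zero : (0 : OneForm I M).IsSmooth := contMDiff_const

theorem IsSmooth.add {η θ : OneForm I M} (h : η.IsSmooth) (h' : θ.IsSmooth) :
    (η + θ).IsSmooth := ContMDiff.add h h'

theorem IsSmooth.smul {η : OneForm I M} (c : ℝ) (h : η.IsSmooth) :
    (c • η).IsSmooth := contDiff_const_smul c |>.contMDiff.comp h

end DeRham
end OneForm

section DeRham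

variable [I.Boundaryless] [IsManifold I ∞ M] [FiniteDimensional ℝ E]
  [J.Boundaryless] [IsManifold J ∞ N] [FiniteDimensional ℝ E']

variable (I M) in
/-- Smooth closed 1-forms. -/
def closedForms : Submodule ℝ (OneForm I M) where
  carrier := {η | η.IsSmooth ∧ ∀ x v w, η.extDeriv x v w = 0}
  zero_mem' := by
    refine ⟨OneForm.IsSmooth.zero, fun x v w => ?_⟩
    have := OneForm.extDeriv_smul (0 : ℝ) (OneForm.IsSmooth.zero (I := I) (M := M)) x v w
    rwa [zero_smul, zero_mul] at this
  add_mem' := by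
    rintro η θ ⟨h1, h2⟩ ⟨h3, h4⟩
    refine ⟨h1.add h3, fun x v w => ?_⟩
    have := OneForm.extDeriv_add h1 h3 x v w
    exact this.trans (by
      rw [show η.extDerivCoord x v w = 0 from h2 x v w,
        show θ.extDerivCoord x v w = 0 from h4 x v w, add_zero])
  smul_mem' := by
    rintro c η ⟨h1, h2⟩
    refine ⟨h1.smul c, fun x v w => ?_⟩
    have := OneForm.extDeriv_smul c h1 x v w
    exact this.trans (by rw [show η.extDerivCoord x v w = 0 from h2 x v w, mul_zero])

variable (I M) in
/-- Exact 1-forms: differentials of smooth functions. -/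
def exactForms : Submodule ℝ (OneForm I M) where
  carrier := {η | ∃ f : M → ℝ, ContMDiff I 𝓘(ℝ, ℝ) ∞ f ∧ η = OneForm.differential f}
  zero_mem' := ⟨fun _ => 0, contMDiff_const, by
    funext x
    exact (mfderiv_const (I := I) (I' := 𝓘(ℝ, ℝ)) (c := (0 : ℝ))).symm⟩
  add_mem' := by
    rintro _ _ ⟨f, hf, rfl⟩ ⟨g, hg, rfl⟩
    refine ⟨f + g, hf.add hg, ?_⟩
    funext x
    exact (mfderiv_add ((hf x).mdifferentiableAt (by simp))
      ((hg x).mdifferentiableAt (by simp))).symm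
  smul_mem' := by
    rintro c _ ⟨f, hf, rfl⟩
    refine ⟨c • f, (contDiff_const_smul c).contMDiff.comp hf, ?_⟩
    funext x
    exact (const_smul_mfderiv ((hf x).mdifferentiableAt (by simp)) c).symm

variable (I M) in
/-- The de Rham cohomology `H¹(M, ℝ)`. -/
abbrev DeRhamH1 : Type _ :=
  closedForms I M ⧸ (exactForms I M).comap (closedForms I M).subtype

/-- Pullback of closed forms under a smooth map. -/
def pullbackClosed (g : C^∞⟮I, M; J, N⟯) : closedForms J N →ₗ[ℝ] closedForms I M where
  toFun η := ⟨OneForm.pullback g η.1, η.2.1.pullback g.contMDiff, fun x v w =>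
    (OneForm.extDeriv_pullback η.2.1 g.contMDiff x v w rfl).trans (η.2.2 _ _ _)⟩
  map_add' _ _ := rfl
  map_smul' _ _ := rfl

/-- The map `g^* : H¹(N, ℝ) → H¹(M, ℝ)` induced by a smooth map `g : M → N`. -/
def DeRhamH1.map (g : C^∞⟮I, M; J, N⟯) : DeRhamH1 J N →ₗ[ℝ] DeRhamH1 I M :=
  Submodule.mapQ _ _ (pullbackClosed g) (by
    rintro ⟨η, hη⟩ ⟨f, hf, h⟩
    refine ⟨f ∘ g, hf.comp g.contMDiff, ?_⟩
    funext x
    change (η (g x)).comp (mfderiv I J g x) = _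
    rw [show η = OneForm.differential f from h]
    exact (mfderiv_comp x ((hf _).mdifferentiableAt (by simp))
      ((g.contMDiff x).mdifferentiableAt (by simp))).symm)

end DeRham
end Forms

section ContactElements

/-! ## The cotangent bundle and the space of cooriented contact elements -/

/-- The cotangent bundle `T^*X` of an `n`-dimensional manifold. -/
abbrev CotangentBundle (n : ℕ) (X : Type u) [TopologicalSpace X]
    [ChartedSpace (EuclideanSpace ℝ (Fin n)) X] : Type u :=
  TotalSpace (EuclideanSpace ℝ (Fin n) →L[ℝ] ℝ)
    (fun x : X => TangentSpace (𝓡 n) x →L[ℝ] ℝ)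

variable {n : ℕ} {X : Type u} [TopologicalSpace X]
    [ChartedSpace (EuclideanSpace ℝ (Fin n)) X]

/-- `T^*_0 X`: the cotangent bundle without its zero section. -/
abbrev NonzeroCovector (n : ℕ) (X : Type u) [TopologicalSpace X]
    [ChartedSpace (EuclideanSpace ℝ (Fin n)) X] : Type u :=
  {z : CotangentBundle n X // z.2 ≠ 0}

/-- Two nonzero covectors are equivalent if they are in the same orbit of the action
`(p, q) ↦ (c p, q)` of the positive reals. -/
def raySetoid (n : ℕ) (X : Type u) [TopologicalSpace X]
    [ChartedSpace (EuclideanSpace ℝ (Fin n)) X] : Setoid (NonzeroCovector n X) where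
  r z w := ∃ c : ℝ, 0 < c ∧ w.1 = ⟨z.1.1, c • z.1.2⟩
  iseqv := by
    refine ⟨fun z => ⟨1, one_pos, by simp⟩, ?_, ?_⟩
    · rintro ⟨⟨x, p⟩, hp⟩ ⟨w, hw⟩ ⟨c, hc, h⟩
      refine ⟨c⁻¹, inv_pos.2 hc, ?_⟩
      dsimp only at h ⊢
      subst h
      simp [smul_smul, inv_mul_cancel₀ hc.ne']
    · rintro ⟨⟨x, p⟩, hp⟩ ⟨w, hw⟩ ⟨v, hv⟩ ⟨c, hc, h⟩ ⟨d, hd, h'⟩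
      refine ⟨d * c, mul_pos hd hc, ?_⟩
      dsimp only at h h' ⊢
      subst h
      simpa [smul_smul] using h'

/-- The space `P_+T^*X` of cooriented contact elements of `X`: the space of orbits of the positive
reals on `T^*_0 X`. -/
def ContactElementSpace (n : ℕ) (X : Type u) [TopologicalSpace X]
    [ChartedSpace (EuclideanSpace ℝ (Fin n)) X] : Type u :=
  Quotient (raySetoid n X)

/-- The projection `τ : T^*_0 X → P_+T^*X`. -/
def toRay (z : CotangentBundle n X) (hz : z.2 ≠ 0) : ContactElementSpace n X :=
  Quotient.mk (raySetoid n X) ⟨z, hz⟩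

/-- The projection `P_+T^*X → X`. -/
def basePoint (y : ContactElementSpace n X) : X :=
  Quotient.lift (s := raySetoid n X) (fun z => z.1.1) (by
    rintro z w ⟨c, -, h⟩
    simp [h]) y

/-- Model space for the fibres of `P_+T^*X`, of dimension `n - 1`. (For `n = 0` the space
`P_+T^*X` is empty.) -/
abbrev ModelFibre (n : ℕ) : Type := EuclideanSpace ℝ (Fin (n - 1))
/-- Model space for `P_+T^*X`. -/
abbrev Model (n : ℕ) : Type := EuclideanSpace ℝ (Fin n) × ModelFibre n

section
variable [IsManifold (𝓡 n) ∞ X]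

/-- The coordinate expression of a covector in the preferred chart of `X` at `x₀`. -/
def coords (x₀ : X) (z : CotangentBundle n X) : EuclideanSpace ℝ (Fin n) →L[ℝ] ℝ :=
  ContinuousLinearMap.comp (show EuclideanSpace ℝ (Fin n) →L[ℝ] ℝ from z.2)
    (tangentCoordChange (𝓡 n) x₀ z.1 z.1)

/-- The covector at `x` with a given coordinate expression in the preferred chart at `x₀`. -/
def covector (x₀ x : X) (q : EuclideanSpace ℝ (Fin n) →L[ℝ] ℝ) : CotangentBundle n X :=
  ⟨x, show EuclideanSpace ℝ (Fin n) →L[ℝ] ℝ from q.comp (tangentCoordChange (𝓡 n) x x₀ x)⟩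

theorem coords_covector (x₀ x x₁ : X) (q : EuclideanSpace ℝ (Fin n) →L[ℝ] ℝ) (h : x ∈ (chartAt (EuclideanSpace ℝ (Fin n)) x₀).source) 
   (h₁ : x ∈ (chartAt (EuclideanSpace ℝ (Fin n)) x₁).source) :
    coords x₁ (covector x₀ x q) = q.comp (tangentCoordChange (𝓡 n) x₁ x₀ x) := by
  ext v
  have := tangentCoordChange_comp (I := 𝓡 n) (w := x₁) (x := x) (y := x₀) (z := x) (v := v)
    (by simpa using ⟨h₁, h⟩)
  exact congrArg q this

theorem coords_covector_self (x₀ x : X) (q : EuclideanSpace ℝ (Fin n) →L[ℝ] ℝ) (h : x ∈ (chartAt (EuclideanSpace ℝ (Fin n)) x₀).source)  :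
    coords x₀ (covector x₀ x q) = q := by
  rw [coords_covector _ _ _ _ h h]
  ext v
  exact congrArg q (tangentCoordChange_self (I := 𝓡 n) (x := x₀) (z := x) (v := v) (by simpa using h))

theorem covector_coords (x₀ : X) (z : CotangentBundle n X)
    (h : z.1 ∈ (chartAt (EuclideanSpace ℝ (Fin n)) x₀).source)  :
    covector x₀ z.1 (coords x₀ z) = z := by
  obtain ⟨x, p⟩ := z
  refine congrArg (TotalSpace.mk x) ?_
  ext v
  have := tangentCoordChange_comp (I := 𝓡 n) (w := x) (x := x₀) (y := x) (z := x) (v := v)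
    (by simpa using h)
  have h2 := tangentCoordChange_self (I := 𝓡 n) (x := x) (z := x) (v := v) (by simp)
  exact congrArg p (this.trans h2)

theorem coords_smul (x₀ x : X) (c : ℝ) (p : TangentSpace (𝓡 n) x →L[ℝ] ℝ) :
    coords x₀ (⟨x, c • p⟩ : CotangentBundle n X) = c • coords x₀ ⟨x, p⟩ := rfl

/-- Linear coordinates on the coordinate covectors, with one coordinate singled out. Each
`A : AffineIndex n` gives an affine chart of the space of rays: the rays on which the first
coordinate is positive are represented uniquely by covectors with first coordinate `1`. -/
abbrev AffineIndex (n : ℕ) : Type :=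
  (EuclideanSpace ℝ (Fin n) →L[ℝ] ℝ) ≃L[ℝ] ℝ × ModelFibre n

theorem exists_affineIndex {q : EuclideanSpace ℝ (Fin n) →L[ℝ] ℝ} (hq : q ≠ 0) :
    ∃ A : AffineIndex n, A q = (1, 0) := by
  have hn : n ≠ 0 := by
    rintro rfl
    exact hq (Subsingleton.elim _ _)
  have hr : Module.finrank ℝ (EuclideanSpace ℝ (Fin n) →L[ℝ] ℝ) =
      Module.finrank ℝ (ℝ × ModelFibre n) := by
    rw [← (LinearMap.toContinuousLinearMap (𝕜 := ℝ) (E := EuclideanSpace ℝ (Fin n)) (F' := ℝ)).finrank_eq, Module.finrank_linearMap]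
    simp
    omega
  let B : AffineIndex n := ContinuousLinearEquiv.ofFinrankEq hr
  have h1 : B q ≠ 0 := by simpa using hq
  obtain ⟨C, hC⟩ := SeparatingDual.exists_continuousLinearEquiv_apply_eq (R := ℝ) h1
    (show ((1, 0) : ℝ × ModelFibre n) ≠ 0 by simp)
  exact ⟨B.trans C, hC⟩

/-- The affine coordinate of (the ray through) a coordinate covector. -/
def affineFun (A : AffineIndex n) (q : EuclideanSpace ℝ (Fin n) →L[ℝ] ℝ) : ModelFibre n :=
  (A q).1⁻¹ • (A q).2

theorem affineFun_smul (A : AffineIndex n) {c : ℝ} (hc : 0 < c) (q) :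
    affineFun A (c • q) = affineFun A q := by
  simp [affineFun, smul_smul, mul_inv_rev, mul_assoc, inv_mul_cancel₀ hc.ne']


theorem coords_covector_ne (x₀ x : X) {q : EuclideanSpace ℝ (Fin n) →L[ℝ] ℝ} (hq : q ≠ 0)
    (h : x ∈ (chartAt (EuclideanSpace ℝ (Fin n)) x₀).source) :
    (covector x₀ x q).2 ≠ 0 := by
  intro h0
  apply hq
  rw [← coords_covector_self x₀ x q h]
  ext v
  exact congrArg (fun p : TangentSpace (𝓡 n) x →L[ℝ] ℝ => p (tangentCoordChange (𝓡 n) x₀ x x v)) h0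

theorem affineIndex_symm_ne (A : AffineIndex n) (w : ModelFibre n) : A.symm (1, w) ≠ 0 := by
  intro h
  have := congrArg A h
  simp at this

theorem affineFun_symm (A : AffineIndex n) (w : ModelFibre n) :
    affineFun A (A.symm (1, w)) = w := by
  simp [affineFun]

theorem symm_affineFun (A : AffineIndex n) {q : EuclideanSpace ℝ (Fin n) →L[ℝ] ℝ}
    (h : 0 < (A q).1) : A.symm (1, affineFun A q) = (A q).1⁻¹ • q := by
  apply A.injective
  rw [A.apply_symm_apply, map_smul]
  ext1
  · simp [inv_mul_cancel₀ h.ne']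
  · rfl

theorem toRay_eq_iff {z w : CotangentBundle n X} (hz : z.2 ≠ 0) (hw : w.2 ≠ 0) :
    toRay z hz = toRay w hw ↔ ∃ c : ℝ, 0 < c ∧ w = ⟨z.1, c • z.2⟩ :=
  ⟨fun h => Quotient.exact h, fun h => Quotient.sound h⟩

theorem toRay_surj (y : ContactElementSpace n X) : ∃ z, ∃ hz : z.2 ≠ 0, y = toRay z hz := by
  induction y using Quotient.inductionOn with
  | h z => exact ⟨z.1, z.2, rfl⟩

/-- `τ(p, q) ↦ (coordinates of q, affine coordinate of p)`. -/
def affineToFun (x₀ : X) (A : AffineIndex n) (y : ContactElementSpace n X) : Model n :=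
  Quotient.lift (s := raySetoid n X)
    (fun z => (chartAt (EuclideanSpace ℝ (Fin n)) x₀ z.1.1, affineFun A (coords x₀ z.1))) (by
      rintro ⟨⟨x, p⟩, hp⟩ ⟨w, hw⟩ ⟨c, hc, h⟩
      dsimp only at h ⊢
      subst h
      dsimp only
      rw [coords_smul, affineFun_smul A hc]) y

open Classical in
/-- Inverse of `affineToFun`. -/
def affineInvFun (x₀ : X) (A : AffineIndex n) (yw : Model n) : ContactElementSpace n X :=
  if h : (covector x₀ ((chartAt (EuclideanSpace ℝ (Fin n)) x₀).symm yw.1)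
      (A.symm (1, yw.2))).2 ≠ 0 then toRay _ h else
    toRay (covector x₀ x₀ (A.symm (1, 0)))
      (coords_covector_ne _ _ (affineIndex_symm_ne A 0) (mem_chart_source _ x₀))

theorem affineInvFun_of_mem (x₀ : X) (A : AffineIndex n) {yw : Model n}
    (h : yw.1 ∈ (chartAt (EuclideanSpace ℝ (Fin n)) x₀).target) :
    affineInvFun x₀ A yw = toRay (covector x₀ ((chartAt (EuclideanSpace ℝ (Fin n)) x₀).symm yw.1)
      (A.symm (1, yw.2))) (coords_covector_ne _ _ (affineIndex_symm_ne A _)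
        ((chartAt (EuclideanSpace ℝ (Fin n)) x₀).map_target h)) :=
  dif_pos _

/-- The domain of an affine chart. -/
def affineSource (x₀ : X) (A : AffineIndex n) : Set (ContactElementSpace n X) :=
  {y | ∃ z : CotangentBundle n X, ∃ hz : z.2 ≠ 0, y = toRay z hz ∧
      z.1 ∈ (chartAt (EuclideanSpace ℝ (Fin n)) x₀).source ∧ 0 < (A (coords x₀ z)).1}

theorem toRay_mem_affineSource (x₀ : X) (A : AffineIndex n) (z : CotangentBundle n X)
    (hz : z.2 ≠ 0) : toRay z hz ∈ affineSource x₀ A ↔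
      z.1 ∈ (chartAt (EuclideanSpace ℝ (Fin n)) x₀).source ∧ 0 < (A (coords x₀ z)).1 := by
  refine ⟨?_, fun h => ⟨z, hz, rfl, h⟩⟩
  rintro ⟨w, hw, h, h1, h2⟩
  obtain ⟨c, hc, rfl⟩ := (toRay_eq_iff hz hw).1 h
  refine ⟨h1, ?_⟩
  rw [coords_smul, map_smul] at h2
  exact pos_of_mul_pos_right h2 hc.le

/-- The chart of `P_+T^*X` given by a chart of `X` and an affine chart of the space of rays. -/
def affineChart (x₀ : X) (A : AffineIndex n) :
    PartialEquiv (ContactElementSpace n X) (Model n) where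
  toFun := affineToFun x₀ A
  invFun := affineInvFun x₀ A
  source := affineSource x₀ A
  target := (chartAt (EuclideanSpace ℝ (Fin n)) x₀).target ×ˢ univ
  map_source' := by
    rintro y ⟨z, hz, rfl, h1, h2⟩
    exact ⟨(chartAt (EuclideanSpace ℝ (Fin n)) x₀).map_source h1, mem_univ _⟩
  map_target' := by
    rintro ⟨y, w⟩ ⟨h1, -⟩
    have hx := (chartAt (EuclideanSpace ℝ (Fin n)) x₀).map_target h1
    rw [affineInvFun_of_mem x₀ A h1, toRay_mem_affineSource]
    refine ⟨hx, ?_⟩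
    rw [coords_covector_self _ _ _ hx]
    simp
  left_inv' := by
    rintro y ⟨z, hz, rfl, h1, h2⟩
    have ht := (chartAt (EuclideanSpace ℝ (Fin n)) x₀).map_source h1
    change affineInvFun x₀ A (chartAt (EuclideanSpace ℝ (Fin n)) x₀ z.1,
      affineFun A (coords x₀ z)) = _
    rw [affineInvFun_of_mem x₀ A ht, eq_comm, toRay_eq_iff]
    refine ⟨(A (coords x₀ z)).1⁻¹, inv_pos.2 h2, ?_⟩
    dsimp only
    rw [(chartAt (EuclideanSpace ℝ (Fin n)) x₀).left_inv h1, symm_affineFun A h2]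
    exact congrArg (fun z' : CotangentBundle n X =>
      (⟨z'.1, (A (coords x₀ z)).1⁻¹ • z'.2⟩ : CotangentBundle n X)) (covector_coords x₀ z h1)
  right_inv' := by
    rintro ⟨y, w⟩ ⟨h1, -⟩
    have hx := (chartAt (EuclideanSpace ℝ (Fin n)) x₀).map_target h1
    rw [affineInvFun_of_mem x₀ A h1]
    change (chartAt (EuclideanSpace ℝ (Fin n)) x₀ ((chartAt (EuclideanSpace ℝ (Fin n)) x₀).symm y),
      affineFun A (coords x₀ (covector x₀ _ _))) = _
    rw [coords_covector_self _ _ _ hx, affineFun_symm,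
      (chartAt (EuclideanSpace ℝ (Fin n)) x₀).right_inv h1]

/-- Covector part of a change of charts, before passing to rays. -/
def transCovector (x₀ x₁ : X) (A : AffineIndex n) (yw : Model n) :
    EuclideanSpace ℝ (Fin n) →L[ℝ] ℝ :=
  (A.symm (1, yw.2)).comp (tangentCoordChange (𝓡 n) x₁ x₀
    ((chartAt (EuclideanSpace ℝ (Fin n)) x₀).symm yw.1))

theorem mem_trans_source (x₀ x₁ : X) (A B : AffineIndex n) (yw : Model n) :
    yw ∈ ((affineChart x₀ A).symm.trans (affineChart x₁ B)).source ↔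
      yw.1 ∈ ((chartAt (EuclideanSpace ℝ (Fin n)) x₀).symm.trans
        (chartAt (EuclideanSpace ℝ (Fin n)) x₁)).source ∧
      0 < (B (transCovector x₀ x₁ A yw)).1 := by
  have key : ∀ h : yw.1 ∈ (chartAt (EuclideanSpace ℝ (Fin n)) x₀).target,
      (affineInvFun x₀ A yw ∈ affineSource x₁ B ↔
        (chartAt (EuclideanSpace ℝ (Fin n)) x₀).symm yw.1 ∈
          (chartAt (EuclideanSpace ℝ (Fin n)) x₁).source ∧
        0 < (B (transCovector x₀ x₁ A yw)).1) := by
    intro h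
    have hx := (chartAt (EuclideanSpace ℝ (Fin n)) x₀).map_target h
    rw [affineInvFun_of_mem x₀ A h, toRay_mem_affineSource]
    refine and_congr_right fun h1 => ?_
    rw [coords_covector _ _ _ _ hx h1]
    rfl
  rw [PartialEquiv.trans_source, OpenPartialHomeomorph.trans_source]
  constructor
  · rintro ⟨⟨h, -⟩, h'⟩
    obtain ⟨h1, h2⟩ := (key h).1 h'
    exact ⟨⟨h, h1⟩, h2⟩
  · rintro ⟨⟨h, h1⟩, h2⟩
    exact ⟨⟨h, mem_univ _⟩, (key h).2 ⟨h1, h2⟩⟩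

theorem trans_eq (x₀ x₁ : X) (A B : AffineIndex n) {yw : Model n}
    (h : yw ∈ ((affineChart x₀ A).symm.trans (affineChart x₁ B)).source) :
    (affineChart x₀ A).symm.trans (affineChart x₁ B) yw =
      ((chartAt (EuclideanSpace ℝ (Fin n)) x₀).symm.trans
        (chartAt (EuclideanSpace ℝ (Fin n)) x₁) yw.1,
       affineFun B (transCovector x₀ x₁ A yw)) := by
  obtain ⟨⟨h1, h2⟩, -⟩ := (mem_trans_source x₀ x₁ A B yw).1 h
  have hx := (chartAt (EuclideanSpace ℝ (Fin n)) x₀).map_target h1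
  change affineToFun x₁ B (affineInvFun x₀ A yw) = _
  rw [affineInvFun_of_mem x₀ A h1]
  change (_, affineFun B (coords x₁ (covector x₀ _ _))) = _
  rw [coords_covector _ _ _ _ hx h2]
  rfl

theorem contDiffOn_chart_trans (x₀ x₁ : X) :
    ContDiffOn ℝ ∞ ((chartAt (EuclideanSpace ℝ (Fin n)) x₀).symm.trans
        (chartAt (EuclideanSpace ℝ (Fin n)) x₁))
      ((chartAt (EuclideanSpace ℝ (Fin n)) x₀).symm.trans
        (chartAt (EuclideanSpace ℝ (Fin n)) x₁)).source := by
  have := contDiffOn_ext_coord_change (I := 𝓡 n) (n := ∞) x₁ x₀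
  simpa [extChartAt] using this

theorem contDiffOn_transCovector (x₀ x₁ : X) (A : AffineIndex n) :
    ContDiffOn ℝ ∞ (transCovector x₀ x₁ A) (((chartAt (EuclideanSpace ℝ (Fin n)) x₀).symm.trans
        (chartAt (EuclideanSpace ℝ (Fin n)) x₁)).source ×ˢ univ) := by
  have h1 : ContDiffOn ℝ ∞ (fun y : EuclideanSpace ℝ (Fin n) => tangentCoordChange (𝓡 n) x₁ x₀
      ((chartAt (EuclideanSpace ℝ (Fin n)) x₀).symm y))
      ((chartAt (EuclideanSpace ℝ (Fin n)) x₀).symm.trans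
        (chartAt (EuclideanSpace ℝ (Fin n)) x₁)).source := by
    have : IsManifold (𝓡 n) (∞ + 1) X := inferInstanceAs (IsManifold (𝓡 n) ∞ X)
    have h2 := contDiffOn_fderiv_coord_change (I := 𝓡 n) (n := ∞)
      (achart (EuclideanSpace ℝ (Fin n)) x₁) (achart (EuclideanSpace ℝ (Fin n)) x₀)
    refine (h2.comp (contDiffOn_chart_trans x₀ x₁) ?_)
    intro y hy
    have hx := (chartAt (EuclideanSpace ℝ (Fin n)) x₀).map_target hy.1
    have := hy.2
    simp at this
    simp [hx, this]
  have h3 : ContDiffOn ℝ ∞ (fun yw : Model n => A.symm (1, yw.2))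
    (((chartAt (EuclideanSpace ℝ (Fin n)) x₀).symm.trans
        (chartAt (EuclideanSpace ℝ (Fin n)) x₁)).source ×ˢ univ) := by
    apply ContDiff.contDiffOn
    fun_prop
  exact h3.clm_comp (h1.comp contDiffOn_fst (fun yw h => h.1))

theorem isOpen_trans_source (x₀ x₁ : X) (A B : AffineIndex n) :
    IsOpen ((affineChart x₀ A).symm.trans (affineChart x₁ B)).source := by
  have h1 : IsOpen (((chartAt (EuclideanSpace ℝ (Fin n)) x₀).symm.trans
        (chartAt (EuclideanSpace ℝ (Fin n)) x₁)).source ×ˢ (univ : Set (ModelFibre n))) :=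
    (OpenPartialHomeomorph.open_source _).prod isOpen_univ
  have h2 : ContinuousOn (fun yw => (B (transCovector x₀ x₁ A yw)).1)
      (((chartAt (EuclideanSpace ℝ (Fin n)) x₀).symm.trans
        (chartAt (EuclideanSpace ℝ (Fin n)) x₁)).source ×ˢ univ) :=
    continuous_fst.comp_continuousOn
      (B.continuous.comp_continuousOn (contDiffOn_transCovector x₀ x₁ A).continuousOn)
  convert h2.isOpen_inter_preimage h1 (isOpen_Ioi (a := (0 : ℝ))) using 1
  · ext yw
    rw [mem_trans_source]
    simp

theorem contDiffOn_trans (x₀ x₁ : X) (A B : AffineIndex n) :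
    ContDiffOn ℝ ∞ ((affineChart x₀ A).symm.trans (affineChart x₁ B))
      ((affineChart x₀ A).symm.trans (affineChart x₁ B)).source := by
  have hsub : ((affineChart x₀ A).symm.trans (affineChart x₁ B)).source ⊆
      ((chartAt (EuclideanSpace ℝ (Fin n)) x₀).symm.trans
        (chartAt (EuclideanSpace ℝ (Fin n)) x₁)).source ×ˢ univ :=
    fun yw h => ⟨((mem_trans_source x₀ x₁ A B yw).1 h).1, mem_univ _⟩
  refine ContDiffOn.congr ?_ (fun yw h => trans_eq x₀ x₁ A B h)
  refine ContDiffOn.prodMk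
    ((contDiffOn_chart_trans x₀ x₁).comp contDiffOn_fst (fun yw h => (hsub h).1)) ?_
  have h1 : ContDiffOn ℝ ∞ (fun yw => B (transCovector x₀ x₁ A yw))
      ((affineChart x₀ A).symm.trans (affineChart x₁ B)).source :=
    B.contDiff.comp_contDiffOn ((contDiffOn_transCovector x₀ x₁ A).mono hsub)
  exact (h1.fst.inv fun yw h => ((mem_trans_source x₀ x₁ A B yw).1 h).2.ne').smul h1.snd

theorem exists_mem_affineSource (y : ContactElementSpace n X) :
    ∃ A : AffineIndex n, y ∈ affineSource (basePoint y) A := by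
  obtain ⟨z, hz, rfl⟩ := toRay_surj y
  have hc : coords z.1 z ≠ 0 := by
    intro h
    apply hz
    have := covector_coords z.1 z (mem_chart_source _ _)
    rw [← this, h]
    rfl
  obtain ⟨A, hA⟩ := exists_affineIndex hc
  exact ⟨A, (toRay_mem_affineSource _ A z hz).2 ⟨mem_chart_source _ _, by
    change 0 < (A (coords z.1 z)).1
    simp [hA]⟩⟩

/-- The smooth atlas of `P_+T^*X` formed by the charts `affineChart x₀ A`. -/
def chartCore (n : ℕ) (X : Type u) [TopologicalSpace X]
    [ChartedSpace (EuclideanSpace ℝ (Fin n)) X] [IsManifold (𝓡 n) ∞ X] :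
    ChartedSpaceCore (Model n) (ContactElementSpace n X) where
  atlas := {e | ∃ x₀ A, e = affineChart x₀ A}
  chartAt y := affineChart (basePoint y) (exists_mem_affineSource y).choose
  mem_chart_source y := (exists_mem_affineSource y).choose_spec
  chart_mem_atlas y := ⟨_, _, rfl⟩
  open_source := by
    rintro _ _ ⟨x₀, A, rfl⟩ ⟨x₁, B, rfl⟩
    exact isOpen_trans_source x₀ x₁ A B
  continuousOn_toFun := by
    rintro _ _ ⟨x₀, A, rfl⟩ ⟨x₁, B, rfl⟩
    exact (contDiffOn_trans x₀ x₁ A B).continuousOn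

instance : TopologicalSpace (ContactElementSpace n X) := (chartCore n X).toTopologicalSpace
instance : ChartedSpace (Model n) (ContactElementSpace n X) := (chartCore n X).toChartedSpace
instance : IsManifold 𝓘(ℝ, Model n) ∞ (ContactElementSpace n X) := by
  apply isManifold_of_contDiffOn
  intro e e' he he'
  have h : ∀ e ∈ atlas (Model n) (ContactElementSpace n X), ∃ x₀ A,
      e.toPartialEquiv = affineChart x₀ A := by
    intro e he
    obtain ⟨_, ⟨e0, rfl⟩, _, ⟨⟨x₀, A, rfl⟩, rfl⟩, h⟩ := he
    exact ⟨x₀, A, congrArg (fun e => e.toPartialEquiv) h⟩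
  obtain ⟨x₀, A, hA⟩ := h e he
  obtain ⟨x₁, B, hB⟩ := h e' he'
  have := contDiffOn_trans x₀ x₁ A B
  rw [← hA, ← hB] at this
  simpa using this
end

end ContactElements

/-! ## The smooth compact-open topology and groups of diffeomorphisms -/

section Topology

/-- The compact-open topology on maps `M → N`. -/
@[reducible]
def compactOpenTopology (M N : Type u) [TopologicalSpace M] [TopologicalSpace N] :
    TopologicalSpace (M → N) :=
  TopologicalSpace.generateFrom
    {S | ∃ (K : Set M) (U : Set N), IsCompact K ∧ IsOpen U ∧ S = {f | MapsTo f K U}}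

/-- The compact-open `C^k` topology on self-maps of a manifold `M`: the coarsest topology for
which `f ↦ T^i f`, the `i`-th iterated tangent map from `T^i M` to `T^i M`, is continuous for the
compact-open topology, for all `i ≤ k`. -/
@[reducible]
def compactOpenCk : (k : ℕ) → {E H : Type} → [NormedAddCommGroup E] → [NormedSpace ℝ E] →
    [TopologicalSpace H] → (I : ModelWithCorners ℝ E H) → (M : Type u) → [TopologicalSpace M] →
    [ChartedSpace H M] → [IsManifold I ∞ M] → TopologicalSpace (M → M)
  | 0, _, _, _, _, _, _, M, _, _, _ => compactOpenTopology M M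
  | k + 1, _, _, _, _, _, I, M, _, _, _ =>
    compactOpenTopology M M ⊓
      (compactOpenCk k I.tangent (TangentBundle I M)).induced (tangentMap I I)

/-- The `C^∞` compact-open topology on the group of diffeomorphisms of `M`. -/
instance {E H : Type} [NormedAddCommGroup E] [NormedSpace ℝ E] [TopologicalSpace H]
    {I : ModelWithCorners ℝ E H} {M : Type u} [TopologicalSpace M] [ChartedSpace H M]
    [IsManifold I ∞ M] : TopologicalSpace (M ≃ₘ⟮I, I⟯ M) :=
  ⨅ k : ℕ, (compactOpenCk k I M).induced (fun f => (f : M → M))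

end Topology

/-! ## Contact geometry of `P_+T^*X` -/

section Contact

variable (n : ℕ) (X : Type u) [TopologicalSpace X]
  [ChartedSpace (EuclideanSpace ℝ (Fin n)) X] [IsManifold (𝓡 n) ∞ X]

variable {n X} in
/-- A nonzero covector `p` at `q` regarded as a covector on `P_+T^*X` at the point `τ(p, q)`:
a tangent vector is sent to the value of `p` on its projection to `X`. Its cooriented kernel is the
contact hyperplane at `τ(p, q)`. -/
def contactCovector (z : CotangentBundle n X) (hz : z.2 ≠ 0) :
    TangentSpace 𝓘(ℝ, Model n) (toRay z hz) →L[ℝ] ℝ :=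
  ContinuousLinearMap.comp z.2 (mfderiv 𝓘(ℝ, Model n) (𝓡 n) basePoint (toRay z hz))

/-- The cooriented contact structure of `P_+T^*X`, given by the open half-spaces on the positive
side of the contact hyperplanes. (The contact hyperplane consists of the `v` for which neither `v`
nor `-v` is positive, so these half-spaces carry exactly the contact structure together with its
coorientation.) -/
def positiveSide : Set (TangentBundle 𝓘(ℝ, Model n) (ContactElementSpace n X)) :=
  {V | ∃ (z : CotangentBundle n X) (hz : z.2 ≠ 0)
    (v : TangentSpace 𝓘(ℝ, Model n) (toRay z hz)),
    V = ⟨toRay z hz, v⟩ ∧ 0 < contactCovector z hz v}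

/-- Contact forms on `P_+T^*X`: smooth 1-forms whose cooriented kernel is the cooriented contact
structure. -/
structure ContactForm where
  /-- The underlying 1-form. -/
  form : OneForm 𝓘(ℝ, Model n) (ContactElementSpace n X)
  smooth : form.IsSmooth
  pos_iff : ∀ V : TangentBundle 𝓘(ℝ, Model n) (ContactElementSpace n X),
    0 < form V.1 V.2 ↔ V ∈ positiveSide n X

/-- The group `Γ` of coorientation preserving contactomorphisms of `P_+T^*X`, with the `C^∞`
topology. -/
abbrev Contactomorphism : Type u :=
  {f : ContactElementSpace n X ≃ₘ⟮𝓘(ℝ, Model n), 𝓘(ℝ, Model n)⟯ ContactElementSpace n X //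
    ∀ V, tangentMap 𝓘(ℝ, Model n) 𝓘(ℝ, Model n) f V ∈ positiveSide n X ↔ V ∈ positiveSide n X}

/-- The identity contactomorphism. -/
def Contactomorphism.refl : Contactomorphism n X :=
  ⟨Diffeomorph.refl _ _ _, fun V => by
    rw [Diffeomorph.coe_refl, tangentMap_id, id]⟩

variable {n X} in
/-- The contact form `(f^*)⁻¹ α = (f⁻¹)^* α`. -/
def Contactomorphism.pushforward (f : Contactomorphism n X) (α : ContactForm n X) :
    ContactForm n X where
  form := OneForm.pullback f.1.symm α.form
  smooth := α.smooth.pullback f.1.symm.contMDiff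
  pos_iff V := by
    have h1 := α.pos_iff (tangentMap 𝓘(ℝ, Model n) 𝓘(ℝ, Model n) f.1.symm V)
    have h2 := f.2 (tangentMap 𝓘(ℝ, Model n) 𝓘(ℝ, Model n) f.1.symm V)
    have h3 : tangentMap 𝓘(ℝ, Model n) 𝓘(ℝ, Model n) f.1
        (tangentMap 𝓘(ℝ, Model n) 𝓘(ℝ, Model n) f.1.symm V) = V := by
      rw [← tangentMap_comp_at _ (f.1.contMDiff.mdifferentiableAt (by simp))
        (f.1.symm.contMDiff.mdifferentiableAt (by simp))]
      have : (f.1 : ContactElementSpace n X → ContactElementSpace n X) ∘ f.1.symm = id :=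
        funext fun y => f.1.apply_symm_apply y
      rw [this, tangentMap_id, id]
    rw [h3] at h2
    exact h1.trans h2.symm

/-- The contact mapping class group `G = Γ / Γ₀`. The cosets of the identity component `Γ₀` are
the connected components of `Γ`. -/
abbrev ContactMappingClassGroup : Type u := ConnectedComponents (Contactomorphism n X)

/-- The space `W` of contact forms modulo the identity component `Γ₀` of `Γ`. -/
abbrev ContactFormClass : Type u :=
  Quot fun α β : ContactForm n X =>
    ∃ f ∈ connectedComponent (Contactomorphism.refl n X), β = f.pushforward α

/-- The mapping class group `K = Diff(X) / Diff₀(X)`. The cosets of the identity component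
`Diff₀(X)` are the connected components of `Diff(X)`. -/
abbrev MappingClassGroup : Type u := ConnectedComponents (X ≃ₘ⟮𝓡 n, 𝓡 n⟯ X)

variable {n X} in
/-- `f` is the canonical lift of the diffeomorphism `e` of `X` to `P_+T^*X`: it sends the contact
element cooriented by the covector `e^*p` at `q` to the one cooriented by `p` at `e(q)`. -/
def IsCanonicalLift (e : X ≃ₘ⟮𝓡 n, 𝓡 n⟯ X) (f : Contactomorphism n X) : Prop :=
  ∀ (q : X) (p : TangentSpace (𝓡 n) (e q) →L[ℝ] ℝ) (hp : p ≠ 0)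
    (hp' : p.comp (mfderiv (𝓡 n) (𝓡 n) e q) ≠ 0),
    f.1 (toRay ⟨q, p.comp (mfderiv (𝓡 n) (𝓡 n) e q)⟩ hp') = toRay ⟨e q, p⟩ hp

end Contact

/-! ## Lagrangian submanifolds of `T^*X` and shapes -/

section Shape

/-- The model with corners of `T^*X`. -/
abbrev cotangentModel (n : ℕ) := (𝓡 n).prod 𝓘(ℝ, EuclideanSpace ℝ (Fin n) →L[ℝ] ℝ)

variable (n : ℕ) (X : Type u) [TopologicalSpace X]
  [ChartedSpace (EuclideanSpace ℝ (Fin n)) X] [IsManifold (𝓡 n) ∞ X]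

/-- The bundle projection `π : T^*X → X`. -/
def cotangentProj : C^∞⟮cotangentModel n, CotangentBundle n X; 𝓡 n, X⟯ :=
  ⟨TotalSpace.proj, contMDiff_proj _⟩

/-- The canonical 1-form `p dq` of `T^*X`. -/
def liouvilleForm : OneForm (cotangentModel n) (CotangentBundle n X) :=
  fun z => ContinuousLinearMap.comp z.2 (mfderiv (cotangentModel n) (𝓡 n) (cotangentProj n X) z)

/-- The zero section `Z` of `T^*X`. -/
def zeroSection : Set (CotangentBundle n X) := {z | z.2 = 0}

variable {n X}

/-- The standard symplectic form `Ω = dp ∧ dq = d(p dq)` of `T^*X`. -/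
def symplecticForm (z : CotangentBundle n X) (v w : TangentSpace (cotangentModel n) z) : ℝ :=
  (liouvilleForm n X).extDeriv z v w

/-- Smooth Lagrangian embeddings of `X` in `T^*X`. (As `X` is closed, these are the
parametrizations of the embedded Lagrangian submanifolds diffeomorphic to `X`.) -/
structure IsLagrangianEmbedding (g : X → CotangentBundle n X) : Prop where
  contMDiff : ContMDiff (𝓡 n) (cotangentModel n) ∞ g
  isEmbedding : Topology.IsEmbedding g
  injective_mfderiv : ∀ x, Function.Injective (mfderiv (𝓡 n) (cotangentModel n) g x)
  isotropic : ∀ x (v w : TangentSpace (𝓡 n) x), symplecticForm (g x)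
    (mfderiv (𝓡 n) (cotangentModel n) g x v) (mfderiv (𝓡 n) (cotangentModel n) g x w) = 0

variable (n X) in
/-- The family `𝓛` of embedded Lagrangian submanifolds `L` of `T^*X` diffeomorphic to `X` for which
the projection `L → X` induces an isomorphism in first cohomology. -/
def lagrangians : Set (Set (CotangentBundle n X)) :=
  {L | ∃ g : C^∞⟮𝓡 n, X; cotangentModel n, CotangentBundle n X⟯,
    IsLagrangianEmbedding g ∧ range g = L ∧
      Function.Bijective (DeRhamH1.map ((cotangentProj n X).comp g))}

/-- `c ∈ H¹(X, ℝ)` is the class `a(L)`: the pullback of `c` to `L` is the Liouville class of `L`,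
i.e. the class of the restriction of `p dq` to `L`. Here `L` is parametrized by an embedding of
`X`, and cohomology classes of `L` are expressed in this parametrization. -/
def HasLiouvilleClass (L : Set (CotangentBundle n X)) (c : DeRhamH1 (𝓡 n) X) : Prop :=
  ∃ g : C^∞⟮𝓡 n, X; cotangentModel n, CotangentBundle n X⟯,
    IsLagrangianEmbedding g ∧ range g = L ∧
      ∃ η : closedForms (𝓡 n) X, η.1 = OneForm.pullback g (liouvilleForm n X) ∧
        DeRhamH1.map ((cotangentProj n X).comp g) c = Submodule.Quotient.mk η

/-- `L` is Lagrangian isotopic to the zero section: there is a smooth path of Lagrangian embeddings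
of `X` from a parametrization of the zero section to a parametrization of `L`. -/
def IsLagrangianIsotopicToZeroSection (L : Set (CotangentBundle n X)) : Prop :=
  ∃ G : ℝ × X → CotangentBundle n X,
    ContMDiff (𝓘(ℝ, ℝ).prod (𝓡 n)) (cotangentModel n) ∞ G ∧
    (∀ t ∈ Icc (0 : ℝ) 1, IsLagrangianEmbedding fun x => G (t, x)) ∧
    (range fun x => G (0, x)) = zeroSection n X ∧ (range fun x => G (1, x)) = L

/-- The symplectic shape of a subset `U` of `T^*X`: the set of all `a(L)`, where `L` is in `𝓛`,
is Lagrangian isotopic to the zero section, and lies in `U`. -/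
def shape (U : Set (CotangentBundle n X)) : Set (DeRhamH1 (𝓡 n) X) :=
  {c | ∃ L ∈ lagrangians n X, IsLagrangianIsotopicToZeroSection L ∧ L ⊆ U ∧
    HasLiouvilleClass L c}

/-- The domain `U_α = {(p, q) ∈ T^*_0 X | p / α < 1} ∪ Z` of a contact form `α`. -/
def ContactForm.domain (α : ContactForm n X) : Set (CotangentBundle n X) :=
  {z | ∃ hz : z.2 ≠ 0, ∃ r < (1 : ℝ), contactCovector z hz = r • α.form (toRay z hz)} ∪
    zeroSection n X

end Shape

end SymplecticShape

end

noncomputable section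

namespace SymplecticShape

universe u

set_option linter.unusedSectionVars false

/-! ## Families of maps converging together with their iterated tangent maps -/

section Convergence
universe v w z

/-! The claim combines an exact equivariance under Diff(X) with an invariance under Γ₀ that is
proved locally in Γ.

Equivariance. A contactomorphism f has a unique lift to the nonzero covectors that is compatible
with the pairing of covectors with tangent vectors of P_+T^*X (`IsLift`). The lift is homogeneous,
preserves p dq and maps U_λ onto the domain of (f^*)⁻¹λ (`domain_pushforward`). If f is the
canonical lift of a diffeomorphism e, it is the cotangent map (p, q) ↦ ((e^*)⁻¹p, e(q)). This map is
smooth across the zero section Z, preserves Z and covers e, so it carries Lagrangians to Lagrangians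
and a(L) to (e^*)⁻¹a(L) (`IsExactSymplectic.shape_image`, `shape_domain_canonicalLift`).

Invariance under Γ₀. The difficulty is that lifts are in general not smooth along Z. As Γ₀ is a
connected component, it is enough that the shape is a locally constant function of f
(`eventually_shape_domain_eq`); no isotopies are needed. So let G be a homogeneous symplectomorphism
that is C¹-close to the identity off Z. In a chart it has the generating function ⟨P, q⟩ + P(Q - q),
where q is the initial position, P the final momentum and Q the final position. A cutoff in q
applied to P(Q - q) yields H that agrees with G over a small ball and is supported over a larger one
(`exists_localization`). Then H⁻¹G is again close to the identity and fixes the fibres over the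
small ball, so a finite cover of X writes G as a product of such H
(`eventually_isShapeInvariant_of_list`).

For a single H, a second cutoff, in the momentum, makes the generating function smooth across Z
(`IsGenerating.truncate`). By homogeneity the estimates do not depend on the scale of this cutoff. A
set U with the property `IsConicNhd` contains a neighbourhood of Z over the compact support, and at
a small scale the truncated map differs from H only inside U; two bijections that agree off a subset
of U have the same image of U. The truncated map is an exact symplectomorphism and acts trivially on
H¹, because it moves base points only inside a ball on which closed 1-forms have primitives. Hence H
preserves the shape of U (`exists_isShapeInvariant_toConicSymplecto`).

The C^∞ topology is used through `tendsto_diffeomorph_iff`, which turns it into continuous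
convergence of all iterated tangent maps along a filter. Lifting to covectors costs one derivative.
Since e ↦ e^* is locally constant on each class (`eventually_map_eq`) and e ↦ canonical lift is
continuous, I and j descend to components. -/

/-- The family `f` of maps converges to `f₀` at `x` along `F` in the sense of continuous
convergence, together with the iterated tangent maps up to order `k`. -/
def ConvAux {ι : Type w} (F : Filter ι) : (k : ℕ) → {E H : Type} → [NormedAddCommGroup E] →
    [NormedSpace ℝ E] → [TopologicalSpace H] → (I : ModelWithCorners ℝ E H) → (M : Type u) →
    [TopologicalSpace M] → [ChartedSpace H M] → [IsManifold I ∞ M] → {E' H' : Type} →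
    [NormedAddCommGroup E'] → [NormedSpace ℝ E'] → [TopologicalSpace H'] →
    (J : ModelWithCorners ℝ E' H') → (N : Type v) → [TopologicalSpace N] →
    [ChartedSpace H' N] → [IsManifold J ∞ N] → (ι → M → N) → (M → N) → M → Prop
  | 0, _, _, _, _, _, _, M, _, _, _, _, _, _, _, _, _, _, _, _, _, f, f₀, x =>
    Filter.Tendsto (fun p : ι × M => f p.1 p.2) (F ×ˢ 𝓝 x) (𝓝 (f₀ x))
  | k + 1, _, _, _, _, _, I, M, _, _, _, _, _, _, _, _, J, N, _, _, _, f, f₀, x =>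
    Filter.Tendsto (fun p : ι × M => f p.1 p.2) (F ×ˢ 𝓝 x) (𝓝 (f₀ x)) ∧
    ∀ v : TangentSpace I x, ConvAux F k I.tangent (TangentBundle I M) J.tangent (TangentBundle J N)
      (fun i => tangentMap I J (f i)) (tangentMap I J f₀) ⟨x, v⟩

variable {ι : Type w} {F : Filter ι} {k : ℕ}
  {E H : Type} [NormedAddCommGroup E] [NormedSpace ℝ E] [TopologicalSpace H]
  {I : ModelWithCorners ℝ E H} {M : Type u} [TopologicalSpace M] [ChartedSpace H M]
  [IsManifold I ∞ M]
  {E' H' : Type} [NormedAddCommGroup E'] [NormedSpace ℝ E'] [TopologicalSpace H']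
  {J : ModelWithCorners ℝ E' H'} {N : Type v} [TopologicalSpace N] [ChartedSpace H' N]
  [IsManifold J ∞ N]
  {E'' H'' : Type} [NormedAddCommGroup E''] [NormedSpace ℝ E''] [TopologicalSpace H'']
  {J' : ModelWithCorners ℝ E'' H''} {N' : Type z} [TopologicalSpace N'] [ChartedSpace H'' N']
  [IsManifold J' ∞ N']

variable (F k I J) in
/-- `C^k`-convergence at a point of a family of maps that are smooth near that point. -/
structure SConv (f : ι → M → N) (f₀ : M → N) (x : M) : Prop where
  smooth₀ : ∀ᶠ y in 𝓝 x, ContMDiffAt I J ∞ f₀ y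
  smooth : ∀ᶠ p in F ×ˢ 𝓝 x, ContMDiffAt I J ∞ (f p.1) p.2
  conv : ConvAux F k I M J N f f₀ x

theorem eventually_prod_nhds {α : Type*} [TopologicalSpace α] {x : α} {P : ι → α → Prop}
    (h : ∀ᶠ p in F ×ˢ 𝓝 x, P p.1 p.2) : ∀ᶠ p in F ×ˢ 𝓝 x, ∀ᶠ y in 𝓝 p.2, P p.1 y := by
  obtain ⟨A, hA, B, hB, h⟩ := Filter.eventually_prod_iff.1 h
  refine Filter.eventually_prod_iff.2 ⟨A, hA, _, hB.eventually_nhds, ?_⟩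
  intro i hi y hy
  exact hy.mono fun y' hy' => h hi hy'

theorem eventually_prod_tangent {x : M} {P : ι → M → Prop} (h : ∀ᶠ p in F ×ˢ 𝓝 x, P p.1 p.2)
    (v : TangentSpace I x) :
    ∀ᶠ p : ι × TangentBundle I M in F ×ˢ 𝓝 (⟨x, v⟩ : TangentBundle I M), P p.1 p.2.1 := by
  have h1 : Filter.Tendsto (fun V : TangentBundle I M => V.1) (𝓝 ⟨x, v⟩) (𝓝 x) :=
    (FiberBundle.continuous_proj E (TangentSpace I : M → Type)).tendsto _
  exact (Filter.tendsto_id.prodMap h1).eventually h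

/-- At order ∞, smoothness at one point need not give a single neighbourhood on which the map is
smooth. The hypothesis is therefore made near the point, and `SConv` carries the same kind of
condition. -/
theorem contMDiffAt_tangentMap {f : M → N} {V : TangentBundle I M}
    (h : ∀ᶠ y in 𝓝 V.1, ContMDiffAt I J ∞ f y) :
    ContMDiffAt I.tangent J.tangent ∞ (tangentMap I J f) V := by
  obtain ⟨s, hs, ho, hx⟩ := eventually_nhds_iff.1 h
  have h1 : ContMDiffOn I J ∞ f s := fun y hy => (hs y hy).contMDiffWithinAt
  have h2 := h1.contMDiffOn_tangentMapWithin (m := ∞) le_rfl ho.uniqueMDiffOn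
  have ho' : IsOpen (TotalSpace.proj ⁻¹' s : Set (TangentBundle I M)) :=
    ho.preimage (FiberBundle.continuous_proj E (TangentSpace I : M → Type))
  refine (h2.contMDiffAt (ho'.mem_nhds hx)).congr_of_eventuallyEq ?_
  filter_upwards [ho'.mem_nhds hx] with W hW
  exact (tangentMapWithin_eq_tangentMap (ho.uniqueMDiffWithinAt hW)
    ((hs _ hW).mdifferentiableAt (by simp))).symm

namespace SConv

theorem tendsto {f : ι → M → N} {f₀ : M → N} {x : M} (h : SConv F k I J f f₀ x) :
    Filter.Tendsto (fun p : ι × M => f p.1 p.2) (F ×ˢ 𝓝 x) (𝓝 (f₀ x)) := by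
  cases k with
  | zero => exact h.conv
  | succ k => exact h.conv.1

theorem of_zero {f : ι → M → N} {f₀ : M → N} {x : M} (h : SConv F k I J f f₀ x) :
    SConv F 0 I J f f₀ x := ⟨h.smooth₀, h.smooth, h.tendsto⟩

theorem tangent {f : ι → M → N} {f₀ : M → N} {x : M} (h : SConv F (k + 1) I J f f₀ x)
    (v : TangentSpace I x) :
    SConv F k I.tangent J.tangent (fun i => tangentMap I J (f i)) (tangentMap I J f₀)
      (⟨x, v⟩ : TangentBundle I M) := by
  refine ⟨?_, ?_, h.conv.2 v⟩
  · have h1 := h.smooth₀.eventually_nhds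
    exact ((FiberBundle.continuous_proj E (TangentSpace I : M → Type)).tendsto
      (⟨x, v⟩ : TangentBundle I M)).eventually h1 |>.mono
      fun V hV => contMDiffAt_tangentMap hV
  · have h1 := eventually_prod_tangent (I := I) (P := fun i y => ∀ᶠ y' in 𝓝 y, ContMDiffAt I J ∞ (f i) y')
      (eventually_prod_nhds (P := fun i y => ContMDiffAt I J ∞ (f i) y) h.smooth) v
    exact h1.mono fun p hp => contMDiffAt_tangentMap hp

theorem succ {f : ι → M → N} {f₀ : M → N} {x : M} (h : SConv F 0 I J f f₀ x)
    (h' : ∀ v : TangentSpace I x, SConv F k I.tangent J.tangent (fun i => tangentMap I J (f i))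
      (tangentMap I J f₀) (⟨x, v⟩ : TangentBundle I M)) : SConv F (k + 1) I J f f₀ x :=
  ⟨h.smooth₀, h.smooth, h.conv, fun v => (h' v).conv⟩

theorem congr {f f' : ι → M → N} {f₀ f₀' : M → N} {x : M} (h : SConv F k I J f f₀ x)
    (h₁ : ∀ᶠ p in F ×ˢ 𝓝 x, f' p.1 p.2 = f p.1 p.2) (h₂ : f₀' =ᶠ[𝓝 x] f₀) :
    SConv F k I J f' f₀' x := by
  induction k generalizing E H M E' H' N with
  | zero =>
    refine ⟨?_, ?_, ?_⟩
    · filter_upwards [h₂.eventually_nhds, h.smooth₀] with y hy hy'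
      exact hy'.congr_of_eventuallyEq hy
    · filter_upwards [eventually_prod_nhds (P := fun i y => f' i y = f i y) h₁, h.smooth] with y hy hy'
      exact hy'.congr_of_eventuallyEq hy
    · change Filter.Tendsto _ _ _
      rw [h₂.self_of_nhds]
      exact h.tendsto.congr' (h₁.mono fun _ h => h.symm)
  | succ k ih =>
    have h0 : SConv F 0 I J f' f₀' x := by
      refine ⟨?_, ?_, ?_⟩
      · filter_upwards [h₂.eventually_nhds, h.smooth₀] with y hy hy'
        exact hy'.congr_of_eventuallyEq hy
      · filter_upwards [eventually_prod_nhds (P := fun i y => f' i y = f i y) h₁, h.smooth] with y hy hy'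
        exact hy'.congr_of_eventuallyEq hy
      · change Filter.Tendsto _ _ _
        rw [h₂.self_of_nhds]
        exact h.tendsto.congr' (h₁.mono fun _ h => h.symm)
    refine h0.succ fun v => ih (h.tangent v) ?_ ?_
    · refine (eventually_prod_tangent (P := fun i y => f' i =ᶠ[𝓝 y] f i)
        (eventually_prod_nhds (P := fun i y => f' i y = f i y) h₁) v).mono fun p hp => ?_
      have hp : f' p.1 =ᶠ[𝓝 p.2.1] f p.1 := hp
      simp only [tangentMap]
      rw [hp.mfderiv_eq, hp.self_of_nhds]
    · have := ((FiberBundle.continuous_proj E (TangentSpace I : M → Type)).tendsto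
        (⟨x, v⟩ : TangentBundle I M)).eventually h₂.eventually_nhds
      refine this.mono fun V hV => ?_
      have hV : f₀' =ᶠ[𝓝 V.1] f₀ := hV
      simp only [tangentMap]
      rw [hV.mfderiv_eq, hV.self_of_nhds]

theorem const {f : M → N} {x : M} (h : ∀ᶠ y in 𝓝 x, ContMDiffAt I J ∞ f y) :
    SConv F k I J (fun _ : ι => f) f x := by
  -- Order zero is treated for arbitrary manifolds because the induction on `k` replaces `M` and `N`
  -- by their tangent bundles.
  have h0 : ∀ {E H : Type} [NormedAddCommGroup E] [NormedSpace ℝ E] [TopologicalSpace H]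
      {I : ModelWithCorners ℝ E H} {M : Type u} [TopologicalSpace M] [ChartedSpace H M]
      [IsManifold I ∞ M]
      {E' H' : Type} [NormedAddCommGroup E'] [NormedSpace ℝ E'] [TopologicalSpace H']
      {J : ModelWithCorners ℝ E' H'} {N : Type v} [TopologicalSpace N] [ChartedSpace H' N]
      [IsManifold J ∞ N] {f : M → N} {x : M} (h : ∀ᶠ y in 𝓝 x, ContMDiffAt I J ∞ f y),
      SConv F 0 I J (fun _ : ι => f) f x := by
    intro E H _ _ _ I M _ _ _ E' H' _ _ _ J N _ _ _ f x h
    exact ⟨h, Filter.tendsto_snd.eventually h,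
      h.self_of_nhds.continuousAt.tendsto.comp Filter.tendsto_snd⟩
  induction k generalizing E H M E' H' N with
  | zero => exact h0 h
  | succ k ih =>
    refine (h0 h).succ fun v => ih ?_
    exact ((FiberBundle.continuous_proj E (TangentSpace I : M → Type)).tendsto
      (⟨x, v⟩ : TangentBundle I M)).eventually h.eventually_nhds |>.mono
      fun V hV => contMDiffAt_tangentMap hV

theorem tendsto_prodMk {f : ι → M → N} {f₀ : M → N} {x : M} (h : SConv F k I J f f₀ x) :
    Filter.Tendsto (fun p : ι × M => (p.1, f p.1 p.2)) (F ×ˢ 𝓝 x) (F ×ˢ 𝓝 (f₀ x)) :=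
  Filter.tendsto_fst.prodMk h.tendsto

/-- Convergence along `F ×ˢ 𝓝 x`, unlike pointwise convergence, is stable under composition when
both factors vary. Higher orders follow from the chain rule, applied to tangent maps. -/
theorem comp {g : ι → N → N'} {g₀ : N → N'} {f : ι → M → N} {f₀ : M → N} {x : M}
    (hg : SConv F k J J' g g₀ (f₀ x)) (hf : SConv F k I J f f₀ x) :
    SConv F k I J' (fun i y => g i (f i y)) (fun y => g₀ (f₀ y)) x := by
  have h0 : ∀ {E H : Type} [NormedAddCommGroup E] [NormedSpace ℝ E] [TopologicalSpace H]
      {I : ModelWithCorners ℝ E H} {M : Type u} [TopologicalSpace M] [ChartedSpace H M]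
      [IsManifold I ∞ M]
      {E' H' : Type} [NormedAddCommGroup E'] [NormedSpace ℝ E'] [TopologicalSpace H']
      {J : ModelWithCorners ℝ E' H'} {N : Type v} [TopologicalSpace N] [ChartedSpace H' N]
      [IsManifold J ∞ N]
      {E'' H'' : Type} [NormedAddCommGroup E''] [NormedSpace ℝ E''] [TopologicalSpace H'']
      {J' : ModelWithCorners ℝ E'' H''} {N' : Type z} [TopologicalSpace N'] [ChartedSpace H'' N']
      [IsManifold J' ∞ N'] {g : ι → N → N'} {g₀ : N → N'} {f : ι → M → N} {f₀ : M → N} {x : M}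
      (_ : SConv F 0 J J' g g₀ (f₀ x)) (_ : SConv F 0 I J f f₀ x),
      SConv F 0 I J' (fun i y => g i (f i y)) (fun y => g₀ (f₀ y)) x := by
    intro E H _ _ _ I M _ _ _ E' H' _ _ _ J N _ _ _ E'' H'' _ _ _ J' N' _ _ _ g g₀ f f₀ x hg hf
    refine ⟨?_, ?_, hg.tendsto.comp hf.tendsto_prodMk⟩
    · filter_upwards [hf.smooth₀,
        hf.smooth₀.self_of_nhds.continuousAt.tendsto.eventually hg.smooth₀] with y h1 h2
      exact ContMDiffAt.comp y h2 h1
    · filter_upwards [hf.smooth, hf.tendsto_prodMk.eventually hg.smooth] with p h1 h2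
      exact ContMDiffAt.comp p.2 h2 h1
  induction k generalizing E H M E' H' N E'' H'' N' with
  | zero => exact h0 hg hf
  | succ k ih =>
    refine (h0 hg.of_zero hf.of_zero).succ fun v => ?_
    have h1 : SConv F k J.tangent J'.tangent (fun i => tangentMap J J' (g i)) (tangentMap J J' g₀)
      (tangentMap I J f₀ ⟨x, v⟩) := hg.tangent _
    refine (ih h1 (hf.tangent v)).congr ?_ ?_
    · have h2 := eventually_prod_tangent (I := I) (P := fun i y => ContMDiffAt I J ∞ (f i) y)
        hf.smooth v
      have h3 := eventually_prod_tangent (I := I) (P := fun i y => ContMDiffAt J J' ∞ (g i) (f i y))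
        (hf.tendsto_prodMk.eventually hg.smooth) v
      filter_upwards [h2, h3] with p h2 h3
      exact tangentMap_comp_at p.2 (h3.mdifferentiableAt (by simp))
        (h2.mdifferentiableAt (by simp))
    · have h2 := ((FiberBundle.continuous_proj E (TangentSpace I : M → Type)).tendsto
        (⟨x, v⟩ : TangentBundle I M)).eventually hf.smooth₀
      have h3 := ((FiberBundle.continuous_proj E (TangentSpace I : M → Type)).tendsto
        (⟨x, v⟩ : TangentBundle I M)).eventually
          (hf.smooth₀.self_of_nhds.continuousAt.tendsto.eventually hg.smooth₀)
      filter_upwards [h2, h3] with p h2 h3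
      exact tangentMap_comp_at p (h3.mdifferentiableAt (by simp))
        (h2.mdifferentiableAt (by simp))

theorem prodMk {g : ι → M → N'} {g₀ : M → N'} {f : ι → M → N} {f₀ : M → N} {x : M}
    (hf : SConv F k I J f f₀ x) (hg : SConv F k I J' g g₀ x) :
    SConv F k I (J.prod J') (fun i y => (f i y, g i y)) (fun y => (f₀ y, g₀ y)) x := by
  have h0 : ∀ {E H : Type} [NormedAddCommGroup E] [NormedSpace ℝ E] [TopologicalSpace H]
      {I : ModelWithCorners ℝ E H} {M : Type u} [TopologicalSpace M] [ChartedSpace H M]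
      [IsManifold I ∞ M]
      {E' H' : Type} [NormedAddCommGroup E'] [NormedSpace ℝ E'] [TopologicalSpace H']
      {J : ModelWithCorners ℝ E' H'} {N : Type v} [TopologicalSpace N] [ChartedSpace H' N]
      [IsManifold J ∞ N]
      {E'' H'' : Type} [NormedAddCommGroup E''] [NormedSpace ℝ E''] [TopologicalSpace H'']
      {J' : ModelWithCorners ℝ E'' H''} {N' : Type z} [TopologicalSpace N'] [ChartedSpace H'' N']
      [IsManifold J' ∞ N'] {g : ι → M → N'} {g₀ : M → N'} {f : ι → M → N} {f₀ : M → N} {x : M}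
      (_ : SConv F 0 I J f f₀ x) (_ : SConv F 0 I J' g g₀ x),
      SConv F 0 I (J.prod J') (fun i y => (f i y, g i y)) (fun y => (f₀ y, g₀ y)) x := by
    intro E H _ _ _ I M _ _ _ E' H' _ _ _ J N _ _ _ E'' H'' _ _ _ J' N' _ _ _ g g₀ f f₀ x hf hg
    refine ⟨?_, ?_, ?_⟩
    · filter_upwards [hf.smooth₀, hg.smooth₀] with y h1 h2 using h1.prodMk h2
    · filter_upwards [hf.smooth, hg.smooth] with y h1 h2 using h1.prodMk h2
    · exact hf.tendsto.prodMk_nhds hg.tendsto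
  induction k generalizing E H M E' H' N E'' H'' N' with
  | zero => exact h0 hf hg
  | succ k ih =>
    refine (h0 hf.of_zero hg.of_zero).succ fun v => ?_
    have h1 := ih (hf.tangent v) (hg.tangent v)
    -- The tangent map of a pair takes values in the tangent bundle of a product. The induction
    -- hypothesis gives a pair of tangent maps, so the smooth identification of the two bundles is
    -- composed with it.
    have h2 : SConv F k (J.tangent.prod J'.tangent) (J.prod J').tangent
        (fun _ : ι => (equivTangentBundleProd J N J' N').symm)
        (equivTangentBundleProd J N J' N').symm
        (tangentMap I J f₀ ⟨x, v⟩, tangentMap I J' g₀ ⟨x, v⟩) :=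
      const (Filter.Eventually.of_forall fun y => contMDiff_equivTangentBundleProd_symm y)
    refine (comp (f₀ := fun y => (tangentMap I J f₀ y, tangentMap I J' g₀ y)) h2 h1).congr ?_ ?_
    · filter_upwards [eventually_prod_tangent (I := I) (P := fun i y => ContMDiffAt I J ∞ (f i) y)
          hf.smooth v,
        eventually_prod_tangent (I := I) (P := fun i y => ContMDiffAt I J' ∞ (g i) y)
          hg.smooth v] with p h2 h3
      simp only [tangentMap, equivTangentBundleProd]
      rw [mfderiv_prodMk (h2.mdifferentiableAt (by simp)) (h3.mdifferentiableAt (by simp))]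
      rfl
    · have hc := (FiberBundle.continuous_proj E (TangentSpace I : M → Type)).tendsto
        (⟨x, v⟩ : TangentBundle I M)
      filter_upwards [hc.eventually hf.smooth₀, hc.eventually hg.smooth₀] with p h2 h3
      simp only [tangentMap, equivTangentBundleProd]
      rw [mfderiv_prodMk (h2.mdifferentiableAt (by simp)) (h3.mdifferentiableAt (by simp))]
      rfl

/-- Post-composition with a fixed map that is smooth near the limit point. -/
theorem map {g : N → N'} {f : ι → M → N} {f₀ : M → N} {x : M} (hf : SConv F k I J f f₀ x)
    (hg : ∀ᶠ y in 𝓝 (f₀ x), ContMDiffAt J J' ∞ g y) :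
    SConv F k I J' (fun i y => g (f i y)) (fun y => g (f₀ y)) x :=
  (const hg).comp hf

/-- Pre-composition with a fixed map that is smooth near the point. -/
theorem precomp {g : ι → N → N'} {g₀ : N → N'} {f : M → N} {x : M}
    (hg : SConv F k J J' g g₀ (f x)) (hf : ∀ᶠ y in 𝓝 x, ContMDiffAt I J ∞ f y) :
    SConv F k I J' (fun i y => g i (f y)) (fun y => g₀ (f y)) x :=
  hg.comp (const hf)

theorem contMDiffAt {f : ι → M → N} {f₀ : M → N} {x : M} (h : SConv F k I J f f₀ x) :
    ContMDiffAt I J ∞ f₀ x := h.smooth₀.self_of_nhds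

end SConv
end Convergence

section Convergence
universe v w z

/-! ### Convergence of maps between vector spaces and of their derivatives. -/

section VectorSpaces
variable {ι : Type w} {F : Filter ι} {k : ℕ}
  {E H : Type} [NormedAddCommGroup E] [NormedSpace ℝ E] [TopologicalSpace H]
  {I : ModelWithCorners ℝ E H} {M : Type u} [TopologicalSpace M] [ChartedSpace H M]
  [IsManifold I ∞ M]
  {V W : Type} [NormedAddCommGroup V] [NormedSpace ℝ V] [NormedAddCommGroup W] [NormedSpace ℝ W]
  {W' : Type} [NormedAddCommGroup W'] [NormedSpace ℝ W']

namespace SConv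

theorem map_contDiffAt {g : V → W} {f : ι → M → V} {f₀ : M → V} {x : M}
    (hf : SConv F k I 𝓘(ℝ, V) f f₀ x) {s : Set V} (hs : IsOpen s) (hx : f₀ x ∈ s)
    (hg : ContDiffOn ℝ ∞ g s) :
    SConv F k I 𝓘(ℝ, W) (fun i y => g (f i y)) (fun y => g (f₀ y)) x :=
  hf.map (by
    filter_upwards [hs.mem_nhds hx] with y hy
    exact (hg.contDiffAt (hs.mem_nhds hy)).contMDiffAt)

theorem map_contDiff {g : V → W} {f : ι → M → V} {f₀ : M → V} {x : M}
    (hf : SConv F k I 𝓘(ℝ, V) f f₀ x) (hg : ContDiff ℝ ∞ g) :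
    SConv F k I 𝓘(ℝ, W) (fun i y => g (f i y)) (fun y => g (f₀ y)) x :=
  hf.map_contDiffAt isOpen_univ (mem_univ _) hg.contDiffOn

theorem prodMk_vec {f : ι → M → V} {f₀ : M → V} {g : ι → M → W} {g₀ : M → W} {x : M}
    (hf : SConv F k I 𝓘(ℝ, V) f f₀ x) (hg : SConv F k I 𝓘(ℝ, W) g g₀ x) :
    SConv F k I 𝓘(ℝ, V × W) (fun i y => (f i y, g i y)) (fun y => (f₀ y, g₀ y)) x := by
  -- The product model and the model of the vector space `V × W` are equal but not by unfolding; the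
  -- identity passes from one to the other.
  have h : SConv F k (𝓘(ℝ, V).prod 𝓘(ℝ, W)) 𝓘(ℝ, V × W) (fun _ : ι => (id : V × W → V × W)) id
      (f₀ x, g₀ x) := by
    refine const (Filter.Eventually.of_forall fun y => ?_)
    rw [modelWithCornersSelf_prod, ← chartedSpaceSelf_prod]
    exact contMDiffAt_id
  exact SConv.comp (f₀ := fun y => (f₀ y, g₀ y)) h (hf.prodMk hg)

theorem sum {α : Type*} (s : Finset α) {f : α → ι → M → V} {f₀ : α → M → V} {x : M}
    (h : ∀ a ∈ s, SConv F k I 𝓘(ℝ, V) (f a) (f₀ a) x) :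
    SConv F k I 𝓘(ℝ, V) (fun i y => ∑ a ∈ s, f a i y) (fun y => ∑ a ∈ s, f₀ a y) x := by
  classical
  induction s using Finset.induction_on with
  | empty =>
    simp only [Finset.sum_empty]
    exact const (Filter.Eventually.of_forall fun y => contMDiffAt_const)
  | insert a s ha ih =>
    simp only [Finset.sum_insert ha]
    exact ((h a (by simp)).prodMk_vec (ih fun b hb => h b (by simp [hb]))).map_contDiff
      (g := fun p : V × V => p.1 + p.2) (by fun_prop)

/-- Directional derivatives of a `C^{k+1}`-convergent family converge in `C^k`. -/
theorem fderiv_apply {f : ι → V → W} {f₀ : V → W} {x : V}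
    (h : SConv F (k + 1) 𝓘(ℝ, V) 𝓘(ℝ, W) f f₀ x) (v : V) :
    SConv F k 𝓘(ℝ, V) 𝓘(ℝ, W) (fun i y => fderiv ℝ (f i) y v) (fun y => fderiv ℝ f₀ y v) x := by
  have h1 : ∀ y : V, ContMDiffAt 𝓘(ℝ, V) 𝓘(ℝ, V).tangent ∞
      (fun y : V => (⟨y, v⟩ : TangentBundle 𝓘(ℝ, V) V)) y := by
    intro y
    rw [contMDiffAt_totalSpace]
    refine ⟨contMDiffAt_id, ?_⟩
    simpa using contMDiffAt_const
  -- The derivative in the direction `v` is the fibre component of the tangent map along the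
  -- constant vector field `v`.
  have h2 := (SConv.precomp (f := fun y : V => (⟨y, v⟩ : TangentBundle 𝓘(ℝ, V) V)) (h.tangent v)
    (Filter.Eventually.of_forall h1)).map (g := fun p : TangentBundle 𝓘(ℝ, W) W => p.2)
    (Filter.Eventually.of_forall fun y => contMDiff_snd_tangentBundle_modelSpace W 𝓘(ℝ, W) y)
  refine h2.congr (Filter.Eventually.of_forall fun p => ?_) (Filter.Eventually.of_forall fun p => ?_)
  · simp only [tangentMap, mfderiv_eq_fderiv]
    rfl
  · simp only [tangentMap, mfderiv_eq_fderiv]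
    rfl

/-- The derivatives of a `C^{k+1}`-convergent family converge in `C^k`. -/
theorem fderiv_clm [FiniteDimensional ℝ V] {f : ι → V → W} {f₀ : V → W} {x : V}
    (h : SConv F (k + 1) 𝓘(ℝ, V) 𝓘(ℝ, W) f f₀ x) :
    SConv F k 𝓘(ℝ, V) 𝓘(ℝ, V →L[ℝ] W) (fun i y => fderiv ℝ (f i) y) (fun y => fderiv ℝ f₀ y) x := by
  let b := Module.finBasis ℝ V
  let c : ∀ j, V →L[ℝ] ℝ := fun j => LinearMap.toContinuousLinearMap (b.coord j)
  -- In finite dimension a linear map is rebuilt, by a fixed linear expression, from its values on a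
  -- basis; so convergence in the basis directions suffices.
  have h1 : ∀ L : V →L[ℝ] W, ∑ j, (c j).smulRight (L (b j)) = L := by
    intro L
    ext v
    conv_rhs => rw [← b.sum_repr v, map_sum]
    simp [c]
  have h2 := SConv.sum (F := F) (I := 𝓘(ℝ, V)) (k := k) Finset.univ (x := x)
    (f := fun j i y => (c j).smulRight (fderiv ℝ (f i) y (b j)))
    (f₀ := fun j y => (c j).smulRight (fderiv ℝ f₀ y (b j))) (fun j _ => by
      refine (h.fderiv_apply (b j)).map_contDiff (g := fun w : W => (c j).smulRight w) ?_
      exact (ContinuousLinearMap.smulRightL ℝ V W (c j)).contDiff)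
  simpa only [h1] using h2

/-- The tangent map is `(y, w) ↦ (f y, Df(y) w)`, and evaluation is jointly continuous. This is how
C¹-convergence of inverse maps is checked, their derivatives being explicit. -/
theorem of_fderiv {f : ι → V → W} {f₀ : V → W} {x : V}
    (h : SConv F 0 𝓘(ℝ, V) 𝓘(ℝ, W) f f₀ x)
    (h' : Filter.Tendsto (fun p : ι × V => fderiv ℝ (f p.1) p.2) (F ×ˢ 𝓝 x)
      (𝓝 (fderiv ℝ f₀ x))) : SConv F 1 𝓘(ℝ, V) 𝓘(ℝ, W) f f₀ x := by
  refine ⟨h.smooth₀, h.smooth, h.tendsto, fun v => ?_⟩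
  change Filter.Tendsto _ _ _
  rw [(tangentBundleModelSpaceHomeomorph 𝓘(ℝ, W)).isInducing.tendsto_nhds_iff]
  have h1 : Filter.Tendsto (fun p : ι × TangentBundle 𝓘(ℝ, V) V => (p.1, p.2.1))
      (F ×ˢ 𝓝 (⟨x, v⟩ : TangentBundle 𝓘(ℝ, V) V)) (F ×ˢ 𝓝 x) :=
    Filter.tendsto_id.prodMap
      ((FiberBundle.continuous_proj V (TangentSpace 𝓘(ℝ, V) : V → Type)).tendsto _)
  have h2 : Filter.Tendsto (fun p : ι × TangentBundle 𝓘(ℝ, V) V => (p.2.2 : V))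
      (F ×ˢ 𝓝 (⟨x, v⟩ : TangentBundle 𝓘(ℝ, V) V)) (𝓝 v) :=
    ((contMDiff_snd_tangentBundle_modelSpace V 𝓘(ℝ, V) (n := ∞)).continuous.tendsto
      (⟨x, v⟩ : TangentBundle 𝓘(ℝ, V) V)).comp Filter.tendsto_snd
  have h3 := (h.tendsto.comp h1).prodMk_nhds
    (((isBoundedBilinearMap_apply (𝕜 := ℝ) (E := V) (F := W)).continuous.tendsto
      (fderiv ℝ f₀ x, v)).comp ((h'.comp h1).prodMk_nhds h2))
  refine Filter.Tendsto.congr (fun p => ?_) (h3.trans_eq (congrArg 𝓝 ?_))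
  · simp only [Function.comp, tangentBundleModelSpaceHomeomorph_coe, tangentMap,
      mfderiv_eq_fderiv]
    rfl
  · simp only [tangentBundleModelSpaceHomeomorph_coe, tangentMap, mfderiv_eq_fderiv]
    rfl

end SConv
end VectorSpaces

/-! ### The compact-open topologies in terms of continuous convergence. -/

section Topology
variable {ι : Type w} {F : Filter ι}

/-- Each point of a compact set has a neighbourhood that `f i` eventually maps into the open set;
finitely many of them suffice. -/
theorem tendsto_compactOpen {M N : Type u} [TopologicalSpace M] [TopologicalSpace N]
    {f : ι → M → N} {f₀ : M → N}
    (h : ∀ x, Filter.Tendsto (fun p : ι × M => f p.1 p.2) (F ×ˢ 𝓝 x) (𝓝 (f₀ x))) :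
    Filter.Tendsto f F (@nhds _ (compactOpenTopology M N) f₀) := by
  rw [TopologicalSpace.tendsto_nhds_generateFrom_iff]
  rintro _ ⟨K, U, hK, hU, rfl⟩ h0
  have h1 : ∀ x ∈ K, ∃ s ∈ 𝓝[K] x, ∀ᶠ i in F, ∀ y ∈ s, f i y ∈ U := by
    intro x hx
    obtain ⟨A, hA, B, hB, h2⟩ := Filter.eventually_prod_iff.1
      ((h x).eventually_mem (hU.mem_nhds (h0 hx)))
    exact ⟨{y | B y}, mem_nhdsWithin_of_mem_nhds hB, hA.mono fun i hi y hy => h2 hi hy⟩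
  have h2 := hK.induction_on (p := fun s => ∀ᶠ i in F, ∀ y ∈ s, f i y ∈ U) (by simp)
    (fun s t hst ht => ht.mono fun i hi y hy => hi y (hst hy))
    (fun s t hs ht => (hs.and ht).mono fun i hi y hy => hy.elim (hi.1 y) (hi.2 y)) h1
  exact h2

/-- A compact neighbourhood of `x` inside the preimage of an open set is itself a test set for the
compact-open topology. -/
theorem tendsto_eval_of_compactOpen {M N : Type u} [TopologicalSpace M] [TopologicalSpace N]
    [LocallyCompactSpace M] {f : ι → M → N} {f₀ : M → N} (hc : Continuous f₀)
    (h : Filter.Tendsto f F (@nhds _ (compactOpenTopology M N) f₀)) (x : M) :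
    Filter.Tendsto (fun p : ι × M => f p.1 p.2) (F ×ˢ 𝓝 x) (𝓝 (f₀ x)) := by
  rw [(nhds_basis_opens _).tendsto_right_iff]
  rintro U ⟨hx, hU⟩
  obtain ⟨K, hKx, hKU, hK⟩ := local_compact_nhds ((hU.preimage hc).mem_nhds hx)
  have h1 := TopologicalSpace.tendsto_nhds_generateFrom_iff.1 h {f | MapsTo f K U}
    ⟨K, U, hK, hU, rfl⟩ hKU
  exact Filter.eventually_prod_iff.2 ⟨_, h1, _, hKx, fun {i} hi {y} hy => hi hy⟩

theorem tendsto_inf_induced {α β : Type*} {t₁ : TopologicalSpace α} {t₂ : TopologicalSpace β}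
    {g : α → β} {f : ι → α} {a : α} :
    Filter.Tendsto f F (@nhds _ (t₁ ⊓ t₂.induced g) a) ↔
      Filter.Tendsto f F (@nhds _ t₁ a) ∧ Filter.Tendsto (g ∘ f) F (@nhds _ t₂ (g a)) := by
  have e : @nhds _ (t₁ ⊓ t₂.induced g) a = @nhds _ t₁ a ⊓ @nhds _ (t₂.induced g) a := nhds_inf
  rw [e, Filter.tendsto_inf, nhds_induced, Filter.tendsto_comap_iff]

theorem tendsto_compactOpenCk {k : ℕ} {E H : Type} [NormedAddCommGroup E] [NormedSpace ℝ E]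
    [TopologicalSpace H] {I : ModelWithCorners ℝ E H} {M : Type u} [TopologicalSpace M]
    [ChartedSpace H M] [IsManifold I ∞ M] {f : ι → M → M} {f₀ : M → M}
    (h : ∀ x, ConvAux F k I M I M f f₀ x) :
    Filter.Tendsto f F (@nhds _ (compactOpenCk k I M) f₀) := by
  induction k generalizing E H M with
  | zero => exact tendsto_compactOpen h
  | succ k ih =>
    change Filter.Tendsto f F (@nhds _ (compactOpenTopology M M ⊓
      (compactOpenCk k I.tangent (TangentBundle I M)).induced (tangentMap I I)) f₀)
    exact tendsto_inf_induced.2 ⟨tendsto_compactOpen fun x => (h x).1, ih fun V => (h V.1).2 V.2⟩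

theorem conv_of_compactOpenCk {k : ℕ} {E H : Type} [NormedAddCommGroup E] [NormedSpace ℝ E]
    [FiniteDimensional ℝ E] [TopologicalSpace H] [LocallyCompactSpace H]
    {I : ModelWithCorners ℝ E H} {M : Type u} [TopologicalSpace M]
    [ChartedSpace H M] [IsManifold I ∞ M] {f : ι → M → M} {f₀ : M → M}
    (h₀ : ContMDiff I I ∞ f₀)
    (h : Filter.Tendsto f F (@nhds _ (compactOpenCk k I M) f₀)) (x : M) :
    ConvAux F k I M I M f f₀ x := by
  have := ChartedSpace.locallyCompactSpace H M
  induction k generalizing E H M with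
  | zero => exact tendsto_eval_of_compactOpen h₀.continuous h x
  | succ k ih =>
    change Filter.Tendsto f F (@nhds _ (compactOpenTopology M M ⊓
      (compactOpenCk k I.tangent (TangentBundle I M)).induced (tangentMap I I)) f₀) at h
    replace h := (tendsto_inf_induced (t₁ := compactOpenTopology M M)
      (t₂ := compactOpenCk k I.tangent (TangentBundle I M)) (g := tangentMap I I)).1 h
    refine ⟨tendsto_eval_of_compactOpen h₀.continuous h.1 x, fun v => ?_⟩
    have h1 : LocallyCompactSpace (ModelProd H E) := inferInstanceAs (LocallyCompactSpace (H × E))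
    exact ih (h₀.contMDiff_tangentMap le_rfl) h.2 _
      (ChartedSpace.locallyCompactSpace (ModelProd H E) (TangentBundle I M))

variable {E H : Type} [NormedAddCommGroup E] [NormedSpace ℝ E]
    [FiniteDimensional ℝ E] [TopologicalSpace H] [LocallyCompactSpace H]
    {I : ModelWithCorners ℝ E H} {M : Type u} [TopologicalSpace M]
    [ChartedSpace H M] [IsManifold I ∞ M]

/-- This is the interface to the C^∞ topology: later arguments take `F` to be a neighbourhood filter
in the group, indexed by the group itself, and work with `SConv`. -/
theorem tendsto_diffeomorph_iff {f : ι → M ≃ₘ⟮I, I⟯ M} {f₀ : M ≃ₘ⟮I, I⟯ M} :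
    Filter.Tendsto f F (𝓝 f₀) ↔ ∀ k x, SConv F k I I (fun i => f i) f₀ x := by
  have h : Filter.Tendsto f F (𝓝 f₀) ↔ ∀ k : ℕ, Filter.Tendsto (fun i => (f i : M → M)) F
      (@nhds _ (compactOpenCk k I M) f₀) := by
    rw [nhds_iInf, Filter.tendsto_iInf]
    refine forall_congr' fun k => ?_
    rw [@nhds_induced _ _ (compactOpenCk k I M), Filter.tendsto_comap_iff]
    rfl
  rw [h]
  refine forall_congr' fun k => ⟨fun h x => ⟨?_, ?_, ?_⟩, fun h => ?_⟩
  · exact Filter.Eventually.of_forall fun y => f₀.contMDiff y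
  · exact Filter.Eventually.of_forall fun y => (f y.1).contMDiff y.2
  · exact conv_of_compactOpenCk f₀.contMDiff h x
  · exact tendsto_compactOpenCk fun x => (h x).conv

end Topology
end Convergence

/-! ## Closed 1-forms, primitives and induced maps -/

section DeRhamFacts
variable {E H : Type*} [NormedAddCommGroup E] [NormedSpace ℝ E] [TopologicalSpace H]
  {I : ModelWithCorners ℝ E H} {M : Type*} [TopologicalSpace M] [ChartedSpace H M]
  {E' H' : Type*} [NormedAddCommGroup E'] [NormedSpace ℝ E'] [TopologicalSpace H']
  {J : ModelWithCorners ℝ E' H'} {N : Type*} [TopologicalSpace N] [ChartedSpace H' N]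
  {E'' H'' : Type*} [NormedAddCommGroup E''] [NormedSpace ℝ E''] [TopologicalSpace H'']
  {J' : ModelWithCorners ℝ E'' H''} {N' : Type*} [TopologicalSpace N'] [ChartedSpace H'' N']
  [I.Boundaryless] [IsManifold I ∞ M] [FiniteDimensional ℝ E]
  [J.Boundaryless] [IsManifold J ∞ N] [FiniteDimensional ℝ E']
  [J'.Boundaryless] [IsManifold J' ∞ N'] [FiniteDimensional ℝ E'']

/-- The form `dt` on the real line. -/
def lineForm : OneForm 𝓘(ℝ, ℝ) ℝ := fun _ => ContinuousLinearMap.id ℝ ℝ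

theorem lineForm_isSmooth : lineForm.IsSmooth :=
  contMDiff_snd_tangentBundle_modelSpace ℝ 𝓘(ℝ, ℝ)

theorem chartRep_modelSpace (θ : OneForm 𝓘(ℝ, E) E) (x₀ y : E) : θ.chartRep x₀ y = θ y := by
  ext w
  simp only [OneForm.chartRep, mfld_simps]
  change θ y (mfderiv 𝓘(ℝ, E) 𝓘(ℝ, E) id y w) = _
  rw [mfderiv_id]
  rfl

theorem extDeriv_lineForm (x v w : ℝ) : lineForm.extDerivCoord x v w = 0 := by
  have h : ∀ w : ℝ, (fun y => lineForm.chartRep x y w) = fun _ => w := by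
    intro w
    funext y
    rw [chartRep_modelSpace]
    rfl
  unfold OneForm.extDerivCoord
  rw [h, h]
  simp

/-- Writing df as the pullback of dt makes the closedness of df, and the behaviour of df under
pullback, special cases of the facts about pullbacks. -/
theorem differential_eq_pullback (f : M → ℝ) :
    (OneForm.differential f : OneForm I M) = OneForm.pullback f lineForm := by
  funext x
  rfl

theorem differential_mem_closedForms {f : M → ℝ} (hf : ContMDiff I 𝓘(ℝ, ℝ) ∞ f) :
    OneForm.differential f ∈ closedForms I M := by
  rw [differential_eq_pullback]
  exact ⟨lineForm_isSmooth.pullback hf, fun x v w =>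
    (OneForm.extDeriv_pullback lineForm_isSmooth hf x v w rfl).trans (extDeriv_lineForm _ _ _)⟩

theorem pullback_comp {g : N → N'} {f : M → N} (hg : ContMDiff J J' ∞ g) (hf : ContMDiff I J ∞ f)
    (η : OneForm J' N') :
    (OneForm.pullback (g ∘ f) η : OneForm I M) =
      OneForm.pullback f (OneForm.pullback g η : OneForm J N) := by
  funext x
  have := mfderiv_comp x ((hg (f x)).mdifferentiableAt (by simp))
    ((hf x).mdifferentiableAt (by simp))
  simp only [OneForm.pullback]
  rw [this]
  rfl

theorem DeRhamH1.map_mk (g : C^∞⟮I, M; J, N⟯) (η : closedForms J N) :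
    DeRhamH1.map g (Submodule.Quotient.mk η) = Submodule.Quotient.mk (pullbackClosed g η) := rfl

theorem DeRhamH1.map_comp (g : C^∞⟮J, N; J', N'⟯) (f : C^∞⟮I, M; J, N⟯) (c : DeRhamH1 J' N') :
    DeRhamH1.map (g.comp f) c = DeRhamH1.map f (DeRhamH1.map g c) := by
  induction c using Submodule.Quotient.induction_on with
  | H η =>
    rw [DeRhamH1.map_mk, DeRhamH1.map_mk, DeRhamH1.map_mk]
    congr 1
    exact Subtype.ext (pullback_comp g.contMDiff f.contMDiff η.1)

theorem DeRhamH1.map_id (c : DeRhamH1 I M) : DeRhamH1.map (ContMDiffMap.id) c = c := by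
  induction c using Submodule.Quotient.induction_on with
  | H η =>
    rw [DeRhamH1.map_mk]
    congr 1
    apply Subtype.ext
    funext x
    change (η.1 x).comp (mfderiv I I id x) = _
    rw [mfderiv_id]
    rfl

/-- Two smooth maps induce the same map on a class if the pullbacks of a representative differ by
a form with local (hence global) primitive `f`. -/
theorem DeRhamH1.map_mk_eq {g g' : C^∞⟮I, M; J, N⟯} {η : closedForms J N} (f : M → ℝ)
    (hf : ContMDiff I 𝓘(ℝ, ℝ) ∞ f)
    (h : ∀ x, mfderiv I 𝓘(ℝ, ℝ) f x =
      OneForm.pullback g η.1 x - OneForm.pullback (I := I) g' η.1 x) :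
    DeRhamH1.map g (Submodule.Quotient.mk η) = DeRhamH1.map g' (Submodule.Quotient.mk η) := by
  rw [DeRhamH1.map_mk, DeRhamH1.map_mk, Submodule.Quotient.eq]
  refine ⟨f, hf, ?_⟩
  funext x
  exact (h x).symm

/-- The Poincaré lemma: on a vector space the exterior derivative vanishes exactly when the
derivative of `θ` is symmetric. The primitive is smooth because its derivative is. -/
theorem exists_primitive_modelSpace {θ : OneForm 𝓘(ℝ, E) E} (h : θ ∈ closedForms 𝓘(ℝ, E) E) :
    ∃ h : E → ℝ, ContDiff ℝ ∞ h ∧ ∀ y, HasFDerivAt h (show E →L[ℝ] ℝ from θ y) y := by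
  let θ' : E → E →L[ℝ] ℝ := θ
  have h1 : ContDiff ℝ ∞ θ' := by
    have := OneForm.contDiffOn_chartRep h.1 (0 : E)
    rw [show θ.chartRep 0 = θ' from funext fun y => chartRep_modelSpace θ 0 y] at this
    simpa only [extChartAt_model_space_eq_id, PartialEquiv.refl_target, contDiffOn_univ] using this
  have h2 : ∀ a ∈ (univ : Set E), ∀ x y : E, fderiv ℝ θ' a x y = fderiv ℝ θ' a y x := by
    intro a _ x y
    have h3 := h.2 a x y
    have h4 : ∀ w : E, (fun y => θ.chartRep a y w) = fun y => θ' y w := fun w => by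
      funext y
      rw [chartRep_modelSpace]
    have h5 : ∀ v w : E, fderiv ℝ (fun y => θ' y w) a v = fderiv ℝ θ' a v w := by
      intro v w
      rw [((h1.differentiable (by simp) a).hasFDerivAt.clm_apply (hasFDerivAt_const w a)).fderiv]
      simp
    simp only [OneForm.extDeriv, OneForm.extDerivCoord, h4, extChartAt_model_space_eq_id,
      PartialEquiv.refl_coe, id] at h3
    change fderiv ℝ (fun z => θ' z y) a x - fderiv ℝ (fun z => θ' z x) a y = 0 at h3
    rw [h5, h5] at h3
    linarith
  obtain ⟨f, hf⟩ := convex_univ.exists_forall_hasFDerivAt_of_fderiv_symmetric isOpen_univ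
    (h1.differentiable (by simp)).differentiableOn h2
  refine ⟨f, ?_, fun y => hf y (mem_univ _)⟩
  rw [contDiff_infty_iff_fderiv]
  refine ⟨fun y => (hf y (mem_univ _)).differentiableAt, ?_⟩
  rwa [show fderiv ℝ f = θ' from funext fun y => (hf y (mem_univ _)).fderiv]

variable (I) in
/-- A coordinate ball. -/
def chartBall (x₀ : M) (r : ℝ) : Set M :=
  (extChartAt I x₀).source ∩ extChartAt I x₀ ⁻¹' Metric.ball (extChartAt I x₀ x₀) r

theorem isOpen_chartBall (x₀ : M) (r : ℝ) : IsOpen (chartBall I x₀ r) :=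
  (continuousOn_extChartAt x₀).isOpen_inter_preimage (isOpen_extChartAt_source x₀)
    Metric.isOpen_ball

theorem mem_chartBall_self (x₀ : M) {r : ℝ} (hr : 0 < r) : x₀ ∈ chartBall I x₀ r :=
  ⟨mem_extChartAt_source x₀, Metric.mem_ball_self hr⟩

theorem exists_chartBall_subset (x₀ : M) {U : Set M} (hU : U ∈ 𝓝 x₀) :
    ∃ r > 0, Metric.ball (extChartAt I x₀ x₀) r ⊆ (extChartAt I x₀).target ∧
      chartBall I x₀ r ⊆ U := by
  have h1 := extChartAt_target_mem_nhds (I := I) x₀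
  have h2 : (extChartAt I x₀).symm ⁻¹' U ∈ 𝓝 (extChartAt I x₀ x₀) :=
    (continuousAt_extChartAt_symm x₀).preimage_mem_nhds (by simpa using hU)
  obtain ⟨r, hr, h⟩ := Metric.mem_nhds_iff.1 (Filter.inter_mem h1 h2)
  refine ⟨r, hr, fun y hy => (h hy).1, fun x hx => ?_⟩
  have := (h hx.2).2
  rwa [mem_preimage, (extChartAt I x₀).left_inv hx.1] at this

/-- A function with vanishing differential on a coordinate ball is constant there. -/
theorem eq_of_mfderiv_eq_zero {x₀ : M} {r : ℝ}
    (hr : Metric.ball (extChartAt I x₀ x₀) r ⊆ (extChartAt I x₀).target) {f : M → ℝ}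
    (hf : ∀ x ∈ chartBall I x₀ r, HasMFDerivAt I 𝓘(ℝ, ℝ) f x (0 : E →L[ℝ] ℝ)) {x y : M}
    (hx : x ∈ chartBall I x₀ r) (hy : y ∈ chartBall I x₀ r) : f x = f y := by
  have h1 : ∀ a ∈ Metric.ball (extChartAt I x₀ x₀) r,
      HasFDerivAt (f ∘ (extChartAt I x₀).symm) (0 : E →L[ℝ] ℝ) a := by
    intro a ha
    have h2 : MDifferentiableAt 𝓘(ℝ, E) I (extChartAt I x₀).symm a :=
      ((contMDiffOn_extChartAt_symm (I := I) (n := ∞) x₀).contMDiffAt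
        ((isOpen_extChartAt_target x₀).mem_nhds (hr ha))).mdifferentiableAt (by simp)
    have h3 := (hf ((extChartAt I x₀).symm a) ⟨(extChartAt I x₀).map_target (hr ha), by
      rwa [mem_preimage, (extChartAt I x₀).right_inv (hr ha)]⟩).comp a h2.hasMFDerivAt
    rw [hasMFDerivAt_iff_hasFDerivAt] at h3
    have h4 : HasFDerivAt (f ∘ (extChartAt I x₀).symm) ((0 : E →L[ℝ] ℝ).comp
      (show E →L[ℝ] E from mfderiv 𝓘(ℝ, E) I (extChartAt I x₀).symm a)) a := h3
    rwa [ContinuousLinearMap.zero_comp] at h4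
  have h2 := IsOpen.is_const_of_fderiv_eq_zero (𝕜 := ℝ) Metric.isOpen_ball
    (convex_ball (extChartAt I x₀ x₀) r).isPreconnected
    (fun a ha => (h1 a ha).differentiableAt.differentiableWithinAt)
    (fun a ha => (h1 a ha).fderiv) hx.2 hy.2
  simp only [Function.comp, (extChartAt I x₀).left_inv hx.1,
    (extChartAt I x₀).left_inv hy.1] at h2
  exact h2

/-- The inverse of a chart extends from a small ball to a smooth map on the model space. -/
theorem exists_smooth_chart_inverse (x₀ : M) :
    ∃ r > 0, Metric.ball (extChartAt I x₀ x₀) r ⊆ (extChartAt I x₀).target ∧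
      ∃ g : E → M, ContMDiff 𝓘(ℝ, E) I ∞ g ∧
        EqOn g (extChartAt I x₀).symm (Metric.ball (extChartAt I x₀ x₀) r) := by
  obtain ⟨r, hr, h⟩ := Metric.mem_nhds_iff.1 (extChartAt_target_mem_nhds (I := I) x₀)
  set c := extChartAt I x₀ x₀
  let χ : ContDiffBump c := ⟨r / 2, r, by positivity, by linarith⟩
  -- `ψ` squeezes the whole space into the ball of radius `r`, where the inverse chart is defined,
  -- and is the identity on the ball of radius `r / 2`.
  let ψ : E → E := fun v => c + χ v • (v - c)
  have h1 : ∀ v, ψ v ∈ Metric.ball c r := by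
    intro v
    by_cases hv : χ v = 0
    · simpa [ψ, hv] using hr
    · have hv' : v ∈ Metric.ball c r := by
        have : v ∈ Function.support χ := hv
        rwa [χ.support_eq] at this
      rw [Metric.mem_ball, dist_eq_norm] at hv' ⊢
      simp only [ψ, add_sub_cancel_left, norm_smul, Real.norm_eq_abs, abs_of_nonneg χ.nonneg]
      calc χ v * ‖v - c‖ ≤ 1 * ‖v - c‖ := by gcongr; exact χ.le_one
        _ < r := by rwa [one_mul]
  have h2 : ContDiff ℝ ∞ ψ := contDiff_const.add (χ.contDiff.smul (contDiff_id.sub contDiff_const))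
  refine ⟨r / 2, by positivity, (Metric.ball_subset_ball (by linarith)).trans h,
    (extChartAt I x₀).symm ∘ ψ, ?_, ?_⟩
  · intro v
    exact ((contMDiffOn_extChartAt_symm (I := I) (n := ∞) x₀).contMDiffAt
      ((isOpen_extChartAt_target x₀).mem_nhds (h (h1 v)))).comp v h2.contMDiff.contMDiffAt
  · intro v hv
    have : χ v = 1 := χ.one_of_mem_closedBall (Metric.ball_subset_closedBall hv)
    simp [ψ, this]

/-- A closed form has a primitive on small coordinate balls. -/
theorem exists_local_primitive (x₀ : M) :
    ∃ r > 0, Metric.ball (extChartAt I x₀ x₀) r ⊆ (extChartAt I x₀).target ∧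
      ∀ η : closedForms I M, ∃ h : M → ℝ, ∀ x ∈ chartBall I x₀ r,
        ContMDiffAt I 𝓘(ℝ, ℝ) ∞ h x ∧ mfderiv I 𝓘(ℝ, ℝ) h x = η.1 x := by
  obtain ⟨r, hr, ht, g, hg, hgr⟩ := exists_smooth_chart_inverse (I := I) x₀
  refine ⟨r, hr, ht, fun η => ?_⟩
  -- The form is pulled back to the whole model space, where a primitive exists, and the primitive
  -- is carried back by the chart. The ball depends only on `g`, so it serves all closed forms.
  obtain ⟨h, hh, hd⟩ := exists_primitive_modelSpace (pullbackClosed ⟨g, hg⟩ η).2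
  refine ⟨h ∘ extChartAt I x₀, fun x hx => ?_⟩
  have hφ : ContMDiffAt I 𝓘(ℝ, E) ∞ (extChartAt I x₀) x :=
    contMDiffAt_extChartAt' (by simpa using hx.1)
  refine ⟨hh.contMDiff.contMDiffAt.comp x hφ, ?_⟩
  rw [mfderiv_comp x (hh.contMDiff.contMDiffAt.mdifferentiableAt (by simp))
    (hφ.mdifferentiableAt (by simp)), mfderiv_eq_fderiv,
    HasFDerivAt.fderiv (hd (extChartAt I x₀ x))]
  have hid : g ∘ extChartAt I x₀ =ᶠ[𝓝 x] id := by
    filter_upwards [(isOpen_chartBall x₀ r).mem_nhds hx] with y hy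
    simp only [Function.comp, hgr hy.2, (extChartAt I x₀).left_inv hy.1, id]
  have h1 := mfderiv_comp x ((hg (extChartAt I x₀ x)).mdifferentiableAt (by simp))
    (hφ.mdifferentiableAt (by simp))
  have h3 : ∀ {a b : M} (_ : a = b) (L L' : E →L[ℝ] E) (_ : L = L'),
      ContinuousLinearMap.comp (show E →L[ℝ] ℝ from η.1 a) L =
      ContinuousLinearMap.comp (show E →L[ℝ] ℝ from η.1 b) L' := by
    rintro a _ rfl L _ rfl
    rfl
  have h4 := h3 hid.self_of_nhds _ _ (h1.symm.trans (hid.mfderiv_eq.trans mfderiv_id))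
  exact h4


/-- Maps that are uniformly close to a given one induce the same map on a given class. -/
theorem eventually_map_eq [CompactSpace M] [T2Space N] [CompactSpace N] {ι : Type*} {F : Filter ι}
    {e : ι → C^∞⟮I, M; J, N⟯} {e₀ : C^∞⟮I, M; J, N⟯}
    (he : ∀ x, Filter.Tendsto (fun p : ι × M => e p.1 p.2) (F ×ˢ 𝓝 x) (𝓝 (e₀ x)))
    (c : DeRhamH1 J N) : ∀ᶠ i in F, DeRhamH1.map (e i) c = DeRhamH1.map e₀ c := by
  have := Manifold.metrizableSpace J N
  let _ := TopologicalSpace.metrizableSpaceMetric N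
  induction c using Submodule.Quotient.induction_on with
  | H η =>
  choose r hr ht hprim using fun y : N => exists_local_primitive (I := J) y
  choose h hh using fun y => hprim y η
  -- Every `δ`-ball lies in a coordinate ball with a primitive of `η`. The second cover below
  -- consists of coordinate balls so small that two of their points are less than `δ / 2` apart; on
  -- them two primitives differ by a constant. Its Lebesgue number `δ'` puts `e i x` and `e₀ x` in
  -- one such ball.
  obtain ⟨δ, hδ, hδB⟩ := lebesgue_number_lemma_of_metric (isCompact_univ (X := N))
    (fun y => isOpen_chartBall (I := J) y (r y))
    (fun y _ => mem_iUnion.2 ⟨y, mem_chartBall_self y (hr y)⟩)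
  choose s hs hst hsC using fun z : N => exists_chartBall_subset (I := J) z
    (Metric.ball_mem_nhds z (show 0 < δ / 4 by positivity))
  obtain ⟨δ', hδ', hδC⟩ := lebesgue_number_lemma_of_metric (isCompact_univ (X := N))
    (fun z => isOpen_chartBall (I := J) z (s z))
    (fun z _ => mem_iUnion.2 ⟨z, mem_chartBall_self z (hs z)⟩)
  have hunif : ∀ᶠ i in F, ∀ x ∈ (univ : Set M), dist (e i x) (e₀ x) < δ' := by
    refine isCompact_univ.induction_on (p := fun t => ∀ᶠ i in F, ∀ x ∈ t,
      dist (e i x) (e₀ x) < δ') (by simp)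
      (fun s t hst ht => ht.mono fun i hi y hy => hi y (hst hy))
      (fun s t hs ht => (hs.and ht).mono fun i hi y hy => hy.elim (hi.1 y) (hi.2 y)) ?_
    intro x _
    have h1 := (he x).dist ((e₀.contMDiff.continuous.tendsto x).comp
      (Filter.tendsto_snd (f := F)))
    rw [dist_self] at h1
    obtain ⟨A, hA, B, hB, h2⟩ := Filter.eventually_prod_iff.1 (h1.eventually_lt_const hδ')
    exact ⟨{y | B y}, mem_nhdsWithin_of_mem_nhds hB, hA.mono fun i hi y hy => h2 hi hy⟩
  filter_upwards [hunif] with i hi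
  choose Y hY using fun x : M => hδB (e₀ x) (mem_univ _)
  -- near `x₀` the difference of the primitives does not depend on the choice of a ball
  have key : ∀ x₀ x : M, dist (e₀ x) (e₀ x₀) < δ / 2 →
      h (Y x) (e i x) - h (Y x) (e₀ x) = h (Y x₀) (e i x) - h (Y x₀) (e₀ x) := by
    intro x₀ x hx
    obtain ⟨z, hz⟩ := hδC (e₀ x) (mem_univ _)
    have hmem : e₀ x ∈ chartBall J z (s z) := hz (Metric.mem_ball_self hδ')
    have hmem' : e i x ∈ chartBall J z (s z) := hz (hi x (mem_univ _))
    have hsub : ∀ w ∈ chartBall J z (s z), dist w (e₀ x) < δ / 2 := by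
      intro w hw
      have h1 := hsC z hw
      have h2 := hsC z hmem
      rw [Metric.mem_ball] at h1 h2
      calc dist w (e₀ x) ≤ dist w z + dist (e₀ x) z := dist_triangle_right _ _ _
        _ < δ / 2 := by linarith
    have h1 := eq_of_mfderiv_eq_zero (hst z) (f := fun w => h (Y x) w - h (Y x₀) w) (fun w hw => by
      have h2 := hh (Y x) w (hY x (by rw [Metric.mem_ball]; linarith [hsub w hw]))
      have h3 := hh (Y x₀) w (hY x₀ (by
        rw [Metric.mem_ball]
        linarith [hsub w hw, dist_triangle w (e₀ x) (e₀ x₀)]))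
      have h4 := (h2.1.mdifferentiableAt (by simp)).hasMFDerivAt.sub
        (h3.1.mdifferentiableAt (by simp)).hasMFDerivAt
      rw [h2.2, h3.2, sub_self] at h4
      exact h4) hmem' hmem
    linarith
  -- The choice `Y x` varies wildly with `x`, but by `key` it can be frozen at `Y x₀` near `x₀`. So
  -- the function is smooth and is a global primitive of the difference of the two pullbacks.
  have hloc : ∀ x₀, ContMDiffAt I 𝓘(ℝ, ℝ) ∞ (fun x => h (Y x) (e i x) - h (Y x) (e₀ x)) x₀ ∧
      mfderiv I 𝓘(ℝ, ℝ) (fun x => h (Y x) (e i x) - h (Y x) (e₀ x)) x₀ =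
      OneForm.pullback (e i) η.1 x₀ - OneForm.pullback (I := I) e₀ η.1 x₀ := by
    intro x₀
    have hev : (fun x => h (Y x) (e i x) - h (Y x) (e₀ x)) =ᶠ[𝓝 x₀]
        fun x => h (Y x₀) (e i x) - h (Y x₀) (e₀ x) := by
      filter_upwards [e₀.contMDiff.continuous.continuousAt.preimage_mem_nhds
        (Metric.ball_mem_nhds (e₀ x₀) (show 0 < δ / 2 by positivity))] with x hx
      exact key x₀ x hx
    have h1 := hh (Y x₀) (e₀ x₀) (hY x₀ (Metric.mem_ball_self hδ))
    have h2 : ContMDiffAt J 𝓘(ℝ, ℝ) ∞ (h (Y x₀)) (e i x₀) ∧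
        mfderiv J 𝓘(ℝ, ℝ) (h (Y x₀)) (e i x₀) = η.1 (e i x₀) := by
      refine hh (Y x₀) (e i x₀) (hY x₀ ?_)
      obtain ⟨z, hz⟩ := hδC (e₀ x₀) (mem_univ _)
      have h1 := hsC z (hz (Metric.mem_ball_self hδ'))
      have h2 := hsC z (hz (hi x₀ (mem_univ _)))
      rw [Metric.mem_ball] at h1 h2 ⊢
      calc dist (e i x₀) (e₀ x₀) ≤ dist (e i x₀) z + dist (e₀ x₀) z := dist_triangle_right _ _ _
        _ < δ := by linarith
    have h3 := h1.1.comp x₀ (e₀.contMDiff x₀)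
    have h4 := h2.1.comp x₀ ((e i).contMDiff x₀)
    refine ⟨(h4.sub h3).congr_of_eventuallyEq hev, ?_⟩
    rw [hev.mfderiv_eq]
    have h5 := (h4.mdifferentiableAt (by simp)).hasMFDerivAt.sub
      (h3.mdifferentiableAt (by simp)).hasMFDerivAt
    rw [mfderiv_comp x₀ (h1.1.mdifferentiableAt (by simp))
      ((e₀.contMDiff x₀).mdifferentiableAt (by simp)),
      mfderiv_comp x₀ (h2.1.mdifferentiableAt (by simp))
      (((e i).contMDiff x₀).mdifferentiableAt (by simp)), h1.2, h2.2] at h5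
    exact h5.mfderiv
  exact DeRhamH1.map_mk_eq _ (fun x => (hloc x).1) fun x => (hloc x).2

end DeRhamFacts

/-! ## Coordinates on `T^*X` and `P_+T^*X` -/

/-- The model vector space of an `n`-manifold. -/
abbrev Vec (n : ℕ) : Type := EuclideanSpace ℝ (Fin n)

/-- Coordinate covectors. -/
abbrev Covec (n : ℕ) : Type := Vec n →L[ℝ] ℝ

section Shortcuts
variable (n : ℕ)

instance : AddCommGroup (Vec n) := inferInstance
instance : AddCommGroup (Covec n) := inferInstance
instance : NormedAddCommGroup (Vec n × Covec n) := inferInstance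
instance : AddCommGroup (Vec n × Covec n) := inferInstance
instance : TopologicalSpace (Vec n × Covec n) := inferInstance
instance : NormedAddCommGroup (Covec n) := inferInstance
instance : SeminormedAddCommGroup (Covec n) := inferInstance
instance : NormedSpace ℝ (Covec n) := inferInstance
instance : NormedSpace ℝ (Vec n × Covec n) := inferInstance
instance : TopologicalSpace (Covec n) := inferInstance
instance : AddCommMonoid (Covec n) := inferInstance
instance : Module ℝ (Covec n) := inferInstance

end Shortcuts

section Coordinates
variable {n : ℕ} {X : Type u} [TopologicalSpace X]
  [ChartedSpace (EuclideanSpace ℝ (Fin n)) X] [IsManifold (𝓡 n) ∞ X]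

instance : TopologicalSpace (CotangentBundle n X) := inferInstance
instance : ChartedSpace (ModelProd (Vec n) (Covec n)) (CotangentBundle n X) := inferInstance
instance : IsManifold (cotangentModel n) ∞ (CotangentBundle n X) := inferInstance

/-- The coordinates of a covector in the chart at `x₀`. -/
def covectorChart (x₀ : X) (z : CotangentBundle n X) : Vec n × Covec n :=
  (chartAt (Vec n) x₀ z.1, coords x₀ z)

/-- The covector with given coordinates in the chart at `x₀`. -/
def ofCoords (x₀ : X) (m : Vec n × Covec n) : CotangentBundle n X :=
  covector x₀ ((chartAt (Vec n) x₀).symm m.1) m.2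

theorem ofCoords_covectorChart (x₀ : X) {z : CotangentBundle n X}
    (hz : z.1 ∈ (chartAt (Vec n) x₀).source) : ofCoords x₀ (covectorChart x₀ z) = z := by
  simp only [ofCoords, covectorChart, (chartAt (Vec n) x₀).left_inv hz, covector_coords x₀ z hz]

theorem covectorChart_ofCoords (x₀ : X) {m : Vec n × Covec n}
    (hm : m.1 ∈ (chartAt (Vec n) x₀).target) : covectorChart x₀ (ofCoords x₀ m) = m := by
  refine Prod.ext ((chartAt (Vec n) x₀).right_inv hm) ?_
  exact coords_covector_self x₀ _ m.2 ((chartAt (Vec n) x₀).map_target hm)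

/-- It links the coordinates used for contact elements to the trivializations that define the smooth
structure of the cotangent bundle. -/
theorem coords_eq_inCoordinates (x₀ : X) {z : CotangentBundle n X}
    (hz : z.1 ∈ (chartAt (Vec n) x₀).source) :
    trivializationAt (Covec n) (fun x : X => TangentSpace (𝓡 n) x →L[ℝ] ℝ) x₀ z =
      (z.1, coords x₀ z) := by
  rw [hom_trivializationAt_apply]
  refine Prod.ext rfl ?_
  simp only [ContinuousLinearMap.inCoordinates]
  rw [TangentBundle.symmL_trivializationAt_eq_core hz]
  ext v
  simp [coords, tangentCoordChange]
  rfl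

theorem contMDiffAt_covectorChart (x₀ : X) {z : CotangentBundle n X}
    (hz : z.1 ∈ (chartAt (Vec n) x₀).source) :
    ContMDiffAt (cotangentModel n) 𝓘(ℝ, Vec n × Covec n) ∞ (covectorChart x₀) z := by
  have h1 : ContMDiffAt (cotangentModel n) 𝓘(ℝ, Vec n) ∞
      (fun z : CotangentBundle n X => chartAt (Vec n) x₀ z.1) z :=
    (contMDiffAt_of_mem_maximalAtlas (I := 𝓡 n) (n := ∞)
      (IsManifold.chart_mem_maximalAtlas x₀) hz).comp z (contMDiff_proj _).contMDiffAt
  let t := trivializationAt (Covec n) (fun x : X => TangentSpace (𝓡 n) x →L[ℝ] ℝ) x₀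
  have hb : t.baseSet = (chartAt (Vec n) x₀).source := by simp [t]
  have hs : z ∈ t.source := t.mem_source.2 (hb ▸ hz)
  have h2 := ((t.contMDiffAt_iff (IM := cotangentModel n) (IB := 𝓡 n) (n := ∞)
    (f := fun z => z) hs).1 contMDiffAt_id).2
  refine h1.prodMk_space (h2.congr_of_eventuallyEq ?_)
  filter_upwards [t.open_source.mem_nhds hs] with w hw
  have hw' : w.1 ∈ (chartAt (Vec n) x₀).source := hb ▸ t.mem_source.1 hw
  exact (congrArg Prod.snd (coords_eq_inCoordinates x₀ hw')).symm

theorem contMDiffAt_ofCoords (x₀ : X) {m : Vec n × Covec n}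
    (hm : m.1 ∈ (chartAt (Vec n) x₀).target) :
    ContMDiffAt 𝓘(ℝ, Vec n × Covec n) (cotangentModel n) ∞ (ofCoords x₀) m := by
  let t := trivializationAt (Covec n) (fun x : X => TangentSpace (𝓡 n) x →L[ℝ] ℝ) x₀
  have hb : t.baseSet = (chartAt (Vec n) x₀).source := by simp [t]
  have hs : ofCoords x₀ m ∈ t.source :=
    t.mem_source.2 (hb ▸ (chartAt (Vec n) x₀).map_target hm)
  refine (t.contMDiffAt_iff (IM := 𝓘(ℝ, Vec n × Covec n)) (IB := 𝓡 n) (n := ∞)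
    (f := ofCoords x₀) hs).2 ⟨?_, ?_⟩
  · exact (contMDiffAt_symm_of_mem_maximalAtlas (I := 𝓡 n) (n := ∞)
      (IsManifold.chart_mem_maximalAtlas x₀) hm).comp m contDiff_fst.contMDiff.contMDiffAt
  · refine (contDiff_snd.contMDiff.contMDiffAt : ContMDiffAt 𝓘(ℝ, Vec n × Covec n) 𝓘(ℝ, Covec n)
      ∞ (fun m : Vec n × Covec n => m.2) m).congr_of_eventuallyEq ?_
    filter_upwards [((chartAt (Vec n) x₀).open_target.preimage continuous_fst).mem_nhds hm]
      with w hw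
    have hw' := (chartAt (Vec n) x₀).map_target (show w.1 ∈ _ from hw)
    exact (congrArg Prod.snd (coords_eq_inCoordinates x₀ (z := ofCoords x₀ w) hw')).trans
      (coords_covector_self x₀ _ w.2 hw')

theorem continuous_cotangent_proj : Continuous (fun z : CotangentBundle n X => z.1) :=
  (cotangentProj n X).contMDiff.continuous

theorem eventually_proj_mem {U : Set X} (hU : IsOpen U) {z : CotangentBundle n X} (hz : z.1 ∈ U) :
    ∀ᶠ w : CotangentBundle n X in 𝓝 z, w.1 ∈ U :=
  continuous_cotangent_proj.continuousAt.eventually_mem (hU.mem_nhds hz)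

theorem eventually_contMDiffAt_covectorChart (x₀ : X) {z : CotangentBundle n X}
    (hz : z.1 ∈ (chartAt (Vec n) x₀).source) : ∀ᶠ w in 𝓝 z,
    ContMDiffAt (cotangentModel n) 𝓘(ℝ, Vec n × Covec n) ∞ (covectorChart x₀) w :=
  (eventually_proj_mem (chartAt (Vec n) x₀).open_source hz).mono
    fun _ h => contMDiffAt_covectorChart x₀ h

theorem eventually_mem_chart_target (x₀ : X) {m : Vec n × Covec n}
    (hm : m.1 ∈ (chartAt (Vec n) x₀).target) :
    ∀ᶠ w : Vec n × Covec n in 𝓝 m, w.1 ∈ (chartAt (Vec n) x₀).target :=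
  ((chartAt (Vec n) x₀).open_target.preimage continuous_fst).mem_nhds hm

theorem eventually_contMDiffAt_ofCoords (x₀ : X) {m : Vec n × Covec n}
    (hm : m.1 ∈ (chartAt (Vec n) x₀).target) : ∀ᶠ w in 𝓝 m,
    ContMDiffAt 𝓘(ℝ, Vec n × Covec n) (cotangentModel n) ∞ (ofCoords x₀) w :=
  (eventually_mem_chart_target x₀ hm).mono fun _ h => contMDiffAt_ofCoords x₀ h

/-- The derivative of the inverse chart, composed with a covector given by its coordinates. -/
theorem ofCoords_snd_mfderiv (x₀ : X) {y : Vec n} (p : Covec n)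
    (hy : y ∈ (chartAt (Vec n) x₀).target) (u : Vec n) :
    (ofCoords x₀ (y, p)).2 (mfderiv 𝓘(ℝ, Vec n) (𝓡 n) (chartAt (Vec n) x₀).symm y u) = p u := by
  set c := chartAt (Vec n) x₀
  have hx := c.map_target hy
  have h1 : MDifferentiableAt 𝓘(ℝ, Vec n) (𝓡 n) c.symm y :=
    (contMDiffAt_symm_of_mem_maximalAtlas (I := 𝓡 n) (n := ∞)
      (IsManifold.chart_mem_maximalAtlas x₀) hy).mdifferentiableAt (by simp)
  have h2 : MDifferentiableAt (𝓡 n) 𝓘(ℝ, Vec n) c (c.symm y) :=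
    (contMDiffAt_of_mem_maximalAtlas (I := 𝓡 n) (n := ∞)
      (IsManifold.chart_mem_maximalAtlas x₀) hx).mdifferentiableAt (by simp)
  have h3 := mfderiv_comp y h2 h1
  have h4 : c ∘ c.symm =ᶠ[𝓝 y] id := by
    filter_upwards [c.open_target.mem_nhds hy] with w hw using c.right_inv hw
  rw [h4.mfderiv_eq, mfderiv_id] at h3
  have h5 := mfderiv_chartAt_eq_tangentCoordChange (I := 𝓡 n) hx
  change p (tangentCoordChange (𝓡 n) (c.symm y) x₀ (c.symm y) _) = _
  rw [← h5]
  exact congrArg p (congrArg (fun L : Vec n →L[ℝ] Vec n => L u) h3).symm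

/-- In these coordinates the bundle projection is the first component followed by the inverse chart,
so the canonical form is literally p dq. -/
theorem liouvilleForm_ofCoords (x₀ : X) {m : Vec n × Covec n}
    (hm : m.1 ∈ (chartAt (Vec n) x₀).target) (w : Vec n × Covec n) :
    liouvilleForm n X (ofCoords x₀ m)
      (mfderiv 𝓘(ℝ, Vec n × Covec n) (cotangentModel n) (ofCoords x₀) m w) = m.2 w.1 := by
  have h1 : MDifferentiableAt 𝓘(ℝ, Vec n) (𝓡 n) (chartAt (Vec n) x₀).symm m.1 :=
    (contMDiffAt_symm_of_mem_maximalAtlas (I := 𝓡 n) (n := ∞)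
      (IsManifold.chart_mem_maximalAtlas x₀) hm).mdifferentiableAt (by simp)
  have h2 := (contMDiffAt_ofCoords x₀ hm).mdifferentiableAt (by simp)
  have h3 := mfderiv_comp m (((cotangentProj n X).contMDiff (ofCoords x₀ m)).mdifferentiableAt
    (by simp)) h2
  have h4 := mfderiv_comp (I := 𝓘(ℝ, Vec n × Covec n)) m (f := fun m : Vec n × Covec n => m.1) h1
    (by
      exact (contDiff_fst (n := ∞)).contMDiff.contMDiffAt.mdifferentiableAt (by simp))
  have h5 : (cotangentProj n X) ∘ ofCoords x₀ =
    (chartAt (Vec n) x₀).symm ∘ fun m : Vec n × Covec n => m.1 := rfl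
  rw [h5, h4] at h3
  have h6 := congrArg (fun L : Vec n × Covec n →L[ℝ] Vec n => L w) h3
  refine (congrArg (fun v => (ofCoords x₀ m).2 v) h6.symm).trans ?_
  refine Eq.trans ?_ (ofCoords_snd_mfderiv x₀ m.2 hm w.1)
  have h7 : mfderiv 𝓘(ℝ, Vec n × Covec n) 𝓘(ℝ, Vec n) (fun m : Vec n × Covec n => m.1) m =
      ContinuousLinearMap.fst ℝ (Vec n) (Covec n) := by
    rw [mfderiv_eq_fderiv]
    exact fderiv_fst
  exact congrArg (fun L : Vec n × Covec n →L[ℝ] Vec n => (ofCoords x₀ m).2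
    (mfderiv 𝓘(ℝ, Vec n) (𝓡 n) (chartAt (Vec n) x₀).symm m.1 (L w))) h7

/-! ### Charts of `P_+T^*X` -/

theorem affineChart_mem (x₀ : X) (A : AffineIndex n) :
    affineChart x₀ A ∈ (chartCore n X).atlas := ⟨x₀, A, rfl⟩

/-- An affine chart as a homeomorphism between open sets. -/
def affineHomeo (x₀ : X) (A : AffineIndex n) :
    OpenPartialHomeomorph (ContactElementSpace n X) (Model n) :=
  (chartCore n X).openPartialHomeomorph _ (affineChart_mem x₀ A)

theorem affineHomeo_mem_maximalAtlas (x₀ : X) (A : AffineIndex n) :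
    affineHomeo x₀ A ∈ IsManifold.maximalAtlas 𝓘(ℝ, Model n) ∞ (ContactElementSpace n X) := by
  apply IsManifold.subset_maximalAtlas
  exact mem_iUnion.2 ⟨_, mem_iUnion.2 ⟨affineChart_mem x₀ A, rfl⟩⟩

theorem contMDiffAt_affineToFun (x₀ : X) (A : AffineIndex n) {y : ContactElementSpace n X}
    (hy : y ∈ affineSource x₀ A) :
    ContMDiffAt 𝓘(ℝ, Model n) 𝓘(ℝ, Model n) ∞ (affineToFun x₀ A) y :=
  contMDiffAt_of_mem_maximalAtlas (affineHomeo_mem_maximalAtlas x₀ A) hy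

theorem contMDiffAt_affineInvFun (x₀ : X) (A : AffineIndex n) {m : Model n}
    (hm : m.1 ∈ (chartAt (Vec n) x₀).target) :
    ContMDiffAt 𝓘(ℝ, Model n) 𝓘(ℝ, Model n) ∞ (affineInvFun x₀ A) m :=
  contMDiffAt_symm_of_mem_maximalAtlas (affineHomeo_mem_maximalAtlas x₀ A)
    (show m ∈ (chartAt (Vec n) x₀).target ×ˢ univ from ⟨hm, mem_univ _⟩)

theorem isOpen_affineSource (x₀ : X) (A : AffineIndex n) :
    IsOpen (affineSource x₀ A : Set (ContactElementSpace n X)) :=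
  (affineHomeo x₀ A).open_source

theorem affineInvFun_affineToFun (x₀ : X) (A : AffineIndex n) {y : ContactElementSpace n X}
    (hy : y ∈ affineSource x₀ A) : affineInvFun x₀ A (affineToFun x₀ A y) = y :=
  (affineChart x₀ A).left_inv hy

theorem basePoint_toRay (z : CotangentBundle n X) (hz : z.2 ≠ 0) : basePoint (toRay z hz) = z.1 :=
  rfl

theorem affineSource_basePoint {x₀ : X} {A : AffineIndex n} {y : ContactElementSpace n X}
    (hy : y ∈ affineSource x₀ A) : basePoint y ∈ (chartAt (Vec n) x₀).source := by
  obtain ⟨z, hz, rfl, h, -⟩ := hy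
  exact h

theorem affineToFun_fst (x₀ : X) (A : AffineIndex n) (y : ContactElementSpace n X) :
    (affineToFun x₀ A y).1 = chartAt (Vec n) x₀ (basePoint y) := by
  obtain ⟨z, hz, rfl⟩ := toRay_surj y
  rfl

theorem affineToFun_fst_mem {x₀ : X} {A : AffineIndex n} {y : ContactElementSpace n X}
    (hy : y ∈ affineSource x₀ A) : (affineToFun x₀ A y).1 ∈ (chartAt (Vec n) x₀).target := by
  rw [affineToFun_fst]
  exact (chartAt (Vec n) x₀).map_source (affineSource_basePoint hy)

theorem basePoint_affineInvFun (x₀ : X) (A : AffineIndex n) {m : Model n}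
    (hm : m.1 ∈ (chartAt (Vec n) x₀).target) :
    basePoint (affineInvFun x₀ A m) = (chartAt (Vec n) x₀).symm m.1 := by
  rw [affineInvFun_of_mem x₀ A hm]
  rfl

theorem contMDiff_basePoint :
    ContMDiff 𝓘(ℝ, Model n) (𝓡 n) ∞ (basePoint : ContactElementSpace n X → X) := by
  intro y
  obtain ⟨A, hA⟩ := exists_mem_affineSource y
  have h1 := contMDiffAt_affineToFun _ _ hA
  have h2 := contMDiffAt_symm_of_mem_maximalAtlas (I := 𝓡 n) (n := ∞)
      (IsManifold.chart_mem_maximalAtlas (basePoint y)) (affineToFun_fst_mem hA)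
  have h3 := h2.comp y ((contDiff_fst (n := ∞)).contMDiff.contMDiffAt.comp y h1)
  refine h3.congr_of_eventuallyEq ?_
  filter_upwards [(isOpen_affineSource _ A).mem_nhds hA] with w hw
  simp only [Function.comp, affineToFun_fst]
  rw [(chartAt (Vec n) _).left_inv (affineSource_basePoint hw)]

/-- A local expression of the projection `τ`, defined everywhere. -/
def localRay (x₀ : X) (A : AffineIndex n) (z : CotangentBundle n X) : ContactElementSpace n X :=
  affineInvFun x₀ A ((covectorChart x₀ z).1, affineFun A (covectorChart x₀ z).2)

/-- A local section of the projection `τ`. -/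
def localSection (x₀ : X) (A : AffineIndex n) (y : ContactElementSpace n X) :
    CotangentBundle n X :=
  ofCoords x₀ ((affineToFun x₀ A y).1, A.symm (1, (affineToFun x₀ A y).2))

theorem localRay_eq (x₀ : X) (A : AffineIndex n) {z : CotangentBundle n X} (hz : z.2 ≠ 0)
    (h : toRay z hz ∈ affineSource x₀ A) : localRay x₀ A z = toRay z hz :=
  affineInvFun_affineToFun x₀ A h

theorem contMDiffAt_localRay (x₀ : X) (A : AffineIndex n) {z : CotangentBundle n X}
    (h : z.1 ∈ (chartAt (Vec n) x₀).source) (h' : (A (coords x₀ z)).1 ≠ 0) :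
    ContMDiffAt (cotangentModel n) 𝓘(ℝ, Model n) ∞ (localRay x₀ A) z := by
  have h1 := contMDiffAt_covectorChart x₀ h
  have h2 : ContDiffAt ℝ ∞ (fun m : Vec n × Covec n => ((m.1, affineFun A m.2) : Model n))
      (covectorChart x₀ z) := by
    have h3 : ContDiffAt ℝ ∞ (fun m : Vec n × Covec n => A m.2) (covectorChart x₀ z) := by
      fun_prop
    exact contDiffAt_fst.prodMk ((h3.fst.inv h').smul h3.snd)
  have h3 : ContMDiffAt 𝓘(ℝ, Model n) 𝓘(ℝ, Model n) ∞ (affineInvFun x₀ A)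
      ((covectorChart x₀ z).1, affineFun A (covectorChart x₀ z).2) :=
    contMDiffAt_affineInvFun x₀ A ((chartAt (Vec n) x₀).map_source h)
  exact h3.comp z (h2.contMDiffAt.comp z h1)

theorem contMDiffAt_localSection (x₀ : X) (A : AffineIndex n) {y : ContactElementSpace n X}
    (hy : y ∈ affineSource x₀ A) :
    ContMDiffAt 𝓘(ℝ, Model n) (cotangentModel n) ∞ (localSection x₀ A) y := by
  have h1 := contMDiffAt_affineToFun x₀ A hy
  have h2 : ContDiff ℝ ∞ (fun m : Model n => (m.1, A.symm (1, m.2))) := by fun_prop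
  have h3 : ContMDiffAt 𝓘(ℝ, Vec n × Covec n) (cotangentModel n) ∞ (ofCoords x₀)
      ((affineToFun x₀ A y).1, A.symm (1, (affineToFun x₀ A y).2)) :=
    contMDiffAt_ofCoords x₀ (affineToFun_fst_mem hy)
  exact h3.comp y (h2.contMDiff.contMDiffAt.comp y h1)

theorem localSection_snd_ne (x₀ : X) (A : AffineIndex n) {y : ContactElementSpace n X}
    (hy : y ∈ affineSource x₀ A) : (localSection x₀ A y).2 ≠ 0 :=
  coords_covector_ne _ _ (affineIndex_symm_ne A _)
    ((chartAt (Vec n) x₀).map_target (affineToFun_fst_mem hy))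

theorem toRay_localSection (x₀ : X) (A : AffineIndex n) {y : ContactElementSpace n X}
    (hy : y ∈ affineSource x₀ A) : toRay (localSection x₀ A y) (localSection_snd_ne x₀ A hy) = y := by
  conv_rhs => rw [← affineInvFun_affineToFun x₀ A hy, affineInvFun_of_mem x₀ A
    (affineToFun_fst_mem hy)]
  rfl

end Coordinates

/-! ## Lifts of contactomorphisms to the cotangent bundle -/

/-- Equal positive half-spaces force the kernel of `L'` to lie in that of `L`, so the functionals
are proportional; a vector with `L' = 1` then gives the positive factor. If `L' = 0`, both vanish
and the factor is arbitrary. -/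
theorem exists_smul_eq_of_pos_iff {E : Type*} [NormedAddCommGroup E] [NormedSpace ℝ E]
    {L L' : E →L[ℝ] ℝ} (h : ∀ v, 0 < L v ↔ 0 < L' v) : ∃ μ : ℝ, 0 < μ ∧ L = μ • L' := by
  have hker : ∀ v, L' v = 0 → L v = 0 := by
    intro v hv
    by_contra hne
    rcases lt_or_gt_of_ne hne with h1 | h1
    · have := (h (-v)).1 (by simpa using h1)
      simp [hv] at this
    · have := (h v).1 h1
      simp [hv] at this
  by_cases h0 : L' = 0
  · refine ⟨1, one_pos, ?_⟩
    ext v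
    simp [h0, hker v (by simp [h0])]
  · obtain ⟨v, hv⟩ : ∃ v, L' v ≠ 0 := by
      by_contra! hc
      exact h0 (ContinuousLinearMap.ext hc)
    have hpos : 0 < L' ((L' v)⁻¹ • v) := by simp [hv]
    have h1 : L' ((L' v)⁻¹ • v) = 1 := by simp [hv]
    set e := (L' v)⁻¹ • v
    refine ⟨L e, (h e).2 hpos, ?_⟩
    ext w
    have := hker (w - L' w • e) (by simp [h1])
    simp only [map_sub, map_smul, smul_eq_mul] at this
    simp only [smul_apply, smul_eq_mul]
    linarith

section Lifts
variable {n : ℕ} {X : Type u} [TopologicalSpace X]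
  [ChartedSpace (EuclideanSpace ℝ (Fin n)) X] [IsManifold (𝓡 n) ∞ X]

/-- The covector `z` pulled back to the tangent space of `P_+T^*X` at `y`. -/
def pulledCovector (z : CotangentBundle n X) (y : ContactElementSpace n X) : Model n →L[ℝ] ℝ :=
  ContinuousLinearMap.comp (show Covec n from z.2)
    (show Model n →L[ℝ] Vec n from mfderiv 𝓘(ℝ, Model n) (𝓡 n) basePoint y)

theorem pulledCovector_smul (x : X) (c : ℝ) (p : TangentSpace (𝓡 n) x →L[ℝ] ℝ)
    (y : ContactElementSpace n X) :
    pulledCovector (⟨x, c • p⟩ : CotangentBundle n X) y = c • pulledCovector ⟨x, p⟩ y := rfl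

/-- In an affine chart the projection to `X` is the first component, so a covector pulled back to
P_+T^*X only sees the base part of a coordinate vector. -/
theorem pulledCovector_mfderiv_affineInvFun (x₀ : X) (A : AffineIndex n)
    {z : CotangentBundle n X} (hz : z.1 ∈ (chartAt (Vec n) x₀).source) {m : Model n}
    (hm : m.1 = chartAt (Vec n) x₀ z.1) (u : Model n) :
    pulledCovector z (affineInvFun x₀ A m) (mfderiv 𝓘(ℝ, Model n) 𝓘(ℝ, Model n)
      (affineInvFun x₀ A) m u) = coords x₀ z u.1 := by
  have ht : m.1 ∈ (chartAt (Vec n) x₀).target := hm ▸ (chartAt (Vec n) x₀).map_source hz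
  have h1 := mfderiv_comp m ((contMDiff_basePoint (affineInvFun x₀ A m)).mdifferentiableAt
    (by simp)) ((contMDiffAt_affineInvFun x₀ A ht).mdifferentiableAt (by simp))
  have h2 : basePoint ∘ affineInvFun x₀ A =ᶠ[𝓝 m]
      (chartAt (Vec n) x₀).symm ∘ fun m : Model n => m.1 := by
    filter_upwards [((chartAt (Vec n) x₀).open_target.preimage continuous_fst).mem_nhds ht]
      with w hw using basePoint_affineInvFun x₀ A hw
  have h3 : MDifferentiableAt 𝓘(ℝ, Vec n) (𝓡 n) (chartAt (Vec n) x₀).symm m.1 :=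
    (contMDiffAt_symm_of_mem_maximalAtlas (I := 𝓡 n) (n := ∞)
      (IsManifold.chart_mem_maximalAtlas x₀) ht).mdifferentiableAt (by simp)
  have h4 := mfderiv_comp (I := 𝓘(ℝ, Model n)) m (f := fun m : Model n => m.1) h3
    (by exact (contDiff_fst (n := ∞)).contMDiff.contMDiffAt.mdifferentiableAt (by simp))
  have h7 : mfderiv 𝓘(ℝ, Model n) 𝓘(ℝ, Vec n) (fun m : Model n => m.1) m =
      ContinuousLinearMap.fst ℝ (Vec n) (ModelFibre n) := by
    rw [mfderiv_eq_fderiv]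
    exact fderiv_fst
  have h8 := h1.symm.trans (h2.mfderiv_eq.trans h4)
  have h9 := congrArg (fun L : Model n →L[ℝ] Vec n => z.2 (L u)) h8
  refine h9.trans ?_
  have h10 := congrArg (fun L : Model n →L[ℝ] Vec n => z.2
    (mfderiv 𝓘(ℝ, Vec n) (𝓡 n) (chartAt (Vec n) x₀).symm m.1 (L u))) h7
  refine h10.trans ?_
  have h11 := ofCoords_snd_mfderiv x₀ (coords x₀ z) ht u.1
  rw [show ((m.1, coords x₀ z) : Vec n × Covec n) = covectorChart x₀ z from Prod.ext hm rfl,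
    ofCoords_covectorChart x₀ hz] at h11
  exact h11

theorem coords_ne_zero {x₀ : X} {z : CotangentBundle n X} (h : z.1 ∈ (chartAt (Vec n) x₀).source)
    (hz : z.2 ≠ 0) : coords x₀ z ≠ 0 := by
  intro h0
  apply hz
  rw [← covector_coords x₀ z h, h0]
  rfl

theorem pulledCovector_ne_zero (z : CotangentBundle n X) (hz : z.2 ≠ 0) :
    pulledCovector z (toRay z hz) ≠ 0 := by
  obtain ⟨A, hA⟩ := exists_mem_affineSource (toRay z hz)
  rw [basePoint_toRay] at hA
  have hs : z.1 ∈ (chartAt (Vec n) z.1).source := mem_chart_source _ _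
  obtain ⟨u, hu⟩ : ∃ u, coords z.1 z u ≠ 0 := by
    by_contra! hc
    exact coords_ne_zero hs hz (ContinuousLinearMap.ext hc)
  intro h0
  apply hu
  rw [← pulledCovector_mfderiv_affineInvFun z.1 A hs (m := affineToFun z.1 A (toRay z hz)) rfl (u, 0),
    affineInvFun_affineToFun _ A hA, h0]
  rfl

/-- Representatives of one ray differ by positive factors, so the existential in the definition may
be tested on any of them. -/
theorem mem_positiveSide_iff {z : CotangentBundle n X} (hz : z.2 ≠ 0)
    {V : TangentBundle 𝓘(ℝ, Model n) (ContactElementSpace n X)} (hV : V.1 = toRay z hz) :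
    V ∈ positiveSide n X ↔ 0 < pulledCovector z V.1 V.2 := by
  constructor
  · rintro ⟨z', hz', v', h, hpos⟩
    have h1 : pulledCovector z' V.1 V.2 = pulledCovector z' (toRay z' hz') v' :=
      congrArg (fun V : TangentBundle 𝓘(ℝ, Model n) (ContactElementSpace n X) =>
        pulledCovector z' V.1 V.2) h
    have h2 : toRay z' hz' = toRay z hz := by rw [← hV, h]
    obtain ⟨c, hc, rfl⟩ := (toRay_eq_iff hz' hz).1 h2
    rw [pulledCovector_smul]
    have h3 : 0 < pulledCovector z' V.1 V.2 := by
      rw [h1]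
      exact hpos
    exact mul_pos hc h3
  · intro h
    obtain ⟨y, v⟩ := V
    dsimp only at hV
    subst hV
    exact ⟨z, hz, v, rfl, h⟩

theorem ContactForm.exists_smul (α : ContactForm n X) (z : CotangentBundle n X) (hz : z.2 ≠ 0) :
    ∃ r : ℝ, 0 < r ∧ pulledCovector z (toRay z hz) = r • (show Model n →L[ℝ] ℝ from
      α.form (toRay z hz)) := by
  refine exists_smul_eq_of_pos_iff fun v => ?_
  exact (mem_positiveSide_iff (V := ⟨toRay z hz, v⟩) hz rfl).symm.trans (α.pos_iff ⟨_, v⟩).symm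

/-- `G` lifts the diffeomorphism `f` of `P_+T^*X` to nonzero covectors, compatibly with the
pairing of covectors with tangent vectors. -/
def IsLift (f : ContactElementSpace n X → ContactElementSpace n X)
    (G : CotangentBundle n X → CotangentBundle n X) : Prop :=
  ∀ z (hz : z.2 ≠ 0), ∃ hz' : (G z).2 ≠ 0, toRay (G z) hz' = f (toRay z hz) ∧
    ∀ v : Model n, pulledCovector (G z) (f (toRay z hz))
      (mfderiv 𝓘(ℝ, Model n) 𝓘(ℝ, Model n) f (toRay z hz) v) = pulledCovector z (toRay z hz) v

/-- Uniqueness of lifts: the ray fixes the covector up to a positive factor, and the pairing with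
one vector on which `z` does not vanish makes this factor `1`. -/
theorem IsLift.eq_of {f : ContactElementSpace n X → ContactElementSpace n X}
    {G : CotangentBundle n X → CotangentBundle n X} (h : IsLift f G) {z w : CotangentBundle n X}
    (hz : z.2 ≠ 0) (hw : w.2 ≠ 0) (h₁ : toRay w hw = f (toRay z hz))
    (h₂ : ∀ v : Model n, pulledCovector w (f (toRay z hz))
      (mfderiv 𝓘(ℝ, Model n) 𝓘(ℝ, Model n) f (toRay z hz) v) = pulledCovector z (toRay z hz) v) :
    G z = w := by
  obtain ⟨hz', h3, h4⟩ := h z hz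
  obtain ⟨c, hc, hG⟩ := (toRay_eq_iff hw hz').1 (h₁.trans h3.symm)
  obtain ⟨v, hv⟩ : ∃ v, pulledCovector z (toRay z hz) v ≠ 0 := by
    by_contra! hc
    exact pulledCovector_ne_zero z hz (ContinuousLinearMap.ext hc)
  have h5 := h4 v
  rw [hG, pulledCovector_smul] at h5
  have h6 := h₂ v
  have h7 : c * pulledCovector z (toRay z hz) v = pulledCovector z (toRay z hz) v := by
    rw [← h6] at h5 ⊢
    exact h5
  have h8 : c = 1 := by
    have := mul_right_cancel₀ hv (h7.trans (one_mul _).symm)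
    exact this
  rw [hG, h8, one_smul]

/-- The dilated image has the defining properties of the image of the dilated covector; uniqueness
does the rest. -/
theorem IsLift.smul {f : ContactElementSpace n X → ContactElementSpace n X}
    {G : CotangentBundle n X → CotangentBundle n X} (h : IsLift f G) {z : CotangentBundle n X}
    (hz : z.2 ≠ 0) {c : ℝ} (hc : 0 < c) : G ⟨z.1, c • z.2⟩ = ⟨(G z).1, c • (G z).2⟩ := by
  have hcz : c • z.2 ≠ 0 := smul_ne_zero hc.ne' hz
  obtain ⟨hz', h3, h4⟩ := h z hz
  have e1 : toRay (⟨z.1, c • z.2⟩ : CotangentBundle n X) hcz = toRay z hz :=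
    ((toRay_eq_iff hz hcz).2 ⟨c, hc, rfl⟩).symm
  have e2 : toRay (⟨(G z).1, c • (G z).2⟩ : CotangentBundle n X) (smul_ne_zero hc.ne' hz') =
    toRay (G z) hz' := ((toRay_eq_iff hz' _).2 ⟨c, hc, rfl⟩).symm
  refine h.eq_of hcz (smul_ne_zero hc.ne' hz') ?_ fun v => ?_
  · rw [e1, e2, h3]
  · rw [e1, pulledCovector_smul, pulledCovector_smul]
    exact congrArg (c * ·) (h4 v)

/-- Any representative `w` of the image ray, pulled back by df, has the same positive side as `z`,
because f preserves the coorientation. Hence a positive multiple of `w` pulls back exactly to `z`.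
-/
theorem Contactomorphism.exists_lift_at (f : Contactomorphism n X) (z : CotangentBundle n X)
    (hz : z.2 ≠ 0) : ∃ w : CotangentBundle n X, ∃ hw : w.2 ≠ 0, toRay w hw = f.1 (toRay z hz) ∧
    ∀ v : Model n, pulledCovector w (f.1 (toRay z hz))
      (mfderiv 𝓘(ℝ, Model n) 𝓘(ℝ, Model n) f.1 (toRay z hz) v) =
        pulledCovector z (toRay z hz) v := by
  obtain ⟨w, hw, hwf⟩ := toRay_surj (f.1 (toRay z hz))
  obtain ⟨μ, hμ, h⟩ := exists_smul_eq_of_pos_iff (L := pulledCovector z (toRay z hz))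
    (L' := (pulledCovector w (f.1 (toRay z hz))).comp (show Model n →L[ℝ] Model n from
      mfderiv 𝓘(ℝ, Model n) 𝓘(ℝ, Model n) f.1 (toRay z hz))) (fun v => by
    have h1 := f.2 ⟨toRay z hz, v⟩
    exact ((mem_positiveSide_iff (V := tangentMap 𝓘(ℝ, Model n) 𝓘(ℝ, Model n) f.1
      ⟨toRay z hz, v⟩) hw (by exact hwf)).symm.trans (h1.trans
        (mem_positiveSide_iff (V := ⟨toRay z hz, v⟩) hz rfl))).symm)
  refine ⟨⟨w.1, μ • w.2⟩, smul_ne_zero hμ.ne' hw, ?_, fun v => ?_⟩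
  · rw [hwf]
    exact ((toRay_eq_iff hw _).2 ⟨μ, hμ, rfl⟩).symm
  · rw [pulledCovector_smul, h]
    rfl

/-- The inverse contactomorphism. -/
def Contactomorphism.symm (f : Contactomorphism n X) : Contactomorphism n X :=
  ⟨f.1.symm, fun V => by
    have h2 := f.2 (tangentMap 𝓘(ℝ, Model n) 𝓘(ℝ, Model n) f.1.symm V)
    have h3 : tangentMap 𝓘(ℝ, Model n) 𝓘(ℝ, Model n) f.1
        (tangentMap 𝓘(ℝ, Model n) 𝓘(ℝ, Model n) f.1.symm V) = V := by
      rw [← tangentMap_comp_at _ (f.1.contMDiff.mdifferentiableAt (by simp))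
        (f.1.symm.contMDiff.mdifferentiableAt (by simp))]
      have : (f.1 : ContactElementSpace n X → ContactElementSpace n X) ∘ f.1.symm = id :=
        funext fun y => f.1.apply_symm_apply y
      rw [this, tangentMap_id, id]
    rw [h3] at h2
    exact h2.symm⟩

/-- The composition `g ∘ f` of contactomorphisms. -/
def Contactomorphism.trans (f g : Contactomorphism n X) : Contactomorphism n X :=
  ⟨f.1.trans g.1, fun V => by
    rw [Diffeomorph.coe_trans, tangentMap_comp_at _ (g.1.contMDiff.mdifferentiableAt (by simp))
        (f.1.contMDiff.mdifferentiableAt (by simp)), g.2, f.2]⟩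

open Classical in
/-- The lift of a contactomorphism to the cotangent bundle, extended by the identity of the zero
section. -/
def Contactomorphism.liftFun (f : Contactomorphism n X) (z : CotangentBundle n X) :
    CotangentBundle n X :=
  if hz : z.2 ≠ 0 then (f.exists_lift_at z hz).choose else z

theorem Contactomorphism.isLift_liftFun (f : Contactomorphism n X) : IsLift f.1 f.liftFun := by
  intro z hz
  have h : f.liftFun z = (f.exists_lift_at z hz).choose := dif_pos hz
  rw [h]
  exact (f.exists_lift_at z hz).choose_spec

theorem Contactomorphism.liftFun_zero (f : Contactomorphism n X) {z : CotangentBundle n X}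
    (hz : z.2 = 0) : f.liftFun z = z := dif_neg (by simpa using hz)

theorem IsLift.comp {f g : ContactElementSpace n X → ContactElementSpace n X}
    {G G' : CotangentBundle n X → CotangentBundle n X}
    (hf : ContMDiff 𝓘(ℝ, Model n) 𝓘(ℝ, Model n) ∞ f)
    (hg : ContMDiff 𝓘(ℝ, Model n) 𝓘(ℝ, Model n) ∞ g) (h : IsLift f G) (h' : IsLift g G') :
    IsLift (g ∘ f) (G' ∘ G) := by
  intro z hz
  obtain ⟨h1, h2, h3⟩ := h z hz
  obtain ⟨h4, h5, h6⟩ := h' (G z) h1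
  refine ⟨h4, ?_, fun v => ?_⟩
  · simp only [Function.comp, h5, h2]
  · rw [← h3, mfderiv_comp _ ((hg _).mdifferentiableAt (by simp))
      ((hf _).mdifferentiableAt (by simp))]
    rw [h2] at h6
    exact h6 _

theorem isLift_id : IsLift (id : ContactElementSpace n X → _) id := by
  intro z hz
  refine ⟨hz, rfl, fun v => ?_⟩
  rw [mfderiv_id]
  rfl

theorem IsLift.unique {f : ContactElementSpace n X → ContactElementSpace n X}
    {G G' : CotangentBundle n X → CotangentBundle n X} (h : IsLift f G) (h' : IsLift f G')
    {z : CotangentBundle n X} (hz : z.2 ≠ 0) : G z = G' z := by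
  obtain ⟨h1, h2, h3⟩ := h' z hz
  exact h.eq_of hz h1 h2 h3

theorem Contactomorphism.liftFun_symm_liftFun (f : Contactomorphism n X)
    (z : CotangentBundle n X) : f.symm.liftFun (f.liftFun z) = z := by
  by_cases hz : z.2 = 0
  · rw [f.liftFun_zero hz, f.symm.liftFun_zero hz]
  · have h := f.isLift_liftFun.comp f.1.contMDiff f.symm.1.contMDiff f.symm.isLift_liftFun
    rw [show (f.symm.1 : ContactElementSpace n X → _) ∘ f.1 = id from
      funext fun y => f.1.symm_apply_apply y] at h
    exact h.unique isLift_id hz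

/-- The lift of a contactomorphism as a bijection. -/
def Contactomorphism.lift (f : Contactomorphism n X) : CotangentBundle n X ≃ CotangentBundle n X where
  toFun := f.liftFun
  invFun := f.symm.liftFun
  left_inv := f.liftFun_symm_liftFun
  right_inv z := f.symm.liftFun_symm_liftFun z

/-- The ratio p/α is preserved: the lift transports the covector and the pushforward transports the
form by the same df. -/
theorem mem_domain_pushforward_iff (f : Contactomorphism n X) (α : ContactForm n X)
    {G : CotangentBundle n X → CotangentBundle n X} (h : IsLift f.1 G)
    (h₀ : ∀ z, z.2 = 0 → (G z).2 = 0) (z : CotangentBundle n X) :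
    G z ∈ (f.pushforward α).domain ↔ z ∈ α.domain := by
  by_cases hz : z.2 = 0
  · exact ⟨fun _ => Or.inr hz, fun _ => Or.inr (h₀ z hz)⟩
  obtain ⟨h1, h2, h3⟩ := h z hz
  have hinv : ∀ v : Model n, (f.pushforward α).form (f.1 (toRay z hz))
      (mfderiv 𝓘(ℝ, Model n) 𝓘(ℝ, Model n) f.1 (toRay z hz) v) = α.form (toRay z hz) v := by
    intro v
    have h4 : OneForm.pullback f.1 (f.pushforward α).form = α.form := by
      have := pullback_comp (I := 𝓘(ℝ, Model n)) f.1.symm.contMDiff f.1.contMDiff α.form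
      rw [show (f.1.symm : ContactElementSpace n X → _) ∘ f.1 = id from
        funext fun y => f.1.symm_apply_apply y] at this
      refine Eq.trans this.symm ?_
      funext y
      change (α.form y).comp (mfderiv 𝓘(ℝ, Model n) 𝓘(ℝ, Model n) id y) = _
      rw [mfderiv_id]
      rfl
    exact congrArg (fun β : OneForm 𝓘(ℝ, Model n) (ContactElementSpace n X) =>
      β (toRay z hz) v) h4
  -- Since df is onto, an identity of covectors at the image point can be tested on the vectors
  -- df(v).
  have hsurj : ∀ w : Model n, ∃ v : Model n,
      mfderiv 𝓘(ℝ, Model n) 𝓘(ℝ, Model n) f.1 (toRay z hz) v = w := by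
    intro w
    have h4 := mfderiv_comp (f.1 (toRay z hz))
      (f.1.contMDiff.mdifferentiableAt (by simp) (x := f.1.symm (f.1 (toRay z hz))))
      (f.1.symm.contMDiff.mdifferentiableAt (by simp))
    rw [show (f.1 : ContactElementSpace n X → _) ∘ f.1.symm = id from
        funext fun y => f.1.apply_symm_apply y, mfderiv_id, f.1.symm_apply_apply] at h4
    exact ⟨mfderiv 𝓘(ℝ, Model n) 𝓘(ℝ, Model n) f.1.symm (f.1 (toRay z hz)) w,
      (congrArg (fun L : Model n →L[ℝ] Model n => L w) h4).symm⟩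
  have key : ∀ r : ℝ, (contactCovector (G z) h1 = r • (f.pushforward α).form (toRay (G z) h1)) ↔
      contactCovector z hz = r • α.form (toRay z hz) := by
    intro r
    have h5 : (contactCovector (G z) h1 = r • (f.pushforward α).form (toRay (G z) h1)) ↔
      pulledCovector (G z) (f.1 (toRay z hz)) = r • (show Model n →L[ℝ] ℝ from
        (f.pushforward α).form (f.1 (toRay z hz))) := by
      rw [← h2]
      rfl
    rw [h5]
    constructor
    · intro h6
      refine ContinuousLinearMap.ext fun v => ?_
      have h7 := congrArg (fun L : Model n →L[ℝ] ℝ => L (mfderiv 𝓘(ℝ, Model n) 𝓘(ℝ, Model n) f.1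
        (toRay z hz) v)) h6
      exact (h3 v).symm.trans (h7.trans (congrArg (r * ·) (hinv v)))
    · intro h6
      refine ContinuousLinearMap.ext fun w => ?_
      obtain ⟨v, rfl⟩ := hsurj w
      have h7 := congrArg (fun L : Model n →L[ℝ] ℝ => L v) h6
      exact (h3 v).trans (h7.trans (congrArg (r * ·) (hinv v)).symm)
  constructor
  · rintro (⟨hz', r, hr, h6⟩ | h6)
    · exact Or.inl ⟨hz, r, hr, (key r).1 h6⟩
    · exact absurd h6 h1
  · rintro (⟨hz', r, hr, h6⟩ | h6)
    · exact Or.inl ⟨h1, r, hr, (key r).2 h6⟩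
    · exact absurd h6 hz

theorem domain_pushforward (f : Contactomorphism n X) (α : ContactForm n X)
    (G : CotangentBundle n X ≃ CotangentBundle n X) (h : IsLift f.1 G)
    (h₀ : ∀ z, z.2 = 0 → (G z).2 = 0) : (f.pushforward α).domain = G '' α.domain := by
  ext w
  obtain ⟨z, rfl⟩ := G.surjective w
  rw [mem_domain_pushforward_iff f α h h₀, G.injective.mem_set_image]

end Lifts

/-! ## Exact symplectomorphisms and shapes -/

section ExactSymplectic
variable {n : ℕ} {X : Type u} [TopologicalSpace X]
  [ChartedSpace (EuclideanSpace ℝ (Fin n)) X] [IsManifold (𝓡 n) ∞ X]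

theorem liouvilleForm_eq (x₀ : X) {z : CotangentBundle n X}
    (hz : z.1 ∈ (chartAt (Vec n) x₀).source) (v : Vec n × Covec n) :
    liouvilleForm n X z v = (covectorChart x₀ z).2 (show Vec n × Covec n from
      mfderiv (cotangentModel n) 𝓘(ℝ, Vec n × Covec n) (covectorChart x₀) z v).1 := by
  have ht : (covectorChart x₀ z).1 ∈ (chartAt (Vec n) x₀).target :=
    (chartAt (Vec n) x₀).map_source hz
  let D : Vec n × Covec n →L[ℝ] Vec n × Covec n :=
    mfderiv (cotangentModel n) 𝓘(ℝ, Vec n × Covec n) (covectorChart x₀) z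
  let D' : Vec n × Covec n →L[ℝ] Vec n × Covec n :=
    mfderiv 𝓘(ℝ, Vec n × Covec n) (cotangentModel n) (ofCoords x₀) (covectorChart x₀ z)
  have h2 : ofCoords x₀ ∘ covectorChart x₀ =ᶠ[𝓝 z] id :=
    (eventually_proj_mem (chartAt (Vec n) x₀).open_source hz).mono
      fun w hw => ofCoords_covectorChart x₀ hw
  have h1 : D'.comp D = ContinuousLinearMap.id ℝ (Vec n × Covec n) :=
    (mfderiv_comp z (I'' := cotangentModel n)
      ((contMDiffAt_ofCoords x₀ ht).mdifferentiableAt (by simp))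
      ((contMDiffAt_covectorChart x₀ hz).mdifferentiableAt (by simp))).symm.trans
        (h2.mfderiv_eq.trans mfderiv_id)
  have h4 : D' (D v) = v := congrArg (fun L : Vec n × Covec n →L[ℝ] Vec n × Covec n => L v) h1
  have h3 : ∀ {z' : CotangentBundle n X} (_ : z' = z) (u : Vec n × Covec n),
      (show Vec n × Covec n →L[ℝ] ℝ from liouvilleForm n X z) u =
        (show Vec n × Covec n →L[ℝ] ℝ from liouvilleForm n X z') u := by
    rintro _ rfl u
    rfl
  have h5 := h3 (ofCoords_covectorChart x₀ hz) (D' (D v))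
  rw [h4] at h5
  have h6 := liouvilleForm_ofCoords x₀ ht (D v)
  exact h5.trans ((congrArg (show Vec n × Covec n →L[ℝ] ℝ from
    liouvilleForm n X (ofCoords x₀ (covectorChart x₀ z))) h4.symm).trans h6)

/-- Smoothness makes `extDeriv_pullback` available for the canonical form, and through it the
relation between Ω and restrictions of p dq. -/
theorem liouvilleForm_isSmooth : (liouvilleForm n X).IsSmooth := by
  intro V
  have hz : V.1.1 ∈ (chartAt (Vec n) V.1.1).source := mem_chart_source _ _
  have h1 := contMDiffAt_tangentMap (V := V) (eventually_contMDiffAt_covectorChart V.1.1 hz)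
  have h2 : ContMDiffAt (cotangentModel n).tangent 𝓘(ℝ, Vec n × Covec n) ∞
      (fun W : TangentBundle (cotangentModel n) (CotangentBundle n X) =>
        covectorChart V.1.1 W.1) V :=
    (contMDiffAt_covectorChart V.1.1 hz).comp V (contMDiff_proj _).contMDiffAt
  have h3 := ((contMDiff_snd_tangentBundle_modelSpace (Vec n × Covec n)
    𝓘(ℝ, Vec n × Covec n) (n := ∞)).contMDiffAt).comp V h1
  have h4 : ContDiff ℝ ∞ (fun p : (Vec n × Covec n) × (Vec n × Covec n) => p.1.2 p.2.1) := by
    fun_prop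
  refine ContMDiffAt.congr_of_eventuallyEq (h4.contMDiff.contMDiffAt.comp V (h2.prodMk_space h3)) ?_
  have h5 : ∀ᶠ W : TangentBundle (cotangentModel n) (CotangentBundle n X) in 𝓝 V,
      W.1.1 ∈ (chartAt (Vec n) V.1.1).source :=
    ((contMDiff_proj (IB := cotangentModel n) (n := ∞) (TangentSpace (cotangentModel n) :
      CotangentBundle n X → Type)).continuous.tendsto V).eventually
      (eventually_proj_mem (chartAt (Vec n) V.1.1).open_source hz)
  filter_upwards [h5] with W hW
  exact liouvilleForm_eq V.1.1 hW W.2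

/-- Diffeomorphisms `Φ` of `T^*X` that preserve the Liouville form up to an exact form and preserve
the zero section. `T` is the map that `Φ` induces in cohomology. -/
structure IsExactSymplectic
    (Φ : CotangentBundle n X ≃ₘ⟮cotangentModel n, cotangentModel n⟯ CotangentBundle n X)
    (T : DeRhamH1 (𝓡 n) X ≃ₗ[ℝ] DeRhamH1 (𝓡 n) X) : Prop where
  exact : ∃ F : CotangentBundle n X → ℝ, ContMDiff (cotangentModel n) 𝓘(ℝ, ℝ) ∞ F ∧
    OneForm.pullback Φ (liouvilleForm n X) = liouvilleForm n X + OneForm.differential F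
  zeroSection : ∀ z, (Φ z).2 = 0 ↔ z.2 = 0
  map_eq : ∀ (g : C^∞⟮𝓡 n, X; cotangentModel n, CotangentBundle n X⟯) c,
    DeRhamH1.map ((cotangentProj n X).comp (Φ.toContMDiffMap.comp g)) c =
      DeRhamH1.map ((cotangentProj n X).comp g) (T c)

theorem mfderiv_comp_diffeomorph_injective
    (Φ : CotangentBundle n X ≃ₘ⟮cotangentModel n, cotangentModel n⟯ CotangentBundle n X)
    {g : X → CotangentBundle n X} {x : X} (hg : MDifferentiableAt (𝓡 n) (cotangentModel n) g x)
    (h : Function.Injective (mfderiv (𝓡 n) (cotangentModel n) g x)) :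
    Function.Injective (mfderiv (𝓡 n) (cotangentModel n) (Φ ∘ g) x) := by
  have h1 := mfderiv_comp x (Φ.contMDiff.mdifferentiableAt (by simp)) hg
  have h2 := mfderiv_comp (g x) (Φ.symm.contMDiff.mdifferentiableAt (by simp))
    (Φ.contMDiff.mdifferentiableAt (x := g x) (by simp))
  rw [show (Φ.symm : CotangentBundle n X → _) ∘ Φ = id from
    funext fun z => Φ.symm_apply_apply z, mfderiv_id] at h2
  intro v w hvw
  apply h
  rw [h1] at hvw
  have h3 := congrArg (mfderiv (cotangentModel n) (cotangentModel n) Φ.symm (Φ (g x))) hvw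
  have h4 : ∀ v : TangentSpace (𝓡 n) x, mfderiv (cotangentModel n) (cotangentModel n) Φ.symm
      (Φ (g x)) ((mfderiv (cotangentModel n) (cotangentModel n) Φ (g x)).comp
        (mfderiv (𝓡 n) (cotangentModel n) g x) v) = mfderiv (𝓡 n) (cotangentModel n) g x v :=
    fun v => (congrArg (fun L : Vec n × Covec n →L[ℝ] Vec n × Covec n =>
      L (mfderiv (𝓡 n) (cotangentModel n) g x v)) h2).symm
  exact (h4 v).symm.trans (h3.trans (h4 w))

namespace IsExactSymplectic
variable {Φ : CotangentBundle n X ≃ₘ⟮cotangentModel n, cotangentModel n⟯ CotangentBundle n X}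
  {T : DeRhamH1 (𝓡 n) X ≃ₗ[ℝ] DeRhamH1 (𝓡 n) X}

theorem symm (h : IsExactSymplectic Φ T) : IsExactSymplectic Φ.symm T.symm := by
  have hid : (Φ : CotangentBundle n X → _) ∘ Φ.symm = id := funext fun z => Φ.apply_symm_apply z
  refine ⟨?_, fun z => ?_, fun g c => ?_⟩
  · obtain ⟨F, hF, h1⟩ := h.exact
    -- Pulling Φ^*(p dq) = p dq + dF back by Φ⁻¹ and solving for (Φ⁻¹)^*(p dq) gives the primitive
    -- -F ∘ Φ⁻¹.
    refine ⟨fun z => -F (Φ.symm z), (hF.comp Φ.symm.contMDiff).neg, ?_⟩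
    have h2 := pullback_comp (I := cotangentModel n) Φ.contMDiff Φ.symm.contMDiff
      (liouvilleForm n X)
    rw [hid, h1] at h2
    have h3 : OneForm.pullback (I := cotangentModel n) id (liouvilleForm n X) =
        liouvilleForm n X := by
      funext z
      change (liouvilleForm n X z).comp (mfderiv (cotangentModel n) (cotangentModel n) id z) = _
      rw [mfderiv_id]
      rfl
    rw [h3] at h2
    have h4 : OneForm.pullback Φ.symm (liouvilleForm n X + OneForm.differential F) =
        OneForm.pullback Φ.symm (liouvilleForm n X) +
          (OneForm.differential (F ∘ Φ.symm) : OneForm (cotangentModel n) _) := by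
      rw [differential_eq_pullback (F ∘ Φ.symm), pullback_comp (J := cotangentModel n) hF
        Φ.symm.contMDiff, ← differential_eq_pullback]
      rfl
    rw [h4] at h2
    refine Eq.trans ?_ (congrArg (· + (OneForm.differential fun z => -F (Φ.symm z) :
      OneForm (cotangentModel n) (CotangentBundle n X))) h2.symm)
    rw [add_assoc, left_eq_add]
    funext z
    have h5 := mfderiv_neg (I := cotangentModel n) (f := F ∘ Φ.symm) (x := z)
    exact (congrArg (fun L : Vec n × Covec n →L[ℝ] ℝ => (show Vec n × Covec n →L[ℝ] ℝ from
      mfderiv (cotangentModel n) 𝓘(ℝ, ℝ) (F ∘ Φ.symm) z) + L) h5).trans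
      (add_neg_cancel (G := Vec n × Covec n →L[ℝ] ℝ) _)
  · rw [← h.zeroSection, Φ.apply_symm_apply]
  · have h1 := h.map_eq (Φ.symm.toContMDiffMap.comp g) (T.symm c)
    rw [T.apply_symm_apply] at h1
    rw [← h1]
    congr 2
    ext x
    change (cotangentProj n X) (Φ (Φ.symm (g x))) = _
    rw [Φ.apply_symm_apply]
    rfl

/-- As Ω = d(p dq), isotropy of `g` is closedness of `g^*(p dq)`. In this form it visibly survives
adding an exact form. -/
theorem isotropic_iff {g : X → CotangentBundle n X} (hg : ContMDiff (𝓡 n) (cotangentModel n) ∞ g)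
    (x : X) (v w : Vec n) : symplecticForm (g x)
      (mfderiv (𝓡 n) (cotangentModel n) g x v) (mfderiv (𝓡 n) (cotangentModel n) g x w) =
      (OneForm.pullback (I := 𝓡 n) g (liouvilleForm n X)).extDerivCoord x v w :=
  (OneForm.extDeriv_pullback liouvilleForm_isSmooth hg x v w rfl).symm

theorem pullback_eq (h : IsExactSymplectic Φ T) : ∃ F : CotangentBundle n X → ℝ,
    ContMDiff (cotangentModel n) 𝓘(ℝ, ℝ) ∞ F ∧ ∀ {g : X → CotangentBundle n X},
      ContMDiff (𝓡 n) (cotangentModel n) ∞ g →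
      OneForm.pullback (Φ ∘ g) (liouvilleForm n X) =
        OneForm.pullback g (liouvilleForm n X) + OneForm.differential (I := 𝓡 n) (F ∘ g) := by
  obtain ⟨F, hF, h1⟩ := h.exact
  refine ⟨F, hF, fun {g} hg => ?_⟩
  rw [pullback_comp (J := cotangentModel n) Φ.contMDiff hg, h1, differential_eq_pullback (F ∘ g),
    pullback_comp (J := cotangentModel n) hF hg, ← differential_eq_pullback]
  rfl

theorem isLagrangianEmbedding (h : IsExactSymplectic Φ T) {g : X → CotangentBundle n X}
    (hg : IsLagrangianEmbedding g) : IsLagrangianEmbedding (Φ ∘ g) := by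
  have hs : ContMDiff (𝓡 n) (cotangentModel n) ∞ (Φ ∘ g) := Φ.contMDiff.comp hg.contMDiff
  refine ⟨hs, Φ.toHomeomorph.isEmbedding.comp hg.isEmbedding, fun x =>
    mfderiv_comp_diffeomorph_injective Φ (hg.contMDiff.mdifferentiableAt (by simp))
      (hg.injective_mfderiv x), fun x v w => ?_⟩
  obtain ⟨F, hF, h1⟩ := h.pullback_eq
  refine (isotropic_iff hs x v w).trans ?_
  rw [h1 hg.contMDiff]
  have h2 := differential_mem_closedForms (I := 𝓡 n) (hF.comp hg.contMDiff)
  refine (OneForm.extDeriv_add (liouvilleForm_isSmooth.pullback hg.contMDiff) h2.1 x v w).trans ?_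
  rw [show OneForm.extDerivCoord (OneForm.differential (I := 𝓡 n) (F ∘ g)) x (show Vec n from v)
    (show Vec n from w) = 0 from h2.2 x v w, add_zero]
  exact (isotropic_iff hg.contMDiff x v w).symm.trans (hg.isotropic x v w)

/-- All data of L are composed with Φ. The Liouville form of Φ ∘ g differs from that of g by an
exact form, and π ∘ Φ ∘ g induces (π ∘ g)^* T. So the equation (π ∘ g)^* c = [g^*(p dq)] becomes the
same equation for T⁻¹ c. Preservation of Z keeps the isotopy starting at the zero section. -/
theorem symm_mem_shape (h : IsExactSymplectic Φ T) {U : Set (CotangentBundle n X)}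
    {c : DeRhamH1 (𝓡 n) X} (hc : c ∈ shape U) : T.symm c ∈ shape (Φ '' U) := by
  obtain ⟨L, ⟨g, hg, hgL, hbij⟩, ⟨G, hG, hG', hG0, hG1⟩, hLU, g', hg', hgL', η, hη, hηc⟩ := hc
  refine ⟨Φ '' L, ⟨Φ.toContMDiffMap.comp g, h.isLagrangianEmbedding hg, ?_, ?_⟩,
    ⟨Φ ∘ G, Φ.contMDiff.comp hG, fun t ht => h.isLagrangianEmbedding (hG' t ht), ?_, ?_⟩,
    image_mono hLU, Φ.toContMDiffMap.comp g', h.isLagrangianEmbedding hg', ?_, ?_⟩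
  · rw [← hgL]
    exact range_comp Φ g
  · have : ⇑(DeRhamH1.map ((cotangentProj n X).comp (Φ.toContMDiffMap.comp g))) =
      DeRhamH1.map ((cotangentProj n X).comp g) ∘ T := funext fun c => h.map_eq g c
    rw [this]
    exact hbij.comp T.bijective
  · rw [show (fun x => (Φ ∘ G) (0, x)) = Φ ∘ fun x => G (0, x) from rfl, range_comp, hG0]
    ext z
    constructor
    · rintro ⟨w, hw, rfl⟩
      exact (h.zeroSection w).2 hw
    · intro hz
      refine ⟨Φ.symm z, (h.symm.zeroSection z).2 hz, Φ.apply_symm_apply z⟩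
  · rw [show (fun x => (Φ ∘ G) (1, x)) = Φ ∘ fun x => G (1, x) from rfl, range_comp, hG1]
  · rw [← hgL']
    exact range_comp Φ g'
  · obtain ⟨F, hF, h1⟩ := h.pullback_eq
    have h2 := differential_mem_closedForms (I := 𝓡 n) (hF.comp g'.contMDiff)
    refine ⟨η + ⟨_, h2⟩, ?_, ?_⟩
    · exact (congrArg (· + OneForm.differential (F ∘ g')) hη).trans (h1 g'.contMDiff).symm
    · rw [h.map_eq, T.apply_symm_apply, hηc, eq_comm, Submodule.Quotient.eq]
      refine ⟨_, hF.comp g'.contMDiff, ?_⟩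
      change η.1 + _ - η.1 = _
      exact add_sub_cancel_left _ _

theorem shape_image (h : IsExactSymplectic Φ T) (U : Set (CotangentBundle n X)) :
    shape (Φ '' U) = T.symm '' shape U := by
  ext c
  constructor
  · intro hc
    have h1 := h.symm.symm_mem_shape hc
    rw [show (Φ.symm : CotangentBundle n X → _) '' (Φ '' U) = U from by
      rw [← image_comp, show (Φ.symm : CotangentBundle n X → _) ∘ Φ = id from
        funext fun z => Φ.symm_apply_apply z, image_id]] at h1
    exact ⟨_, h1, T.symm_apply_apply c⟩
  · rintro ⟨c, hc, rfl⟩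
    exact h.symm_mem_shape hc

end IsExactSymplectic
end ExactSymplectic

/-! ## Regularity of lifts -/

namespace SConv
universe v w
variable {ι : Type w} {F : Filter ι} {k : ℕ}
  {E H : Type} [NormedAddCommGroup E] [NormedSpace ℝ E] [TopologicalSpace H]
  {I : ModelWithCorners ℝ E H} {M : Type u} [TopologicalSpace M] [ChartedSpace H M]
  [IsManifold I ∞ M]
  {E' H' : Type} [NormedAddCommGroup E'] [NormedSpace ℝ E'] [TopologicalSpace H']
  {J : ModelWithCorners ℝ E' H'} {N : Type v} [TopologicalSpace N] [ChartedSpace H' N]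
  [IsManifold J ∞ N]

theorem of_succ {f : ι → M → N} {f₀ : M → N} {x : M} (h : SConv F (k + 1) I J f f₀ x) :
    SConv F k I J f f₀ x := by
  induction k generalizing E H M E' H' N with
  | zero => exact h.of_zero
  | succ k ih => exact h.of_zero.succ fun v => ih (h.tangent v)

end SConv

section LiftRegularity
variable {n : ℕ} {X : Type u} [TopologicalSpace X]
  [ChartedSpace (EuclideanSpace ℝ (Fin n)) X] [IsManifold (𝓡 n) ∞ X]

/-- The covector determined by the coordinates `a` of its ray, if it takes the value `s` on the
projection of `d`. -/
def rescale (B : AffineIndex n) (a d : Model n) (s : ℝ) : Vec n × Covec n :=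
  (a.1, (s / B.symm (1, a.2) d.1) • B.symm (1, a.2))

/-- A map in affine coordinates. -/
def affineRep (x₀ x₁ : X) (A B : AffineIndex n)
    (f : ContactElementSpace n X → ContactElementSpace n X) (m : Model n) : Model n :=
  affineToFun x₁ B (f (affineInvFun x₀ A m))

theorem eq_affineIndex_symm (B : AffineIndex n) {q : Covec n} (h : 0 < (B q).1) :
    q = (B q).1 • B.symm (1, affineFun B q) := by
  rw [symm_affineFun B h, smul_smul, mul_inv_cancel₀ h.ne', one_smul]

theorem contMDiffAt_affineRep {x₀ x₁ : X} {A B : AffineIndex n}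
    {f : ContactElementSpace n X → ContactElementSpace n X} {m : Model n}
    (hm : m.1 ∈ (chartAt (Vec n) x₀).target)
    (hy : f (affineInvFun x₀ A m) ∈ affineSource x₁ B)
    (hf : ContMDiffAt 𝓘(ℝ, Model n) 𝓘(ℝ, Model n) ∞ f (affineInvFun x₀ A m)) :
    ContMDiffAt 𝓘(ℝ, Model n) 𝓘(ℝ, Model n) ∞ (affineRep x₀ x₁ A B f) m :=
  (contMDiffAt_affineToFun x₁ B hy).comp m (hf.comp m (contMDiffAt_affineInvFun x₀ A hm))

/-- The pairing condition on a lift, read in coordinates: the pulled back covectors see only base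
components, so the derivative of the affine expression of f is all that enters. -/
theorem IsLift.pairing {f : ContactElementSpace n X → ContactElementSpace n X}
    {G : CotangentBundle n X → CotangentBundle n X} (h : IsLift f G) {x₀ x₁ : X}
    {A B : AffineIndex n} {z : CotangentBundle n X} (hz : z.2 ≠ 0)
    (hA : toRay z hz ∈ affineSource x₀ A) (hB : f (toRay z hz) ∈ affineSource x₁ B)
    (hf : ContMDiffAt 𝓘(ℝ, Model n) 𝓘(ℝ, Model n) ∞ f (toRay z hz)) (u : Model n) :
    coords x₁ (G z)
      (fderiv ℝ (affineRep x₀ x₁ A B f) (affineToFun x₀ A (toRay z hz)) u).1 =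
      coords x₀ z u.1 := by
  obtain ⟨hz', h1, h2⟩ := h z hz
  set m := affineToFun x₀ A (toRay z hz) with hm
  have ht : m.1 ∈ (chartAt (Vec n) x₀).target := affineToFun_fst_mem hA
  have hy : affineInvFun x₀ A m = toRay z hz := affineInvFun_affineToFun x₀ A hA
  have hs : z.1 ∈ (chartAt (Vec n) x₀).source := affineSource_basePoint hA
  have hs' : (G z).1 ∈ (chartAt (Vec n) x₁).source := by
    rw [← h1] at hB
    exact affineSource_basePoint hB
  have hf' : ContMDiffAt 𝓘(ℝ, Model n) 𝓘(ℝ, Model n) ∞ f (affineInvFun x₀ A m) := by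
    rw [hy]
    exact hf
  have hB' : f (affineInvFun x₀ A m) ∈ affineSource x₁ B := by
    rw [hy]
    exact hB
  have hr := contMDiffAt_affineRep ht hB' hf'
  have ht' : (affineRep x₀ x₁ A B f m).1 ∈ (chartAt (Vec n) x₁).target := affineToFun_fst_mem hB'
  have h3 := mfderiv_comp m (I'' := 𝓘(ℝ, Model n))
    ((contMDiffAt_affineInvFun x₁ B ht').mdifferentiableAt (by simp))
    (hr.mdifferentiableAt (by simp))
  have h4 := mfderiv_comp m (hf'.mdifferentiableAt (by simp))
    ((contMDiffAt_affineInvFun x₀ A ht).mdifferentiableAt (by simp))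
  have h5 : affineInvFun x₁ B ∘ affineRep x₀ x₁ A B f =ᶠ[𝓝 m] f ∘ affineInvFun x₀ A := by
    have := (hf'.continuousAt.comp (contMDiffAt_affineInvFun x₀ A ht).continuousAt).eventually_mem
      ((isOpen_affineSource x₁ B).mem_nhds hB')
    exact this.mono fun w hw => affineInvFun_affineToFun x₁ B hw
  have h6 := h3.symm.trans (h5.mfderiv_eq.trans h4)
  rw [mfderiv_eq_fderiv] at h6
  have h7 : ∀ y, y = toRay z hz → ∀ v : Model n, pulledCovector (G z) (f y)
      (mfderiv 𝓘(ℝ, Model n) 𝓘(ℝ, Model n) f y v) = pulledCovector z y v := by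
    rintro _ rfl
    exact h2
  have h8 := h7 _ hy (mfderiv 𝓘(ℝ, Model n) 𝓘(ℝ, Model n) (affineInvFun x₀ A) m u)
  have h9 : pulledCovector z (affineInvFun x₀ A m) (mfderiv 𝓘(ℝ, Model n) 𝓘(ℝ, Model n)
      (affineInvFun x₀ A) m u) = coords x₀ z u.1 :=
    pulledCovector_mfderiv_affineInvFun x₀ A hs (affineToFun_fst x₀ A _) u
  rw [h9] at h8
  rw [← h8]
  have h10 : (affineRep x₀ x₁ A B f m).1 = chartAt (Vec n) x₁ (G z).1 := by
    change (affineToFun x₁ B (f (affineInvFun x₀ A m))).1 = _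
    rw [affineToFun_fst, hy, ← h1, basePoint_toRay]
  have h11 := pulledCovector_mfderiv_affineInvFun x₁ B hs' h10
    (fderiv ℝ (affineRep x₀ x₁ A B f) m u)
  refine h11.symm.trans ?_
  have h12 : affineInvFun x₁ B (affineRep x₀ x₁ A B f m) = f (affineInvFun x₀ A m) :=
    affineInvFun_affineToFun x₁ B hB'
  have h13 : ∀ {y y' : ContactElementSpace n X} (_ : y = y') (L L' : Model n →L[ℝ] Model n)
      (_ : L = L'), pulledCovector (G z) y (L u) = pulledCovector (G z) y' (L' u) := by
    rintro y _ rfl L _ rfl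
    rfl
  exact h13 h12 _ _ h6

/-- f determines the ray of `G z`, and one pairing, with a vector `u` on which `z` does not vanish,
determines its length. So G is an explicit smooth expression in `z`, f and one directional
derivative of f; the first conclusion says that the denominator in it is nonzero. -/
theorem IsLift.eq_ofCoords {f : ContactElementSpace n X → ContactElementSpace n X}
    {G : CotangentBundle n X → CotangentBundle n X} (h : IsLift f G) {x₀ x₁ : X}
    {A B : AffineIndex n} {z : CotangentBundle n X} (hz : z.2 ≠ 0)
    (hA : toRay z hz ∈ affineSource x₀ A) (hB : f (toRay z hz) ∈ affineSource x₁ B)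
    (hf : ContMDiffAt 𝓘(ℝ, Model n) 𝓘(ℝ, Model n) ∞ f (toRay z hz)) (u : Model n)
    (hu : coords x₀ z u.1 ≠ 0) :
    let m := affineToFun x₀ A (toRay z hz)
    B.symm (1, (affineRep x₀ x₁ A B f m).2) (fderiv ℝ (affineRep x₀ x₁ A B f) m u).1 ≠ 0 ∧
    G z = ofCoords x₁ (rescale B (affineRep x₀ x₁ A B f m)
      (fderiv ℝ (affineRep x₀ x₁ A B f) m u) (coords x₀ z u.1)) := by
  intro m
  have hp := h.pairing hz hA hB hf u
  obtain ⟨hz', h1, h2⟩ := h z hz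
  have hy : affineInvFun x₀ A m = toRay z hz := affineInvFun_affineToFun x₀ A hA
  have h3 : affineRep x₀ x₁ A B f m = affineToFun x₁ B (toRay (G z) hz') := by
    change affineToFun x₁ B (f (affineInvFun x₀ A m)) = _
    rw [hy, h1]
  rw [← h1] at hB
  obtain ⟨hs, hpos⟩ := (toRay_mem_affineSource x₁ B (G z) hz').1 hB
  have h4 : coords x₁ (G z) = (B (coords x₁ (G z))).1 • B.symm (1, (affineRep x₀ x₁ A B f m).2) := by
    rw [h3]
    exact eq_affineIndex_symm B hpos
  set μ := (B (coords x₁ (G z))).1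
  set d := fderiv ℝ (affineRep x₀ x₁ A B f) m u
  have h5 : μ * B.symm (1, (affineRep x₀ x₁ A B f m).2) d.1 = coords x₀ z u.1 := by
    rw [← hp]
    conv_rhs => rw [h4]
    rfl
  have h6 : B.symm (1, (affineRep x₀ x₁ A B f m).2) d.1 ≠ 0 := by
    intro h0
    apply hu
    rw [← h5, h0, mul_zero]
  refine ⟨h6, ?_⟩
  rw [← h5, rescale, mul_div_assoc, div_self h6, mul_one, ← h4, h3]
  exact (ofCoords_covectorChart x₁ hs).symm

theorem contDiffOn_rescale (B : AffineIndex n) :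
    ContDiffOn ℝ ∞ (fun p : (Model n × Model n) × ℝ => rescale B p.1.1 p.1.2 p.2)
      {p | B.symm (1, p.1.1.2) p.1.2.1 ≠ 0} := by
  have h1 : ContDiff ℝ ∞ (fun p : (Model n × Model n) × ℝ => B.symm (1, p.1.1.2)) := by fun_prop
  have h2 : ContDiff ℝ ∞ (fun p : (Model n × Model n) × ℝ => B.symm (1, p.1.1.2) p.1.2.1) := by
    fun_prop
  have h3 : ContDiffOn ℝ ∞ (fun p : (Model n × Model n) × ℝ =>
      p.2 / B.symm (1, p.1.1.2) p.1.2.1) {p | B.symm (1, p.1.1.2) p.1.2.1 ≠ 0} :=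
    contDiff_snd.contDiffOn.div h2.contDiffOn fun p hp => hp
  have h4 := h3.smul h1.contDiffOn
  exact ContDiffOn.prodMk (by fun_prop) h4

theorem isOpen_rescale (B : AffineIndex n) :
    IsOpen {p : (Model n × Model n) × ℝ | B.symm (1, p.1.1.2) p.1.2.1 ≠ 0} := by
  have h2 : Continuous (fun p : (Model n × Model n) × ℝ => B.symm (1, p.1.1.2) p.1.2.1) := by
    fun_prop
  exact isOpen_ne_fun h2 continuous_const

/-- By the explicit formula of `IsLift.eq_ofCoords` the lift inherits the convergence of f with the
loss of one derivative. -/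
theorem IsLift.sConv {ι : Type*} {F : Filter ι} {k : ℕ}
    {f : ι → ContactElementSpace n X → ContactElementSpace n X}
    {f₀ : ContactElementSpace n X → ContactElementSpace n X}
    {G : ι → CotangentBundle n X → CotangentBundle n X}
    {G₀ : CotangentBundle n X → CotangentBundle n X} (h : ∀ i, IsLift (f i) (G i))
    (h₀ : IsLift f₀ G₀) {z₀ : CotangentBundle n X} (hz₀ : z₀.2 ≠ 0)
    (hf : SConv F (k + 1) 𝓘(ℝ, Model n) 𝓘(ℝ, Model n) f f₀ (toRay z₀ hz₀)) :
    SConv F k (cotangentModel n) (cotangentModel n) G G₀ z₀ := by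
  obtain ⟨A, hA⟩ := exists_mem_affineSource (toRay z₀ hz₀)
  obtain ⟨B, hB⟩ := exists_mem_affineSource (f₀ (toRay z₀ hz₀))
  set x₀ := basePoint (toRay z₀ hz₀) with hx₀
  set x₁ := basePoint (f₀ (toRay z₀ hz₀))
  obtain ⟨hs, hpos⟩ := (toRay_mem_affineSource x₀ A z₀ hz₀).1 hA
  -- One direction `u` works near `z₀`, since not vanishing on `u` is an open condition; so the
  -- formula holds with a fixed `u` for all nearby covectors.
  obtain ⟨u, hu⟩ : ∃ u, coords x₀ z₀ u ≠ 0 := by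
    by_contra! hc
    exact coords_ne_zero hs hz₀ (ContinuousLinearMap.ext hc)
  -- coordinates of the source
  let m : CotangentBundle n X → Model n := fun z =>
    ((covectorChart x₀ z).1, affineFun A (covectorChart x₀ z).2)
  have hc1 := eventually_contMDiffAt_covectorChart x₀ hs
  have hco : ContinuousAt (covectorChart x₀) z₀ := hc1.self_of_nhds.continuousAt
  have hpos' : ∀ᶠ z in 𝓝 z₀, 0 < (A (coords x₀ z)).1 := by
    have : ContinuousAt (fun z => (A (covectorChart x₀ z).2).1) z₀ := by
      have h1 : Continuous (fun q : Vec n × Covec n => (A q.2).1) := by fun_prop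
      exact h1.continuousAt.comp hco
    exact this.eventually (lt_mem_nhds hpos)
  have hu' : ∀ᶠ z in 𝓝 z₀, coords x₀ z u ≠ 0 := by
    have : ContinuousAt (fun z => (covectorChart x₀ z).2 u) z₀ := by
      have h1 : Continuous (fun q : Vec n × Covec n => q.2 u) := by fun_prop
      exact h1.continuousAt.comp hco
    exact this.eventually_ne hu
  have hs' := eventually_proj_mem (chartAt (Vec n) x₀).open_source hs
  have hne : ∀ᶠ z in 𝓝 z₀, z.2 ≠ 0 := by
    filter_upwards [hu'] with z hz h0
    apply hz
    have : coords x₀ z = 0 := by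
      rw [show z = ⟨z.1, 0⟩ from by rw [← h0]]
      rfl
    rw [this]
    rfl
  have hm : ∀ᶠ z in 𝓝 z₀, ContMDiffAt (cotangentModel n) 𝓘(ℝ, Model n) ∞ m z := by
    filter_upwards [hc1, hpos'] with z h1 h2
    have h3 : ContDiffAt ℝ ∞ (fun q : Vec n × Covec n => ((q.1, affineFun A q.2) : Model n))
        (covectorChart x₀ z) := by
      have h3 : ContDiffAt ℝ ∞ (fun q : Vec n × Covec n => A q.2) (covectorChart x₀ z) := by
        fun_prop
      exact contDiffAt_fst.prodMk ((h3.fst.inv h2.ne').smul h3.snd)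
    exact h3.contMDiffAt.comp z h1
  have hm₀ : affineInvFun x₀ A (m z₀) = toRay z₀ hz₀ := affineInvFun_affineToFun x₀ A hA
  have ht : (m z₀).1 ∈ (chartAt (Vec n) x₀).target := (chartAt (Vec n) x₀).map_source hs
  -- the representation of the family in coordinates
  have hrep : SConv F (k + 1) 𝓘(ℝ, Model n) 𝓘(ℝ, Model n)
      (fun i => affineRep x₀ x₁ A B (f i)) (affineRep x₀ x₁ A B f₀) (m z₀) := by
    have h1 : SConv F (k + 1) 𝓘(ℝ, Model n) 𝓘(ℝ, Model n) (fun i w => f i (affineInvFun x₀ A w))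
        (fun w => f₀ (affineInvFun x₀ A w)) (m z₀) := by
      refine SConv.precomp (by rw [hm₀]; exact hf) ?_
      filter_upwards [((chartAt (Vec n) x₀).open_target.preimage continuous_fst).mem_nhds ht]
        with w hw using contMDiffAt_affineInvFun x₀ A hw
    refine SConv.map h1 ?_
    have h2 : f₀ (affineInvFun x₀ A (m z₀)) ∈ affineSource x₁ B := by
      rw [hm₀]
      exact hB
    filter_upwards [(isOpen_affineSource x₁ B).mem_nhds h2] with y hy
    exact contMDiffAt_affineToFun x₁ B hy
  have h1 := hrep.of_succ.precomp hm
  have h2 := (hrep.fderiv_apply ((u, 0) : Model n)).precomp hm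
  have h3 : SConv F k (cotangentModel n) 𝓘(ℝ, ℝ) (fun _ z => (covectorChart x₀ z).2 u)
      (fun z => (covectorChart x₀ z).2 u) z₀ := by
    refine SConv.const ?_
    filter_upwards [hc1] with z hz
    have h1 : ContDiff ℝ ∞ (fun q : Vec n × Covec n => q.2 u) := by fun_prop
    exact h1.contMDiff.contMDiffAt.comp z hz
  have h4 := (h1.prodMk_vec h2).prodMk_vec h3
  have hf₀ : ∀ᶠ z in 𝓝 z₀, ∀ hz : z.2 ≠ 0, toRay z hz ∈ affineSource x₀ A ∧
      f₀ (toRay z hz) ∈ affineSource x₁ B ∧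
      ContMDiffAt 𝓘(ℝ, Model n) 𝓘(ℝ, Model n) ∞ f₀ (toRay z hz) := by
    have h5 : ContinuousAt (localRay x₀ A) z₀ :=
      (contMDiffAt_localRay x₀ A hs hpos.ne').continuousAt
    have h6 : localRay x₀ A z₀ = toRay z₀ hz₀ := hm₀
    have h7 : ∀ᶠ y in 𝓝 (toRay z₀ hz₀), f₀ y ∈ affineSource x₁ B :=
      hf.contMDiffAt.continuousAt.eventually_mem ((isOpen_affineSource x₁ B).mem_nhds hB)
    rw [ContinuousAt, h6] at h5
    filter_upwards [h5.eventually h7, h5.eventually hf.smooth₀, hs', hpos'] with z h8 h9 h10 h11 hz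
    have h12 : toRay z hz ∈ affineSource x₀ A := (toRay_mem_affineSource x₀ A z hz).2 ⟨h10, h11⟩
    rw [localRay_eq x₀ A hz h12] at h8 h9
    exact ⟨h12, h8, h9⟩
  have hfi : ∀ᶠ p in F ×ˢ 𝓝 z₀, ∀ hz : p.2.2 ≠ 0, toRay p.2 hz ∈ affineSource x₀ A ∧
      f p.1 (toRay p.2 hz) ∈ affineSource x₁ B ∧
      ContMDiffAt 𝓘(ℝ, Model n) 𝓘(ℝ, Model n) ∞ (f p.1) (toRay p.2 hz) := by
    have h5 : ContinuousAt (localRay x₀ A) z₀ :=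
      (contMDiffAt_localRay x₀ A hs hpos.ne').continuousAt
    have h6 : localRay x₀ A z₀ = toRay z₀ hz₀ := hm₀
    rw [ContinuousAt, h6] at h5
    have h5' : Filter.Tendsto (fun p : ι × CotangentBundle n X => (p.1, localRay x₀ A p.2))
      (F ×ˢ 𝓝 z₀) (F ×ˢ 𝓝 (toRay z₀ hz₀)) := Filter.tendsto_id.prodMap h5
    have h7 : ∀ᶠ p in F ×ˢ 𝓝 (toRay z₀ hz₀), f p.1 p.2 ∈ affineSource x₁ B :=
      hf.tendsto.eventually_mem ((isOpen_affineSource x₁ B).mem_nhds hB)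
    filter_upwards [h5'.eventually h7, h5'.eventually hf.smooth, Filter.tendsto_snd.eventually hs',
      Filter.tendsto_snd.eventually hpos'] with p h8 h9 h10 h11 hz
    have h12 : toRay p.2 hz ∈ affineSource x₀ A :=
      (toRay_mem_affineSource x₀ A p.2 hz).2 ⟨h10, h11⟩
    rw [localRay_eq x₀ A hz h12] at h8 h9
    exact ⟨h12, h8, h9⟩
  obtain ⟨-, hB₀, hs₀⟩ := hf₀.self_of_nhds hz₀
  have h5 := h4.map_contDiffAt (isOpen_rescale B)
    (h₀.eq_ofCoords hz₀ hA hB₀ hs₀ (u, 0) hu).1 (contDiffOn_rescale B)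
  have hx₁ : (affineRep x₀ x₁ A B f₀ (m z₀)).1 ∈ (chartAt (Vec n) x₁).target := by
    refine affineToFun_fst_mem ?_
    rw [hm₀]
    exact hB
  have h6 := h5.map (eventually_contMDiffAt_ofCoords x₁ (by exact hx₁))
  refine h6.congr ?_ ?_
  · filter_upwards [hfi, Filter.tendsto_snd.eventually hne, Filter.tendsto_snd.eventually hu']
      with p h7 h8 h9
    obtain ⟨h10, h11, h12⟩ := h7 h8
    exact ((h p.1).eq_ofCoords h8 h10 h11 h12 (u, 0) h9).2
  · filter_upwards [hf₀, hne, hu'] with z h7 h8 h9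
    obtain ⟨h10, h11, h12⟩ := h7 h8
    exact (h₀.eq_ofCoords h8 h10 h11 h12 (u, 0) h9).2

/-- Smoothness is convergence of a constant family: the index set is a point, and `SConv` includes
smoothness of the limit. -/
theorem IsLift.contMDiffAt {f : ContactElementSpace n X → ContactElementSpace n X}
    {G : CotangentBundle n X → CotangentBundle n X} (h : IsLift f G)
    (hf : ContMDiff 𝓘(ℝ, Model n) 𝓘(ℝ, Model n) ∞ f) {z : CotangentBundle n X} (hz : z.2 ≠ 0) :
    ContMDiffAt (cotangentModel n) (cotangentModel n) ∞ G z :=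
  (IsLift.sConv (ι := Unit) (F := ⊤) (k := 0) (fun _ => h) h hz
    (SConv.const (Filter.Eventually.of_forall hf))).contMDiffAt

theorem liouvilleForm_eq_pulledCovector (x₀ : X) (A : AffineIndex n) {z : CotangentBundle n X}
    (hz : z.2 ≠ 0) (hA : toRay z hz ∈ affineSource x₀ A) (v : Vec n × Covec n) :
    liouvilleForm n X z v = pulledCovector z (localRay x₀ A z)
      (mfderiv (cotangentModel n) 𝓘(ℝ, Model n) (localRay x₀ A) z v) := by
  obtain ⟨hs, hpos⟩ := (toRay_mem_affineSource x₀ A z hz).1 hA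
  have h1 := mfderiv_comp z ((contMDiff_basePoint (localRay x₀ A z)).mdifferentiableAt (by simp))
    ((contMDiffAt_localRay x₀ A hs hpos.ne').mdifferentiableAt (by simp))
  have h2 : basePoint ∘ localRay x₀ A =ᶠ[𝓝 z] (cotangentProj n X : CotangentBundle n X → X) := by
    filter_upwards [eventually_proj_mem (chartAt (Vec n) x₀).open_source hs] with w hw
    refine (basePoint_affineInvFun x₀ A ((chartAt (Vec n) x₀).map_source hw)).trans ?_
    exact (chartAt (Vec n) x₀).left_inv hw
  have h3 := h2.mfderiv_eq.symm.trans h1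
  exact congrArg (fun L : Vec n × Covec n →L[ℝ] Vec n => z.2 (L v)) h3

/-- Off the zero section, p dq at `z` is `z`, as a covector on P_+T^*X, pulled back by τ. Since τ ∘
G = f ∘ τ and G is compatible with the pairing under df, the form is preserved. -/
theorem IsLift.liouvilleForm {f : ContactElementSpace n X → ContactElementSpace n X}
    {G : CotangentBundle n X → CotangentBundle n X} (h : IsLift f G)
    (hf : ContMDiff 𝓘(ℝ, Model n) 𝓘(ℝ, Model n) ∞ f) {z : CotangentBundle n X} (hz : z.2 ≠ 0) :
    OneForm.pullback (I := cotangentModel n) G (liouvilleForm n X) z = liouvilleForm n X z := by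
  obtain ⟨hz', h1, h2⟩ := h z hz
  obtain ⟨A, hA⟩ := exists_mem_affineSource (toRay z hz)
  obtain ⟨B, hB⟩ := exists_mem_affineSource (toRay (G z) hz')
  set x₀ := basePoint (toRay z hz)
  set x₁ := basePoint (toRay (G z) hz')
  obtain ⟨hs, hpos⟩ := (toRay_mem_affineSource x₀ A z hz).1 hA
  obtain ⟨hs', hpos'⟩ := (toRay_mem_affineSource x₁ B (G z) hz').1 hB
  have hG := h.contMDiffAt hf hz
  have h3 := mfderiv_comp z (I'' := 𝓘(ℝ, Model n))
    ((contMDiffAt_localRay x₁ B hs' hpos'.ne').mdifferentiableAt (by simp))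
    (hG.mdifferentiableAt (by simp))
  have h4 := mfderiv_comp z ((hf (localRay x₀ A z)).mdifferentiableAt (by simp))
    ((contMDiffAt_localRay x₀ A hs hpos.ne').mdifferentiableAt (by simp))
  have h5 : localRay x₁ B ∘ G =ᶠ[𝓝 z] f ∘ localRay x₀ A := by
    have hc := contMDiffAt_localRay x₀ A hs hpos.ne'
    have e1 : ∀ᶠ w in 𝓝 z, localRay x₀ A w ∈ affineSource x₀ A :=
      hc.continuousAt.eventually_mem ((isOpen_affineSource x₀ A).mem_nhds
        (by rw [localRay_eq x₀ A hz hA]; exact hA))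
    have e2 : ∀ᶠ w in 𝓝 z, f (localRay x₀ A w) ∈ affineSource x₁ B :=
      (hf.continuous.continuousAt.comp hc.continuousAt).eventually_mem
        ((isOpen_affineSource x₁ B).mem_nhds
        (by
          change f (localRay x₀ A z) ∈ _
          rw [localRay_eq x₀ A hz hA, ← h1]; exact hB))
    have e3 : ∀ᶠ w in 𝓝 z, 0 < (A (covectorChart x₀ w).2).1 := by
      have h1 : Continuous (fun q : Vec n × Covec n => (A q.2).1) := by fun_prop
      exact (h1.continuousAt.comp (contMDiffAt_covectorChart x₀ hs).continuousAt).eventually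
        (lt_mem_nhds hpos)
    have e4 := eventually_proj_mem (chartAt (Vec n) x₀).open_source hs
    filter_upwards [e1, e2, e3, e4] with w h6 h7 h8 h9
    have hw : w.2 ≠ 0 := by
      intro h0
      have : coords x₀ w = 0 := by
        rw [show w = ⟨w.1, 0⟩ from by rw [← h0]]
        rfl
      rw [show (covectorChart x₀ w).2 = coords x₀ w from rfl, this, map_zero] at h8
      exact lt_irrefl _ h8
    obtain ⟨hw', h10, -⟩ := h w hw
    have h11 : toRay w hw ∈ affineSource x₀ A := (toRay_mem_affineSource x₀ A w hw).2 ⟨h9, h8⟩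
    rw [localRay_eq x₀ A hw h11] at h7
    simp only [Function.comp]
    rw [localRay_eq x₀ A hw h11, localRay_eq x₁ B hw' (by rw [h10]; exact h7), h10]
  have h6 := h3.symm.trans (h5.mfderiv_eq.trans h4)
  refine ContinuousLinearMap.ext fun v => ?_
  have h7 := liouvilleForm_eq_pulledCovector x₁ B hz' hB
    (mfderiv (cotangentModel n) (cotangentModel n) G z v)
  have h8 := liouvilleForm_eq_pulledCovector x₀ A hz hA v
  refine h7.trans (Eq.trans ?_ h8.symm)
  have h9 : ∀ y, y = toRay z hz → ∀ v : Model n, pulledCovector (G z) (f y)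
      (mfderiv 𝓘(ℝ, Model n) 𝓘(ℝ, Model n) f y v) = pulledCovector z y v := by
    rintro _ rfl
    exact h2
  refine Eq.trans ?_ (h9 _ (localRay_eq x₀ A hz hA)
    (mfderiv (cotangentModel n) 𝓘(ℝ, Model n) (localRay x₀ A) z v))
  have h13 : ∀ {y y' : ContactElementSpace n X} (_ : y = y')
      (L L' : Vec n × Covec n →L[ℝ] Model n)
      (_ : L = L'), pulledCovector (G z) y (L v) = pulledCovector (G z) y' (L' v) := by
    rintro y _ rfl L _ rfl
    rfl
  exact h13 h5.self_of_nhds _ _ h6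

end LiftRegularity

/-! ## Homogeneous symplectomorphisms -/

section Conic
variable {n : ℕ} {X : Type u} [TopologicalSpace X]
  [ChartedSpace (EuclideanSpace ℝ (Fin n)) X] [IsManifold (𝓡 n) ∞ X]

/-- Fibrewise multiplication by a scalar. -/
def dilate (c : ℝ) (z : CotangentBundle n X) : CotangentBundle n X := ⟨z.1, c • z.2⟩

theorem dilate_ne_zero {c : ℝ} (hc : 0 < c) {z : CotangentBundle n X} (hz : z.2 ≠ 0) :
    (dilate c z).2 ≠ 0 := smul_ne_zero hc.ne' hz

variable (n X) in
/-- Homogeneous symplectomorphisms of `T^*X`: bijections that fix the zero section, and that off the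
zero section are smooth, equivariant under dilation and preserve the Liouville form. -/
structure ConicSymplecto where
  toEquiv : CotangentBundle n X ≃ CotangentBundle n X
  map_zero : ∀ z, z.2 = 0 → toEquiv z = z
  map_dilate : ∀ z (c : ℝ), 0 < c → z.2 ≠ 0 → toEquiv (dilate c z) = dilate c (toEquiv z)
  smooth : ∀ z, z.2 ≠ 0 → ContMDiffAt (cotangentModel n) (cotangentModel n) ∞ toEquiv z
  smooth_symm : ∀ z, z.2 ≠ 0 → ContMDiffAt (cotangentModel n) (cotangentModel n) ∞ toEquiv.symm z
  liouville : ∀ z, z.2 ≠ 0 →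
    OneForm.pullback (I := cotangentModel n) toEquiv (liouvilleForm n X) z = liouvilleForm n X z

namespace ConicSymplecto

theorem map_ne_zero (G : ConicSymplecto n X) {z : CotangentBundle n X} (hz : z.2 ≠ 0) :
    (G.toEquiv z).2 ≠ 0 := by
  intro h
  have := G.toEquiv.injective (G.map_zero _ h)
  exact hz (this ▸ h)

theorem symm_map_zero (G : ConicSymplecto n X) (z : CotangentBundle n X) (hz : z.2 = 0) :
    G.toEquiv.symm z = z := by
  rw [Equiv.symm_apply_eq, G.map_zero z hz]

theorem symm_map_ne_zero (G : ConicSymplecto n X) {z : CotangentBundle n X} (hz : z.2 ≠ 0) :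
    (G.toEquiv.symm z).2 ≠ 0 := by
  intro h
  have h1 := G.map_zero _ h
  rw [G.toEquiv.apply_symm_apply] at h1
  exact hz (h1 ▸ h)

variable (n X) in
/-- The identity. -/
def refl : ConicSymplecto n X where
  toEquiv := Equiv.refl _
  map_zero _ _ := rfl
  map_dilate _ _ _ _ := rfl
  smooth _ _ := contMDiffAt_id
  smooth_symm _ _ := contMDiffAt_id
  liouville z _ := by
    change (liouvilleForm n X z).comp (mfderiv (cotangentModel n) (cotangentModel n) id z) = _
    rw [mfderiv_id]
    rfl

/-- The composition of homogeneous symplectomorphisms. -/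
def trans (G G' : ConicSymplecto n X) : ConicSymplecto n X where
  toEquiv := G.toEquiv.trans G'.toEquiv
  map_zero z hz := by
    rw [Equiv.trans_apply, G.map_zero z hz, G'.map_zero z hz]
  map_dilate z c hc hz := by
    rw [Equiv.trans_apply, Equiv.trans_apply, G.map_dilate z c hc hz,
      G'.map_dilate _ c hc (G.map_ne_zero hz)]
  smooth z hz := (G'.smooth _ (G.map_ne_zero hz)).comp z (G.smooth z hz)
  smooth_symm z hz := (G.smooth_symm _ (G'.symm_map_ne_zero hz)).comp z (G'.smooth_symm z hz)
  liouville z hz := by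
    have h1 := mfderiv_comp z ((G'.smooth _ (G.map_ne_zero hz)).mdifferentiableAt (by simp))
      ((G.smooth z hz).mdifferentiableAt (by simp))
    refine ContinuousLinearMap.ext fun v => ?_
    have h2 := congrArg (fun L : Vec n × Covec n →L[ℝ] ℝ => L
      (mfderiv (cotangentModel n) (cotangentModel n) G.toEquiv z v))
      (G'.liouville _ (G.map_ne_zero hz))
    have h3 := congrArg (fun L : Vec n × Covec n →L[ℝ] ℝ => L v) (G.liouville z hz)
    have h4 := congrArg (fun L : Vec n × Covec n →L[ℝ] Vec n × Covec n =>
      (show Vec n × Covec n →L[ℝ] ℝ from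
        liouvilleForm n X (G'.toEquiv (G.toEquiv z))) (L v)) h1
    exact h4.trans (h2.trans h3)

/-- The inverse. -/
def symm (G : ConicSymplecto n X) : ConicSymplecto n X where
  toEquiv := G.toEquiv.symm
  map_zero := G.symm_map_zero
  map_dilate z c hc hz := by
    rw [Equiv.symm_apply_eq, G.map_dilate _ c hc (G.symm_map_ne_zero hz), Equiv.apply_symm_apply]
  smooth := G.smooth_symm
  smooth_symm := G.smooth
  liouville z hz := by
    have h1 := mfderiv_comp z ((G.smooth _ (G.symm_map_ne_zero hz)).mdifferentiableAt (by simp))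
      ((G.smooth_symm z hz).mdifferentiableAt (by simp))
    rw [show (G.toEquiv : CotangentBundle n X → _) ∘ G.toEquiv.symm = id from
      funext fun w => G.toEquiv.apply_symm_apply w, mfderiv_id] at h1
    refine ContinuousLinearMap.ext fun v => ?_
    have h2 := congrArg (fun L : Vec n × Covec n →L[ℝ] ℝ => L
      (mfderiv (cotangentModel n) (cotangentModel n) G.toEquiv.symm z v))
      (G.liouville _ (G.symm_map_ne_zero hz))
    refine h2.symm.trans ?_
    have h3 : ∀ {z' : CotangentBundle n X} (_ : z' = z)
        (L : Vec n × Covec n →L[ℝ] Vec n × Covec n) (_ : ContinuousLinearMap.id ℝ _ = L),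
        (show Vec n × Covec n →L[ℝ] ℝ from liouvilleForm n X z') (L v) =
          (show Vec n × Covec n →L[ℝ] ℝ from liouvilleForm n X z) v := by
      rintro _ rfl L rfl
      rfl
    exact h3 (G.toEquiv.apply_symm_apply z) _ h1

end ConicSymplecto

/-- The homogeneous symplectomorphism that lifts a contactomorphism. -/
def Contactomorphism.conicLift (f : Contactomorphism n X) : ConicSymplecto n X where
  toEquiv := f.lift
  map_zero _ hz := f.liftFun_zero hz
  map_dilate z _ hc hz := f.isLift_liftFun.smul (z := z) hz hc
  smooth _ hz := f.isLift_liftFun.contMDiffAt f.1.contMDiff hz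
  smooth_symm _ hz := f.symm.isLift_liftFun.contMDiffAt f.symm.1.contMDiff hz
  liouville _ hz := f.isLift_liftFun.liouvilleForm f.1.contMDiff hz

/-- `U` contains the zero section, and any compact set of nonzero covectors after sufficient
contraction. -/
def IsConicNhd (U : Set (CotangentBundle n X)) : Prop :=
  zeroSection n X ⊆ U ∧ ∀ C : Set (CotangentBundle n X), IsCompact C → (∀ z ∈ C, z.2 ≠ 0) →
    ∃ ε > 0, ∀ t, 0 < t → t < ε → ∀ z ∈ C, dilate t z ∈ U

/-- G⁻¹ is continuous off the zero section and commutes with dilations, so a compact set of nonzero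
covectors may be tested after applying G⁻¹. The class is thus stable under composition of such maps.
-/
theorem IsConicNhd.image {U : Set (CotangentBundle n X)} (h : IsConicNhd U)
    (G : ConicSymplecto n X) : IsConicNhd (G.toEquiv '' U) := by
  refine ⟨fun z hz => ⟨z, h.1 hz, G.map_zero z hz⟩, fun C hC hC0 => ?_⟩
  have hC' : IsCompact (G.toEquiv.symm '' C) := hC.image_of_continuousOn
    fun z hz => (G.smooth_symm z (hC0 z hz)).continuousAt.continuousWithinAt
  obtain ⟨ε, hε, h1⟩ := h.2 _ hC' (by
    rintro _ ⟨z, hz, rfl⟩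
    exact G.symm_map_ne_zero (hC0 z hz))
  refine ⟨ε, hε, fun t ht htε z hz => ⟨_, h1 t ht htε _ ⟨z, hz, rfl⟩, ?_⟩⟩
  rw [G.map_dilate _ t ht (G.symm_map_ne_zero (hC0 z hz)), Equiv.apply_symm_apply]

/-- The ratio p/α is a quotient of values on one coordinate vector field with base part `u`: the
value of the covector is `coords x₀ z u`, and that of α is `g z`. Both are continuous, and `g` is
positive at `z₀`. -/
theorem ContactForm.locally_bounded (α : ContactForm n X) {z₀ : CotangentBundle n X}
    (hz₀ : z₀.2 ≠ 0) : ∃ R : ℝ, 0 < R ∧ ∀ᶠ z in 𝓝 z₀, ∀ hz : z.2 ≠ 0, ∃ r ≤ R,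
      contactCovector z hz = r • α.form (toRay z hz) := by
  obtain ⟨A, hA⟩ := exists_mem_affineSource (toRay z₀ hz₀)
  set x₀ := basePoint (toRay z₀ hz₀)
  obtain ⟨hs, hpos⟩ := (toRay_mem_affineSource x₀ A z₀ hz₀).1 hA
  obtain ⟨u, hu⟩ : ∃ u, 0 < coords x₀ z₀ u := by
    obtain ⟨u, hu⟩ : ∃ u, coords x₀ z₀ u ≠ 0 := by
      by_contra! hc
      exact coords_ne_zero hs hz₀ (ContinuousLinearMap.ext hc)
    rcases lt_or_gt_of_ne hu with h | h
    · exact ⟨-u, by simpa using h⟩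
    · exact ⟨u, h⟩
  let m : CotangentBundle n X → Model n := fun z =>
    ((covectorChart x₀ z).1, affineFun A (covectorChart x₀ z).2)
  have hco : ContinuousAt (covectorChart x₀) z₀ := (contMDiffAt_covectorChart x₀ hs).continuousAt
  have hm : ContinuousAt m z₀ := by
    have h3 : ContinuousAt (fun q : Vec n × Covec n => A q.2) (covectorChart x₀ z₀) := by
      fun_prop
    have h4 : ContinuousAt (fun q : Vec n × Covec n => ((q.1, affineFun A q.2) : Model n))
        (covectorChart x₀ z₀) :=
      continuousAt_fst.prodMk ((h3.fst.inv₀ hpos.ne').smul h3.snd)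
    exact h4.comp hco
  have ht : (m z₀).1 ∈ (chartAt (Vec n) x₀).target := (chartAt (Vec n) x₀).map_source hs
  let V : CotangentBundle n X → TangentBundle 𝓘(ℝ, Model n) (ContactElementSpace n X) := fun z =>
    tangentMap 𝓘(ℝ, Model n) 𝓘(ℝ, Model n) (affineInvFun x₀ A) ⟨m z, ((u, 0) : Model n)⟩
  have hV : ContinuousAt V z₀ := by
    have h1 : Continuous (fun y : Model n =>
        (⟨y, ((u, 0) : Model n)⟩ : TangentBundle 𝓘(ℝ, Model n) (Model n))) := by
      refine ContMDiff.continuous (I := 𝓘(ℝ, Model n)) (I' := 𝓘(ℝ, Model n).tangent) (n := ∞)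
        fun y => ?_
      rw [contMDiffAt_totalSpace]
      refine ⟨contMDiffAt_id, ?_⟩
      simpa using contMDiffAt_const
    have h2 := contMDiffAt_tangentMap (I := 𝓘(ℝ, Model n)) (J := 𝓘(ℝ, Model n))
      (f := affineInvFun x₀ A) (V := ⟨m z₀, ((u, 0) : Model n)⟩) (by
        filter_upwards [((chartAt (Vec n) x₀).open_target.preimage continuous_fst).mem_nhds ht]
          with w hw using contMDiffAt_affineInvFun x₀ A hw)
    exact ContinuousAt.comp (f := fun z => (⟨m z, ((u, 0) : Model n)⟩ :
      TangentBundle 𝓘(ℝ, Model n) (Model n))) h2.continuousAt (h1.continuousAt.comp hm)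
  let g : CotangentBundle n X → ℝ := fun z => α.form (V z).1 (V z).2
  have hg : ContinuousAt g z₀ := α.smooth.continuous.continuousAt.comp hV
  have key : ∀ z (hz : z.2 ≠ 0), toRay z hz ∈ affineSource x₀ A → ∃ r : ℝ, 0 < r ∧
      coords x₀ z u = r * g z ∧ contactCovector z hz = r • α.form (toRay z hz) := by
    intro z hz hzA
    obtain ⟨r, hr, h1⟩ := α.exists_smul z hz
    refine ⟨r, hr, ?_, h1⟩
    have h2 : affineInvFun x₀ A (m z) = toRay z hz := affineInvFun_affineToFun x₀ A hzA
    rw [← pulledCovector_mfderiv_affineInvFun x₀ A (affineSource_basePoint hzA) (m := m z) rfl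
      (u, 0)]
    have h3 : ∀ y, y = toRay z hz → ∀ v : Model n, pulledCovector z y v =
      r * (show Model n →L[ℝ] ℝ from α.form y) v := by
      rintro _ rfl v
      exact congrArg (fun L : Model n →L[ℝ] ℝ => L v) h1
    exact h3 _ h2 _
  obtain ⟨r₀, hr₀, h₀, -⟩ := key z₀ hz₀ hA
  have hg₀ : 0 < g z₀ := pos_of_mul_pos_right (h₀ ▸ hu) hr₀.le
  -- Near `z₀` the numerator stays below its value plus `1` and the denominator above half its
  -- value.
  refine ⟨(coords x₀ z₀ u + 1) / (g z₀ / 2), by positivity, ?_⟩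
  have hco' : ContinuousAt (fun z => (covectorChart x₀ z).2 u) z₀ := by
    have h1 : Continuous (fun q : Vec n × Covec n => q.2 u) := by fun_prop
    exact h1.continuousAt.comp hco
  have hpos' : ∀ᶠ z in 𝓝 z₀, 0 < (A (coords x₀ z)).1 := by
    have : ContinuousAt (fun z => (A (covectorChart x₀ z).2).1) z₀ := by
      have h1 : Continuous (fun q : Vec n × Covec n => (A q.2).1) := by fun_prop
      exact h1.continuousAt.comp hco
    exact this.eventually (lt_mem_nhds hpos)
  filter_upwards [hg.eventually (lt_mem_nhds (half_lt_self hg₀)),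
    hco'.eventually (gt_mem_nhds (lt_add_one (coords x₀ z₀ u))), hpos',
    eventually_proj_mem (chartAt (Vec n) x₀).open_source hs] with z h1 h2 h3 h4 hz
  obtain ⟨r, hr, h5, h6⟩ := key z hz ((toRay_mem_affineSource x₀ A z hz).2 ⟨h4, h3⟩)
  refine ⟨r, ?_, h6⟩
  rw [le_div_iff₀ (by positivity)]
  calc r * (g z₀ / 2) ≤ r * g z := mul_le_mul_of_nonneg_left h1.le hr.le
    _ = coords x₀ z u := h5.symm
    _ ≤ _ := h2.le

/-- The ratio p/α is bounded by some R on a compact set and is multiplied by `t` under dilation, so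
it drops below `1` for `t < R⁻¹`. -/
theorem ContactForm.isConicNhd_domain (α : ContactForm n X) : IsConicNhd α.domain := by
  refine ⟨fun z hz => Or.inr hz, fun C hC hC0 => ?_⟩
  obtain ⟨R, hR, h⟩ : ∃ R : ℝ, 0 < R ∧ ∀ z ∈ C, ∀ hz : z.2 ≠ 0, ∃ r ≤ R,
      contactCovector z hz = r • α.form (toRay z hz) := by
    refine hC.induction_on (p := fun s => ∃ R : ℝ, 0 < R ∧ ∀ z ∈ s, ∀ hz : z.2 ≠ 0, ∃ r ≤ R,
      contactCovector z hz = r • α.form (toRay z hz)) ⟨1, one_pos, by simp⟩ ?_ ?_ ?_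
    · rintro s t hst ⟨R, hR, h⟩
      exact ⟨R, hR, fun z hz => h z (hst hz)⟩
    · rintro s t ⟨R, hR, h⟩ ⟨R', hR', h'⟩
      refine ⟨max R R', lt_max_of_lt_left hR, ?_⟩
      rintro z (hz | hz) hz0
      · obtain ⟨r, hr, h1⟩ := h z hz hz0
        exact ⟨r, le_max_of_le_left hr, h1⟩
      · obtain ⟨r, hr, h1⟩ := h' z hz hz0
        exact ⟨r, le_max_of_le_right hr, h1⟩
    · intro z hz
      obtain ⟨R, hR, h⟩ := α.locally_bounded (hC0 z hz)
      exact ⟨_, mem_nhdsWithin_of_mem_nhds h, R, hR, fun w hw => hw⟩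
  refine ⟨R⁻¹, inv_pos.2 hR, fun t ht htR z hz => Or.inl ⟨dilate_ne_zero ht (hC0 z hz), ?_⟩⟩
  obtain ⟨r, hr, h1⟩ := h z hz (hC0 z hz)
  refine ⟨t * r, ?_, ?_⟩
  · calc t * r ≤ t * R := mul_le_mul_of_nonneg_left hr ht.le
      _ < R⁻¹ * R := mul_lt_mul_of_pos_right htR hR
      _ = 1 := inv_mul_cancel₀ hR.ne'
  · have h2 : toRay (dilate t z) (dilate_ne_zero ht (hC0 z hz)) = toRay z (hC0 z hz) :=
      ((toRay_eq_iff _ _).2 ⟨t, ht, rfl⟩).symm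
    have h3 : ∀ y, y = toRay z (hC0 z hz) → pulledCovector (dilate t z) y =
        (t * r) • (show Model n →L[ℝ] ℝ from α.form y) := by
      rintro _ rfl
      rw [mul_smul]
      exact congrArg (fun L : Model n →L[ℝ] ℝ => t • L) h1
    exact h3 _ h2

end Conic

/-! ## Lifts of diffeomorphisms -/

section CotangentLift
variable {n : ℕ} {X : Type u} [TopologicalSpace X]
  [ChartedSpace (EuclideanSpace ℝ (Fin n)) X] [IsManifold (𝓡 n) ∞ X]

theorem coords_apply (x₀ : X) {z : CotangentBundle n X} (hz : z.1 ∈ (chartAt (Vec n) x₀).source)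
    (u : Vec n) : coords x₀ z u = (show Covec n from z.2)
      (mfderiv 𝓘(ℝ, Vec n) (𝓡 n) (chartAt (Vec n) x₀).symm (chartAt (Vec n) x₀ z.1) u) := by
  have h := ofCoords_snd_mfderiv x₀ (coords x₀ z) ((chartAt (Vec n) x₀).map_source hz) u
  rw [show ((chartAt (Vec n) x₀ z.1, coords x₀ z) : Vec n × Covec n) = covectorChart x₀ z from rfl,
    ofCoords_covectorChart x₀ hz] at h
  exact h.symm

/-- The symplectomorphism `(p, q) ↦ ((e^*)⁻¹ p, e(q))` of `T^*X`. -/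
def cotangentMap (e : X ≃ₘ⟮𝓡 n, 𝓡 n⟯ X) (z : CotangentBundle n X) : CotangentBundle n X :=
  ⟨e z.1, ContinuousLinearMap.comp (show Covec n from z.2)
    (show Vec n →L[ℝ] Vec n from mfderiv (𝓡 n) (𝓡 n) e.symm (e z.1))⟩

theorem mfderiv_symm_comp (e : X ≃ₘ⟮𝓡 n, 𝓡 n⟯ X) (x : X) :
    ContinuousLinearMap.comp (show Vec n →L[ℝ] Vec n from mfderiv (𝓡 n) (𝓡 n) e.symm (e x))
      (show Vec n →L[ℝ] Vec n from mfderiv (𝓡 n) (𝓡 n) e x) = ContinuousLinearMap.id ℝ (Vec n) := by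
  have h := mfderiv_comp x (e.symm.contMDiff.mdifferentiableAt (by simp))
    (e.contMDiff.mdifferentiableAt (x := x) (by simp))
  rw [show (e.symm : X → X) ∘ e = id from funext fun x => e.symm_apply_apply x, mfderiv_id] at h
  exact h.symm

theorem mfderiv_comp_symm (e : X ≃ₘ⟮𝓡 n, 𝓡 n⟯ X) (x : X) :
    ContinuousLinearMap.comp (show Vec n →L[ℝ] Vec n from mfderiv (𝓡 n) (𝓡 n) e x)
      (show Vec n →L[ℝ] Vec n from mfderiv (𝓡 n) (𝓡 n) e.symm (e x)) =
        ContinuousLinearMap.id ℝ (Vec n) := by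
  have h := mfderiv_symm_comp e x
  have h1 := congrArg (fun L : Vec n →L[ℝ] Vec n => (L : Vec n →ₗ[ℝ] Vec n)) h
  refine ContinuousLinearMap.coe_injective ?_
  -- In finite dimension a left inverse is a right inverse. This gives the identity at `x` itself,
  -- without transport along `e.symm (e x) = x`.
  exact mul_eq_one_comm.1 h1

theorem cotangentMap_symm (e : X ≃ₘ⟮𝓡 n, 𝓡 n⟯ X) (z : CotangentBundle n X) :
    cotangentMap e.symm (cotangentMap e z) = z := by
  have h : ∀ x, x = z.1 → (⟨x, ContinuousLinearMap.comp (ContinuousLinearMap.comp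
      (show Covec n from z.2)
      (show Vec n →L[ℝ] Vec n from mfderiv (𝓡 n) (𝓡 n) e.symm (e z.1)))
      (show Vec n →L[ℝ] Vec n from mfderiv (𝓡 n) (𝓡 n) e x)⟩ : CotangentBundle n X) = z := by
    rintro _ rfl
    refine congrArg (TotalSpace.mk z.1) ?_
    exact congrArg (fun L : Vec n →L[ℝ] Vec n =>
      ContinuousLinearMap.comp (show Covec n from z.2) L) (mfderiv_symm_comp e z.1)
  exact h _ (e.symm_apply_apply z.1)

theorem cotangentMap_ne_zero (e : X ≃ₘ⟮𝓡 n, 𝓡 n⟯ X) {z : CotangentBundle n X} (hz : z.2 ≠ 0) :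
    (cotangentMap e z).2 ≠ 0 := by
  intro h
  apply hz
  have h1 := cotangentMap_symm e z
  rw [← h1]
  change ContinuousLinearMap.comp (show Covec n from (cotangentMap e z).2) _ = _
  rw [h]
  exact ContinuousLinearMap.zero_comp _

theorem cotangentMap_zero_iff (e : X ≃ₘ⟮𝓡 n, 𝓡 n⟯ X) (z : CotangentBundle n X) :
    (cotangentMap e z).2 = 0 ↔ z.2 = 0 := by
  refine ⟨fun h => by_contra fun h' => cotangentMap_ne_zero e h' h, fun h => ?_⟩
  change ContinuousLinearMap.comp (show Covec n from z.2) _ = _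
  rw [h]
  exact ContinuousLinearMap.zero_comp _

theorem cotangentMap_smul (e : X ≃ₘ⟮𝓡 n, 𝓡 n⟯ X) (c : ℝ) (z : CotangentBundle n X) :
    cotangentMap e ⟨z.1, c • z.2⟩ = ⟨(cotangentMap e z).1, c • (cotangentMap e z).2⟩ := rfl

/-- A map of `X` in charts. -/
def baseRep (x₀ x₁ : X) (e : X → X) (y : Vec n) : Vec n :=
  chartAt (Vec n) x₁ (e ((chartAt (Vec n) x₀).symm y))

theorem contMDiffAt_chart (x₀ : X) {x : X} (hx : x ∈ (chartAt (Vec n) x₀).source) :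
    ContMDiffAt (𝓡 n) 𝓘(ℝ, Vec n) ∞ (chartAt (Vec n) x₀) x :=
  contMDiffAt_of_mem_maximalAtlas (I := 𝓡 n) (n := ∞) (IsManifold.chart_mem_maximalAtlas x₀) hx

theorem contMDiffAt_chart_symm (x₀ : X) {y : Vec n} (hy : y ∈ (chartAt (Vec n) x₀).target) :
    ContMDiffAt 𝓘(ℝ, Vec n) (𝓡 n) ∞ (chartAt (Vec n) x₀).symm y :=
  contMDiffAt_symm_of_mem_maximalAtlas (I := 𝓡 n) (n := ∞) (IsManifold.chart_mem_maximalAtlas x₀) hy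

theorem contMDiffAt_baseRep {x₀ x₁ : X} {e : X → X} (he : ContMDiff (𝓡 n) (𝓡 n) ∞ e) {y : Vec n}
    (hy : y ∈ (chartAt (Vec n) x₀).target)
    (hy' : e ((chartAt (Vec n) x₀).symm y) ∈ (chartAt (Vec n) x₁).source) :
    ContMDiffAt 𝓘(ℝ, Vec n) 𝓘(ℝ, Vec n) ∞ (baseRep x₀ x₁ e) y :=
  (contMDiffAt_chart x₁ hy').comp y ((he _).comp y (contMDiffAt_chart_symm x₀ hy))

theorem coords_cotangentMap (e : X ≃ₘ⟮𝓡 n, 𝓡 n⟯ X) {x₀ x₁ : X} {z : CotangentBundle n X}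
    (hz : z.1 ∈ (chartAt (Vec n) x₀).source) (hz' : e z.1 ∈ (chartAt (Vec n) x₁).source)
    (u : Vec n) : coords x₁ (cotangentMap e z)
      (fderiv ℝ (baseRep x₀ x₁ e) (chartAt (Vec n) x₀ z.1) u) = coords x₀ z u := by
  set y := chartAt (Vec n) x₀ z.1 with hy
  have ht : y ∈ (chartAt (Vec n) x₀).target := (chartAt (Vec n) x₀).map_source hz
  have hl : (chartAt (Vec n) x₀).symm y = z.1 := (chartAt (Vec n) x₀).left_inv hz
  have hr : ContMDiffAt 𝓘(ℝ, Vec n) 𝓘(ℝ, Vec n) ∞ (baseRep x₀ x₁ e) y :=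
    contMDiffAt_baseRep e.contMDiff ht (by rw [hl]; exact hz')
  have hb : baseRep x₀ x₁ e y = chartAt (Vec n) x₁ (e z.1) := by
    rw [baseRep, hl]
  have ht' : baseRep x₀ x₁ e y ∈ (chartAt (Vec n) x₁).target := by
    rw [hb]
    exact (chartAt (Vec n) x₁).map_source hz'
  have h1 := mfderiv_comp y (I'' := 𝓡 n)
    ((contMDiffAt_chart_symm x₁ ht').mdifferentiableAt (by simp))
    (hr.mdifferentiableAt (by simp))
  have h2 := mfderiv_comp y
    (e.symm.contMDiff.mdifferentiableAt (x := (chartAt (Vec n) x₁).symm (baseRep x₀ x₁ e y)) (by simp))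
    (((contMDiffAt_chart_symm x₁ ht').comp y hr).mdifferentiableAt (by simp))
  have h3 : e.symm ∘ (chartAt (Vec n) x₁).symm ∘ baseRep x₀ x₁ e =ᶠ[𝓝 y]
      (chartAt (Vec n) x₀).symm := by
    have : ∀ᶠ w in 𝓝 y, e ((chartAt (Vec n) x₀).symm w) ∈ (chartAt (Vec n) x₁).source :=
      (e.continuous.continuousAt.comp (contMDiffAt_chart_symm x₀ ht).continuousAt).eventually_mem
        ((chartAt (Vec n) x₁).open_source.mem_nhds (by simpa [hl] using hz'))
    filter_upwards [this] with w hw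
    simp only [Function.comp, baseRep]
    rw [(chartAt (Vec n) x₁).left_inv hw, e.symm_apply_apply]
  rw [h1, h3.mfderiv_eq, mfderiv_eq_fderiv] at h2
  rw [coords_apply x₀ hz, coords_apply x₁ (z := cotangentMap e z) hz']
  have h4 := congrArg (fun L : Vec n →L[ℝ] Vec n => (show Covec n from z.2) (L u)) h2
  refine Eq.trans ?_ h4.symm
  have h5 : ∀ {a b : Vec n} (_ : a = b) {c d : X} (_ : c = d),
      (show Covec n from z.2) (mfderiv (𝓡 n) (𝓡 n) e.symm c
        (mfderiv 𝓘(ℝ, Vec n) (𝓡 n) (chartAt (Vec n) x₁).symm a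
          (fderiv ℝ (baseRep x₀ x₁ e) y u))) =
      (show Covec n from z.2) (mfderiv (𝓡 n) (𝓡 n) e.symm d
        (mfderiv 𝓘(ℝ, Vec n) (𝓡 n) (chartAt (Vec n) x₁).symm b
          (fderiv ℝ (baseRep x₀ x₁ e) y u))) := by
    rintro a _ rfl c _ rfl
    rfl
  refine h5 hb.symm ?_
  change _ = (chartAt (Vec n) x₁).symm (baseRep x₀ x₁ e y)
  rw [hb, (chartAt (Vec n) x₁).left_inv hz']

/-- A vector in the kernel is killed by every covector, because the cotangent map preserves the
pairing; so the derivative is injective, hence invertible. -/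
theorem exists_equiv_fderiv_baseRep (e : X ≃ₘ⟮𝓡 n, 𝓡 n⟯ X) {x₀ x₁ : X} {x : X}
    (hz : x ∈ (chartAt (Vec n) x₀).source) (hz' : e x ∈ (chartAt (Vec n) x₁).source) :
    ∃ L : Vec n ≃L[ℝ] Vec n, (L : Vec n →L[ℝ] Vec n) =
      fderiv ℝ (baseRep x₀ x₁ e) (chartAt (Vec n) x₀ x) := by
  set D := fderiv ℝ (baseRep x₀ x₁ e) (chartAt (Vec n) x₀ x)
  have hinj : Function.Injective (D : Vec n →ₗ[ℝ] Vec n) := by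
    rw [← LinearMap.ker_eq_bot, LinearMap.ker_eq_bot']
    intro u hu
    have h : ∀ p : Covec n, p u = 0 := by
      intro p
      have h1 := coords_cotangentMap e (z := covector x₀ x p) hz hz' u
      rw [coords_covector_self x₀ x p hz] at h1
      rw [← h1]
      exact (congrArg (coords x₁ (cotangentMap e (covector x₀ x p))) hu).trans (map_zero _)
    by_contra hne
    obtain ⟨p, hp⟩ := SeparatingDual.exists_ne_zero (R := ℝ) hne
    exact hp (h p)
  refine ⟨(LinearEquiv.ofInjectiveEndo _ hinj).toContinuousLinearEquiv, ?_⟩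
  ext u
  rfl

theorem cotangentMap_eq_ofCoords (e : X ≃ₘ⟮𝓡 n, 𝓡 n⟯ X) {x₀ x₁ : X} {z : CotangentBundle n X}
    (hz : z.1 ∈ (chartAt (Vec n) x₀).source) (hz' : e z.1 ∈ (chartAt (Vec n) x₁).source) :
    cotangentMap e z = ofCoords x₁ (baseRep x₀ x₁ e (covectorChart x₀ z).1,
      (covectorChart x₀ z).2.comp
        (fderiv ℝ (baseRep x₀ x₁ e) (covectorChart x₀ z).1).inverse) := by
  obtain ⟨L, hL⟩ := exists_equiv_fderiv_baseRep e hz hz'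
  have h1 : coords x₁ (cotangentMap e z) = (covectorChart x₀ z).2.comp
        (fderiv ℝ (baseRep x₀ x₁ e) (covectorChart x₀ z).1).inverse := by
    ext u
    change _ = coords x₀ z ((fderiv ℝ (baseRep x₀ x₁ e) (chartAt (Vec n) x₀ z.1)).inverse u)
    rw [← hL, ContinuousLinearMap.inverse_equiv]
    have := coords_cotangentMap e hz hz' (L.symm u)
    rw [← hL] at this
    rw [ContinuousLinearEquiv.coe_coe, ← this, ContinuousLinearEquiv.coe_coe, L.apply_symm_apply]
  rw [← h1]
  have h2 : baseRep x₀ x₁ e (covectorChart x₀ z).1 = chartAt (Vec n) x₁ (cotangentMap e z).1 := by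
    change chartAt (Vec n) x₁ (e ((chartAt (Vec n) x₀).symm (chartAt (Vec n) x₀ z.1))) = _
    rw [(chartAt (Vec n) x₀).left_inv hz]
    rfl
  rw [h2]
  exact (ofCoords_covectorChart x₁ (z := cotangentMap e z) hz').symm

theorem contDiffOn_comp_inverse :
    ContDiffOn ℝ ∞ (fun p : (Vec n × (Vec n →L[ℝ] Vec n)) × Covec n =>
      ((p.1.1, p.2.comp p.1.2.inverse) : Vec n × Covec n))
      {p | p.1.2 ∈ range ((↑) : (Vec n ≃L[ℝ] Vec n) → (Vec n →L[ℝ] Vec n))} := by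
  rintro p ⟨L, hL⟩
  refine ContDiffAt.contDiffWithinAt ?_
  have h1 : ContDiffAt ℝ ∞ (fun p : (Vec n × (Vec n →L[ℝ] Vec n)) × Covec n => p.1.2.inverse) p := by
    have h2 := contDiffAt_map_inverse (n := ∞) L
    rw [hL] at h2
    exact ContDiffAt.comp (f := fun p : (Vec n × (Vec n →L[ℝ] Vec n)) × Covec n => p.1.2) p h2
      contDiffAt_fst.snd
  exact ContDiffAt.prodMk (by fun_prop) (contDiffAt_snd.clm_comp h1)

theorem isOpen_comp_inverse : IsOpen {p : (Vec n × (Vec n →L[ℝ] Vec n)) × Covec n |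
    p.1.2 ∈ range ((↑) : (Vec n ≃L[ℝ] Vec n) → (Vec n →L[ℝ] Vec n))} :=
  ContinuousLinearEquiv.isOpen.preimage (by fun_prop : Continuous fun p :
    (Vec n × (Vec n →L[ℝ] Vec n)) × Covec n => p.1.2)

/-- In charts the map is (y, p) ↦ (E(y), p ∘ DE(y)⁻¹), and inversion of linear maps is smooth at
invertible ones. One derivative of e is used up. -/
theorem sConv_cotangentMap {ι : Type*} {F : Filter ι} {k : ℕ} {e : ι → X ≃ₘ⟮𝓡 n, 𝓡 n⟯ X}
    {e₀ : X ≃ₘ⟮𝓡 n, 𝓡 n⟯ X} {z₀ : CotangentBundle n X}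
    (he : SConv F (k + 1) (𝓡 n) (𝓡 n) (fun i => e i) e₀ z₀.1) :
    SConv F k (cotangentModel n) (cotangentModel n) (fun i => cotangentMap (e i))
      (cotangentMap e₀) z₀ := by
  set x₀ := z₀.1
  set x₁ := e₀ z₀.1
  have hs : z₀.1 ∈ (chartAt (Vec n) x₀).source := mem_chart_source _ _
  have hs' : e₀ z₀.1 ∈ (chartAt (Vec n) x₁).source := mem_chart_source _ _
  have ht : (covectorChart x₀ z₀).1 ∈ (chartAt (Vec n) x₀).target :=
    (chartAt (Vec n) x₀).map_source hs
  have hl : (chartAt (Vec n) x₀).symm (covectorChart x₀ z₀).1 = z₀.1 :=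
    (chartAt (Vec n) x₀).left_inv hs
  have hrep : SConv F (k + 1) 𝓘(ℝ, Vec n) 𝓘(ℝ, Vec n) (fun i => baseRep x₀ x₁ (e i))
      (baseRep x₀ x₁ e₀) (covectorChart x₀ z₀).1 := by
    have h1 : SConv F (k + 1) 𝓘(ℝ, Vec n) (𝓡 n) (fun i w => e i ((chartAt (Vec n) x₀).symm w))
        (fun w => e₀ ((chartAt (Vec n) x₀).symm w)) (covectorChart x₀ z₀).1 := by
      refine SConv.precomp (g := fun i => e i) (by rw [hl]; exact he) ?_
      filter_upwards [(chartAt (Vec n) x₀).open_target.mem_nhds ht] with w hw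
        using contMDiffAt_chart_symm x₀ hw
    refine SConv.map h1 ?_
    filter_upwards [(chartAt (Vec n) x₁).open_source.mem_nhds (by rw [hl]; exact hs')] with y hy
    exact contMDiffAt_chart x₁ hy
  have hc := eventually_contMDiffAt_covectorChart x₀ hs
  have hc1 : ∀ᶠ z in 𝓝 z₀, ContMDiffAt (cotangentModel n) 𝓘(ℝ, Vec n) ∞
      (fun z => (covectorChart x₀ z).1) z := by
    filter_upwards [hc] with z hz
    exact (contDiff_fst (n := ∞)).contMDiff.contMDiffAt.comp z hz
  have hc2 : ∀ᶠ z in 𝓝 z₀, ContMDiffAt (cotangentModel n) 𝓘(ℝ, Covec n) ∞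
      (fun z => (covectorChart x₀ z).2) z := by
    filter_upwards [hc] with z hz
    exact (contDiff_snd (n := ∞)).contMDiff.contMDiffAt.comp z hz
  have h1 := hrep.of_succ.precomp (f := fun z => (covectorChart x₀ z).1) hc1
  have h2 := hrep.fderiv_clm.precomp (f := fun z => (covectorChart x₀ z).1) hc1
  have h3 := (h1.prodMk_vec h2).prodMk_vec (SConv.const (F := F) (k := k) hc2)
  have h4 := h3.map_contDiffAt isOpen_comp_inverse
    (exists_equiv_fderiv_baseRep e₀ hs hs') contDiffOn_comp_inverse
  have ht' : baseRep x₀ x₁ e₀ (covectorChart x₀ z₀).1 ∈ (chartAt (Vec n) x₁).target := by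
    rw [baseRep, hl]
    exact (chartAt (Vec n) x₁).map_source hs'
  have h5 := h4.map (eventually_contMDiffAt_ofCoords x₁ (by exact ht'))
  refine h5.congr ?_ ?_
  · have h6 : Filter.Tendsto (fun p : ι × CotangentBundle n X => e p.1 p.2.1) (F ×ˢ 𝓝 z₀)
        (𝓝 (e₀ z₀.1)) := he.tendsto.comp
          (Filter.tendsto_id.prodMap (continuous_cotangent_proj.tendsto z₀))
    filter_upwards [h6.eventually_mem ((chartAt (Vec n) x₁).open_source.mem_nhds hs'),
      Filter.tendsto_snd.eventually (eventually_proj_mem (chartAt (Vec n) x₀).open_source hs)]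
      with p h7 h8
    exact cotangentMap_eq_ofCoords (e p.1) h8 h7
  · filter_upwards [(e₀.continuous.comp continuous_cotangent_proj).continuousAt.eventually_mem
      ((chartAt (Vec n) x₁).open_source.mem_nhds hs'),
      eventually_proj_mem (chartAt (Vec n) x₀).open_source hs] with z h7 h8
    exact cotangentMap_eq_ofCoords e₀ h8 h7

theorem contMDiff_cotangentMap (e : X ≃ₘ⟮𝓡 n, 𝓡 n⟯ X) :
    ContMDiff (cotangentModel n) (cotangentModel n) ∞ (cotangentMap e) := fun _ =>
  (sConv_cotangentMap (ι := Unit) (F := ⊤) (k := 0) (e := fun _ => e)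
    (SConv.const (Filter.Eventually.of_forall e.contMDiff))).contMDiffAt

/-- `cotangentMap` as a diffeomorphism. -/
def cotangentDiffeo (e : X ≃ₘ⟮𝓡 n, 𝓡 n⟯ X) :
    CotangentBundle n X ≃ₘ⟮cotangentModel n, cotangentModel n⟯ CotangentBundle n X where
  toFun := cotangentMap e
  invFun := cotangentMap e.symm
  left_inv := cotangentMap_symm e
  right_inv z := cotangentMap_symm e.symm z
  contMDiff_toFun := contMDiff_cotangentMap e
  contMDiff_invFun := contMDiff_cotangentMap e.symm

/-- The map covers e and acts on covectors by the inverse of e^*, so the two effects on the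
tautological form cancel. -/
theorem liouvilleForm_cotangentMap (e : X ≃ₘ⟮𝓡 n, 𝓡 n⟯ X) :
    OneForm.pullback (cotangentMap e) (liouvilleForm n X) = liouvilleForm n X := by
  funext z
  have h1 := mfderiv_comp z ((cotangentProj n X).contMDiff.mdifferentiableAt
    (x := cotangentMap e z) (by simp)) ((contMDiff_cotangentMap e).mdifferentiableAt (by simp))
  have h2 := mfderiv_comp z (e.symm.contMDiff.mdifferentiableAt
    (x := cotangentProj n X (cotangentMap e z)) (by simp))
    (((cotangentProj n X).contMDiff.comp (contMDiff_cotangentMap e)).mdifferentiableAt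
      (x := z) (by simp))
  have h3 : e.symm ∘ ((cotangentProj n X : CotangentBundle n X → X) ∘ cotangentMap e) =
      (cotangentProj n X : CotangentBundle n X → X) :=
    funext fun z : CotangentBundle n X => e.symm_apply_apply z.1
  rw [h1, h3] at h2
  refine ContinuousLinearMap.ext fun v => ?_
  exact (congrArg (fun L : Vec n × Covec n →L[ℝ] Vec n => (show Covec n from z.2) (L v)) h2).symm

/-- The automorphism `e^*` of `H¹(X, ℝ)`. -/
def cohomologyEquiv (e : X ≃ₘ⟮𝓡 n, 𝓡 n⟯ X) : DeRhamH1 (𝓡 n) X ≃ₗ[ℝ] DeRhamH1 (𝓡 n) X :=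
  LinearEquiv.ofLinearMap (DeRhamH1.map e.toContMDiffMap) (DeRhamH1.map e.symm.toContMDiffMap)
    (LinearMap.ext fun c => by
      rw [LinearMap.comp_apply, ← DeRhamH1.map_comp]
      have h : e.symm.toContMDiffMap.comp e.toContMDiffMap = ContMDiffMap.id := by
        ext x
        exact e.symm_apply_apply x
      rw [h, DeRhamH1.map_id]
      rfl)
    (LinearMap.ext fun c => by
      rw [LinearMap.comp_apply, ← DeRhamH1.map_comp]
      have h : e.toContMDiffMap.comp e.symm.toContMDiffMap = ContMDiffMap.id := by
        ext x
        exact e.apply_symm_apply x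
      rw [h, DeRhamH1.map_id]
      rfl)

theorem isExactSymplectic_cotangentDiffeo (e : X ≃ₘ⟮𝓡 n, 𝓡 n⟯ X) :
    IsExactSymplectic (cotangentDiffeo e) (cohomologyEquiv e) := by
  refine ⟨⟨fun _ => 0, contMDiff_const, ?_⟩, cotangentMap_zero_iff e, fun g c => ?_⟩
  · refine (liouvilleForm_cotangentMap e).trans ?_
    rw [left_eq_add]
    funext z
    exact mfderiv_const
  · exact DeRhamH1.map_comp e.toContMDiffMap ((cotangentProj n X).comp g) c

/-- The lift of a diffeomorphism to `P_+T^*X`. -/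
def rayMap (e : X ≃ₘ⟮𝓡 n, 𝓡 n⟯ X) (y : ContactElementSpace n X) : ContactElementSpace n X :=
  Quotient.lift (s := raySetoid n X) (fun z => toRay (cotangentMap e z.1)
    (cotangentMap_ne_zero e z.2)) (by
    rintro z w ⟨c, hc, h⟩
    refine (toRay_eq_iff _ _).2 ⟨c, hc, ?_⟩
    rw [h]
    exact cotangentMap_smul e c z.1) y

theorem rayMap_toRay (e : X ≃ₘ⟮𝓡 n, 𝓡 n⟯ X) (z : CotangentBundle n X) (hz : z.2 ≠ 0) :
    rayMap e (toRay z hz) = toRay (cotangentMap e z) (cotangentMap_ne_zero e hz) := rfl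

theorem rayMap_symm (e : X ≃ₘ⟮𝓡 n, 𝓡 n⟯ X) (y : ContactElementSpace n X) :
    rayMap e.symm (rayMap e y) = y := by
  obtain ⟨z, hz, rfl⟩ := toRay_surj y
  rw [rayMap_toRay, rayMap_toRay]
  congr 1
  exact cotangentMap_symm e z

/-- Locally the map is a section of τ, followed by the cotangent map, followed by τ; only the middle
factor varies. -/
theorem sConv_rayMap {ι : Type*} {F : Filter ι} {k : ℕ} {e : ι → X ≃ₘ⟮𝓡 n, 𝓡 n⟯ X}
    {e₀ : X ≃ₘ⟮𝓡 n, 𝓡 n⟯ X} {y₀ : ContactElementSpace n X}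
    (he : SConv F (k + 1) (𝓡 n) (𝓡 n) (fun i => e i) e₀ (basePoint y₀)) :
    SConv F k 𝓘(ℝ, Model n) 𝓘(ℝ, Model n) (fun i => rayMap (e i)) (rayMap e₀) y₀ := by
  obtain ⟨A, hA⟩ := exists_mem_affineSource y₀
  set x₀ := basePoint y₀
  have hw : toRay (localSection x₀ A y₀) (localSection_snd_ne x₀ A hA) = y₀ :=
    toRay_localSection x₀ A hA
  have hb : (localSection x₀ A y₀).1 = basePoint y₀ :=
    (basePoint_toRay _ (localSection_snd_ne x₀ A hA)).symm.trans (congrArg basePoint hw)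
  have h1 : SConv F k 𝓘(ℝ, Model n) (cotangentModel n)
      (fun i y => cotangentMap (e i) (localSection x₀ A y))
      (fun y => cotangentMap e₀ (localSection x₀ A y)) y₀ := by
    refine SConv.precomp (sConv_cotangentMap (by rw [hb]; exact he)) ?_
    filter_upwards [(isOpen_affineSource x₀ A).mem_nhds hA] with y hy
      using contMDiffAt_localSection x₀ A hy
  set w₀ := cotangentMap e₀ (localSection x₀ A y₀)
  have hw₀ : w₀.2 ≠ 0 := cotangentMap_ne_zero e₀ (localSection_snd_ne x₀ A hA)
  obtain ⟨B, hB⟩ := exists_mem_affineSource (toRay w₀ hw₀)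
  set x₁ := basePoint (toRay w₀ hw₀)
  obtain ⟨hs, hpos⟩ := (toRay_mem_affineSource x₁ B w₀ hw₀).1 hB
  have hopen : ∀ᶠ w in 𝓝 w₀, w.1 ∈ (chartAt (Vec n) x₁).source ∧ 0 < (B (coords x₁ w)).1 := by
    refine (eventually_proj_mem (chartAt (Vec n) x₁).open_source hs).and ?_
    have h1 : Continuous (fun q : Vec n × Covec n => (B q.2).1) := by fun_prop
    exact (h1.continuousAt.comp (contMDiffAt_covectorChart x₁ hs).continuousAt).eventually
      (lt_mem_nhds hpos)
  have h2 := h1.map (g := localRay x₁ B) (hopen.mono fun w hw =>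
    contMDiffAt_localRay x₁ B hw.1 hw.2.ne')
  have key : ∀ (e : X ≃ₘ⟮𝓡 n, 𝓡 n⟯ X) y, y ∈ affineSource x₀ A →
      ((cotangentMap e (localSection x₀ A y)).1 ∈ (chartAt (Vec n) x₁).source ∧
        0 < (B (coords x₁ (cotangentMap e (localSection x₀ A y)))).1) →
      rayMap e y = localRay x₁ B (cotangentMap e (localSection x₀ A y)) := by
    intro e y hy h
    have h3 := cotangentMap_ne_zero e (localSection_snd_ne x₀ A hy)
    rw [localRay_eq x₁ B h3 ((toRay_mem_affineSource x₁ B _ h3).2 h),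
      ← rayMap_toRay e _ (localSection_snd_ne x₀ A hy),
      toRay_localSection x₀ A hy]
  refine h2.congr ?_ ?_
  · filter_upwards [h1.tendsto.eventually hopen,
      Filter.tendsto_snd.eventually ((isOpen_affineSource x₀ A).mem_nhds hA)] with p h3 h4
    exact key (e p.1) p.2 h4 h3
  · filter_upwards [h1.contMDiffAt.continuousAt.eventually hopen,
      (isOpen_affineSource x₀ A).mem_nhds hA] with y h3 h4
    exact key e₀ y h4 h3

theorem contMDiff_rayMap (e : X ≃ₘ⟮𝓡 n, 𝓡 n⟯ X) :
    ContMDiff 𝓘(ℝ, Model n) 𝓘(ℝ, Model n) ∞ (rayMap e) := fun _ =>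
  (sConv_rayMap (ι := Unit) (F := ⊤) (k := 0) (e := fun _ => e)
    (SConv.const (Filter.Eventually.of_forall e.contMDiff))).contMDiffAt

theorem isLift_cotangentMap (e : X ≃ₘ⟮𝓡 n, 𝓡 n⟯ X) : IsLift (rayMap e) (cotangentMap e) := by
  intro z hz
  refine ⟨cotangentMap_ne_zero e hz, rfl, fun v => ?_⟩
  have h1 := mfderiv_comp (toRay z hz) ((contMDiff_basePoint (n := n) (X := X)).mdifferentiableAt
    (x := rayMap e (toRay z hz)) (by simp)) ((contMDiff_rayMap e).mdifferentiableAt (by simp))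
  have h2 := mfderiv_comp (toRay z hz) (e.symm.contMDiff.mdifferentiableAt
    (x := basePoint (rayMap e (toRay z hz))) (by simp))
    ((contMDiff_basePoint.comp (contMDiff_rayMap e)).mdifferentiableAt
      (x := toRay z hz) (by simp))
  have h3 : e.symm ∘ basePoint ∘ rayMap e = (basePoint : ContactElementSpace n X → X) := by
    funext y
    obtain ⟨w, hw, rfl⟩ := toRay_surj y
    exact e.symm_apply_apply w.1
  rw [h1, h3] at h2
  exact (congrArg (fun L : Model n →L[ℝ] Vec n => (show Covec n from z.2) (L v)) h2).symm

/-- The canonical lift of a diffeomorphism. -/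
def canonicalLift (e : X ≃ₘ⟮𝓡 n, 𝓡 n⟯ X) : Contactomorphism n X :=
  ⟨{ toFun := rayMap e
     invFun := rayMap e.symm
     left_inv := rayMap_symm e
     right_inv := fun y => rayMap_symm e.symm y
     contMDiff_toFun := contMDiff_rayMap e
     contMDiff_invFun := contMDiff_rayMap e.symm }, fun V => by
    obtain ⟨y, v⟩ := V
    obtain ⟨z, hz, rfl⟩ := toRay_surj y
    refine (mem_positiveSide_iff (z := cotangentMap e z) (cotangentMap_ne_zero e hz) rfl).trans
      (Iff.trans ?_ (mem_positiveSide_iff (V := ⟨toRay z hz, v⟩) hz rfl).symm)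
    obtain ⟨-, -, h⟩ := isLift_cotangentMap e z hz
    exact iff_of_eq (congrArg (0 < ·) (h v))⟩

theorem isCanonicalLift_canonicalLift (e : X ≃ₘ⟮𝓡 n, 𝓡 n⟯ X) :
    IsCanonicalLift e (canonicalLift e) := by
  intro q p hp hp'
  refine (rayMap_toRay e _ hp').trans ?_
  congr 1
  refine congrArg (TotalSpace.mk (e q)) ?_
  have h := mfderiv_comp_symm e q
  exact congrArg (fun L : Vec n →L[ℝ] Vec n => ContinuousLinearMap.comp (show Covec n from p) L) h

/-- The loss of one derivative is harmless in the C^∞ topology. Continuity is what makes `j` well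
defined on components. -/
theorem tendsto_canonicalLift {e₀ : X ≃ₘ⟮𝓡 n, 𝓡 n⟯ X} :
    Filter.Tendsto (canonicalLift : (X ≃ₘ⟮𝓡 n, 𝓡 n⟯ X) → Contactomorphism n X) (𝓝 e₀)
      (𝓝 (canonicalLift e₀)) := by
  rw [tendsto_subtype_rng, tendsto_diffeomorph_iff]
  intro k y
  have h := (tendsto_diffeomorph_iff (F := 𝓝 e₀) (f := id) (f₀ := e₀)).1 Filter.tendsto_id
    (k + 1) (basePoint y)
  exact sConv_rayMap h

theorem continuous_canonicalLift :
    Continuous (canonicalLift : (X ≃ₘ⟮𝓡 n, 𝓡 n⟯ X) → Contactomorphism n X) :=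
  continuous_iff_continuousAt.2 fun _ => tendsto_canonicalLift

theorem domain_canonicalLift_pushforward (e : X ≃ₘ⟮𝓡 n, 𝓡 n⟯ X) (α : ContactForm n X) :
    ((canonicalLift e).pushforward α).domain = cotangentDiffeo e '' α.domain :=
  domain_pushforward (canonicalLift e) α (cotangentDiffeo e).toEquiv (isLift_cotangentMap e)
    fun z => (cotangentMap_zero_iff e z).2

theorem shape_domain_canonicalLift (e : X ≃ₘ⟮𝓡 n, 𝓡 n⟯ X) (α : ContactForm n X) :
    shape ((canonicalLift e).pushforward α).domain =
      (cohomologyEquiv e).symm '' shape α.domain := by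
  rw [domain_canonicalLift_pushforward,
    (isExactSymplectic_cotangentDiffeo e).shape_image]

end CotangentLift

/-! ## Perturbations of the identity along a subspace -/

section Shear
variable {E : Type} [NormedAddCommGroup E] [NormedSpace ℝ E] [FiniteDimensional ℝ E]

/-- `g` takes values in `S` and is a contraction, with factor `1/2`, along the translates of `S`. -/
structure IsContractingAlong (S : Submodule ℝ E) (g : E → E) : Prop where
  mem : ∀ x, g x ∈ S
  le : ∀ x y, x - y ∈ S → ‖g x - g y‖ ≤ 1 / 2 * ‖x - y‖

namespace IsContractingAlong
variable {S : Submodule ℝ E} {g : E → E}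

theorem norm_sub_le_two_mul (h : IsContractingAlong S g) {x y : E} (hxy : x - y ∈ S) :
    ‖x - y‖ ≤ 2 * ‖(x + g x) - (y + g y)‖ := by
  have h1 := h.le x y hxy
  have h2 : x - y = ((x + g x) - (y + g y)) - (g x - g y) := by abel
  have h3 := norm_sub_le ((x + g x) - (y + g y)) (g x - g y)
  rw [← h2] at h3
  linarith

theorem injective (h : IsContractingAlong S g) : Function.Injective fun x => x + g x := by
  intro x y hxy
  dsimp only at hxy
  have h1 : x - y = g y - g x := by
    rw [sub_eq_sub_iff_add_eq_add, hxy, add_comm]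
  have h2 := h.norm_sub_le_two_mul (x := x) (y := y) (h1 ▸ S.sub_mem (h.mem y) (h.mem x))
  rw [hxy, sub_self, norm_zero, mul_zero] at h2
  exact sub_eq_zero.1 (norm_le_zero_iff.1 h2)

/-- A solution of x + g(x) = y has the form y + s with s in S, and s is then a fixed point of s ↦
-g(y + s), a contraction of S. -/
theorem surjective (h : IsContractingAlong S g) : Function.Surjective fun x => x + g x := by
  intro y
  let T : S → S := fun s => ⟨-g (y + s), S.neg_mem (h.mem _)⟩
  have hT : ContractingWith (1 / 2) T := by
    refine ⟨by rw [← NNReal.coe_lt_coe]; norm_num, LipschitzWith.of_dist_le_mul fun s t => ?_⟩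
    rw [Subtype.dist_eq, Subtype.dist_eq, dist_eq_norm, dist_eq_norm]
    have h1 := h.le (y + s) (y + t) (by
      rw [add_sub_add_left_eq_sub]
      exact S.sub_mem s.2 t.2)
    rw [add_sub_add_left_eq_sub] at h1
    have h2 : -g (y + s) - -g (y + t) = -(g (y + s) - g (y + t)) := by abel
    change ‖-g (y + s) - -g (y + t)‖ ≤ _
    rw [h2, norm_neg]
    simpa using h1
  have hc : CompleteSpace S := FiniteDimensional.complete ℝ S
  have h1 := hT.fixedPoint_isFixedPt
  set s := ContractingWith.fixedPoint T hT
  have h2 : -g (y + s) = s := congrArg Subtype.val h1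
  refine ⟨y + s, ?_⟩
  change y + s + g (y + s) = y
  have h3 : (s : E) + g (y + s) = 0 := by
    rw [add_comm, ← neg_eq_iff_add_eq_zero, h2]
  rw [add_assoc, h3, add_zero]

/-- The bijection `x ↦ x + g x`. -/
def equiv (h : IsContractingAlong S g) : E ≃ E :=
  Equiv.ofBijective (fun x => x + g x) ⟨h.injective, h.surjective⟩

theorem symm_add (h : IsContractingAlong S g) (x : E) :
    h.equiv.symm x + g (h.equiv.symm x) = x := h.equiv.apply_symm_apply x

theorem sub_symm_mem (h : IsContractingAlong S g) (x : E) : h.equiv.symm x - x ∈ S := by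
  have h1 : h.equiv.symm x - x = -g (h.equiv.symm x) := by
    rw [sub_eq_iff_eq_add, neg_add_eq_sub, eq_sub_iff_add_eq, h.symm_add]
  rw [h1]
  exact S.neg_mem (h.mem _)

/-- The expansion estimate is applied to the preimage of `x` and to `x` itself, whose images differ
by `g x`. It yields uniform convergence of the inverses. -/
theorem norm_symm_sub_le (h : IsContractingAlong S g) (x : E) :
    ‖h.equiv.symm x - x‖ ≤ 2 * ‖g x‖ := by
  have h1 := h.norm_sub_le_two_mul (h.sub_symm_mem x)
  rwa [h.symm_add, sub_add_cancel_left, norm_neg] at h1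

/-- A kernel vector satisfies v = -Dg v. As g has values in the closed subspace S, v lies in S, and
along S the derivative has norm at most 1/2, so v = 0. -/
theorem exists_hasFDerivAt (h : IsContractingAlong S g) {x : E} (hg : DifferentiableAt ℝ g x) :
    ∃ L : E ≃L[ℝ] E, HasFDerivAt (fun x => x + g x) (L : E →L[ℝ] E) x := by
  set D := fderiv ℝ g x
  have hinj : Function.Injective ((ContinuousLinearMap.id ℝ E + D : E →L[ℝ] E) : E →ₗ[ℝ] E) := by
    rw [← LinearMap.ker_eq_bot, LinearMap.ker_eq_bot']
    intro v hv
    have hv : v + D v = 0 := hv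
    -- Both facts are read off the curve t ↦ g(x + tv): its velocity lies in S because the curve
    -- does, and then its Lipschitz constant bounds that velocity.
    let γ : ℝ → E := fun t => g (x + t • v)
    have hγ : HasDerivAt γ (D v) 0 := by
      have h1 : HasDerivAt (fun t : ℝ => x + t • v) v 0 := by
        simpa using ((hasDerivAt_id (0 : ℝ)).smul_const v).const_add x
      have h2 : HasFDerivAt g D (x + (0 : ℝ) • v) := by
        simpa using hg.hasFDerivAt
      exact h2.comp_hasDerivAt (0 : ℝ) h1
    have hDv : D v ∈ S := by
      have h1 := range_deriv_subset_closure_span_image γ dense_univ (mem_range_self 0)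
      rw [hγ.deriv] at h1
      have h2 : (Submodule.span ℝ (γ '' univ) : Set E) ⊆ S := by
        rw [SetLike.coe_subset_coe, Submodule.span_le]
        rintro _ ⟨t, -, rfl⟩
        exact h.mem _
      exact closure_minimal h2 S.closed_of_finiteDimensional h1
    have hvS : v ∈ S := by
      rw [eq_neg_of_add_eq_zero_left hv]
      exact S.neg_mem hDv
    have hlip : LipschitzWith (1 / 2 * ‖v‖₊) γ := by
      refine LipschitzWith.of_dist_le_mul fun s t => ?_
      have h1 : (x + s • v) - (x + t • v) = (s - t) • v := by
        rw [add_sub_add_left_eq_sub, sub_smul]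
      have h2 := h.le (x + s • v) (x + t • v) (by
        rw [h1]
        exact S.smul_mem _ hvS)
      rw [h1, norm_smul] at h2
      rw [dist_eq_norm, dist_eq_norm]
      refine h2.trans (le_of_eq ?_)
      push_cast
      ring
    have h1 := norm_deriv_le_of_lipschitz (x₀ := 0) hlip
    rw [hγ.deriv] at h1
    have h2 : ‖D v‖ = ‖v‖ := by
      rw [eq_neg_of_add_eq_zero_right hv, norm_neg]
    rw [h2] at h1
    push_cast at h1
    exact norm_le_zero_iff.1 (by linarith)
  refine ⟨(LinearEquiv.ofInjectiveEndo _ hinj).toContinuousLinearEquiv, ?_⟩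
  have h1 : HasFDerivAt (fun x => x + g x) (ContinuousLinearMap.id ℝ E + D) x :=
    (hasFDerivAt_id x).add hg.hasFDerivAt
  have h2 : ((LinearEquiv.ofInjectiveEndo _ hinj).toContinuousLinearEquiv : E →L[ℝ] E) =
      ContinuousLinearMap.id ℝ E + D := by
    ext v
    rfl
  rw [h2]
  exact h1

/-- Injectivity identifies the global inverse with the one of the inverse function theorem.
Smoothness of g is needed at one point only, which matters as homogeneous maps are not smooth at
zero momentum. -/
theorem contDiffAt_symm (h : IsContractingAlong S g) {x : E} (hg : ContDiffAt ℝ ∞ g x) :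
    ContDiffAt ℝ ∞ h.equiv.symm (x + g x) := by
  obtain ⟨L, hL⟩ := h.exists_hasFDerivAt (hg.differentiableAt (by simp))
  have h1 : ContDiffAt ℝ ∞ (fun x => x + g x) x := contDiffAt_id.add hg
  have h2 := h1.to_localInverse hL (by simp)
  have h3 := (h1.hasStrictFDerivAt' hL (by simp)).eventually_right_inverse
  refine h2.congr_of_eventuallyEq ?_
  filter_upwards [h3] with y hy
  rw [Equiv.symm_apply_eq]
  exact hy.symm

theorem contDiffAt_symm' (h : IsContractingAlong S g) {y : E}
    (hg : ContDiffAt ℝ ∞ g (h.equiv.symm y)) : ContDiffAt ℝ ∞ h.equiv.symm y := by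
  have h1 := h.contDiffAt_symm hg
  rwa [h.symm_add] at h1

end IsContractingAlong

/-- If perturbations tend to `0`, the inverses of the perturbed identities tend to the identity. -/
theorem SConv.shear_symm {ι : Type*} {F : Filter ι} {S : Submodule ℝ E} {g G : ι → E → E} {x : E}
    (hg : SConv F 1 𝓘(ℝ, E) 𝓘(ℝ, E) g (fun _ => 0) x)
    (h : ∀ᶠ i in F, ∃ h : IsContractingAlong S (g i), ∀ y, G i y = h.equiv.symm y) :
    SConv F 1 𝓘(ℝ, E) 𝓘(ℝ, E) G id x := by
  have h' : ∀ᶠ p in F ×ˢ 𝓝 x, ∃ h : IsContractingAlong S (g p.1), ∀ y, G p.1 y = h.equiv.symm y :=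
    Filter.tendsto_fst.eventually h
  have ht : Filter.Tendsto (fun p : ι × E => G p.1 p.2) (F ×ˢ 𝓝 x) (𝓝 x) := by
    have h1 : Filter.Tendsto (fun p : ι × E => 2 * ‖g p.1 p.2‖) (F ×ˢ 𝓝 x) (𝓝 0) := by
      simpa using hg.tendsto.norm.const_mul 2
    have h2 : Filter.Tendsto (fun p : ι × E => G p.1 p.2 - p.2) (F ×ˢ 𝓝 x) (𝓝 0) := by
      refine squeeze_zero_norm' ?_ h1
      filter_upwards [h'] with p ⟨h3, h4⟩
      rw [h4]
      exact h3.norm_symm_sub_le p.2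
    simpa using h2.add Filter.tendsto_snd
  have ht' : Filter.Tendsto (fun p : ι × E => (p.1, G p.1 p.2)) (F ×ˢ 𝓝 x) (F ×ˢ 𝓝 x) :=
    Filter.tendsto_fst.prodMk ht
  have hs : ∀ᶠ p in F ×ˢ 𝓝 x, ContDiffAt ℝ ∞ (g p.1) (G p.1 p.2) := by
    filter_upwards [ht'.eventually hg.smooth] with p hp using hp.contDiffAt
  refine SConv.of_fderiv ⟨Filter.Eventually.of_forall fun y => contMDiffAt_id, ?_, ht⟩ ?_
  · filter_upwards [h', hs] with p ⟨h1, h2⟩ h3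
    rw [h2] at h3
    have h4 := h1.contDiffAt_symm' h3
    rw [show G p.1 = h1.equiv.symm from funext h2]
    exact h4.contMDiffAt
  · have h1 : Filter.Tendsto (fun p : ι × E => fderiv ℝ (g p.1) (G p.1 p.2)) (F ×ˢ 𝓝 x) (𝓝 0) := by
      have := hg.fderiv_clm.tendsto.comp ht'
      simpa [Function.comp_def] using this
    -- The derivative of the inverse at y is (id + Dg)⁻¹ taken at the preimage of y, and inversion
    -- of linear maps is continuous at the identity.
    have h2 : Filter.Tendsto (fun p : ι × E => (ContinuousLinearMap.id ℝ E +
        fderiv ℝ (g p.1) (G p.1 p.2)).inverse) (F ×ˢ 𝓝 x) (𝓝 (ContinuousLinearMap.id ℝ E)) := by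
      have h3 : ContinuousAt (ContinuousLinearMap.inverse : (E →L[ℝ] E) → E →L[ℝ] E)
          (ContinuousLinearMap.id ℝ E) :=
        (contDiffAt_map_inverse (n := ∞) (ContinuousLinearEquiv.refl ℝ E)).continuousAt
      have h4 : ContinuousLinearMap.inverse (ContinuousLinearMap.id ℝ E) =
          ContinuousLinearMap.id ℝ E :=
        ContinuousLinearMap.inverse_equiv (ContinuousLinearEquiv.refl ℝ E)
      rw [ContinuousAt, h4] at h3
      refine h3.comp ?_
      simpa using h1.const_add (ContinuousLinearMap.id ℝ E)
    rw [show fderiv ℝ (id : E → E) x = ContinuousLinearMap.id ℝ E from fderiv_id]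
    refine h2.congr' ?_
    filter_upwards [h', hs] with p ⟨h3, h4⟩ h5
    have h6 := h5.differentiableAt (by simp)
    obtain ⟨L, hL⟩ := h3.exists_hasFDerivAt h6
    have h7 : ContinuousLinearMap.id ℝ E + fderiv ℝ (g p.1) (G p.1 p.2) = L :=
      ((hasFDerivAt_id _).add h6.hasFDerivAt).unique hL
    rw [h7, ContinuousLinearMap.inverse_equiv]
    have h8 : ContDiffAt ℝ ∞ (G p.1) p.2 := by
      rw [h4] at h5
      rw [show G p.1 = h3.equiv.symm from funext h4]
      exact h3.contDiffAt_symm' h5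
    have h9 := hL.comp p.2 (h8.differentiableAt (by simp)).hasFDerivAt
    have h10 : (fun x => x + g p.1 x) ∘ G p.1 = id := by
      funext y
      simp only [Function.comp, h4]
      exact h3.symm_add y
    rw [h10] at h9
    have h11 := h9.unique (hasFDerivAt_id p.2)
    ext v
    have h12 : L (fderiv ℝ (G p.1) p.2 v) = v := congrArg (fun L : E →L[ℝ] E => L v) h11
    rw [ContinuousLinearEquiv.coe_coe, L.symm_apply_eq, h12]

end Shear

/-! ## Symplectomorphisms given by generating functions -/

section Generating
variable {n : ℕ}

/-- The cotangent bundle of the model space. -/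
abbrev Phase (n : ℕ) : Type := Vec n × Covec n

/-- Evaluation at a vector. -/
def evalAt (v : Vec n) : Covec n →L[ℝ] ℝ := ContinuousLinearMap.apply ℝ ℝ v

theorem evalAt_apply (v : Vec n) (P : Covec n) : evalAt v P = P v := rfl

/-- `⟨P, q⟩ + σ(q, P)` is a generating function, with the partial derivatives `a = ∂σ/∂q` and
`b = ∂σ/∂P`, of a symplectomorphism `(q, P + a) ↦ (q + b, P)` that is supported over `K` and smooth
where `P` is in `O`. -/
structure IsGenerating (K : Set (Vec n)) (O : Set (Covec n)) (σ : Phase n → ℝ)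
    (a : Phase n → Covec n) (b : Phase n → Vec n) : Prop where
  a_le : ∀ q P P', ‖a (q, P) - a (q, P')‖ ≤ 1 / 2 * ‖P - P'‖
  b_le : ∀ q q' P, ‖b (q, P) - b (q', P)‖ ≤ 1 / 2 * ‖q - q'‖
  eq_zero : ∀ x : Phase n, x.1 ∉ K → a x = 0 ∧ b x = 0 ∧ σ x = 0
  a_zero : ∀ q, a (q, 0) = 0
  b_zero : ∀ q, b (q, 0) = 0
  smooth_a : ∀ x : Phase n, x.2 ∈ O → ContDiffAt ℝ ∞ a x
  smooth_b : ∀ x : Phase n, x.2 ∈ O → ContDiffAt ℝ ∞ b x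
  smooth : ∀ x : Phase n, x.2 ∈ O → ContDiffAt ℝ ∞ σ x
  hasFDerivAt : ∀ x : Phase n, x.2 ∈ O → HasFDerivAt σ
    ((a x).comp (ContinuousLinearMap.fst ℝ (Vec n) (Covec n)) +
      (evalAt (b x)).comp (ContinuousLinearMap.snd ℝ (Vec n) (Covec n))) x
  mem_iff : ∀ x : Phase n, x.2 + a x ∈ O ↔ x.2 ∈ O

theorem isContractingAlong_snd {a : Phase n → Covec n}
    (h : ∀ q P P', ‖a (q, P) - a (q, P')‖ ≤ 1 / 2 * ‖P - P'‖) :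
    IsContractingAlong (Submodule.prod ⊥ ⊤) fun x : Phase n => ((0, a x) : Phase n) := by
  refine ⟨fun x => ⟨rfl, trivial⟩, ?_⟩
  rintro ⟨q, P⟩ ⟨q', P'⟩ ⟨h1, -⟩
  obtain rfl : q = q' := sub_eq_zero.1 h1
  rw [Prod.mk_sub_mk, Prod.mk_sub_mk, sub_self, Prod.norm_mk, Prod.norm_mk, norm_zero,
    max_eq_right (norm_nonneg _), sub_self, norm_zero, max_eq_right (norm_nonneg _)]
  exact h q P P'

theorem isContractingAlong_fst {b : Phase n → Vec n}
    (h : ∀ q q' P, ‖b (q, P) - b (q', P)‖ ≤ 1 / 2 * ‖q - q'‖) :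
    IsContractingAlong (Submodule.prod ⊤ ⊥) fun x : Phase n => ((b x, 0) : Phase n) := by
  refine ⟨fun x => ⟨trivial, rfl⟩, ?_⟩
  rintro ⟨q, P⟩ ⟨q', P'⟩ ⟨-, h1⟩
  obtain rfl : P = P' := sub_eq_zero.1 h1
  rw [Prod.mk_sub_mk, Prod.mk_sub_mk, sub_self, Prod.norm_mk, Prod.norm_mk, norm_zero,
    max_eq_left (norm_nonneg _), sub_self, norm_zero, max_eq_left (norm_nonneg _)]
  exact h q q' P

namespace IsGenerating
variable {K : Set (Vec n)} {O : Set (Covec n)} {σ : Phase n → ℝ} {a : Phase n → Covec n}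
  {b : Phase n → Vec n}

/-- `(q, P) ↦ (q, P + a)`. -/
def source (h : IsGenerating K O σ a b) : Phase n ≃ Phase n := (isContractingAlong_snd h.a_le).equiv

/-- `(q, P) ↦ (q + b, P)`. -/
def target (h : IsGenerating K O σ a b) : Phase n ≃ Phase n := (isContractingAlong_fst h.b_le).equiv

/-- The symplectomorphism with the given generating function. -/
def toEquiv (h : IsGenerating K O σ a b) : Phase n ≃ Phase n := h.source.symm.trans h.target

theorem source_apply (h : IsGenerating K O σ a b) (x : Phase n) :
    h.source x = (x.1, x.2 + a x) := by
  refine Prod.ext ?_ rfl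
  exact add_zero _

theorem target_apply (h : IsGenerating K O σ a b) (x : Phase n) :
    h.target x = (x.1 + b x, x.2) := by
  refine Prod.ext rfl ?_
  exact add_zero _

theorem toEquiv_source (h : IsGenerating K O σ a b) (x : Phase n) :
    h.toEquiv (h.source x) = h.target x := by
  rw [toEquiv, Equiv.trans_apply, Equiv.symm_apply_apply]

theorem toEquiv_apply (h : IsGenerating K O σ a b) (x : Phase n) :
    h.toEquiv (x.1, x.2 + a x) = (x.1 + b x, x.2) := by
  rw [← h.source_apply, h.toEquiv_source, h.target_apply]

theorem source_symm_fst (h : IsGenerating K O σ a b) (x : Phase n) : (h.source.symm x).1 = x.1 := by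
  obtain ⟨y, rfl⟩ := h.source.surjective x
  rw [Equiv.symm_apply_apply, source_apply]

theorem source_symm_snd (h : IsGenerating K O σ a b) (x : Phase n) :
    (h.source.symm x).2 + a (h.source.symm x) = x.2 := by
  obtain ⟨y, rfl⟩ := h.source.surjective x
  rw [Equiv.symm_apply_apply, source_apply]

theorem source_symm_mem (h : IsGenerating K O σ a b) {x : Phase n} (hx : x.2 ∈ O) :
    (h.source.symm x).2 ∈ O := by
  rw [← h.mem_iff, h.source_symm_snd]
  exact hx

theorem toEquiv_eq_self (h : IsGenerating K O σ a b) {x : Phase n} (hx : a x = 0) (hx' : b x = 0) :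
    h.toEquiv x = x := by
  have h1 := h.toEquiv_apply x
  rwa [hx, hx', add_zero, add_zero] at h1

theorem toEquiv_of_notMem (h : IsGenerating K O σ a b) {x : Phase n} (hx : x.1 ∉ K) :
    h.toEquiv x = x :=
  h.toEquiv_eq_self (h.eq_zero x hx).1 (h.eq_zero x hx).2.1

theorem toEquiv_of_zero (h : IsGenerating K O σ a b) {x : Phase n} (hx : x.2 = 0) :
    h.toEquiv x = x := by
  obtain ⟨q, P⟩ := x
  obtain rfl : P = 0 := hx
  exact h.toEquiv_eq_self (h.a_zero q) (h.b_zero q)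

theorem contDiffAt_source_symm (h : IsGenerating K O σ a b) {x : Phase n} (hx : x.2 ∈ O) :
    ContDiffAt ℝ ∞ h.source.symm x :=
  (isContractingAlong_snd h.a_le).contDiffAt_symm'
    (contDiffAt_const.prodMk (h.smooth_a _ (h.source_symm_mem hx)))

theorem contDiffAt_target (h : IsGenerating K O σ a b) {x : Phase n} (hx : x.2 ∈ O) :
    ContDiffAt ℝ ∞ h.target x :=
  contDiffAt_id.add ((h.smooth_b x hx).prodMk contDiffAt_const)

theorem contDiffAt_toEquiv (h : IsGenerating K O σ a b) {x : Phase n} (hx : x.2 ∈ O) :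
    ContDiffAt ℝ ∞ h.toEquiv x :=
  (h.contDiffAt_target (h.source_symm_mem hx)).comp x (h.contDiffAt_source_symm hx)

theorem target_symm_snd (h : IsGenerating K O σ a b) (x : Phase n) : (h.target.symm x).2 = x.2 := by
  obtain ⟨y, rfl⟩ := h.target.surjective x
  rw [Equiv.symm_apply_apply, target_apply]

theorem contDiffAt_toEquiv_symm (h : IsGenerating K O σ a b) {x : Phase n} (hx : x.2 ∈ O) :
    ContDiffAt ℝ ∞ h.toEquiv.symm x := by
  have hx' : (h.target.symm x).2 ∈ O := by rwa [h.target_symm_snd]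
  have h1 : ContDiffAt ℝ ∞ h.target.symm x :=
    (isContractingAlong_fst h.b_le).contDiffAt_symm'
      ((h.smooth_b _ hx').prodMk contDiffAt_const)
  have h2 : ContDiffAt ℝ ∞ h.source (h.target.symm x) :=
    contDiffAt_id.add (contDiffAt_const.prodMk (h.smooth_a _ hx'))
  exact h2.comp x h1

/-- A primitive of the difference of the Liouville form and its pullback. -/
def primitive (h : IsGenerating K O σ a b) (x : Phase n) : ℝ :=
  (h.source.symm x).2 (b (h.source.symm x)) - σ (h.source.symm x)

theorem primitive_of_notMem (h : IsGenerating K O σ a b) {x : Phase n} (hx : x.1 ∉ K) :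
    h.primitive x = 0 := by
  rw [← h.source_symm_fst] at hx
  obtain ⟨-, h1, h2⟩ := h.eq_zero _ hx
  rw [primitive, h1, h2, map_zero, sub_zero]

theorem contDiffAt_primitive (h : IsGenerating K O σ a b) {x : Phase n} (hx : x.2 ∈ O) :
    ContDiffAt ℝ ∞ h.primitive x := by
  have h1 := h.contDiffAt_source_symm hx
  have h2 := (h.smooth_b _ (h.source_symm_mem hx)).comp x h1
  have h3 := (h.smooth _ (h.source_symm_mem hx)).comp x h1
  exact (h1.snd.clm_apply h2).sub h3

/-- With p = P + a and Q = q + b, one has P dQ - p dq = P db - a dq = d(P(b)) - (b dP + a dq) =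
d(P(b) - σ). -/
theorem liouville (h : IsGenerating K O σ a b) {x : Phase n} (hx : x.2 ∈ O) (w : Phase n) :
    (h.toEquiv x).2 (fderiv ℝ h.toEquiv x w).1 = x.2 w.1 + fderiv ℝ h.primitive x w := by
  set y := h.source.symm x with hy
  have hyO : y.2 ∈ O := h.source_symm_mem hx
  have h1 := ((h.contDiffAt_source_symm hx).differentiableAt (by simp)).hasFDerivAt
  set u := fderiv ℝ h.source.symm x w with hu
  have hb := ((h.smooth_b y hyO).differentiableAt (by simp)).hasFDerivAt
  have h2 : u.1 = w.1 := by
    have h3 := h1.fst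
    rw [show (fun x => (h.source.symm x).1) = Prod.fst from funext h.source_symm_fst] at h3
    exact congrArg (fun L : Phase n →L[ℝ] Vec n => L w) (h3.unique hasFDerivAt_fst)
  have h3 : (fderiv ℝ h.toEquiv x w).1 = u.1 + fderiv ℝ b y u := by
    have h4 : HasFDerivAt (fun x => (h.toEquiv x).1)
        ((ContinuousLinearMap.fst ℝ (Vec n) (Covec n) + fderiv ℝ b y).comp
          (fderiv ℝ h.source.symm x)) x := by
      have h5 : HasFDerivAt (fun y : Phase n => y.1 + b y)
        (ContinuousLinearMap.fst ℝ (Vec n) (Covec n) + fderiv ℝ b y) y := hasFDerivAt_fst.add hb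
      exact HasFDerivAt.comp (g := fun y : Phase n => y.1 + b y) x h5 h1
    have h5 := ((h.contDiffAt_toEquiv hx).differentiableAt (by simp)).hasFDerivAt.fst
    exact congrArg (fun L : Phase n →L[ℝ] Vec n => L w) (h5.unique h4)
  have h4 : (h.toEquiv x).2 = y.2 := by
    rw [toEquiv, Equiv.trans_apply, target_apply]
  have h5 : fderiv ℝ h.primitive x w = u.2 (b y) + y.2 (fderiv ℝ b y u) -
      (a y u.1 + u.2 (b y)) := by
    have h6 : HasFDerivAt (fun y : Phase n => y.2 (b y) - σ y) _ y :=
      ((hasFDerivAt_snd (p := y)).clm_apply hb).sub (h.hasFDerivAt y hyO)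
    have h7 := (HasFDerivAt.comp (g := fun y : Phase n => y.2 (b y) - σ y) x h6 h1).fderiv
    have h8 : fderiv ℝ h.primitive x w = _ := congrArg (fun L : Phase n →L[ℝ] ℝ => L w) h7
    rw [h8]
    simp [evalAt, ← hu]
    ring
  have h6 : x.2 = y.2 + a y := (h.source_symm_snd x).symm
  rw [h3, h4, h5, h6, ← h2, map_add, add_apply]
  ring

end IsGenerating
end Generating

/-! ## Gluing with the identity -/

section Glue
variable {n : ℕ} {X : Type u} [TopologicalSpace X]
  [ChartedSpace (EuclideanSpace ℝ (Fin n)) X] [IsManifold (𝓡 n) ∞ X]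

/-- If `e x` were outside `s`, it would be fixed, and injectivity would put `x` outside as well. So
a map supported over `K` does not leave the chart. -/
theorem Equiv.mapsTo_of_eq_self {α : Type*} (e : α ≃ α) {s : Set α} (h : ∀ x ∉ s, e x = x) {x : α}
    (hx : x ∈ s) : e x ∈ s := by
  by_contra hc
  have h1 := e.injective (h _ hc)
  exact hc (h1.symm ▸ hx)

theorem Equiv.symm_eq_self {α : Type*} (e : α ≃ α) {s : Set α} (h : ∀ x ∉ s, e x = x) {x : α}
    (hx : x ∉ s) : e.symm x = x := by
  rw [Equiv.symm_apply_eq, h x hx]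

open Classical in
/-- A map given in the chart at `x₀`, extended by the identity. -/
def glueFun (x₀ : X) (K : Set (Vec n)) (e : Phase n → Phase n) (z : CotangentBundle n X) :
    CotangentBundle n X :=
  if z.1 ∈ (chartAt (Vec n) x₀).source ∧ chartAt (Vec n) x₀ z.1 ∈ K then
    ofCoords x₀ (e (covectorChart x₀ z)) else z

variable {x₀ : X} {K : Set (Vec n)}

theorem glueFun_of_mem_source {e : Phase n → Phase n} (he : ∀ x, x.1 ∉ K → e x = x)
    {z : CotangentBundle n X} (hz : z.1 ∈ (chartAt (Vec n) x₀).source) :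
    glueFun x₀ K e z = ofCoords x₀ (e (covectorChart x₀ z)) := by
  by_cases h : chartAt (Vec n) x₀ z.1 ∈ K
  · exact if_pos ⟨hz, h⟩
  · rw [glueFun, if_neg fun h' => h h'.2, he _ h, ofCoords_covectorChart x₀ hz]

theorem glueFun_of_notMem {e : Phase n → Phase n}
    {z : CotangentBundle n X} (hz : z.1 ∉ (chartAt (Vec n) x₀).symm '' K) :
    glueFun x₀ K e z = z := by
  refine if_neg fun h => hz ⟨_, h.2, (chartAt (Vec n) x₀).left_inv h.1⟩

theorem mem_source_of_mem_image (hK : K ⊆ (chartAt (Vec n) x₀).target) {x : X}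
    (hx : x ∈ (chartAt (Vec n) x₀).symm '' K) : x ∈ (chartAt (Vec n) x₀).source := by
  obtain ⟨y, hy, rfl⟩ := hx
  exact (chartAt (Vec n) x₀).map_target (hK hy)

theorem fst_mem_target (hK : K ⊆ (chartAt (Vec n) x₀).target) {e : Phase n ≃ Phase n}
    (he : ∀ x, x.1 ∉ K → e x = x) {x : Phase n} (hx : x.1 ∈ (chartAt (Vec n) x₀).target) :
    (e x).1 ∈ (chartAt (Vec n) x₀).target := by
  by_cases h : x.1 ∈ K
  · exact hK (Equiv.mapsTo_of_eq_self e (s := {x | x.1 ∈ K}) he h)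
  · rwa [he x h]

theorem glueFun_glueFun (hK : K ⊆ (chartAt (Vec n) x₀).target) {e : Phase n ≃ Phase n}
    (he : ∀ x, x.1 ∉ K → e x = x) {e' : Phase n ≃ Phase n} (he' : ∀ x, e' (e x) = x)
    (z : CotangentBundle n X) : glueFun x₀ K e' (glueFun x₀ K e z) = z := by
  by_cases hz : z.1 ∈ (chartAt (Vec n) x₀).source
  · have h1 : (e (covectorChart x₀ z)).1 ∈ (chartAt (Vec n) x₀).target :=
      fst_mem_target hK he ((chartAt (Vec n) x₀).map_source hz)
    have he'' : ∀ x : Phase n, x.1 ∉ K → e' x = x := fun x hx => by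
      conv_lhs => rw [← he x hx]
      exact he' x
    rw [glueFun_of_mem_source he hz, glueFun_of_mem_source he''
      (z := ofCoords x₀ (e (covectorChart x₀ z))) ((chartAt (Vec n) x₀).map_target h1),
      covectorChart_ofCoords x₀ h1, he', ofCoords_covectorChart x₀ hz]
  · have h1 : z.1 ∉ (chartAt (Vec n) x₀).symm '' K := fun h => hz (mem_source_of_mem_image hK h)
    rw [glueFun_of_notMem h1, glueFun_of_notMem h1]

/-- A bijection given in the chart at `x₀`, extended by the identity. -/
def glue (x₀ : X) (hK : K ⊆ (chartAt (Vec n) x₀).target) (e : Phase n ≃ Phase n)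
    (he : ∀ x, x.1 ∉ K → e x = x) : CotangentBundle n X ≃ CotangentBundle n X where
  toFun := glueFun x₀ K e
  invFun := glueFun x₀ K e.symm
  left_inv := glueFun_glueFun hK he e.symm_apply_apply
  right_inv := glueFun_glueFun hK (fun _ hx => Equiv.symm_eq_self e (s := {x | x.1 ∈ K}) he hx)
    e.apply_symm_apply

theorem isClosed_image_symm [T2Space X] (hKc : IsCompact K) (hK : K ⊆ (chartAt (Vec n) x₀).target) :
    IsClosed ((chartAt (Vec n) x₀).symm '' K) :=
  (hKc.image_of_continuousOn ((chartAt (Vec n) x₀).continuousOn_symm.mono hK)).isClosed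

theorem glueFun_eventually_eq_id [T2Space X] (hKc : IsCompact K)
    (hK : K ⊆ (chartAt (Vec n) x₀).target) (e : Phase n → Phase n) {z : CotangentBundle n X}
    (hz : z.1 ∉ (chartAt (Vec n) x₀).symm '' K) : glueFun x₀ K e =ᶠ[𝓝 z] id :=
  (eventually_proj_mem (isClosed_image_symm hKc hK).isOpen_compl hz).mono
    fun _ hw => glueFun_of_notMem hw

theorem glueFun_eventually_eq {e : Phase n → Phase n} (he : ∀ x, x.1 ∉ K → e x = x)
    {z : CotangentBundle n X} (hz : z.1 ∈ (chartAt (Vec n) x₀).source) :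
    glueFun x₀ K e =ᶠ[𝓝 z] ofCoords x₀ ∘ e ∘ covectorChart x₀ :=
  (eventually_proj_mem (chartAt (Vec n) x₀).open_source hz).mono
    fun _ hw => glueFun_of_mem_source he hw

/-- The chart domain and the complement of the image of `K` form an open cover: that image is
compact, hence closed in a Hausdorff space. -/
theorem contMDiffAt_glueFun [T2Space X] (hKc : IsCompact K)
    (hK : K ⊆ (chartAt (Vec n) x₀).target) {e : Phase n ≃ Phase n} (he : ∀ x, x.1 ∉ K → e x = x)
    {z : CotangentBundle n X} (h : z.1 ∈ (chartAt (Vec n) x₀).source →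
      ContDiffAt ℝ ∞ e (covectorChart x₀ z)) :
    ContMDiffAt (cotangentModel n) (cotangentModel n) ∞ (glueFun x₀ K e) z := by
  by_cases hz : z.1 ∈ (chartAt (Vec n) x₀).source
  · refine ContMDiffAt.congr_of_eventuallyEq ?_ (glueFun_eventually_eq he hz)
    have h1 : (e (covectorChart x₀ z)).1 ∈ (chartAt (Vec n) x₀).target :=
      fst_mem_target hK he ((chartAt (Vec n) x₀).map_source hz)
    exact (contMDiffAt_ofCoords x₀ h1).comp z
      ((h hz).contMDiffAt.comp z (contMDiffAt_covectorChart x₀ hz))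
  · exact contMDiffAt_id.congr_of_eventuallyEq
      (glueFun_eventually_eq_id hKc hK e fun h => hz (mem_source_of_mem_image hK h))

theorem liouvilleForm_congr {z z' : CotangentBundle n X} (h : z = z') (v : Vec n × Covec n) :
    (show Vec n × Covec n →L[ℝ] ℝ from liouvilleForm n X z) v =
      (show Vec n × Covec n →L[ℝ] ℝ from liouvilleForm n X z') v := by
  subst h
  rfl

theorem pullback_glueFun_of_notMem [T2Space X] (hKc : IsCompact K)
    (hK : K ⊆ (chartAt (Vec n) x₀).target) (e : Phase n → Phase n) {z : CotangentBundle n X}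
    (hz : z.1 ∉ (chartAt (Vec n) x₀).symm '' K) :
    OneForm.pullback (I := cotangentModel n) (glueFun x₀ K e) (liouvilleForm n X) z =
      liouvilleForm n X z := by
  have h1 := glueFun_eventually_eq_id hKc hK e hz
  refine ContinuousLinearMap.ext fun v => ?_
  have h2 := h1.mfderiv_eq (I := cotangentModel n) (I' := cotangentModel n)
  have h3 : (show Vec n × Covec n →L[ℝ] Vec n × Covec n from
      mfderiv (cotangentModel n) (cotangentModel n) (glueFun x₀ K e) z) v = v :=
    congrArg (fun L : Vec n × Covec n →L[ℝ] Vec n × Covec n => L v) (h2.trans mfderiv_id)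
  refine (congrArg (show Vec n × Covec n →L[ℝ] ℝ from
    liouvilleForm n X (glueFun x₀ K e z)) h3).trans ?_
  exact liouvilleForm_congr h1.self_of_nhds v

theorem pullback_glueFun (hK : K ⊆ (chartAt (Vec n) x₀).target) {e : Phase n ≃ Phase n}
    (he : ∀ x, x.1 ∉ K → e x = x) {z : CotangentBundle n X}
    (hz : z.1 ∈ (chartAt (Vec n) x₀).source) (h : ContDiffAt ℝ ∞ e (covectorChart x₀ z))
    (v : Vec n × Covec n) :
    OneForm.pullback (I := cotangentModel n) (glueFun x₀ K e) (liouvilleForm n X) z v =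
      (e (covectorChart x₀ z)).2 (fderiv ℝ e (covectorChart x₀ z) (show Vec n × Covec n from
        mfderiv (cotangentModel n) 𝓘(ℝ, Vec n × Covec n) (covectorChart x₀) z v)).1 := by
  have h1 : (e (covectorChart x₀ z)).1 ∈ (chartAt (Vec n) x₀).target :=
    fst_mem_target hK he ((chartAt (Vec n) x₀).map_source hz)
  have h2 := mfderiv_comp z (I'' := 𝓘(ℝ, Vec n × Covec n)) (g := e)
    (h.contMDiffAt.mdifferentiableAt (by simp))
    ((contMDiffAt_covectorChart x₀ hz).mdifferentiableAt (by simp))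
  have h3 := mfderiv_comp z (I'' := cotangentModel n) (g := ofCoords x₀) (f := e ∘ covectorChart x₀)
    ((contMDiffAt_ofCoords x₀ h1).mdifferentiableAt (by simp))
    ((h.contMDiffAt.comp z (contMDiffAt_covectorChart x₀ hz)).mdifferentiableAt (by simp))
  have h4 := glueFun_eventually_eq he hz
  rw [h2, mfderiv_eq_fderiv] at h3
  have h5 := (h4.mfderiv_eq (I := cotangentModel n) (I' := cotangentModel n)).trans h3
  have h6 := liouvilleForm_ofCoords x₀ h1 (fderiv ℝ e (covectorChart x₀ z)
    (show Vec n × Covec n from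
        mfderiv (cotangentModel n) 𝓘(ℝ, Vec n × Covec n) (covectorChart x₀) z v))
  refine Eq.trans ?_ h6
  refine (congrArg (fun L : Vec n × Covec n →L[ℝ] Vec n × Covec n => (show Vec n × Covec n →L[ℝ] ℝ
    from liouvilleForm n X (glueFun x₀ K e z)) (L v)) h5).trans ?_
  exact liouvilleForm_congr h4.self_of_nhds _

end Glue

/-! ## Global symplectomorphisms from local generating functions -/

section GlobalGenerating
variable {n : ℕ} {X : Type u} [TopologicalSpace X]
  [ChartedSpace (EuclideanSpace ℝ (Fin n)) X] [IsManifold (𝓡 n) ∞ X]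

/-- Every closed 1-form of `X` has a primitive on `N`. -/
def HasPrimitives (N : Set X) : Prop :=
  ∀ η : closedForms (𝓡 n) X, ∃ h : X → ℝ, ∀ x ∈ N, ContMDiffAt (𝓡 n) 𝓘(ℝ, ℝ) ∞ h x ∧
    mfderiv (𝓡 n) 𝓘(ℝ, ℝ) h x = η.1 x

variable {x₀ : X} {K : Set (Vec n)} {O : Set (Covec n)} {σ : Phase n → ℝ} {a : Phase n → Covec n}
  {b : Phase n → Vec n}

theorem coords_zero {z : CotangentBundle n X} (hz : z.2 = 0) : coords x₀ z = 0 := by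
  rw [show z = ⟨z.1, 0⟩ from by rw [← hz]]
  rfl

theorem ofCoords_smul (x₀ : X) (x : Phase n) (c : ℝ) :
    ofCoords x₀ (x.1, c • x.2) = dilate c (ofCoords x₀ x) := rfl

theorem covectorChart_dilate (x₀ : X) (z : CotangentBundle n X) (c : ℝ) :
    covectorChart x₀ (dilate c z) = ((covectorChart x₀ z).1, c • (covectorChart x₀ z).2) := rfl

namespace IsGenerating

theorem glueFun_of_zero (h : IsGenerating K O σ a b) {z : CotangentBundle n X} (hz : z.2 = 0) :
    glueFun x₀ K h.toEquiv z = z := by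
  by_cases hs : z.1 ∈ (chartAt (Vec n) x₀).source ∧ chartAt (Vec n) x₀ z.1 ∈ K
  · rw [glueFun_of_mem_source (fun x hx => h.toEquiv_of_notMem hx) hs.1,
      h.toEquiv_of_zero (coords_zero hz), ofCoords_covectorChart x₀ hs.1]
  · exact if_neg hs

theorem glueFun_fst_mem (h : IsGenerating K O σ a b) (hK : K ⊆ (chartAt (Vec n) x₀).target)
    {z : CotangentBundle n X} (hz : z.1 ∈ (chartAt (Vec n) x₀).symm '' K) :
    (glueFun x₀ K h.toEquiv z).1 ∈ (chartAt (Vec n) x₀).symm '' K := by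
  have hs := mem_source_of_mem_image hK hz
  rw [glueFun_of_mem_source (fun x hx => h.toEquiv_of_notMem hx) hs]
  refine ⟨_, Equiv.mapsTo_of_eq_self h.toEquiv (s := {x | x.1 ∈ K})
    (fun x hx => h.toEquiv_of_notMem hx) ?_, rfl⟩
  obtain ⟨y, hy, hyz⟩ := hz
  change chartAt (Vec n) x₀ z.1 ∈ K
  rwa [← hyz, (chartAt (Vec n) x₀).right_inv (hK hy)]

variable [T2Space X]

theorem notMem_of_glueFun (e : Phase n ≃ Phase n) (he : ∀ x, x.1 ∉ K → e x = x) :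
    ∀ x : Phase n, x.1 ∉ K → e.symm x = x :=
  fun _ hx => Equiv.symm_eq_self e (s := {x | x.1 ∈ K}) he hx

/-- The diffeomorphism of `T^*X` given by a generating function. -/
def toDiffeomorph (h : IsGenerating K univ σ a b) (hKc : IsCompact K)
    (hK : K ⊆ (chartAt (Vec n) x₀).target) :
    CotangentBundle n X ≃ₘ⟮cotangentModel n, cotangentModel n⟯ CotangentBundle n X where
  toEquiv := glue x₀ hK h.toEquiv fun _ hx => h.toEquiv_of_notMem hx
  contMDiff_toFun _ := contMDiffAt_glueFun hKc hK (fun _ hx => h.toEquiv_of_notMem hx)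
    fun _ => h.contDiffAt_toEquiv (mem_univ _)
  contMDiff_invFun _ := contMDiffAt_glueFun hKc hK
    (notMem_of_glueFun _ fun _ hx => h.toEquiv_of_notMem hx)
    fun _ => h.contDiffAt_toEquiv_symm (mem_univ _)

theorem pullback_glueFun_eq (h : IsGenerating K O σ a b)
    (hK : K ⊆ (chartAt (Vec n) x₀).target) {z : CotangentBundle n X}
    (hz : z.1 ∈ (chartAt (Vec n) x₀).source) (hO : coords x₀ z ∈ O) (v : Vec n × Covec n) :
    OneForm.pullback (I := cotangentModel n) (glueFun x₀ K h.toEquiv) (liouvilleForm n X) z v =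
      (show Vec n × Covec n →L[ℝ] ℝ from liouvilleForm n X z) v +
        fderiv ℝ h.primitive (covectorChart x₀ z) (show Vec n × Covec n from
        mfderiv (cotangentModel n) 𝓘(ℝ, Vec n × Covec n) (covectorChart x₀) z v) := by
  refine (pullback_glueFun hK (fun _ hx => h.toEquiv_of_notMem hx) hz
    (h.contDiffAt_toEquiv hO) v).trans ?_
  refine (h.liouville hO _).trans ?_
  exact congrArg (· + _) (liouvilleForm_eq x₀ hz v).symm

open Classical in
theorem exists_primitive (h : IsGenerating K univ σ a b) (hKc : IsCompact K)
    (hK : K ⊆ (chartAt (Vec n) x₀).target) :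
    ∃ F : CotangentBundle n X → ℝ, ContMDiff (cotangentModel n) 𝓘(ℝ, ℝ) ∞ F ∧
      OneForm.pullback (glueFun x₀ K h.toEquiv) (liouvilleForm n X) =
        liouvilleForm n X + OneForm.differential F := by
  let F : CotangentBundle n X → ℝ := fun z =>
    if z.1 ∈ (chartAt (Vec n) x₀).source then h.primitive (covectorChart x₀ z) else 0
  have h1 : ∀ z : CotangentBundle n X, z.1 ∈ (chartAt (Vec n) x₀).source →
      F =ᶠ[𝓝 z] h.primitive ∘ covectorChart x₀ := fun z hz => by
    filter_upwards [eventually_proj_mem (chartAt (Vec n) x₀).open_source hz] with w hw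
      using if_pos hw
  have h2 : ∀ z : CotangentBundle n X, z.1 ∉ (chartAt (Vec n) x₀).source →
      F =ᶠ[𝓝 z] fun _ => 0 := fun z hz => by
    have hz' : z.1 ∉ (chartAt (Vec n) x₀).symm '' K := fun h => hz (mem_source_of_mem_image hK h)
    filter_upwards [eventually_proj_mem (isClosed_image_symm hKc hK).isOpen_compl hz'] with w hw
    by_cases hs : w.1 ∈ (chartAt (Vec n) x₀).source
    · refine (if_pos hs).trans (h.primitive_of_notMem fun hk => hw ?_)
      exact ⟨_, hk, (chartAt (Vec n) x₀).left_inv hs⟩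
    · exact if_neg hs
  refine ⟨F, fun z => ?_, ?_⟩
  · by_cases hz : z.1 ∈ (chartAt (Vec n) x₀).source
    · refine ContMDiffAt.congr_of_eventuallyEq ?_ (h1 z hz)
      exact (h.contDiffAt_primitive (mem_univ _)).contMDiffAt.comp z
        (contMDiffAt_covectorChart x₀ hz)
    · exact contMDiffAt_const.congr_of_eventuallyEq (h2 z hz)
  · funext z
    refine ContinuousLinearMap.ext fun v => ?_
    by_cases hz : z.1 ∈ (chartAt (Vec n) x₀).source
    · refine (h.pullback_glueFun_eq hK hz (mem_univ _) v).trans ?_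
      have h3 := mfderiv_comp z (I'' := 𝓘(ℝ, ℝ)) (g := h.primitive)
        ((h.contDiffAt_primitive (mem_univ _)).contMDiffAt.mdifferentiableAt (by simp))
        ((contMDiffAt_covectorChart x₀ hz).mdifferentiableAt (by simp))
      rw [mfderiv_eq_fderiv] at h3
      have h4 := ((h1 z hz).mfderiv_eq (I := cotangentModel n) (I' := 𝓘(ℝ, ℝ))).trans h3
      exact congrArg (fun L : Vec n × Covec n →L[ℝ] ℝ =>
        (show Vec n × Covec n →L[ℝ] ℝ from liouvilleForm n X z) v + L v) h4.symm
    · have hz' : z.1 ∉ (chartAt (Vec n) x₀).symm '' K := fun h => hz (mem_source_of_mem_image hK h)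
      have h3 := ((h2 z hz).mfderiv_eq (I := cotangentModel n) (I' := 𝓘(ℝ, ℝ))).trans mfderiv_const
      refine (congrArg (fun L : Vec n × Covec n →L[ℝ] ℝ => L v)
        (pullback_glueFun_of_notMem hKc hK h.toEquiv hz')).trans ?_
      refine Eq.trans ?_ (congrArg (fun L : Vec n × Covec n →L[ℝ] ℝ =>
        (show Vec n × Covec n →L[ℝ] ℝ from liouvilleForm n X z) v + L v) h3.symm)
      exact (add_zero _).symm

/-- Base points move only over the image of `K` and stay in `N`, where η has a primitive p. So p ∘
g₁ - p ∘ g₂ is a global primitive of g₁^*η - g₂^*η. -/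
theorem map_glueFun_eq (h : IsGenerating K univ σ a b) (hKc : IsCompact K)
    (hK : K ⊆ (chartAt (Vec n) x₀).target) {N : Set X} (hNp : HasPrimitives (n := n) N)
    (hKN : (chartAt (Vec n) x₀).symm '' K ⊆ N)
    (g : C^∞⟮𝓡 n, X; cotangentModel n, CotangentBundle n X⟯) (c : DeRhamH1 (𝓡 n) X) :
    DeRhamH1.map ((cotangentProj n X).comp ((h.toDiffeomorph hKc hK).toContMDiffMap.comp g)) c =
      DeRhamH1.map ((cotangentProj n X).comp g) c := by
  induction c using Submodule.Quotient.induction_on with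
  | H η =>
  obtain ⟨p, hp⟩ := hNp η
  set g₁ := (cotangentProj n X).comp ((h.toDiffeomorph hKc hK).toContMDiffMap.comp g) with hg₁
  set g₂ := (cotangentProj n X).comp g with hg₂
  have h1 : ∀ x, g₂ x ∉ (chartAt (Vec n) x₀).symm '' K → g₁ x = g₂ x := fun x hx =>
    congrArg (fun z : CotangentBundle n X => z.1) (glueFun_of_notMem (e := h.toEquiv) hx)
  have h2 : ∀ x, g₂ x ∈ N → g₁ x ∈ N := by
    intro x hx
    by_cases hk : g₂ x ∈ (chartAt (Vec n) x₀).symm '' K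
    · exact hKN (h.glueFun_fst_mem hK hk)
    · rwa [h1 x hk]
  have h3 : ∀ x, g₂ x ∉ N → ∀ᶠ y in 𝓝 x, g₁ y = g₂ y := by
    intro x hx
    have := g₂.contMDiff.continuous.continuousAt.eventually_mem
      ((isClosed_image_symm hKc hK).isOpen_compl.mem_nhds fun hk => hx (hKN hk))
    exact this.mono h1
  have hd : ∀ x, g₂ x ∈ N → ContMDiffAt (𝓡 n) 𝓘(ℝ, ℝ) ∞ (p ∘ g₁) x ∧
      ContMDiffAt (𝓡 n) 𝓘(ℝ, ℝ) ∞ (p ∘ g₂) x := fun x hx =>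
    ⟨(hp _ (h2 x hx)).1.comp x (g₁.contMDiff x), (hp _ hx).1.comp x (g₂.contMDiff x)⟩
  -- Outside `N` nothing is known about p, but there g₁ and g₂ agree locally and the difference
  -- vanishes whatever p is.
  have hz : ∀ x, g₂ x ∉ N → (p ∘ g₁ - p ∘ g₂) =ᶠ[𝓝 x] fun _ => (0 : ℝ) := by
    intro x hx
    filter_upwards [h3 x hx] with y hy
    simp [hy]
  refine DeRhamH1.map_mk_eq (p ∘ g₁ - p ∘ g₂) (fun x => ?_) fun x => ?_
  · by_cases hx : g₂ x ∈ N
    · exact (hd x hx).1.sub (hd x hx).2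
    · exact contMDiffAt_const.congr_of_eventuallyEq (hz x hx)
  · by_cases hx : g₂ x ∈ N
    · have h4 := mfderiv_sub (I := 𝓡 n) ((hd x hx).1.mdifferentiableAt (by simp))
        ((hd x hx).2.mdifferentiableAt (by simp))
      refine h4.trans ?_
      have h5 := mfderiv_comp x ((hp _ (h2 x hx)).1.mdifferentiableAt (by simp))
        ((g₁.contMDiff x).mdifferentiableAt (by simp))
      have h6 := mfderiv_comp x ((hp _ hx).1.mdifferentiableAt (by simp))
        ((g₂.contMDiff x).mdifferentiableAt (by simp))
      rw [(hp _ (h2 x hx)).2] at h5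
      rw [(hp _ hx).2] at h6
      exact congrArg₂ (fun L L' : Vec n →L[ℝ] ℝ => L - L') h5 h6
    · have h4 : (g₁ : X → X) =ᶠ[𝓝 x] g₂ := h3 x hx
      have h5 : (OneForm.pullback (I := 𝓡 n) g₁ η.1 x : Vec n →L[ℝ] ℝ) =
          OneForm.pullback (I := 𝓡 n) g₂ η.1 x := by
        have h6 : ∀ {a b : X} (_ : a = b) (L L' : Vec n →L[ℝ] Vec n) (_ : L = L'),
            ContinuousLinearMap.comp (show Vec n →L[ℝ] ℝ from η.1 a) L =
            ContinuousLinearMap.comp (show Vec n →L[ℝ] ℝ from η.1 b) L' := by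
          rintro a _ rfl L _ rfl
          rfl
        exact h6 h4.self_of_nhds _ _ h4.mfderiv_eq
      refine ((hz x hx).mfderiv_eq.trans mfderiv_const).trans ?_
      exact (sub_eq_zero (G := Vec n →L[ℝ] ℝ).2 h5).symm

theorem isExactSymplectic (h : IsGenerating K univ σ a b) (hKc : IsCompact K)
    (hK : K ⊆ (chartAt (Vec n) x₀).target) {N : Set X} (hNp : HasPrimitives (n := n) N)
    (hKN : (chartAt (Vec n) x₀).symm '' K ⊆ N) :
    IsExactSymplectic (h.toDiffeomorph hKc hK) (LinearEquiv.refl ℝ (DeRhamH1 (𝓡 n) X)) := by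
  refine ⟨h.exists_primitive hKc hK, fun z => ⟨fun hz => ?_, fun hz => ?_⟩,
    fun g c => h.map_glueFun_eq hKc hK hNp hKN g c⟩
  · have h1 : (h.toDiffeomorph hKc hK) ((h.toDiffeomorph hKc hK) z) =
        (h.toDiffeomorph hKc hK) z := h.glueFun_of_zero hz
    rwa [(h.toDiffeomorph hKc hK).injective h1] at hz
  · have h1 : (h.toDiffeomorph hKc hK) z = z := h.glueFun_of_zero hz
    rwa [h1]

theorem shape_image (h : IsGenerating K univ σ a b) (hKc : IsCompact K)
    (hK : K ⊆ (chartAt (Vec n) x₀).target) {N : Set X} (hNp : HasPrimitives (n := n) N)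
    (hKN : (chartAt (Vec n) x₀).symm '' K ⊆ N) (U : Set (CotangentBundle n X)) :
    shape (glueFun x₀ K h.toEquiv '' U) = shape U := by
  have h1 := (h.isExactSymplectic hKc hK hNp hKN).shape_image U
  refine h1.trans ?_
  exact image_id _

theorem toEquiv_smul (h : IsGenerating K O σ a b)
    (ha : ∀ (x : Phase n) (c : ℝ), 0 < c → a (x.1, c • x.2) = c • a x)
    (hb : ∀ (x : Phase n) (c : ℝ), 0 < c → b (x.1, c • x.2) = b x) (x : Phase n) {c : ℝ}
    (hc : 0 < c) : h.toEquiv (x.1, c • x.2) = ((h.toEquiv x).1, c • (h.toEquiv x).2) := by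
  obtain ⟨y, rfl⟩ := h.source.surjective x
  rw [h.toEquiv_source, h.source_apply, h.target_apply]
  have h1 := h.toEquiv_apply (y.1, c • y.2)
  rw [ha y c hc, hb y c hc] at h1
  simpa only [smul_add] using h1

/-- The homogeneous symplectomorphism given by a homogeneous generating function. -/
def toConicSymplecto (h : IsGenerating K {0}ᶜ σ a b) (hKc : IsCompact K)
    (hK : K ⊆ (chartAt (Vec n) x₀).target) (hσ : ∀ x : Phase n, σ x = x.2 (b x))
    (ha : ∀ (x : Phase n) (c : ℝ), 0 < c → a (x.1, c • x.2) = c • a x)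
    (hb : ∀ (x : Phase n) (c : ℝ), 0 < c → b (x.1, c • x.2) = b x) : ConicSymplecto n X where
  toEquiv := glue x₀ hK h.toEquiv fun _ hx => h.toEquiv_of_notMem hx
  map_zero _ hz := h.glueFun_of_zero hz
  map_dilate z c hc hz := by
    change glueFun x₀ K h.toEquiv _ = dilate c (glueFun x₀ K h.toEquiv z)
    by_cases hs : z.1 ∈ (chartAt (Vec n) x₀).source
    · rw [glueFun_of_mem_source (fun _ hx => h.toEquiv_of_notMem hx) hs,
        glueFun_of_mem_source (z := dilate c z) (fun _ hx => h.toEquiv_of_notMem hx) hs,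
        covectorChart_dilate, h.toEquiv_smul ha hb _ hc, ofCoords_smul]
    · rw [glueFun, if_neg fun hh => hs hh.1, glueFun, if_neg fun hh => hs hh.1]
  smooth z hz := contMDiffAt_glueFun hKc hK (fun _ hx => h.toEquiv_of_notMem hx)
    fun hs => h.contDiffAt_toEquiv (coords_ne_zero hs hz)
  smooth_symm z hz := contMDiffAt_glueFun hKc hK
    (notMem_of_glueFun _ fun _ hx => h.toEquiv_of_notMem hx)
    fun hs => h.contDiffAt_toEquiv_symm (coords_ne_zero hs hz)
  liouville z hz := by
    by_cases hs : z.1 ∈ (chartAt (Vec n) x₀).source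
    · refine ContinuousLinearMap.ext fun v => ?_
      refine (h.pullback_glueFun_eq hK hs (coords_ne_zero hs hz) v).trans ?_
      -- For σ = P(b), which is Euler's relation for degree one, the primitive P(b) - σ is zero, so
      -- p dq is preserved exactly and not only up to an exact form.
      have h1 : h.primitive = fun _ => 0 := by
        funext x
        rw [primitive, hσ, sub_self]
      rw [h1]
      refine Eq.trans ?_ (add_zero _)
      congr 1
      rw [fderiv_fun_const]
      rfl
    · exact pullback_glueFun_of_notMem hKc hK h.toEquiv
        fun hk => hs (mem_source_of_mem_image hK hk)

end IsGenerating
end GlobalGenerating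

/-! ## Truncation of homogeneous generating functions -/

section Truncation
variable {n : ℕ}

/-- Functionals on covectors are evaluations. -/
theorem exists_evalAt_inverse (n : ℕ) :
    ∃ J : (Covec n →L[ℝ] ℝ) →L[ℝ] Vec n, ∀ ℓ, evalAt (J ℓ) = ℓ := by
  let p : Fin n → Covec n := fun i => EuclideanSpace.proj i
  let J : (Covec n →L[ℝ] ℝ) →L[ℝ] Vec n :=
    ∑ i, (ContinuousLinearMap.apply ℝ ℝ (p i)).smulRight (EuclideanSpace.single i (1 : ℝ))
  refine ⟨J, fun ℓ => ContinuousLinearMap.ext fun P => ?_⟩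
  have h1 : J ℓ = ∑ i, ℓ (p i) • EuclideanSpace.single i (1 : ℝ) := by
    simp [J]
  have h2 : P = ∑ i, P (EuclideanSpace.single i (1 : ℝ)) • p i := by
    refine ContinuousLinearMap.ext fun v => ?_
    have h3 : v = ∑ i, v i • EuclideanSpace.single i (1 : ℝ) := by
      have := (EuclideanSpace.basisFun (Fin n) ℝ).sum_repr v
      simpa using this.symm
    conv_lhs => rw [h3]
    simp [p, mul_comm]
  rw [evalAt_apply, h1, map_sum]
  conv_rhs => rw [h2, map_sum]
  refine Finset.sum_congr rfl fun i _ => ?_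
  rw [map_smul, map_smul, smul_eq_mul, smul_eq_mul, mul_comm]

/-- `ρ` is a smooth function of the covectors with gradient `v` that vanishes for `‖P‖ < ε`, is `1`
for `2 ε < ‖P‖`, and has derivatives of size `C / ε`. -/
structure IsCutoff (C ε : ℝ) (ρ : Covec n → ℝ) (v : Covec n → Vec n) : Prop where
  smooth : ContDiff ℝ ∞ ρ
  smooth_grad : ContDiff ℝ ∞ v
  hasFDerivAt : ∀ P, HasFDerivAt ρ (evalAt (v P)) P
  nonneg : ∀ P, 0 ≤ ρ P
  le_one : ∀ P, ρ P ≤ 1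
  eq_zero : ∀ P, ‖P‖ < ε → ρ P = 0 ∧ v P = 0
  eq_one : ∀ P, 2 * ε < ‖P‖ → ρ P = 1 ∧ v P = 0
  lipschitz : ∀ P P', |ρ P - ρ P'| ≤ C / ε * ‖P - P'‖
  norm_grad_le : ∀ P, ‖v P‖ ≤ C / ε

/-- One bump function B is fixed and rescaled to P ↦ 1 - B(P/ε), which divides its Lipschitz
constant by ε. Thus C does not depend on ε. The map J is there to turn differentials on covectors
into vectors. -/
theorem exists_bump {V W : Type} [NormedAddCommGroup V] [NormedSpace ℝ V] [NormedAddCommGroup W]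
    [NormedSpace ℝ W] [FiniteDimensional ℝ W] (J : (W →L[ℝ] ℝ) →L[ℝ] V) :
    ∃ C : ℝ, 0 ≤ C ∧ ∀ ε > 0, ∃ ρ : W → ℝ, ContDiff ℝ ∞ ρ ∧ (∀ P, 0 ≤ ρ P ∧ ρ P ≤ 1) ∧
      (∀ P, ‖P‖ < ε → ρ P = 0 ∧ fderiv ℝ ρ P = 0) ∧
      (∀ P, 2 * ε < ‖P‖ → ρ P = 1 ∧ fderiv ℝ ρ P = 0) ∧
      (∀ P P', |ρ P - ρ P'| ≤ C / ε * ‖P - P'‖) ∧ ∀ P, ‖J (fderiv ℝ ρ P)‖ ≤ C / ε := by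
  let B : ContDiffBump (0 : W) := ⟨1, 2, one_pos, one_lt_two⟩
  have hB : ContDiff ℝ ∞ B := B.contDiff
  obtain ⟨c, hc⟩ := hB.lipschitzWith_of_hasCompactSupport B.hasCompactSupport (by simp)
  refine ⟨max c (‖J‖ * c), le_max_of_le_left c.2, fun ε hε => ?_⟩
  set C := max (c : ℝ) (‖J‖ * c)
  have hs : ∀ P : W, ‖ε⁻¹ • P‖ = ‖P‖ / ε := fun P => by
    rw [norm_smul, Real.norm_of_nonneg (by positivity), div_eq_inv_mul]
  have hρ : ContDiff ℝ ∞ fun P : W => 1 - B (ε⁻¹ • P) :=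
    contDiff_const.sub (hB.comp (contDiff_id.const_smul _))
  have hlip : ∀ P P' : W, |(1 - B (ε⁻¹ • P)) - (1 - B (ε⁻¹ • P'))| ≤ c / ε * ‖P - P'‖ := by
    intro P P'
    have h1 := hc.dist_le_mul (ε⁻¹ • P') (ε⁻¹ • P)
    rw [Real.dist_eq, dist_eq_norm, ← smul_sub, norm_smul, Real.norm_of_nonneg (by positivity),
      norm_sub_rev, ← mul_assoc, ← div_eq_mul_inv] at h1
    rwa [sub_sub_sub_cancel_left]
  have hgrad : ∀ P : W, ‖fderiv ℝ (fun P : W => 1 - B (ε⁻¹ • P)) P‖ ≤ c / ε := by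
    intro P
    have h1 : LipschitzWith (c / ⟨ε, hε.le⟩) fun P : W => 1 - B (ε⁻¹ • P) :=
      LipschitzWith.of_dist_le_mul fun P P' => by
        rw [Real.dist_eq, dist_eq_norm]
        exact hlip P P'
    exact norm_fderiv_le_of_lipschitz ℝ h1
  refine ⟨fun P => 1 - B (ε⁻¹ • P), hρ, fun P => ⟨sub_nonneg.2 B.le_one,
    sub_le_self _ B.nonneg⟩, fun P hP => ?_, fun P hP => ?_, fun P P' => ?_, fun P => ?_⟩
  · have h1 : (fun P : W => 1 - B (ε⁻¹ • P)) =ᶠ[𝓝 P] fun _ => 0 := by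
      filter_upwards [(isOpen_lt continuous_norm continuous_const).mem_nhds hP] with Q hQ
      rw [B.one_of_mem_closedBall, sub_self]
      rw [mem_closedBall_zero_iff, hs]
      exact ((div_lt_one hε).2 hQ).le
    exact ⟨h1.self_of_nhds, by rw [h1.fderiv_eq, fderiv_fun_const]; rfl⟩
  · have h1 : (fun P : W => 1 - B (ε⁻¹ • P)) =ᶠ[𝓝 P] fun _ => 1 := by
      filter_upwards [(isOpen_lt continuous_const continuous_norm).mem_nhds hP] with Q hQ
      rw [B.zero_of_le_dist, sub_zero]
      rw [dist_zero_right, hs]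
      exact ((lt_div_iff₀ hε).2 hQ).le
    exact ⟨h1.self_of_nhds, by rw [h1.fderiv_eq, fderiv_fun_const]; rfl⟩
  · refine (hlip P P').trans ?_
    gcongr
    exact le_max_left _ _
  · refine (J.le_opNorm _).trans ((mul_le_mul_of_nonneg_left (hgrad P) (norm_nonneg _)).trans ?_)
    rw [← mul_div_assoc]
    gcongr
    exact le_max_right _ _

set_option synthInstance.maxHeartbeats 200000 in
theorem exists_isCutoff (n : ℕ) : ∃ C : ℝ, 0 ≤ C ∧ ∀ ε > 0,
    ∃ (ρ : Covec n → ℝ) (v : Covec n → Vec n), IsCutoff C ε ρ v := by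
  obtain ⟨J, hJ⟩ := exists_evalAt_inverse n
  obtain ⟨C, hC, h⟩ := exists_bump J
  refine ⟨C, hC, fun ε hε => ?_⟩
  obtain ⟨ρ, h1, h2, h3, h4, h5, h6⟩ := h ε hε
  refine ⟨ρ, fun P => J (fderiv ℝ ρ P), h1, ?_, fun P => ?_, fun P => (h2 P).1, fun P => (h2 P).2,
    fun P hP => ⟨(h3 P hP).1, ?_⟩, fun P hP => ⟨(h4 P hP).1, ?_⟩, h5, h6⟩
  · exact J.contDiff.comp (h1.fderiv_right (m := ∞) (by simp))
  · rw [hJ]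
    exact (h1.differentiable (by simp) P).hasFDerivAt
  · rw [(h3 P hP).2]
    exact J.map_zero
  · rw [(h4 P hP).2]
    exact J.map_zero

variable {K : Set (Vec n)} {σ : Phase n → ℝ} {a : Phase n → Covec n} {b : Phase n → Vec n}

/-- A generating function that is homogeneous in the covector, cut off near the zero section. -/
theorem IsGenerating.truncate (h : IsGenerating K {0}ᶜ σ a b) (hσ : ∀ x : Phase n, σ x = x.2 (b x))
    {δ C ε : ℝ} (hδ : 0 ≤ δ) (hC : 0 ≤ C) (hε : 0 < ε) (hδC : δ * (1 + 2 * C) ≤ 1 / 2)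
    (ha : ∀ q P P', ‖a (q, P) - a (q, P')‖ ≤ δ * ‖P - P'‖)
    (hb : ∀ q q' P, ‖b (q, P) - b (q', P)‖ ≤ δ * ‖q - q'‖)
    {ρ : Covec n → ℝ} {v : Covec n → Vec n} (hρ : IsCutoff C ε ρ v) :
    IsGenerating K univ (fun x => ρ x.2 * σ x) (fun x => ρ x.2 • a x)
      (fun x => ρ x.2 • b x + σ x • v x.2) := by
  have hzero : ∀ x : Phase n, x.2 = 0 → ∀ᶠ y in 𝓝 x, ρ y.2 = 0 ∧ v y.2 = 0 := fun x hx => by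
    have h1 : {y : Phase n | ‖y.2‖ < ε} ∈ 𝓝 x :=
      (isOpen_lt continuous_snd.norm continuous_const).mem_nhds (by simpa [hx] using hε)
    exact Filter.mem_of_superset h1 fun y hy => hρ.eq_zero _ hy
  have hρ' : ∀ P, ‖ρ P‖ ≤ 1 := fun P => by
    rw [Real.norm_of_nonneg (hρ.nonneg P)]
    exact hρ.le_one P
  have hρs : ContDiff ℝ ∞ fun x : Phase n => ρ x.2 := hρ.smooth.comp contDiff_snd
  have hvs : ContDiff ℝ ∞ fun x : Phase n => v x.2 := hρ.smooth_grad.comp contDiff_snd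
  -- Where the cutoff varies, ‖a‖ is at most 2δε, which compensates the factor C/ε from the cutoff.
  -- The resulting constant δ(1 + 2C) is free of ε. If both momenta exceed 2ε, the cutoff is `1` and
  -- nothing changes.
  have hnear : ∀ q P P', ‖P'‖ ≤ 2 * ε →
      ‖ρ P • a (q, P) - ρ P' • a (q, P')‖ ≤ 1 / 2 * ‖P - P'‖ := by
    intro q P P' hP
    have h1 : ρ P • a (q, P) - ρ P' • a (q, P') =
        ρ P • (a (q, P) - a (q, P')) + (ρ P - ρ P') • a (q, P') := by
      module
    have h2 : ‖a (q, P')‖ ≤ δ * (2 * ε) := by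
      have := ha q P' 0
      rw [h.a_zero, sub_zero, sub_zero] at this
      exact this.trans (mul_le_mul_of_nonneg_left hP hδ)
    rw [h1]
    refine (norm_add_le _ _).trans ?_
    rw [norm_smul, norm_smul]
    calc ‖ρ P‖ * ‖a (q, P) - a (q, P')‖ + ‖ρ P - ρ P'‖ * ‖a (q, P')‖
        ≤ 1 * (δ * ‖P - P'‖) + (C / ε * ‖P - P'‖) * (δ * (2 * ε)) := by
          gcongr
          · exact hρ' P
          · exact ha q P P'
          · exact hρ.lipschitz P P'
      _ = δ * (1 + 2 * C) * ‖P - P'‖ := by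
          field_simp
      _ ≤ _ := mul_le_mul_of_nonneg_right hδC (norm_nonneg _)
  refine ⟨fun q P P' => ?_, fun q q' P => ?_, fun x hx => ?_, fun q => ?_, fun q => ?_,
    fun x _ => ?_, fun x _ => ?_, fun x _ => ?_, fun x _ => ?_, fun x => by simp⟩
  · by_cases hP' : ‖P'‖ ≤ 2 * ε
    · exact hnear q P P' hP'
    by_cases hP : ‖P‖ ≤ 2 * ε
    · rw [norm_sub_rev, norm_sub_rev P]
      exact hnear q P' P hP
    · dsimp only
      rw [(hρ.eq_one P (not_le.1 hP)).1, (hρ.eq_one P' (not_le.1 hP')).1, one_smul, one_smul]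
      exact h.a_le q P P'
  · have h1 : ρ P • b (q, P) + σ (q, P) • v P - (ρ P • b (q', P) + σ (q', P) • v P) =
        ρ P • (b (q, P) - b (q', P)) + (P (b (q, P) - b (q', P))) • v P := by
      rw [hσ, hσ, map_sub]
      module
    -- Because σ = P(b), the new term σ v costs a factor ‖P‖ ‖v‖. This is bounded independently of
    -- ε, as v is at most C/ε and vanishes beyond 2ε.
    have h2 : ‖P‖ * ‖v P‖ ≤ 2 * C := by
      by_cases hP : ‖P‖ ≤ 2 * ε
      · calc ‖P‖ * ‖v P‖ ≤ 2 * ε * (C / ε) := by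
              gcongr
              exact hρ.norm_grad_le P
          _ = 2 * C := by field_simp
      · rw [(hρ.eq_one P (not_le.1 hP)).2, norm_zero, mul_zero]
        positivity
    dsimp only
    rw [h1]
    refine (norm_add_le _ _).trans ?_
    rw [norm_smul, norm_smul]
    calc ‖ρ P‖ * ‖b (q, P) - b (q', P)‖ + ‖P (b (q, P) - b (q', P))‖ * ‖v P‖
        ≤ 1 * ‖b (q, P) - b (q', P)‖ + (‖P‖ * ‖b (q, P) - b (q', P)‖) * ‖v P‖ := by
          gcongr
          · exact hρ' P
          · exact P.le_opNorm _
      _ = ‖b (q, P) - b (q', P)‖ * (1 + ‖P‖ * ‖v P‖) := by ring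
      _ ≤ (δ * ‖q - q'‖) * (1 + 2 * C) := by
          gcongr
          exact hb q q' P
      _ = δ * (1 + 2 * C) * ‖q - q'‖ := by ring
      _ ≤ _ := mul_le_mul_of_nonneg_right hδC (norm_nonneg _)
  · obtain ⟨h1, h2, h3⟩ := h.eq_zero x hx
    simp [h1, h2, h3]
  · simp [h.a_zero]
  · simp [h.b_zero, hσ]
  -- At zero momentum the homogeneous functions need not be smooth, but the cutoff and its gradient
  -- vanish nearby, so the truncated functions are locally zero.
  · by_cases hx : x.2 = 0
    · exact contDiffAt_const.congr_of_eventuallyEq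
        ((hzero x hx).mono fun y hy => show ρ y.2 • a y = 0 by rw [hy.1, zero_smul])
    · exact hρs.contDiffAt.smul (h.smooth_a x hx)
  · by_cases hx : x.2 = 0
    · exact contDiffAt_const.congr_of_eventuallyEq
        ((hzero x hx).mono fun y hy => show ρ y.2 • b y + σ y • v y.2 = 0 by
          rw [hy.1, hy.2, zero_smul, smul_zero, add_zero])
    · exact (hρs.contDiffAt.smul (h.smooth_b x hx)).add ((h.smooth x hx).smul hvs.contDiffAt)
  · by_cases hx : x.2 = 0
    · exact contDiffAt_const.congr_of_eventuallyEq
        ((hzero x hx).mono fun y hy => show ρ y.2 * σ y = 0 by rw [hy.1, zero_mul])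
    · exact hρs.contDiffAt.mul (h.smooth x hx)
  · by_cases hx : x.2 = 0
    · have h1 : HasFDerivAt (fun y : Phase n => ρ y.2 * σ y) (0 : Phase n →L[ℝ] ℝ) x :=
        (hasFDerivAt_const (0 : ℝ) x).congr_of_eventuallyEq
          ((hzero x hx).mono fun y hy => show ρ y.2 * σ y = 0 by rw [hy.1, zero_mul])
      refine h1.congr_fderiv ?_
      obtain ⟨h2, h3⟩ := (hzero x hx).self_of_nhds
      refine ContinuousLinearMap.ext fun w => ?_
      simp [h2, h3, evalAt_apply]
    · have h1 : HasFDerivAt (fun y : Phase n => ρ y.2) _ x :=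
        (hρ.hasFDerivAt x.2).comp x hasFDerivAt_snd
      refine (h1.mul (h.hasFDerivAt x hx)).congr_fderiv ?_
      refine ContinuousLinearMap.ext fun w => ?_
      simp [evalAt_apply]
      ring

end Truncation

/-! ## Homogeneous symplectomorphisms that preserve shapes -/

section ShapeInvariant
variable {n : ℕ} {X : Type u} [TopologicalSpace X]
  [ChartedSpace (EuclideanSpace ℝ (Fin n)) X] [IsManifold (𝓡 n) ∞ X]

/-- `G` preserves the shapes of conic neighbourhoods of the zero section. -/
def ConicSymplecto.IsShapeInvariant (G : ConicSymplecto n X) : Prop :=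
  ∀ U, IsConicNhd U → shape (G.toEquiv '' U) = shape U

theorem ConicSymplecto.IsShapeInvariant.trans {G G' : ConicSymplecto n X} (h : G.IsShapeInvariant)
    (h' : G'.IsShapeInvariant) : (G.trans G').IsShapeInvariant := fun U hU => by
  have h1 : (G.trans G').toEquiv '' U = G'.toEquiv '' (G.toEquiv '' U) := by
    rw [image_image]
    rfl
  rw [h1, h' _ (hU.image G), h U hU]

/-- The complements of U have equal images, hence so does U. This is how a nonsmooth homogeneous map
is traded for a smooth one without changing the image of U. -/
theorem image_eq_image_of_eqOn_compl {α : Type*} (e e' : α ≃ α) {S U : Set α} (hS : S ⊆ U)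
    (h : ∀ x ∉ S, e x = e' x) : e '' U = e' '' U := by
  have h1 : e '' Uᶜ = e' '' Uᶜ := image_congr fun x hx => h x fun hxS => hx (hS hxS)
  rw [Equiv.image_compl, Equiv.image_compl] at h1
  exact compl_injective h1

variable {x₀ : X} {K : Set (Vec n)} {σ : Phase n → ℝ} {a : Phase n → Covec n}
  {b : Phase n → Vec n}

/-- The conic condition is applied to the compact set of coordinate unit covectors over `K`; every
other nonzero covector over `K` is a dilation of one of them. -/
theorem IsConicNhd.exists_ball_subset {U : Set (CotangentBundle n X)} (hU : IsConicNhd U)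
    (hKc : IsCompact K) (hK : K ⊆ (chartAt (Vec n) x₀).target) :
    ∃ ε > 0, ∀ z : CotangentBundle n X, z.1 ∈ (chartAt (Vec n) x₀).source →
      chartAt (Vec n) x₀ z.1 ∈ K → ‖coords x₀ z‖ < ε → z ∈ U := by
  have hC : IsCompact (ofCoords x₀ '' (K ×ˢ Metric.sphere (0 : Covec n) 1) :
      Set (CotangentBundle n X)) :=
    (hKc.prod (isCompact_sphere 0 1)).image_of_continuousOn fun m hm =>
      (contMDiffAt_ofCoords x₀ (hK hm.1)).continuousAt.continuousWithinAt
  obtain ⟨ε, hε, h⟩ := hU.2 _ hC (by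
    rintro _ ⟨m, hm, rfl⟩
    refine coords_covector_ne _ _ ?_ ((chartAt (Vec n) x₀).map_target (hK hm.1))
    exact ne_zero_of_mem_unit_sphere (⟨m.2, hm.2⟩ : Metric.sphere (0 : Covec n) 1))
  refine ⟨ε, hε, fun z hz hzK hzε => ?_⟩
  by_cases h0 : z.2 = 0
  · exact hU.1 h0
  have hc := norm_pos_iff.2 (coords_ne_zero hz h0)
  have h1 := h ‖coords x₀ z‖ hc hzε _ ⟨(chartAt (Vec n) x₀ z.1, ‖coords x₀ z‖⁻¹ • coords x₀ z),
    ⟨hzK, by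
      rw [mem_sphere_zero_iff_norm, norm_smul, norm_inv, norm_norm, inv_mul_cancel₀ hc.ne']⟩, rfl⟩
  rw [← ofCoords_smul] at h1
  dsimp only at h1
  rw [smul_smul, mul_inv_cancel₀ hc.ne', one_smul] at h1
  rwa [show (chartAt (Vec n) x₀ z.1, coords x₀ z) = covectorChart x₀ z from rfl,
    ofCoords_covectorChart x₀ hz] at h1

theorem IsGenerating.toEquiv_eq_of_eq {O O' : Set (Covec n)} {σ' : Phase n → ℝ}
    {a' : Phase n → Covec n} {b' : Phase n → Vec n} (h : IsGenerating K O σ a b)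
    (h' : IsGenerating K O' σ' a' b') {x : Phase n} (ha : a' x = a x) (hb : b' x = b x) :
    h'.toEquiv (h.source x) = h.toEquiv (h.source x) := by
  rw [h.toEquiv_source, h.source_apply, ← ha, ← h'.source_apply, h'.toEquiv_source,
    h'.target_apply, h.target_apply, hb]

variable (n) in
/-- There is a universal bound such that the homogeneous symplectomorphisms with generating
functions below the bound preserve shapes. -/
theorem exists_isShapeInvariant_toConicSymplecto [T2Space X] : ∃ δ > 0, δ ≤ 1 / 2 ∧
    ∀ {x₀ : X} {K : Set (Vec n)} {σ : Phase n → ℝ} {a : Phase n → Covec n} {b : Phase n → Vec n}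
    (h : IsGenerating K {0}ᶜ σ a b) (hKc : IsCompact K) (hK : K ⊆ (chartAt (Vec n) x₀).target)
    (hσ : ∀ x : Phase n, σ x = x.2 (b x))
    (ha : ∀ (x : Phase n) (c : ℝ), 0 < c → a (x.1, c • x.2) = c • a x)
    (hb : ∀ (x : Phase n) (c : ℝ), 0 < c → b (x.1, c • x.2) = b x) {N : Set X}
    (_ : HasPrimitives (n := n) N) (_ : (chartAt (Vec n) x₀).symm '' K ⊆ N),
    (∀ q P P', ‖a (q, P) - a (q, P')‖ ≤ δ * ‖P - P'‖) →
    (∀ q q' P, ‖b (q, P) - b (q', P)‖ ≤ δ * ‖q - q'‖) →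
    (h.toConicSymplecto hKc hK hσ ha hb).IsShapeInvariant := by
  obtain ⟨C, hC, hcut⟩ := exists_isCutoff n
  have hpos : 0 < 2 * (1 + 2 * C) := by positivity
  -- This solves the requirement δ(1 + 2C) ≤ 1/2 of `IsGenerating.truncate`. Since C is independent
  -- of the scale of the cutoff, δ is chosen before U is known.
  refine ⟨(2 * (1 + 2 * C))⁻¹, inv_pos.2 hpos, ?_, ?_⟩
  · rw [one_div]
    exact inv_anti₀ two_pos (by linarith)
  intro x₀ K σ a b h hKc hK hσ ha hb N hN hKN hδa hδb U hU
  obtain ⟨ε', hε', hεU⟩ := hU.exists_ball_subset hKc hK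
  -- The cutoff is a function of the final momentum P, while U is described by the initial momentum
  -- P + a. As ‖a‖ ≤ ‖P‖/2, an initial momentum of norm at least ε' forces ‖P‖ ≥ 2ε'/3 > 2(ε'/4),
  -- where the cutoff is already `1`.
  obtain ⟨ρ, v, hρ⟩ := hcut (ε' / 4) (by positivity)
  have h' := h.truncate hσ (inv_pos.2 hpos).le hC (by positivity) (by
    rw [mul_inv, mul_assoc, inv_mul_cancel₀ (by positivity)]
    norm_num) hδa hδb hρ
  refine Eq.trans (congrArg shape ?_) (h'.shape_image hKc hK hN hKN U)
  refine image_eq_image_of_eqOn_compl _ (glue x₀ hK h'.toEquiv fun _ hx => h'.toEquiv_of_notMem hx)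
    (S := {z | z.1 ∈ (chartAt (Vec n) x₀).source ∧ chartAt (Vec n) x₀ z.1 ∈ K ∧
      ‖coords x₀ z‖ < ε'}) (fun z hz => hεU z hz.1 hz.2.1 hz.2.2) fun z hz => ?_
  change glueFun x₀ K h.toEquiv z = glueFun x₀ K h'.toEquiv z
  by_cases hs : z.1 ∈ (chartAt (Vec n) x₀).source ∧ chartAt (Vec n) x₀ z.1 ∈ K
  · rw [glueFun, if_pos hs, glueFun, if_pos hs]
    have hn : ε' ≤ ‖coords x₀ z‖ := not_lt.1 fun hlt => hz ⟨hs.1, hs.2, hlt⟩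
    congr 1
    obtain ⟨x, hx⟩ := h.source.surjective (covectorChart x₀ z)
    have h1 : coords x₀ z = x.2 + a x := by
      rw [h.source_apply] at hx
      exact (congrArg Prod.snd hx).symm
    have h2 : ‖a x‖ ≤ 1 / 2 * ‖x.2‖ := by
      have := h.a_le x.1 x.2 0
      rwa [h.a_zero, sub_zero, sub_zero] at this
    have h3 : 2 * (ε' / 4) < ‖x.2‖ := by
      have := norm_add_le x.2 (a x)
      rw [← h1] at this
      linarith
    obtain ⟨h4, h5⟩ := hρ.eq_one _ h3
    rw [← hx]
    refine (h.toEquiv_eq_of_eq h' ?_ ?_).symm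
    · rw [h4, one_smul]
    · rw [h4, h5, one_smul, smul_zero, add_zero]
  · rw [glueFun, if_neg hs, glueFun, if_neg hs]

end ShapeInvariant

/-! ## Uniform estimates for homogeneous functions -/

section Estimates

/-- Segments that avoid the origin are covered by the mean value inequality. On a segment through
the origin ‖x - y‖ = ‖x‖ + ‖y‖, and the linear growth bound suffices. -/
theorem norm_sub_le_of_hasFDerivAt_of_ne_zero {V W : Type*} [NormedAddCommGroup V] [NormedSpace ℝ V]
    [NormedAddCommGroup W] [NormedSpace ℝ W] {f : V → W} {f' : V → V →L[ℝ] W} {δ : ℝ}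
    (hf : ∀ x, x ≠ 0 → HasFDerivAt f (f' x) x) (hf' : ∀ x, x ≠ 0 → ‖f' x‖ ≤ δ)
    (h : ∀ x, ‖f x‖ ≤ δ * ‖x‖) (x y : V) : ‖f x - f y‖ ≤ δ * ‖x - y‖ := by
  by_cases h0 : (0 : V) ∈ segment ℝ x y
  · have h1 := dist_add_dist_of_mem_segment h0
    rw [dist_zero_right, dist_zero_left, dist_eq_norm] at h1
    calc ‖f x - f y‖ ≤ ‖f x‖ + ‖f y‖ := norm_sub_le _ _
      _ ≤ δ * ‖x‖ + δ * ‖y‖ := add_le_add (h x) (h y)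
      _ = δ * ‖x - y‖ := by rw [← h1, mul_add]
  · have hne : ∀ z ∈ segment ℝ x y, z ≠ 0 := fun z hz hz0 => h0 (hz0 ▸ hz)
    exact (convex_segment x y).norm_image_sub_le_of_norm_hasFDerivWithin_le
      (fun z hz => (hf z (hne z hz)).hasFDerivWithinAt) (fun z hz => hf' z (hne z hz))
      (right_mem_segment ℝ x y) (left_mem_segment ℝ x y)

theorem eventually_forall_mem_of_isCompact {ι α : Type*} {F : Filter ι} [TopologicalSpace α]
    {C : Set α} (hC : IsCompact C) {P : ι → α → Prop}
    (h : ∀ x ∈ C, ∀ᶠ p in F ×ˢ 𝓝 x, P p.1 p.2) : ∀ᶠ i in F, ∀ x ∈ C, P i x := by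
  refine hC.induction_on (p := fun t => ∀ᶠ i in F, ∀ x ∈ t, P i x) (by simp)
    (fun s t hst ht => ht.mono fun i hi y hy => hi y (hst hy))
    (fun s t hs ht => (hs.and ht).mono fun i hi y hy => hy.elim (hi.1 y) (hi.2 y)) ?_
  intro x hx
  obtain ⟨A, hA, B, hB, h2⟩ := Filter.eventually_prod_iff.1 (h x hx)
  exact ⟨_, mem_nhdsWithin_of_mem_nhds hB, hA.mono fun i hi y hy => h2 hi hy⟩

theorem norm_comp_inl_le {E E' W : Type*} [NormedAddCommGroup E] [NormedSpace ℝ E]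
    [NormedAddCommGroup E'] [NormedSpace ℝ E'] [NormedAddCommGroup W] [NormedSpace ℝ W]
    (L : E × E' →L[ℝ] W) : ‖L.comp (ContinuousLinearMap.inl ℝ E E')‖ ≤ ‖L‖ :=
  (ContinuousLinearMap.opNorm_comp_le _ _).trans ((mul_le_mul_of_nonneg_left
    (ContinuousLinearMap.norm_inl_le_one ℝ _ _) (norm_nonneg _)).trans (mul_one _).le)

theorem norm_comp_inr_le {E E' W : Type*} [NormedAddCommGroup E] [NormedSpace ℝ E]
    [NormedAddCommGroup E'] [NormedSpace ℝ E'] [NormedAddCommGroup W] [NormedSpace ℝ W]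
    (L : E × E' →L[ℝ] W) : ‖L.comp (ContinuousLinearMap.inr ℝ E E')‖ ≤ ‖L‖ :=
  (ContinuousLinearMap.opNorm_comp_le _ _).trans ((mul_le_mul_of_nonneg_left
    (ContinuousLinearMap.norm_inr_le_one ℝ _ _) (norm_nonneg _)).trans (mul_one _).le)

variable {n : ℕ} {ι : Type*} {F : Filter ι} {V : Type} [NormedAddCommGroup V] [NormedSpace ℝ V]
  {u : ι → Phase n → V} {K : Set (Vec n)} {δ : ℝ}

theorem SConv.eventually_norm_le (hK : IsCompact K) (hδ : 0 < δ)
    (hu : ∀ x : Phase n, x.1 ∈ K → x.2 ≠ 0 →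
      SConv F 1 𝓘(ℝ, Phase n) 𝓘(ℝ, V) u (fun _ => 0) x) :
    ∀ᶠ i in F, ∀ q ∈ K, ∀ P : Covec n, ‖P‖ = 1 → DifferentiableAt ℝ (u i) (q, P) ∧
      ‖u i (q, P)‖ ≤ δ ∧ ‖fderiv ℝ (u i) (q, P)‖ ≤ δ := by
  have h1 := eventually_forall_mem_of_isCompact (F := F)
    (hK.prod (isCompact_sphere (0 : Covec n) 1)) (P := fun i x => DifferentiableAt ℝ (u i) x ∧
      ‖u i x‖ ≤ δ ∧ ‖fderiv ℝ (u i) x‖ ≤ δ) (by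
    rintro ⟨q, P⟩ ⟨hq, hP⟩
    have h2 := hu (q, P) hq (ne_zero_of_mem_unit_sphere (⟨P, hP⟩ : Metric.sphere (0 : Covec n) 1))
    have h3 := h2.tendsto.norm
    have h4 := h2.fderiv_clm.tendsto.norm
    rw [norm_zero] at h3
    rw [fderiv_fun_const, Pi.zero_apply, norm_zero] at h4
    filter_upwards [h2.smooth, h3.eventually_le_const hδ, h4.eventually_le_const hδ]
      with p h5 h6 h7 using ⟨h5.contDiffAt.differentiableAt (by simp), h6, h7⟩)
  filter_upwards [h1] with i hi q hq P hP
  exact hi (q, P) ⟨hq, mem_sphere_zero_iff_norm.2 hP⟩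

/-- For functions of degree one in P the derivative in P has degree zero, so bounds on the compact
set K × (unit sphere) extend to all nonzero momenta. -/
theorem SConv.eventually_lipschitz_snd (hK : IsCompact K) (hδ : 0 < δ)
    (hu : ∀ x : Phase n, x.1 ∈ K → x.2 ≠ 0 →
      SConv F 1 𝓘(ℝ, Phase n) 𝓘(ℝ, V) u (fun _ => 0) x)
    (hh : ∀ᶠ i in F, ∀ (x : Phase n) (c : ℝ), 0 < c → u i (x.1, c • x.2) = c • u i x) :
    ∀ᶠ i in F, ∀ q ∈ K, ∀ P P', ‖u i (q, P) - u i (q, P')‖ ≤ δ * ‖P - P'‖ := by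
  filter_upwards [SConv.eventually_norm_le hK hδ hu, hh] with i hi hh q hq
  -- Homogeneity is only assumed for positive factors; the factor `2` at the origin gives u = 2u.
  have h0 : u i (q, 0) = 0 := by
    have := hh (q, 0) 2 two_pos
    rw [smul_zero, two_smul] at this
    exact left_eq_add.1 this
  have hscale : ∀ P : Covec n, P ≠ 0 → ‖‖P‖⁻¹ • P‖ = 1 := fun P hP => norm_smul_inv_norm hP
  refine norm_sub_le_of_hasFDerivAt_of_ne_zero (f' := fun P =>
    (fderiv ℝ (u i) (q, ‖P‖⁻¹ • P)).comp (ContinuousLinearMap.inr ℝ (Vec n) (Covec n)))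
    (fun P hP => ?_) (fun P hP => ?_) fun P => ?_
  · have hP' := norm_pos_iff.2 hP
    have h1 : (fun P' => u i (q, P')) = fun P' => ‖P‖ • u i (q, ‖P‖⁻¹ • P') := by
      funext P'
      rw [← hh (q, ‖P‖⁻¹ • P') _ hP', smul_smul, mul_inv_cancel₀ hP'.ne', one_smul]
    have h2 : HasFDerivAt (fun P' : Covec n => ((q, ‖P‖⁻¹ • P') : Phase n))
        ((0 : Covec n →L[ℝ] Vec n).prod (‖P‖⁻¹ • ContinuousLinearMap.id ℝ (Covec n))) P :=
      (hasFDerivAt_const q P).prodMk ((hasFDerivAt_id P).const_smul ‖P‖⁻¹)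
    have h3 := ((hi q hq _ (hscale P hP)).1.hasFDerivAt.comp P h2).const_smul ‖P‖
    rw [h1]
    refine h3.congr_fderiv ?_
    refine ContinuousLinearMap.ext fun Q => ?_
    have h4 : ((0 : Vec n), ‖P‖⁻¹ • Q) = ‖P‖⁻¹ • ((0, Q) : Phase n) := by
      rw [Prod.smul_mk, smul_zero]
    change ‖P‖ • fderiv ℝ (u i) (q, ‖P‖⁻¹ • P) ((0 : Vec n), ‖P‖⁻¹ • Q) =
      fderiv ℝ (u i) (q, ‖P‖⁻¹ • P) (0, Q)
    rw [h4, map_smul, smul_smul, mul_inv_cancel₀ hP'.ne', one_smul]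
  · exact (norm_comp_inr_le _).trans (hi q hq _ (hscale P hP)).2.2
  · by_cases hP : P = 0
    · rw [hP, h0, norm_zero, norm_zero, mul_zero]
    · have hP' := norm_pos_iff.2 hP
      have h1 := hh (q, ‖P‖⁻¹ • P) _ hP'
      dsimp only at h1
      rw [smul_smul, mul_inv_cancel₀ hP'.ne', one_smul] at h1
      rw [h1, norm_smul, norm_norm, mul_comm]
      exact mul_le_mul_of_nonneg_right (hi q hq _ (hscale P hP)).2.1 (norm_nonneg _)

/-- Degree zero in P reduces the estimate to unit momenta, and vanishing off K makes it global in q.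
Zero momentum is excluded, since degree zero says nothing there. -/
theorem SConv.eventually_lipschitz_fst (hK : IsCompact K) (hδ : 0 < δ)
    (hu : ∀ x : Phase n, x.1 ∈ K → x.2 ≠ 0 →
      SConv F 1 𝓘(ℝ, Phase n) 𝓘(ℝ, V) u (fun _ => 0) x)
    (hh : ∀ᶠ i in F, ∀ (x : Phase n) (c : ℝ), 0 < c → u i (x.1, c • x.2) = u i x)
    (hu0 : ∀ i (x : Phase n), x.1 ∉ K → u i x = 0) :
    ∀ᶠ i in F, ∀ q q' P, P ≠ 0 → ‖u i (q, P) - u i (q', P)‖ ≤ δ * ‖q - q'‖ := by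
  filter_upwards [SConv.eventually_norm_le hK hδ hu, hh] with i hi hh q q' P hP
  have hscale : ‖‖P‖⁻¹ • P‖ = 1 := norm_smul_inv_norm hP
  rw [← hh (q, P) _ (inv_pos.2 (norm_pos_iff.2 hP)), ← hh (q', P) _
    (inv_pos.2 (norm_pos_iff.2 hP))]
  dsimp only
  have h1 : ∀ y, ∃ L : Vec n →L[ℝ] V, HasFDerivAt (fun y => u i (y, ‖P‖⁻¹ • P)) L y ∧ ‖L‖ ≤ δ := by
    intro y
    by_cases hy : y ∈ K
    · have h2 : HasFDerivAt (fun y : Vec n => ((y, ‖P‖⁻¹ • P) : Phase n))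
          (ContinuousLinearMap.inl ℝ (Vec n) (Covec n)) y :=
        (hasFDerivAt_id y).prodMk (hasFDerivAt_const _ _)
      obtain ⟨h3, -, h4⟩ := hi y hy _ hscale
      exact ⟨_, h3.hasFDerivAt.comp y h2, (norm_comp_inl_le _).trans h4⟩
    · refine ⟨0, (hasFDerivAt_const (0 : V) y).congr_of_eventuallyEq ?_, by simpa using hδ.le⟩
      filter_upwards [hK.isClosed.isOpen_compl.mem_nhds hy] with w hw using hu0 i _ hw
  choose L hL hLδ using h1
  exact convex_univ.norm_image_sub_le_of_norm_hasFDerivWithin_le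
    (fun y _ => (hL y).hasFDerivWithinAt) (fun y _ => hLδ y) (mem_univ q') (mem_univ q)

end Estimates

/-! ## Localized generating functions of homogeneous symplectomorphisms -/

section Localize
variable {n : ℕ}

/-- `G` is a homogeneous symplectomorphism onto its image over `D`. -/
structure IsLocalSymplecto (D : Set (Vec n)) (G : Phase n → Phase n) : Prop where
  zero : ∀ q ∈ D, G (q, 0) = (q, 0)
  smul : ∀ (x : Phase n) (c : ℝ), 0 < c → G (x.1, c • x.2) = ((G x).1, c • (G x).2)
  smooth : ∀ x : Phase n, x.1 ∈ D → x.2 ≠ 0 → ContDiffAt ℝ ∞ G x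
  liouville : ∀ x : Phase n, x.1 ∈ D → x.2 ≠ 0 → ∀ w, (G x).2 (fderiv ℝ G x w).1 = x.2 w.1

open Classical in
/-- The fibre component, over `D`, of the displacement. -/
def fibreShift (D : Set (Vec n)) (G : Phase n → Phase n) (x : Phase n) : Covec n :=
  if x.1 ∈ D then (G x).2 - x.2 else 0

/-- The fibre component of `G` is a small perturbation of the identity. -/
def IsFibreShiftSmall (D : Set (Vec n)) (G : Phase n → Phase n) : Prop :=
  IsContractingAlong (Submodule.prod ⊥ ⊤) fun x => ((0, fibreShift D G x) : Phase n)

theorem isFibreShiftSmall {D : Set (Vec n)} {G : Phase n → Phase n}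
    (h : ∀ q ∈ D, ∀ P P', ‖((G (q, P)).2 - P) - ((G (q, P')).2 - P')‖ ≤ 1 / 2 * ‖P - P'‖) :
    IsFibreShiftSmall D G := by
  refine isContractingAlong_snd fun q P P' => ?_
  by_cases hq : q ∈ D
  · rw [fibreShift, if_pos hq, fibreShift, if_pos hq]
    exact h q hq P P'
  · rw [fibreShift, if_neg hq, fibreShift, if_neg hq, sub_self, norm_zero]
    positivity

open Classical in
/-- The map `(q, G(q, p).2) ↦ (q, p)`. -/
def fibreInverse (D : Set (Vec n)) (G : Phase n → Phase n) : Phase n → Phase n :=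
  if h : IsFibreShiftSmall D G then (IsContractingAlong.equiv h).symm else id

variable {D : Set (Vec n)} {G : Phase n → Phase n}

namespace IsFibreShiftSmall

theorem fibreInverse_eq (h : IsFibreShiftSmall D G) (x : Phase n) :
    fibreInverse D G x = (IsContractingAlong.equiv h).symm x := by
  rw [fibreInverse, dif_pos h]

theorem fibreInverse_add (h : IsFibreShiftSmall D G) (x : Phase n) :
    fibreInverse D G x + (0, fibreShift D G (fibreInverse D G x)) = x := by
  rw [h.fibreInverse_eq]
  exact IsContractingAlong.symm_add h x

theorem fibreInverse_eq_of_add_eq (h : IsFibreShiftSmall D G) {x y : Phase n}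
    (hy : y + (0, fibreShift D G y) = x) : fibreInverse D G x = y := by
  rw [h.fibreInverse_eq, Equiv.symm_apply_eq]
  exact hy.symm

theorem fibreInverse_fst (h : IsFibreShiftSmall D G) (x : Phase n) :
    (fibreInverse D G x).1 = x.1 := by
  have := congrArg Prod.fst (h.fibreInverse_add x)
  rwa [Prod.fst_add, add_zero] at this

theorem map_fibreInverse_snd (h : IsFibreShiftSmall D G) {x : Phase n} (hx : x.1 ∈ D) :
    (G (fibreInverse D G x)).2 = x.2 := by
  have h1 := congrArg Prod.snd (h.fibreInverse_add x)
  rw [Prod.snd_add, fibreShift, h.fibreInverse_fst, if_pos hx, add_sub_cancel] at h1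
  exact h1

theorem fibreInverse_of_map (h : IsFibreShiftSmall D G) {x : Phase n} (hx : x.1 ∈ D) :
    fibreInverse D G (x.1, (G x).2) = x := by
  refine h.fibreInverse_eq_of_add_eq ?_
  rw [fibreShift, if_pos hx]
  refine Prod.ext (add_zero _) ?_
  exact add_sub_cancel _ _

end IsFibreShiftSmall

namespace IsLocalSymplecto

theorem zero_snd (h : IsLocalSymplecto D G) (q : Vec n) : (G (q, 0)).2 = 0 := by
  have := congrArg Prod.snd (h.smul (q, 0) 2 two_pos)
  dsimp only at this
  rw [smul_zero, two_smul] at this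
  exact left_eq_add.1 this

theorem fibreShift_smul (h : IsLocalSymplecto D G) (x : Phase n) {c : ℝ} (hc : 0 < c) :
    fibreShift D G (x.1, c • x.2) = c • fibreShift D G x := by
  rw [fibreShift, fibreShift]
  split_ifs
  · rw [h.smul x c hc, smul_sub]
  · rw [smul_zero]

theorem fibreInverse_smul (h : IsLocalSymplecto D G) (hs : IsFibreShiftSmall D G) (x : Phase n)
    {c : ℝ} (hc : 0 < c) : fibreInverse D G (x.1, c • x.2) =
      ((fibreInverse D G x).1, c • (fibreInverse D G x).2) := by
  refine hs.fibreInverse_eq_of_add_eq ?_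
  rw [h.fibreShift_smul _ hc]
  have h1 := hs.fibreInverse_add x
  refine Prod.ext ?_ ?_
  · exact (add_zero _).trans (hs.fibreInverse_fst x)
  · have h2 := congrArg Prod.snd h1
    simp only [Prod.snd_add] at h2
    simp only [Prod.snd_add]
    rw [← smul_add, h2]

theorem fibreInverse_zero (h : IsLocalSymplecto D G) (hs : IsFibreShiftSmall D G) (q : Vec n) :
    fibreInverse D G (q, 0) = (q, 0) := by
  refine hs.fibreInverse_eq_of_add_eq ?_
  rw [fibreShift, h.zero_snd, sub_zero, ite_self]
  exact add_zero _

theorem fibreInverse_snd_ne (h : IsLocalSymplecto D G) (hs : IsFibreShiftSmall D G) {x : Phase n}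
    (hx : x.2 ≠ 0) : (fibreInverse D G x).2 ≠ 0 := by
  intro h0
  have h1 : fibreInverse D G x = ((fibreInverse D G x).1, 0) := Prod.ext rfl h0
  have h2 := hs.fibreInverse_add x
  have h3 : fibreShift D G (fibreInverse D G x) = 0 := by
    rw [h1, fibreShift, h.zero_snd, sub_zero, ite_self]
  rw [h3] at h2
  apply hx
  rw [← h2, Prod.snd_add, h0, add_zero]

theorem contDiffAt_fibreShift (h : IsLocalSymplecto D G) {x : Phase n} (hx : x.1 ∈ interior D)
    (hx' : x.2 ≠ 0) : ContDiffAt ℝ ∞ (fibreShift D G) x := by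
  refine ((h.smooth x (interior_subset hx) hx').snd.sub contDiffAt_snd).congr_of_eventuallyEq ?_
  filter_upwards [(isOpen_interior.preimage continuous_fst).mem_nhds hx] with y hy
  exact if_pos (interior_subset hy)

theorem contDiffAt_fibreInverse (h : IsLocalSymplecto D G) (hs : IsFibreShiftSmall D G)
    {x : Phase n} (hx : x.1 ∈ interior D) (hx' : x.2 ≠ 0) :
    ContDiffAt ℝ ∞ (fibreInverse D G) x := by
  have h1 : fibreInverse D G = (IsContractingAlong.equiv hs).symm := funext hs.fibreInverse_eq
  rw [h1]
  refine IsContractingAlong.contDiffAt_symm' hs (contDiffAt_const.prodMk ?_)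
  rw [← h1]
  exact h.contDiffAt_fibreShift (by rwa [hs.fibreInverse_fst]) (h.fibreInverse_snd_ne hs hx')

end IsLocalSymplecto

variable (D G) in
/-- The position of `G` as a function of the initial position and of the final momentum. -/
def mixedMap (x : Phase n) : Phase n := G (fibreInverse D G x)

/-- The generating function of a homogeneous symplectomorphism, cut off by `χ`. -/
def cutoffGen (χ : Vec n → ℝ) (D : Set (Vec n)) (G : Phase n → Phase n) (x : Phase n) : ℝ :=
  χ x.1 * x.2 ((mixedMap D G x).1 - x.1)

/-- The derivative of `cutoffGen` in the covector. -/
def cutoffGenVec (χ : Vec n → ℝ) (D : Set (Vec n)) (G : Phase n → Phase n) (x : Phase n) : Vec n :=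
  χ x.1 • ((mixedMap D G x).1 - x.1)

/-- The derivative of `cutoffGen` in the base point. -/
def cutoffGenCovec (χ : Vec n → ℝ) (D : Set (Vec n)) (G : Phase n → Phase n) (x : Phase n) :
    Covec n :=
  χ x.1 • ((fibreInverse D G x).2 - x.2) + x.2 ((mixedMap D G x).1 - x.1) • fderiv ℝ χ x.1

namespace IsLocalSymplecto
variable {χ : Vec n → ℝ} {K : Set (Vec n)}

theorem mixedMap_fst_smul (h : IsLocalSymplecto D G) (hs : IsFibreShiftSmall D G) (x : Phase n)
    {c : ℝ} (hc : 0 < c) : (mixedMap D G (x.1, c • x.2)).1 = (mixedMap D G x).1 := by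
  rw [mixedMap, h.fibreInverse_smul hs x hc, h.smul _ c hc, mixedMap]

theorem cutoffGenVec_smul (h : IsLocalSymplecto D G) (hs : IsFibreShiftSmall D G) (x : Phase n)
    {c : ℝ} (hc : 0 < c) : cutoffGenVec χ D G (x.1, c • x.2) = cutoffGenVec χ D G x := by
  rw [cutoffGenVec, h.mixedMap_fst_smul hs x hc, cutoffGenVec]

theorem cutoffGenCovec_smul (h : IsLocalSymplecto D G) (hs : IsFibreShiftSmall D G) (x : Phase n)
    {c : ℝ} (hc : 0 < c) :
    cutoffGenCovec χ D G (x.1, c • x.2) = c • cutoffGenCovec χ D G x := by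
  rw [cutoffGenCovec, h.mixedMap_fst_smul hs x hc, h.fibreInverse_smul hs x hc, cutoffGenCovec]
  simp only [smul_add, smul_sub, smul_smul, smul_apply, smul_eq_mul]
  rw [mul_comm c (χ x.1)]

theorem contDiffAt_mixedMap (h : IsLocalSymplecto D G) (hs : IsFibreShiftSmall D G)
    {x : Phase n} (hx : x.1 ∈ interior D) (hx' : x.2 ≠ 0) : ContDiffAt ℝ ∞ (mixedMap D G) x := by
  have h1 : (fibreInverse D G x).1 ∈ D := by
    rw [hs.fibreInverse_fst]
    exact interior_subset hx
  exact (h.smooth _ h1 (h.fibreInverse_snd_ne hs hx')).comp x (h.contDiffAt_fibreInverse hs hx hx')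

/-- For S = P(Q - q) as a function of (q, P), with p the initial momentum, dS = (Q - q) dP + P dQ -
P dq. Preservation of the Liouville form says P dQ = p dq, which leaves (p - P) dq + (Q - q) dP. -/
theorem hasFDerivAt_pairing (h : IsLocalSymplecto D G) (hs : IsFibreShiftSmall D G)
    {x : Phase n} (hx : x.1 ∈ interior D) (hx' : x.2 ≠ 0) :
    HasFDerivAt (fun x : Phase n => x.2 ((mixedMap D G x).1 - x.1))
      (((fibreInverse D G x).2 - x.2).comp (ContinuousLinearMap.fst ℝ (Vec n) (Covec n)) +
        (evalAt ((mixedMap D G x).1 - x.1)).comp (ContinuousLinearMap.snd ℝ (Vec n) (Covec n))) x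
      := by
  have hxD : (fibreInverse D G x).1 ∈ D := by
    rw [hs.fibreInverse_fst]
    exact interior_subset hx
  have h0 := h.fibreInverse_snd_ne hs hx'
  have h1 := ((h.contDiffAt_fibreInverse hs hx hx').differentiableAt (by simp)).hasFDerivAt
  have h2 := ((h.smooth _ hxD h0).differentiableAt (by simp)).hasFDerivAt
  have h3 : HasFDerivAt (mixedMap D G) _ x := h2.comp x h1
  have h4 := (hasFDerivAt_snd (p := x)).clm_apply (h3.fst.sub hasFDerivAt_fst)
  refine h4.congr_fderiv (ContinuousLinearMap.ext fun w => ?_)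
  have h5 : (fderiv ℝ (fibreInverse D G) x w).1 = w.1 := by
    have h6 := h1.fst
    rw [show (fun x => (fibreInverse D G x).1) = Prod.fst from funext hs.fibreInverse_fst] at h6
    exact congrArg (fun L : Phase n →L[ℝ] Vec n => L w) (h6.unique hasFDerivAt_fst)
  have h7 := h.liouville _ hxD h0 (fderiv ℝ (fibreInverse D G) x w)
  rw [hs.map_fibreInverse_snd (interior_subset hx), h5] at h7
  simp [evalAt_apply, h7]

-- The two partial derivatives of χ P(Q - q) come from the product rule and `hasFDerivAt_pairing`.
-- Estimates are only demanded over K and for nonzero P; elsewhere the functions vanish.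
set_option synthInstance.maxHeartbeats 200000 in
theorem isGenerating (h : IsLocalSymplecto D G) (hs : IsFibreShiftSmall D G) (hK : IsClosed K)
    (hKD : K ⊆ interior D) (hχ : ContDiff ℝ ∞ χ) (hχK : ∀ q ∉ K, χ q = 0)
    (ha : ∀ q ∈ K, ∀ P P', ‖cutoffGenCovec χ D G (q, P) - cutoffGenCovec χ D G (q, P')‖ ≤
      1 / 2 * ‖P - P'‖)
    (hb : ∀ q q' P, P ≠ 0 → ‖cutoffGenVec χ D G (q, P) - cutoffGenVec χ D G (q', P)‖ ≤
      1 / 2 * ‖q - q'‖) :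
    IsGenerating K {0}ᶜ (cutoffGen χ D G) (cutoffGenCovec χ D G) (cutoffGenVec χ D G) := by
  have hχ0 : ∀ q ∉ K, χ =ᶠ[𝓝 q] fun _ => 0 := fun q hq => by
    filter_upwards [hK.isOpen_compl.mem_nhds hq] with y hy using hχK y hy
  have hdχ : ∀ q ∉ K, fderiv ℝ χ q = 0 := fun q hq => by
    rw [(hχ0 q hq).fderiv_eq, fderiv_fun_const]
    rfl
  have hzero : ∀ x : Phase n, x.1 ∉ K →
      cutoffGenCovec χ D G x = 0 ∧ cutoffGenVec χ D G x = 0 ∧ cutoffGen χ D G x = 0 := fun x hx => by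
    simp [cutoffGenCovec, cutoffGenVec, cutoffGen, hχK _ hx, hdχ _ hx]
  have hzero' : ∀ x : Phase n, x.1 ∉ K → ∀ᶠ y in 𝓝 x,
      cutoffGenCovec χ D G y = 0 ∧ cutoffGenVec χ D G y = 0 ∧ cutoffGen χ D G y = 0 := fun x hx =>
    Filter.mem_of_superset ((hK.isOpen_compl.preimage continuous_fst).mem_nhds hx)
      fun y hy => hzero y hy
  have hvec0 : ∀ q, cutoffGenVec χ D G (q, 0) = 0 := fun q => by
    by_cases hq : q ∈ K
    · rw [cutoffGenVec, mixedMap, h.fibreInverse_zero hs, h.zero q (interior_subset (hKD hq)),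
        sub_self, smul_zero]
    · exact (hzero (q, 0) hq).2.1
  have hcovec0 : ∀ q, cutoffGenCovec χ D G (q, 0) = 0 := fun q => by
    rw [cutoffGenCovec, h.fibreInverse_zero hs]
    simp
  have hal : ∀ q P P', ‖cutoffGenCovec χ D G (q, P) - cutoffGenCovec χ D G (q, P')‖ ≤
      1 / 2 * ‖P - P'‖ := fun q P P' => by
    by_cases hq : q ∈ K
    · exact ha q hq P P'
    · rw [(hzero (q, P) hq).1, (hzero (q, P') hq).1, sub_self, norm_zero]
      positivity
  have hχf : ContDiff ℝ ∞ fun x : Phase n => χ x.1 := hχ.comp contDiff_fst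
  have hdχf : ContDiff ℝ ∞ fun x : Phase n => fderiv ℝ χ x.1 :=
    (hχ.fderiv_right (m := ∞) (by simp)).comp contDiff_fst
  have hm : ∀ x : Phase n, x.1 ∈ K → x.2 ≠ 0 →
      ContDiffAt ℝ ∞ (fun x : Phase n => (mixedMap D G x).1 - x.1) x := fun x hx hx' =>
    (h.contDiffAt_mixedMap hs (hKD hx) hx').fst.sub contDiffAt_fst
  refine ⟨hal, fun q q' P => ?_, hzero, hcovec0, hvec0, fun x hx => ?_, fun x hx => ?_,
    fun x hx => ?_, fun x hx => ?_, fun x => ?_⟩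
  · by_cases hP : P = 0
    · rw [hP, hvec0, hvec0, sub_self, norm_zero]
      positivity
    · exact hb q q' P hP
  · by_cases hxK : x.1 ∈ K
    · exact (hχf.contDiffAt.smul ((h.contDiffAt_fibreInverse hs (hKD hxK) hx).snd.sub
        contDiffAt_snd)).add ((contDiffAt_snd.clm_apply (hm x hxK hx)).smul hdχf.contDiffAt)
    · exact contDiffAt_const.congr_of_eventuallyEq ((hzero' x hxK).mono fun y hy => hy.1)
  · by_cases hxK : x.1 ∈ K
    · exact hχf.contDiffAt.smul (hm x hxK hx)
    · exact contDiffAt_const.congr_of_eventuallyEq ((hzero' x hxK).mono fun y hy => hy.2.1)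
  · by_cases hxK : x.1 ∈ K
    · exact hχf.contDiffAt.mul (contDiffAt_snd.clm_apply (hm x hxK hx))
    · exact contDiffAt_const.congr_of_eventuallyEq ((hzero' x hxK).mono fun y hy => hy.2.2)
  · by_cases hxK : x.1 ∈ K
    · have h1 : HasFDerivAt (fun x : Phase n => χ x.1) _ x :=
        ((hχ.differentiable (by simp) x.1).hasFDerivAt).comp x hasFDerivAt_fst
      refine (h1.mul (h.hasFDerivAt_pairing hs (hKD hxK) hx)).congr_fderiv ?_
      refine ContinuousLinearMap.ext fun w => ?_
      simp [evalAt_apply, cutoffGenCovec, cutoffGenVec]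
      ring
    · refine ((hasFDerivAt_const (0 : ℝ) x).congr_of_eventuallyEq
        ((hzero' x hxK).mono fun y hy => hy.2.2)).congr_fderiv ?_
      obtain ⟨h1, h2, -⟩ := hzero x hxK
      rw [h1, h2]
      refine ContinuousLinearMap.ext fun w => ?_
      change (0 : ℝ) = (0 : Covec n) w.1 + w.2 0
      rw [map_zero, add_zero]
      rfl
  -- The norm of a(q, P) is at most ‖P‖/2, so P + a(q, P) vanishes only together with P.
  · have h1 := hal x.1 x.2 0
    rw [hcovec0, sub_zero, sub_zero] at h1
    refine not_congr ⟨fun h0 => ?_, fun h0 => ?_⟩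
    · have h2 : ‖x.2‖ = ‖cutoffGenCovec χ D G x‖ := by
        rw [eq_neg_of_add_eq_zero_left h0, norm_neg]
      rw [← h2] at h1
      exact norm_le_zero_iff.1 (by linarith [norm_nonneg x.2])
    · have h2 : x.2 = 0 := h0
      have h3 : x = (x.1, 0) := Prod.ext rfl h2
      rw [h3, hcovec0]
      exact add_zero _

end IsLocalSymplecto
end Localize

/-! ## Convergence of localized generating functions -/

section LocalConvergence
variable {n : ℕ} {ι : Type*} {F : Filter ι} {D K : Set (Vec n)} {G : ι → Phase n → Phase n}
  {χ : Vec n → ℝ}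

theorem SConv.of_eventually_eq_zero {V W : Type} [NormedAddCommGroup V] [NormedSpace ℝ V]
    [NormedAddCommGroup W] [NormedSpace ℝ W] {k : ℕ} {u : ι → V → W} {s : Set V} (hs : IsOpen s)
    {x : V} (hx : x ∈ s) (hu : ∀ i, ∀ y ∈ s, u i y = 0) :
    SConv F k 𝓘(ℝ, V) 𝓘(ℝ, W) u (fun _ => 0) x := by
  have h1 : SConv F k 𝓘(ℝ, V) 𝓘(ℝ, W) (fun (_ : ι) (_ : V) => (0 : W)) (fun _ => 0) x :=
    SConv.const (Filter.Eventually.of_forall fun y => contMDiffAt_const)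
  refine h1.congr ?_ (Filter.EventuallyEq.refl _ _)
  filter_upwards [Filter.tendsto_snd.eventually (hs.mem_nhds hx)] with p hp using hu _ _ hp

theorem SConv.of_id {V : Type} [NormedAddCommGroup V] [NormedSpace ℝ V] {k : ℕ} {x : V} :
    SConv F k 𝓘(ℝ, V) 𝓘(ℝ, V) (fun _ : ι => id) id x :=
  SConv.const (Filter.Eventually.of_forall fun _ => contMDiffAt_id)

theorem SConv.snd_sub {x : Phase n} (h : SConv F 1 𝓘(ℝ, Phase n) 𝓘(ℝ, Phase n) G id x) :
    SConv F 1 𝓘(ℝ, Phase n) 𝓘(ℝ, Covec n) (fun i y => (G i y).2 - y.2) (fun _ => 0) x := by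
  have h1 : ContDiff ℝ ∞ (fun p : Phase n × Phase n => p.1.2 - p.2.2) := by fun_prop
  refine ((h.prodMk_vec SConv.of_id).map_contDiff h1).congr (Filter.Eventually.of_forall
    fun p => rfl) (Filter.Eventually.of_forall fun y => ?_)
  exact (sub_self _).symm

theorem eventually_isFibreShiftSmall (hD : IsCompact D)
    (hG : ∀ x : Phase n, x.1 ∈ D → x.2 ≠ 0 → SConv F 1 𝓘(ℝ, Phase n) 𝓘(ℝ, Phase n) G id x)
    (hl : ∀ᶠ i in F, IsLocalSymplecto D (G i)) : ∀ᶠ i in F, IsFibreShiftSmall D (G i) := by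
  refine (SConv.eventually_lipschitz_snd (u := fun i x => (G i x).2 - x.2) hD one_half_pos
    (fun x hx hx' => (hG x hx hx').snd_sub) ?_).mono fun i hi => isFibreShiftSmall hi
  filter_upwards [hl] with i hi x c hc
  rw [hi.smul x c hc, smul_sub]

theorem SConv.fibreInverse {x : Phase n} (hx : x.1 ∈ interior D)
    (hG : SConv F 1 𝓘(ℝ, Phase n) 𝓘(ℝ, Phase n) G id x)
    (hs : ∀ᶠ i in F, IsFibreShiftSmall D (G i)) :
    SConv F 1 𝓘(ℝ, Phase n) 𝓘(ℝ, Phase n) (fun i => fibreInverse D (G i)) id x := by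
  refine SConv.shear_symm (S := Submodule.prod ⊥ ⊤)
    (g := fun i y => ((0, fibreShift D (G i) y) : Phase n)) ?_
    (hs.mono fun i hi => ⟨show IsContractingAlong (Submodule.prod ⊥ ⊤)
      (fun y => ((0, fibreShift D (G i) y) : Phase n)) from hi, hi.fibreInverse_eq⟩)
  have h1 : ContDiff ℝ ∞ (fun P : Covec n => ((0, P) : Phase n)) := by fun_prop
  refine (hG.snd_sub.map_contDiff h1).congr ?_ (Filter.EventuallyEq.refl _ _)
  filter_upwards [Filter.tendsto_snd.eventually
    ((isOpen_interior.preimage continuous_fst).mem_nhds hx)] with p hp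
  rw [fibreShift, if_pos (interior_subset hp)]

/-- Both functions are fixed smooth expressions in x, the fibre inverse and the mixed map. The
latter two tend to the identity, at which the expressions vanish. -/
theorem SConv.cutoff {x : Phase n} (hx : x.1 ∈ interior D) (hχ : ContDiff ℝ ∞ χ)
    (hG : SConv F 1 𝓘(ℝ, Phase n) 𝓘(ℝ, Phase n) G id x)
    (hs : ∀ᶠ i in F, IsFibreShiftSmall D (G i)) :
    SConv F 1 𝓘(ℝ, Phase n) 𝓘(ℝ, Covec n) (fun i => cutoffGenCovec χ D (G i)) (fun _ => 0) x ∧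
      SConv F 1 𝓘(ℝ, Phase n) 𝓘(ℝ, Vec n) (fun i => cutoffGenVec χ D (G i)) (fun _ => 0) x := by
  have h1 := SConv.fibreInverse hx hG hs
  have h2 : SConv F 1 𝓘(ℝ, Phase n) 𝓘(ℝ, Phase n) (fun i => mixedMap D (G i)) id x :=
    SConv.comp (g := G) (g₀ := id) hG h1
  have h3 := (SConv.of_id (F := F) (k := 1) (x := x)).prodMk_vec (h1.prodMk_vec h2)
  have hd : ContDiff ℝ ∞ (fderiv ℝ χ) := hχ.fderiv_right (m := ∞) (by simp)
  have h4 : ContDiff ℝ ∞ (fun p : Phase n × Phase n × Phase n =>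
      χ p.1.1 • (p.2.1.2 - p.1.2) + p.1.2 (p.2.2.1 - p.1.1) • fderiv ℝ χ p.1.1) := by
    have e1 : ContDiff ℝ ∞ (fun p : Phase n × Phase n × Phase n => χ p.1.1) :=
      hχ.comp (by fun_prop)
    have e2 : ContDiff ℝ ∞ (fun p : Phase n × Phase n × Phase n => fderiv ℝ χ p.1.1) :=
      hd.comp (by fun_prop)
    have e3 : ContDiff ℝ ∞ (fun p : Phase n × Phase n × Phase n => p.1.2) := by fun_prop
    have e4 : ContDiff ℝ ∞ (fun p : Phase n × Phase n × Phase n => p.2.2.1 - p.1.1) := by fun_prop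
    have e5 : ContDiff ℝ ∞ (fun p : Phase n × Phase n × Phase n => p.2.1.2 - p.1.2) := by fun_prop
    exact (e1.smul e5).add ((e3.clm_apply e4).smul e2)
  have h5 : ContDiff ℝ ∞ (fun p : Phase n × Phase n × Phase n => χ p.1.1 • (p.2.2.1 - p.1.1)) := by
    have e1 : ContDiff ℝ ∞ (fun p : Phase n × Phase n × Phase n => χ p.1.1) :=
      hχ.comp (by fun_prop)
    exact e1.smul (by fun_prop)
  refine ⟨(h3.map_contDiff h4).congr (Filter.Eventually.of_forall fun p => rfl)
    (Filter.Eventually.of_forall fun y => ?_), (h3.map_contDiff h5).congr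
    (Filter.Eventually.of_forall fun p => rfl) (Filter.Eventually.of_forall fun y => ?_)⟩
  · simp
  · simp

theorem cutoff_eq_zero (hK : IsClosed K) (hχK : ∀ q ∉ K, χ q = 0) (G : Phase n → Phase n)
    (x : Phase n) (hx : x.1 ∉ K) : cutoffGenCovec χ D G x = 0 ∧ cutoffGenVec χ D G x = 0 := by
  have h1 : χ =ᶠ[𝓝 x.1] fun _ => 0 := by
    filter_upwards [hK.isOpen_compl.mem_nhds hx] with y hy using hχK y hy
  have h2 : fderiv ℝ χ x.1 = 0 := by
    rw [h1.fderiv_eq, fderiv_fun_const]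
    rfl
  simp [cutoffGenCovec, cutoffGenVec, hχK _ hx, h2]

/-- `χ` is a smooth function on a compact set `D` that is supported in the set `K` in the interior
of `D`. -/
structure IsCutoffOn (D K : Set (Vec n)) (χ : Vec n → ℝ) : Prop where
  isCompact : IsCompact D
  isClosed : IsClosed K
  subset : K ⊆ interior D
  smooth : ContDiff ℝ ∞ χ
  eq_zero : ∀ q ∉ K, χ q = 0

theorem SConv.cutoff_of_ne_zero (hc : IsCutoffOn D K χ)
    (hG : ∀ x : Phase n, x.1 ∈ D → x.2 ≠ 0 → SConv F 1 𝓘(ℝ, Phase n) 𝓘(ℝ, Phase n) G id x)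
    (hl : ∀ᶠ i in F, IsLocalSymplecto D (G i)) {x : Phase n} (hx : x.2 ≠ 0) :
    SConv F 1 𝓘(ℝ, Phase n) 𝓘(ℝ, Covec n) (fun i => cutoffGenCovec χ D (G i)) (fun _ => 0) x ∧
      SConv F 1 𝓘(ℝ, Phase n) 𝓘(ℝ, Vec n) (fun i => cutoffGenVec χ D (G i)) (fun _ => 0) x := by
  by_cases hxK : x.1 ∈ K
  · exact SConv.cutoff (hc.subset hxK) hc.smooth (hG x (interior_subset (hc.subset hxK)) hx)
      (eventually_isFibreShiftSmall hc.isCompact hG hl)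
  · have h1 : IsOpen {y : Phase n | y.1 ∉ K} := hc.isClosed.isOpen_compl.preimage continuous_fst
    exact ⟨SConv.of_eventually_eq_zero h1 hxK fun i y hy => (cutoff_eq_zero hc.isClosed hc.eq_zero _ y hy).1,
      SConv.of_eventually_eq_zero h1 hxK fun i y hy => (cutoff_eq_zero hc.isClosed hc.eq_zero _ y hy).2⟩

theorem eventually_isGenerating (hc : IsCutoffOn D K χ)
    (hG : ∀ x : Phase n, x.1 ∈ D → x.2 ≠ 0 → SConv F 1 𝓘(ℝ, Phase n) 𝓘(ℝ, Phase n) G id x)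
    (hl : ∀ᶠ i in F, IsLocalSymplecto D (G i)) {δ : ℝ} (hδ : 0 < δ) (hδ' : δ ≤ 1 / 2) :
    ∀ᶠ i in F,
      IsGenerating K {0}ᶜ (cutoffGen χ D (G i)) (cutoffGenCovec χ D (G i))
        (cutoffGenVec χ D (G i)) ∧
      (∀ q P P', ‖cutoffGenCovec χ D (G i) (q, P) - cutoffGenCovec χ D (G i) (q, P')‖ ≤
        δ * ‖P - P'‖) ∧
      ∀ q q' P, ‖cutoffGenVec χ D (G i) (q, P) - cutoffGenVec χ D (G i) (q', P)‖ ≤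
        δ * ‖q - q'‖ := by
  have hKc : IsCompact K := hc.isCompact.of_isClosed_subset hc.isClosed (hc.subset.trans interior_subset)
  have hs := eventually_isFibreShiftSmall hc.isCompact hG hl
  have h1 := SConv.eventually_lipschitz_snd (u := fun i => cutoffGenCovec χ D (G i)) hKc hδ
    (fun x _ hx => (SConv.cutoff_of_ne_zero hc hG hl hx).1) (by
      filter_upwards [hl, hs] with i hi hi' x c hc' using hi.cutoffGenCovec_smul hi' x hc')
  have h2 := SConv.eventually_lipschitz_fst (u := fun i => cutoffGenVec χ D (G i)) hKc hδ
    (fun x _ hx => (SConv.cutoff_of_ne_zero hc hG hl hx).2) (by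
      filter_upwards [hl, hs] with i hi hi' x c hc' using hi.cutoffGenVec_smul hi' x hc')
    (fun i x hx => (cutoff_eq_zero hc.isClosed hc.eq_zero _ x hx).2)
  filter_upwards [hl, hs, h1, h2] with i hi hi' h3 h4
  have h5 := hi.isGenerating hi' hc.isClosed hc.subset hc.smooth hc.eq_zero
    (fun q hq P P' => (h3 q hq P P').trans (mul_le_mul_of_nonneg_right hδ' (norm_nonneg _)))
    (fun q q' P hP => (h4 q q' P hP).trans (mul_le_mul_of_nonneg_right hδ' (norm_nonneg _)))
  refine ⟨h5, fun q P P' => ?_, fun q q' P => ?_⟩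
  · by_cases hq : q ∈ K
    · exact h3 q hq P P'
    · rw [(h5.eq_zero (q, P) hq).1, (h5.eq_zero (q, P') hq).1, sub_self, norm_zero]
      positivity
  · by_cases hP : P = 0
    · rw [hP, h5.b_zero, h5.b_zero, sub_self, norm_zero]
      positivity
    · exact h4 q q' P hP

/-- The inverse symplectomorphism is `source` after the inverse of `target`, so a single shear has
to be inverted. Fragmentation composes with these inverses. -/
theorem SConv.toEquiv_symm {O : Set (Covec n)} {σ : ι → Phase n → ℝ} {a : ι → Phase n → Covec n}
    {b : ι → Phase n → Vec n} {E : ι → Phase n → Phase n} {x : Phase n}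
    (ha : SConv F 1 𝓘(ℝ, Phase n) 𝓘(ℝ, Covec n) a (fun _ => 0) x)
    (hb : SConv F 1 𝓘(ℝ, Phase n) 𝓘(ℝ, Vec n) b (fun _ => 0) x)
    (hE : ∀ᶠ i in F, ∃ h : IsGenerating K O (σ i) (a i) (b i), ∀ y, E i y = h.toEquiv.symm y) :
    SConv F 1 𝓘(ℝ, Phase n) 𝓘(ℝ, Phase n) E id x := by
  classical
  let T : ι → Phase n → Phase n := fun i =>
    if h : IsGenerating K O (σ i) (a i) (b i) then h.target.symm else id
  have hT : ∀ {i} (h : IsGenerating K O (σ i) (a i) (b i)), T i = h.target.symm :=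
    fun h => dif_pos h
  have h1 : SConv F 1 𝓘(ℝ, Phase n) 𝓘(ℝ, Phase n) T id x := by
    refine SConv.shear_symm (S := Submodule.prod ⊤ ⊥) (g := fun i y => ((b i y, 0) : Phase n)) ?_ ?_
    · have h2 : ContDiff ℝ ∞ (fun v : Vec n => ((v, 0) : Phase n)) := by fun_prop
      exact hb.map_contDiff h2
    · filter_upwards [hE] with i hi
      obtain ⟨h2, -⟩ := hi
      exact ⟨isContractingAlong_fst h2.b_le, fun y => congrFun (hT h2) y⟩
  have h2 : SConv F 1 𝓘(ℝ, Phase n) 𝓘(ℝ, Phase n) (fun i y => ((y.1, y.2 + a i y) : Phase n))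
      id x := by
    have h3 : ContDiff ℝ ∞ (fun p : Phase n × Covec n => ((p.1.1, p.1.2 + p.2) : Phase n)) := by
      fun_prop
    refine ((SConv.of_id.prodMk_vec ha).map_contDiff h3).congr (Filter.Eventually.of_forall
      fun p => rfl) (Filter.Eventually.of_forall fun y => ?_)
    exact Prod.ext rfl (add_zero _).symm
  refine (SConv.comp (g := fun i y => ((y.1, y.2 + a i y) : Phase n)) (g₀ := id) h2 h1).congr ?_
    (Filter.EventuallyEq.refl _ _)
  filter_upwards [Filter.tendsto_fst.eventually hE] with p ⟨h3, h4⟩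
  rw [h4, hT h3, ← h3.source_apply]
  rfl

end LocalConvergence

/-! ### Where the localized symplectomorphism agrees with the given one. -/

section LocalEquality
variable {n : ℕ} {D K : Set (Vec n)} {G : Phase n → Phase n} {χ : Vec n → ℝ} {O : Set (Covec n)}

/-- Where χ is locally `1` its derivative vanishes, so a = p - P and b = Q - q, and the relation (q,
P + a) ↦ (q + b, P) is the original map. -/
theorem IsGenerating.toEquiv_eq_of_cutoff_eq_one
    (h : IsGenerating K O (cutoffGen χ D G) (cutoffGenCovec χ D G) (cutoffGenVec χ D G))
    (hs : IsFibreShiftSmall D G) {x : Phase n} (hx : x.1 ∈ D) (hχ : χ =ᶠ[𝓝 x.1] fun _ => 1) :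
    h.toEquiv x = G x := by
  have h1 := h.toEquiv_apply (x.1, (G x).2)
  have h2 := hs.fibreInverse_of_map hx
  have h3 : fderiv ℝ χ x.1 = 0 := by
    rw [hχ.fderiv_eq, fderiv_fun_const]
    rfl
  rw [cutoffGenCovec, cutoffGenVec, mixedMap, h2] at h1
  simp only [hχ.self_of_nhds, h3, one_smul, smul_zero, add_zero, add_sub_cancel] at h1
  exact h1

/-- At a fixed point of G both displacements are zero, so a and b vanish whatever χ does.
Localization therefore does not disturb fibres that are already fixed. -/
theorem IsGenerating.toEquiv_eq_self_of_cutoff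
    (h : IsGenerating K O (cutoffGen χ D G) (cutoffGenCovec χ D G) (cutoffGenVec χ D G))
    (hs : IsFibreShiftSmall D G) {x : Phase n} (hx : x.1 ∈ D) (hG : G x = x) :
    h.toEquiv x = x := by
  have h2 := hs.fibreInverse_of_map hx
  rw [hG] at h2
  refine h.toEquiv_eq_self ?_ ?_
  · rw [cutoffGenCovec, mixedMap, h2, hG]
    simp
  · rw [cutoffGenVec, mixedMap, h2, hG, sub_self, smul_zero]

end LocalEquality

/-! ## Homogeneous symplectomorphisms near the identity preserve shapes -/

section Fragmentation
variable {n : ℕ} {X : Type u} [TopologicalSpace X]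
  [ChartedSpace (EuclideanSpace ℝ (Fin n)) X] [IsManifold (𝓡 n) ∞ X]

theorem ConicSymplecto.map_dilate' (G : ConicSymplecto n X) (z : CotangentBundle n X) {c : ℝ}
    (hc : 0 < c) : G.toEquiv (dilate c z) = dilate c (G.toEquiv z) := by
  by_cases hz : z.2 = 0
  · rw [G.map_zero z hz, G.map_zero (dilate c z) (by
      change c • z.2 = 0
      rw [hz]
      exact smul_zero c)]
  · exact G.map_dilate z c hc hz

theorem ofCoords_zero (x₀ : X) (q : Vec n) : (ofCoords x₀ (q, 0) : CotangentBundle n X).2 = 0 := rfl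

theorem ofCoords_snd_ne_zero (x₀ : X) {x : Phase n} (hx : x.1 ∈ (chartAt (Vec n) x₀).target)
    (hx' : x.2 ≠ 0) : (ofCoords x₀ x : CotangentBundle n X).2 ≠ 0 :=
  coords_covector_ne _ _ hx' ((chartAt (Vec n) x₀).map_target hx)

/-- The coordinate expression of a homogeneous symplectomorphism. -/
def localExpr (x₀ : X) (G : ConicSymplecto n X) (x : Phase n) : Phase n :=
  covectorChart x₀ (G.toEquiv (ofCoords x₀ x))

theorem isLocalSymplecto_localExpr (x₀ : X) (G : ConicSymplecto n X) {D : Set (Vec n)}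
    (hD : D ⊆ (chartAt (Vec n) x₀).target)
    (h : ∀ x : Phase n, x.1 ∈ D → x.2 ≠ 0 →
      (G.toEquiv (ofCoords x₀ x)).1 ∈ (chartAt (Vec n) x₀).source) :
    IsLocalSymplecto D (localExpr x₀ G) := by
  refine ⟨fun q hq => ?_, fun x c hc => ?_, fun x hx hx' => ?_, fun x hx hx' w => ?_⟩
  · rw [localExpr, G.map_zero _ (ofCoords_zero x₀ q)]
    exact covectorChart_ofCoords x₀ (hD hq)
  · rw [localExpr, ofCoords_smul, G.map_dilate' _ hc, covectorChart_dilate]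
    rfl
  · exact ((contMDiffAt_covectorChart x₀ (h x hx hx')).comp x
      ((G.smooth _ (ofCoords_snd_ne_zero x₀ (hD hx) hx')).comp x
        (contMDiffAt_ofCoords x₀ (hD hx)))).contDiffAt
  · have h1 := contMDiffAt_ofCoords x₀ (hD hx)
    have h2 := G.smooth _ (ofCoords_snd_ne_zero x₀ (hD hx) hx')
    have h3 := contMDiffAt_covectorChart x₀ (h x hx hx')
    have h4 := mfderiv_comp x (I' := cotangentModel n) (I'' := cotangentModel n)
      (g := G.toEquiv) (f := ofCoords x₀) (h2.mdifferentiableAt (by simp))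
      (h1.mdifferentiableAt (by simp))
    have h5 := mfderiv_comp x (I' := cotangentModel n) (I'' := 𝓘(ℝ, Phase n))
      (g := covectorChart x₀) (f := G.toEquiv ∘ ofCoords x₀) (h3.mdifferentiableAt (by simp))
      ((h2.comp x h1).mdifferentiableAt (by simp))
    rw [mfderiv_eq_fderiv] at h5
    set u : Phase n := mfderiv 𝓘(ℝ, Phase n) (cotangentModel n) (ofCoords x₀) x w with hu
    have h6 : fderiv ℝ (localExpr x₀ G) x w =
        (show Phase n →L[ℝ] Phase n from mfderiv (cotangentModel n) 𝓘(ℝ, Phase n)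
          (covectorChart x₀) (G.toEquiv (ofCoords x₀ x)))
        ((show Phase n →L[ℝ] Phase n from
          mfderiv (cotangentModel n) (cotangentModel n) G.toEquiv (ofCoords x₀ x)) u) :=
      (congrArg (fun L : Phase n →L[ℝ] Phase n => L w) h5).trans
        (congrArg (fun L : Phase n →L[ℝ] Phase n =>
          (show Phase n →L[ℝ] Phase n from mfderiv (cotangentModel n) 𝓘(ℝ, Phase n)
          (covectorChart x₀) (G.toEquiv (ofCoords x₀ x))) (L w)) h4)
    rw [h6]
    have h7 := liouvilleForm_eq x₀ (h x hx hx')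
      ((show Phase n →L[ℝ] Phase n from
          mfderiv (cotangentModel n) (cotangentModel n) G.toEquiv (ofCoords x₀ x)) u)
    refine Eq.trans h7.symm ?_
    have h8 := congrArg (fun L : Phase n →L[ℝ] ℝ => L u)
      (G.liouville _ (ofCoords_snd_ne_zero x₀ (hD hx) hx'))
    exact h8.trans (liouvilleForm_ofCoords x₀ (hD hx) w)

variable {ι : Type u} {F : Filter ι} {G : ι → ConicSymplecto n X}

theorem SConv.localExpr (x₀ : X) {x : Phase n} (hx : x.1 ∈ (chartAt (Vec n) x₀).target)
    (hG : SConv F 1 (cotangentModel n) (cotangentModel n) (fun i => (G i).toEquiv) id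
      (ofCoords x₀ x)) :
    SConv F 1 𝓘(ℝ, Phase n) 𝓘(ℝ, Phase n) (fun i => localExpr x₀ (G i)) id x := by
  have h1 := (hG.precomp (eventually_contMDiffAt_ofCoords x₀ hx)).map
    (g := covectorChart x₀) (J' := 𝓘(ℝ, Phase n)) (eventually_contMDiffAt_covectorChart x₀
      ((chartAt (Vec n) x₀).map_target hx))
  refine h1.congr (Filter.Eventually.of_forall fun p => rfl) ?_
  filter_upwards [eventually_mem_chart_target x₀ hx] with y hy
  exact (covectorChart_ofCoords x₀ hy).symm

/-- Homogeneity reduces the claim to unit covectors over D, which form a compact set, and to the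
zero section, which is fixed. -/
theorem eventually_map_mem_source (x₀ : X) {D : Set (Vec n)} (hDc : IsCompact D)
    (hD : D ⊆ (chartAt (Vec n) x₀).target)
    (hG : ∀ z : CotangentBundle n X, z.2 ≠ 0 →
      SConv F 1 (cotangentModel n) (cotangentModel n) (fun i => (G i).toEquiv) id z) :
    ∀ᶠ i in F, ∀ x : Phase n, x.1 ∈ D →
      ((G i).toEquiv (ofCoords x₀ x)).1 ∈ (chartAt (Vec n) x₀).source := by
  have h1 := eventually_forall_mem_of_isCompact (F := F)
    (hDc.prod (isCompact_sphere (0 : Covec n) 1)) (P := fun i x =>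
      ((G i).toEquiv (ofCoords x₀ x)).1 ∈ (chartAt (Vec n) x₀).source) (by
    rintro x ⟨hx, hP⟩
    have hx' : x.2 ≠ 0 := ne_zero_of_mem_unit_sphere (⟨x.2, hP⟩ : Metric.sphere (0 : Covec n) 1)
    have h2 := (hG _ (ofCoords_snd_ne_zero x₀ (hD hx) hx')).tendsto
    have h3 : Filter.Tendsto (fun p : ι × Phase n => (p.1, (ofCoords x₀ p.2 : CotangentBundle n X)))
        (F ×ˢ 𝓝 x) (F ×ˢ 𝓝 (ofCoords x₀ x)) :=
      Filter.tendsto_id.prodMap (contMDiffAt_ofCoords x₀ (hD hx)).continuousAt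
    exact (h2.comp h3).eventually (eventually_proj_mem (chartAt (Vec n) x₀).open_source
      ((chartAt (Vec n) x₀).map_target (hD hx))))
  filter_upwards [h1] with i hi x hx
  by_cases hx' : x.2 = 0
  · rw [(G i).map_zero _ (by
      rw [show x = (x.1, 0) from Prod.ext rfl hx']
      exact ofCoords_zero x₀ x.1)]
    exact (chartAt (Vec n) x₀).map_target (hD hx)
  · have h2 := hi (x.1, ‖x.2‖⁻¹ • x.2) ⟨hx, mem_sphere_zero_iff_norm.2 (norm_smul_inv_norm hx')⟩
    rwa [ofCoords_smul, (G i).map_dilate' _ (inv_pos.2 (norm_pos_iff.2 hx'))] at h2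

theorem glueFun_eq_of_toEquiv_eq_localExpr {x₀ : X} {K : Set (Vec n)} {O : Set (Covec n)}
    {σ : Phase n → ℝ} {a : Phase n → Covec n} {b : Phase n → Vec n} (h : IsGenerating K O σ a b)
    (G : ConicSymplecto n X) {z : CotangentBundle n X} (hz : z.1 ∈ (chartAt (Vec n) x₀).source)
    (hz' : (G.toEquiv z).1 ∈ (chartAt (Vec n) x₀).source)
    (hG : h.toEquiv (covectorChart x₀ z) = SymplecticShape.localExpr x₀ G (covectorChart x₀ z)) :
    glueFun x₀ K h.toEquiv z = G.toEquiv z := by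
  rw [glueFun_of_mem_source (fun _ hx => h.toEquiv_of_notMem hx) hz, hG,
    SymplecticShape.localExpr, ofCoords_covectorChart x₀ hz, ofCoords_covectorChart x₀ hz']

theorem SConv.glueFun [T2Space X] {x₀ : X} {K : Set (Vec n)} (hKc : IsCompact K)
    (hK : K ⊆ (chartAt (Vec n) x₀).target) {E : ι → Phase n → Phase n}
    (hE : ∀ᶠ i in F, ∀ x : Phase n, x.1 ∉ K → E i x = x) {z : CotangentBundle n X}
    (h : z.1 ∈ (chartAt (Vec n) x₀).source →
      SConv F 1 𝓘(ℝ, Phase n) 𝓘(ℝ, Phase n) E id (covectorChart x₀ z)) :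
    SConv F 1 (cotangentModel n) (cotangentModel n) (fun i => glueFun x₀ K (E i)) id z := by
  by_cases hz : z.1 ∈ (chartAt (Vec n) x₀).source
  · have h1 := ((h hz).precomp (eventually_contMDiffAt_covectorChart x₀ hz)).map
      (g := ofCoords x₀) (J' := cotangentModel n) (eventually_contMDiffAt_ofCoords x₀
      ((chartAt (Vec n) x₀).map_source hz))
    have h2 := eventually_proj_mem (chartAt (Vec n) x₀).open_source hz
    refine h1.congr ?_ ?_
    · filter_upwards [Filter.tendsto_fst.eventually hE, Filter.tendsto_snd.eventually h2]
        with p hp hp' using glueFun_of_mem_source hp hp'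
    · filter_upwards [h2] with y hy
      exact (ofCoords_covectorChart x₀ hy).symm
  · have h1 : SConv F 1 (cotangentModel n) (cotangentModel n)
      (fun (_ : ι) => (id : CotangentBundle n X → CotangentBundle n X)) id z :=
        SConv.const (Filter.Eventually.of_forall fun y => contMDiffAt_id)
    refine h1.congr ?_ (Filter.EventuallyEq.refl _ _)
    have h2 := eventually_proj_mem (isClosed_image_symm hKc hK).isOpen_compl
      (z := z) fun hk => hz (mem_source_of_mem_image hK hk)
    filter_upwards [Filter.tendsto_snd.eventually h2] with p hp using glueFun_of_notMem hp

-- One step of the fragmentation. The set A depends only on `x₀`, so a cover can be chosen before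
-- the family. Convergence is asserted for the inverses of H because the next step works with H⁻¹G,
-- and the last clause keeps what earlier steps achieved.
set_option maxHeartbeats 800000 in
theorem exists_localization [T2Space X] (x₀ : X) : ∃ A : Set X, IsOpen A ∧ x₀ ∈ A ∧
    ∀ {ι : Type u} {F : Filter ι} {G : ι → ConicSymplecto n X},
    (∀ z : CotangentBundle n X, z.2 ≠ 0 →
      SConv F 1 (cotangentModel n) (cotangentModel n) (fun i => (G i).toEquiv) id z) →
    ∃ H : ι → ConicSymplecto n X, (∀ᶠ i in F, (H i).IsShapeInvariant) ∧
      (∀ z : CotangentBundle n X, z.2 ≠ 0 →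
        SConv F 1 (cotangentModel n) (cotangentModel n) (fun i => (H i).toEquiv.symm) id z) ∧
      (∀ᶠ i in F, ∀ z : CotangentBundle n X, z.1 ∈ A → (H i).toEquiv z = (G i).toEquiv z) ∧
      ∀ᶠ i in F, ∀ x : X, (∀ z : CotangentBundle n X, z.1 = x → (G i).toEquiv z = z) →
        ∀ z : CotangentBundle n X, z.1 = x → (H i).toEquiv z = z := by
  obtain ⟨r, hr, hrt, hprim⟩ := exists_local_primitive (I := 𝓡 n) x₀
  obtain ⟨δ, hδ, hδ', hinv⟩ := exists_isShapeInvariant_toConicSymplecto (X := X) n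
  set φ := chartAt (Vec n) x₀ with hφ
  have hrt : Metric.ball (φ x₀) r ⊆ φ.target := by simpa using hrt
  -- Nested balls: χ is `1` up to radius r/4, the support K has radius r/2, the maps are inverted
  -- fibrewise over D of radius 3r/4, and closed forms have primitives on radius r.
  let χ : ContDiffBump (φ x₀) := ⟨r / 4, r / 2, by positivity, by linarith⟩
  set D := Metric.closedBall (φ x₀) (3 * r / 4)
  set K := Metric.closedBall (φ x₀) (r / 2)
  have hDt : D ⊆ φ.target := (Metric.closedBall_subset_ball (by linarith)).trans hrt
  have hKD : K ⊆ interior D := (Metric.closedBall_subset_ball (by linarith)).trans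
    (interior_maximal Metric.ball_subset_closedBall Metric.isOpen_ball)
  have hKt : K ⊆ φ.target := (hKD.trans interior_subset).trans hDt
  have hKc : IsCompact K := isCompact_closedBall _ _
  have hc : IsCutoffOn D K χ := ⟨isCompact_closedBall _ _, Metric.isClosed_closedBall, hKD,
    χ.contDiff, fun q hq => χ.zero_of_le_dist (not_le.1 hq).le⟩
  have hprim' : HasPrimitives (n := n) (chartBall (𝓡 n) x₀ r) := hprim
  have hKN : φ.symm '' K ⊆ chartBall (𝓡 n) x₀ r := by
    rintro _ ⟨q, hq, rfl⟩
    refine ⟨by simpa using φ.map_target (hKt hq), ?_⟩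
    simp only [mem_preimage]
    have h1 : φ (φ.symm q) ∈ Metric.ball (φ x₀) r := by
      rw [φ.right_inv (hKt hq)]
      exact Metric.closedBall_subset_ball (by linarith) hq
    simpa using h1
  refine ⟨φ.source ∩ φ ⁻¹' Metric.ball (φ x₀) (r / 4),
    φ.isOpen_inter_preimage Metric.isOpen_ball, ⟨mem_chart_source _ _,
    Metric.mem_ball_self (by positivity)⟩, ?_⟩
  intro ι F G hG
  have hĜ : ∀ x : Phase n, x.1 ∈ D → x.2 ≠ 0 →
      SConv F 1 𝓘(ℝ, Phase n) 𝓘(ℝ, Phase n) (fun i => localExpr x₀ (G i)) id x :=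
    fun x hx hx' => SConv.localExpr x₀ (hDt hx) (hG _ (ofCoords_snd_ne_zero x₀ (hDt hx) hx'))
  have hmem := eventually_map_mem_source x₀ hc.isCompact hDt hG
  have hl : ∀ᶠ i in F, IsLocalSymplecto D (localExpr x₀ (G i)) := hmem.mono fun i hi =>
    isLocalSymplecto_localExpr x₀ (G i) hDt fun x hx _ => hi x hx
  have hs := eventually_isFibreShiftSmall hc.isCompact hĜ hl
  let σ := fun i => cutoffGen χ D (localExpr x₀ (G i))
  let a := fun i => cutoffGenCovec χ D (localExpr x₀ (G i))
  let b := fun i => cutoffGenVec χ D (localExpr x₀ (G i))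
  have key : ∀ᶠ i in F, ∃ (H : ConicSymplecto n X) (h : IsGenerating K {0}ᶜ (σ i) (a i) (b i)),
      H.IsShapeInvariant ∧ IsFibreShiftSmall D (localExpr x₀ (G i)) ∧
      (H.toEquiv : CotangentBundle n X → _) = glueFun x₀ K h.toEquiv ∧
      (H.toEquiv.symm : CotangentBundle n X → _) = glueFun x₀ K h.toEquiv.symm := by
    filter_upwards [hl, hs, eventually_isGenerating hc hĜ hl hδ hδ'] with i hi hi' ⟨h1, h2, h3⟩
    exact ⟨h1.toConicSymplecto hKc hKt (fun x => by simp [cutoffGen, cutoffGenVec])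
      (fun x c hc => hi.cutoffGenCovec_smul hi' x hc) (fun x c hc => hi.cutoffGenVec_smul hi' x hc),
      h1, hinv _ _ _ _ _ _ hprim' hKN h2 h3, hi', rfl, rfl⟩
  classical
  -- The identity is a filler for indices at which the generating function is not yet small; every
  -- assertion about H is eventual.
  let H : ι → ConicSymplecto n X := fun i =>
    if h : ∃ (H : ConicSymplecto n X) (h : IsGenerating K {0}ᶜ (σ i) (a i) (b i)),
      H.IsShapeInvariant ∧ IsFibreShiftSmall D (localExpr x₀ (G i)) ∧
      (H.toEquiv : CotangentBundle n X → _) = glueFun x₀ K h.toEquiv ∧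
      (H.toEquiv.symm : CotangentBundle n X → _) = glueFun x₀ K h.toEquiv.symm
    then h.choose else ConicSymplecto.refl n X
  have hH : ∀ᶠ i in F, ∃ h : IsGenerating K {0}ᶜ (σ i) (a i) (b i),
      (H i).IsShapeInvariant ∧ IsFibreShiftSmall D (localExpr x₀ (G i)) ∧
      ((H i).toEquiv : CotangentBundle n X → _) = glueFun x₀ K h.toEquiv ∧
      ((H i).toEquiv.symm : CotangentBundle n X → _) = glueFun x₀ K h.toEquiv.symm := by
    filter_upwards [key] with i hi
    have h1 : H i = hi.choose := dif_pos hi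
    rw [h1]
    exact hi.choose_spec
  refine ⟨H, hH.mono fun i ⟨_, h, _⟩ => h, fun z hz => ?_, ?_, ?_⟩
  · let E : ι → Phase n → Phase n := fun i =>
      if h : IsGenerating K {0}ᶜ (σ i) (a i) (b i) then h.toEquiv.symm else id
    have hE : ∀ i (h : IsGenerating K {0}ᶜ (σ i) (a i) (b i)), E i = h.toEquiv.symm :=
      fun i h => dif_pos h
    have h1 : SConv F 1 (cotangentModel n) (cotangentModel n) (fun i => glueFun x₀ K (E i)) id z := by
      refine SConv.glueFun hKc hKt ?_ fun hzs => ?_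
      · filter_upwards [hH] with i ⟨h, _⟩ x hx
        rw [hE i h]
        exact IsGenerating.notMem_of_glueFun h.toEquiv (fun x hx => h.toEquiv_of_notMem hx) x hx
      · obtain ⟨h2, h3⟩ := SConv.cutoff_of_ne_zero hc hĜ hl (x := covectorChart x₀ z)
          (coords_ne_zero hzs hz)
        exact SConv.toEquiv_symm (σ := σ) h2 h3 (hH.mono fun i ⟨h, _⟩ => ⟨h, congrFun (hE i h)⟩)
    refine h1.congr ?_ (Filter.EventuallyEq.refl _ _)
    filter_upwards [Filter.tendsto_fst.eventually hH] with p ⟨h, _, _, _, h2⟩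
    rw [hE _ h, h2]
  · filter_upwards [hH, hmem] with i ⟨h, _, h1, h2, _⟩ h3 z ⟨hz, hzA⟩
    have hzD : φ z.1 ∈ D := (Metric.ball_subset_closedBall.trans
      (Metric.closedBall_subset_closedBall (by linarith))) hzA
    have h4 : χ =ᶠ[𝓝 (covectorChart x₀ z).1] fun _ => 1 := χ.eventuallyEq_one_of_mem_ball hzA
    have h5 := h3 (covectorChart x₀ z) hzD
    rw [ofCoords_covectorChart x₀ hz] at h5
    rw [h2]
    exact glueFun_eq_of_toEquiv_eq_localExpr h (G i) hz h5
      (h.toEquiv_eq_of_cutoff_eq_one h1 hzD h4)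
  · filter_upwards [hH] with i ⟨h, _, h1, h2, _⟩ x hx z hz
    rw [h2]
    by_cases hs : z.1 ∈ φ.source ∧ φ z.1 ∈ K
    · have h3 : localExpr x₀ (G i) (covectorChart x₀ z) = covectorChart x₀ z := by
        rw [localExpr, ofCoords_covectorChart x₀ hs.1, hx z hz]
      have h4 : (covectorChart x₀ z).1 ∈ D := interior_subset (hKD hs.2)
      have h5 := h.toEquiv_eq_self_of_cutoff h1 h4 h3
      exact (if_pos hs).trans ((congrArg (ofCoords x₀) h5).trans (ofCoords_covectorChart x₀ hs.1))
    · exact if_neg hs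

end Fragmentation

/-! ## Invariance of shapes near the identity -/

section Invariance
variable {n : ℕ} {X : Type u} [TopologicalSpace X]
  [ChartedSpace (EuclideanSpace ℝ (Fin n)) X] [IsManifold (𝓡 n) ∞ X]

theorem ConicSymplecto.IsShapeInvariant.congr {G G' : ConicSymplecto n X} (h : G.IsShapeInvariant)
    (h' : ∀ z, G'.toEquiv z = G.toEquiv z) : G'.IsShapeInvariant := fun U hU => by
  rw [image_congr fun z _ => h' z, h U hU]

theorem ConicSymplecto.isShapeInvariant_refl :
    (ConicSymplecto.refl n X).IsShapeInvariant := fun U _ => congrArg shape (image_id U)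

/-- Induction on the sets over which G may move covectors. H takes over what happens over the first
set, H⁻¹G is close to the identity and acts only over the remaining ones, and G is the product of H
with H⁻¹G. -/
theorem eventually_isShapeInvariant_of_list [T2Space X] {A : X → Set X}
    (hA : ∀ x₀ : X, ∀ {ι : Type u} {F : Filter ι} {G : ι → ConicSymplecto n X},
    (∀ z : CotangentBundle n X, z.2 ≠ 0 →
      SConv F 1 (cotangentModel n) (cotangentModel n) (fun i => (G i).toEquiv) id z) →
    ∃ H : ι → ConicSymplecto n X, (∀ᶠ i in F, (H i).IsShapeInvariant) ∧
      (∀ z : CotangentBundle n X, z.2 ≠ 0 →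
        SConv F 1 (cotangentModel n) (cotangentModel n) (fun i => (H i).toEquiv.symm) id z) ∧
      (∀ᶠ i in F, ∀ z : CotangentBundle n X, z.1 ∈ A x₀ → (H i).toEquiv z = (G i).toEquiv z) ∧
      ∀ᶠ i in F, ∀ x : X, (∀ z : CotangentBundle n X, z.1 = x → (G i).toEquiv z = z) →
        ∀ z : CotangentBundle n X, z.1 = x → (H i).toEquiv z = z)
    {ι : Type u} {F : Filter ι} (l : List X) {G : ι → ConicSymplecto n X}
    (hG : ∀ z : CotangentBundle n X, z.2 ≠ 0 →
      SConv F 1 (cotangentModel n) (cotangentModel n) (fun i => (G i).toEquiv) id z)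
    (hl : ∀ᶠ i in F, ∀ z : CotangentBundle n X, (∀ x ∈ l, z.1 ∉ A x) → (G i).toEquiv z = z) :
    ∀ᶠ i in F, (G i).IsShapeInvariant := by
  induction l generalizing G with
  | nil =>
    filter_upwards [hl] with i hi
    exact ConicSymplecto.isShapeInvariant_refl.congr fun z => hi z (by simp)
  | cons x₀ l ih =>
    obtain ⟨H, h1, h2, h3, h4⟩ := hA x₀ hG
    have h5 : ∀ᶠ i in F, ((G i).trans (H i).symm).IsShapeInvariant := by
      refine ih (fun z hz => SConv.comp (g := fun i => (H i).toEquiv.symm) (g₀ := id)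
        (h2 z hz) (hG z hz)) ?_
      filter_upwards [h3, h4, hl] with i h3 h4 hl z hz
      change (H i).toEquiv.symm ((G i).toEquiv z) = z
      rw [Equiv.symm_apply_eq]
      -- Over the first set H equals G. Off all sets of the longer list G fixes the whole fibre,
      -- hence so does H.
      by_cases hzA : z.1 ∈ A x₀
      · exact (h3 z hzA).symm
      · have h6 : ∀ w : CotangentBundle n X, w.1 = z.1 → (G i).toEquiv w = w := fun w hw =>
          hl w fun x hx => by
            rw [hw]
            rcases List.mem_cons.1 hx with rfl | hx
            exacts [hzA, hz x hx]
        rw [h6 z rfl, h4 z.1 h6 z rfl]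
    filter_upwards [h1, h5] with i h1 h5
    exact (h5.trans h1).congr fun z => ((H i).toEquiv.apply_symm_apply _).symm

/-- Homogeneous symplectomorphisms that are `C¹`-close to the identity preserve shapes. -/
theorem eventually_isShapeInvariant [T2Space X] [CompactSpace X] {ι : Type u} {F : Filter ι}
    {G : ι → ConicSymplecto n X} (hG : ∀ z : CotangentBundle n X, z.2 ≠ 0 →
      SConv F 1 (cotangentModel n) (cotangentModel n) (fun i => (G i).toEquiv) id z) :
    ∀ᶠ i in F, (G i).IsShapeInvariant := by
  choose A hAo hA h using fun x : X => exists_localization (n := n) x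
  obtain ⟨t, ht⟩ := isCompact_univ.elim_finite_subcover A hAo
    (fun x _ => mem_iUnion.2 ⟨x, hA x⟩)
  refine eventually_isShapeInvariant_of_list (A := A) (fun x => h x) t.toList hG
    (Filter.Eventually.of_forall fun i z hz => ?_)
  obtain ⟨x, hx⟩ := mem_iUnion.1 (ht (mem_univ z.1))
  obtain ⟨hxt, hx⟩ := mem_iUnion.1 hx
  exact absurd hx (hz x (Finset.mem_toList.2 hxt))

end Invariance

/-! ## The groups of diffeomorphisms and contactomorphisms -/

section Groups
variable {n : ℕ} {X : Type u} [TopologicalSpace X]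
  [ChartedSpace (EuclideanSpace ℝ (Fin n)) X] [IsManifold (𝓡 n) ∞ X]

/-- A locally constant function is constant on connected components. This replaces isotopies
throughout. -/
theorem apply_eq_of_mem_connectedComponent {α β : Type*} [TopologicalSpace α] {f : α → β}
    (hf : ∀ x, ∀ᶠ y in 𝓝 x, f y = f x) {x y : α} (h : y ∈ connectedComponent x) : f y = f x :=
  (IsLocallyConstant.iff_eventually_eq f).2 hf |>.apply_eq_of_isPreconnected
    isPreconnected_connectedComponent h mem_connectedComponent

theorem exists_connectedComponents_lift {α β : Type*} [TopologicalSpace α] {f : α → β}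
    (hf : ∀ x, ∀ y ∈ connectedComponent x, f y = f x) :
    ∃ g : ConnectedComponents α → β, ∀ x, g (ConnectedComponents.mk x) = f x :=
  ⟨Quotient.lift f fun x y h => hf y x (by
    have h' : connectedComponent x = connectedComponent y := h
    exact h' ▸ mem_connectedComponent), fun _ => rfl⟩

theorem Contactomorphism.ext' {f g : Contactomorphism n X} (h : ∀ y, f.1 y = g.1 y) : f = g :=
  Subtype.ext (Diffeomorph.ext h)

theorem ContactForm.ext' {α β : ContactForm n X} (h : α.form = β.form) : α = β := by
  cases α
  cases β
  congr

theorem Contactomorphism.pushforward_trans (f g : Contactomorphism n X) (α : ContactForm n X) :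
    (f.trans g).pushforward α = g.pushforward (f.pushforward α) :=
  ContactForm.ext' (pullback_comp (I := 𝓘(ℝ, Model n)) f.1.symm.contMDiff g.1.symm.contMDiff α.form)

theorem Contactomorphism.sConv (f₀ : Contactomorphism n X) (k : ℕ) (y : ContactElementSpace n X) :
    SConv (𝓝 f₀) k 𝓘(ℝ, Model n) 𝓘(ℝ, Model n) (fun f : Contactomorphism n X => f.1) f₀.1 y :=
  tendsto_diffeomorph_iff.1 (continuous_subtype_val.tendsto f₀) k y

theorem Contactomorphism.continuous_trans_left (g : Contactomorphism n X) :
    Continuous fun f : Contactomorphism n X => g.trans f := by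
  refine continuous_iff_continuousAt.2 fun f₀ => ?_
  rw [ContinuousAt, tendsto_subtype_rng, tendsto_diffeomorph_iff]
  intro k y
  exact (f₀.sConv k (g.1 y)).precomp (Filter.Eventually.of_forall fun y => g.1.contMDiff y)

theorem Contactomorphism.continuous_trans_right (g : Contactomorphism n X) :
    Continuous fun f : Contactomorphism n X => f.trans g := by
  refine continuous_iff_continuousAt.2 fun f₀ => ?_
  rw [ContinuousAt, tendsto_subtype_rng, tendsto_diffeomorph_iff]
  intro k y
  exact (f₀.sConv k y).map (Filter.Eventually.of_forall fun y => g.1.contMDiff y)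

theorem Contactomorphism.symm_trans (f : Contactomorphism n X) :
    f.symm.trans f = Contactomorphism.refl n X :=
  Contactomorphism.ext' fun y => f.1.apply_symm_apply y

theorem Contactomorphism.symm_trans_trans (f g : Contactomorphism n X) :
    f.trans (f.symm.trans g) = g :=
  Contactomorphism.ext' fun y => congrArg g.1 (f.1.symm_apply_apply y)

/-- The mapping class of a contactomorphism acts on classes of contact forms. -/
theorem mk_pushforward_eq_of_mem_connectedComponent {f g : Contactomorphism n X}
    (h : g ∈ connectedComponent f) (α : ContactForm n X) :
    (Quot.mk _ (g.pushforward α) : ContactFormClass n X) = Quot.mk _ (f.pushforward α) := by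
  refine (Quot.sound ⟨f.symm.trans g, ?_, ?_⟩).symm
  · have h1 := (Contactomorphism.continuous_trans_left f.symm).mapsTo_connectedComponent f h
    rwa [Contactomorphism.symm_trans] at h1
  · rw [← Contactomorphism.pushforward_trans, Contactomorphism.symm_trans_trans]

/-- Right translation by `g` is continuous and sends the identity component into the component of
`g`, so g ∘ f and g lie in one component. -/
theorem mk_pushforward_pushforward {f : Contactomorphism n X}
    (h : f ∈ connectedComponent (Contactomorphism.refl n X)) (g : Contactomorphism n X)
    (α : ContactForm n X) :
    (Quot.mk _ (g.pushforward α) : ContactFormClass n X) =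
      Quot.mk _ (g.pushforward (f.pushforward α)) := by
  rw [← Contactomorphism.pushforward_trans]
  refine (mk_pushforward_eq_of_mem_connectedComponent (f := g) ?_ α).symm
  have h1 := (Contactomorphism.continuous_trans_right g).mapsTo_connectedComponent _ h
  rwa [show (Contactomorphism.refl n X).trans g = g from
    Contactomorphism.ext' fun y => rfl] at h1

variable [T2Space X] [CompactSpace X]

/-- Local constancy at f₀ is reduced to the identity: f = (f ∘ f₀⁻¹) ∘ f₀, and the lift of f ∘ f₀⁻¹
is close to the identity when f is close to f₀. It is then applied to the conic neighbourhood given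
by the pushforward by f₀. -/
theorem eventually_shape_domain_eq (f₀ : Contactomorphism n X) (α : ContactForm n X) :
    ∀ᶠ f in 𝓝 f₀, shape (f.pushforward α).domain = shape (f₀.pushforward α).domain := by
  have h1 : ∀ᶠ f in 𝓝 f₀, (f₀.symm.trans f).conicLift.IsShapeInvariant := by
    refine eventually_isShapeInvariant fun z hz => ?_
    refine IsLift.sConv (f := fun f => (f₀.symm.trans f).1) (f₀ := id)
      (fun f => (f₀.symm.trans f).isLift_liftFun) isLift_id hz ?_
    -- Order two, because lifting costs one derivative and C¹-closeness of the lifts is required.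
    refine ((f₀.sConv 2 (f₀.symm.1 (toRay z hz))).precomp
      (Filter.Eventually.of_forall fun y => f₀.symm.1.contMDiff y)).congr
      (Filter.Eventually.of_forall fun p => rfl) (Filter.Eventually.of_forall fun y => ?_)
    exact (f₀.1.apply_symm_apply y).symm
  filter_upwards [h1] with f hf
  have h2 := domain_pushforward (f₀.symm.trans f) (f₀.pushforward α) (f₀.symm.trans f).lift
    (f₀.symm.trans f).isLift_liftFun fun z hz => by
      change ((f₀.symm.trans f).liftFun z).2 = 0
      rwa [(f₀.symm.trans f).liftFun_zero hz]
  rw [← Contactomorphism.pushforward_trans, Contactomorphism.symm_trans_trans] at h2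
  rw [h2]
  exact hf _ (f₀.pushforward α).isConicNhd_domain

/-- Shapes are invariant under contactomorphisms isotopic to the identity. -/
theorem shape_domain_pushforward {f : Contactomorphism n X}
    (h : f ∈ connectedComponent (Contactomorphism.refl n X)) (α : ContactForm n X) :
    shape (f.pushforward α).domain = shape α.domain := by
  have h1 := apply_eq_of_mem_connectedComponent
    (f := fun f : Contactomorphism n X => shape (f.pushforward α).domain)
    (fun f₀ => eventually_shape_domain_eq f₀ α) h
  refine h1.trans (congrArg (fun β : ContactForm n X => shape β.domain) (ContactForm.ext' ?_))
  funext y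
  change (α.form y).comp (mfderiv 𝓘(ℝ, Model n) 𝓘(ℝ, Model n) id y) = _
  rw [mfderiv_id]
  rfl

/-- For each fixed class c the value e^*c is locally constant in e; treating classes one at a time
avoids any topology or finiteness on cohomology. -/
theorem cohomologyEquiv_eq_of_mem_connectedComponent {e e' : X ≃ₘ⟮𝓡 n, 𝓡 n⟯ X}
    (h : e' ∈ connectedComponent e) : cohomologyEquiv e' = cohomologyEquiv e := by
  refine LinearEquiv.ext fun c => ?_
  refine apply_eq_of_mem_connectedComponent
    (f := fun e : X ≃ₘ⟮𝓡 n, 𝓡 n⟯ X => DeRhamH1.map e.toContMDiffMap c) (fun e₀ => ?_) h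
  refine eventually_map_eq (e := fun e : X ≃ₘ⟮𝓡 n, 𝓡 n⟯ X => e.toContMDiffMap)
    (e₀ := e₀.toContMDiffMap) (fun x => ?_) c
  exact ((tendsto_diffeomorph_iff (F := 𝓝 e₀) (f := id) (f₀ := e₀)).1
    Filter.tendsto_id 0 x).tendsto

theorem exists_shape_equivariance :
    ∃ (j : MappingClassGroup n X → ContactMappingClassGroup n X)
      (I : MappingClassGroup n X → (DeRhamH1 (𝓡 n) X ≃ₗ[ℝ] DeRhamH1 (𝓡 n) X))
      (act : ContactMappingClassGroup n X → ContactFormClass n X → ContactFormClass n X)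
      (Shape : ContactFormClass n X → Set (DeRhamH1 (𝓡 n) X)),
      (∀ e : X ≃ₘ⟮𝓡 n, 𝓡 n⟯ X, ∃ f : Contactomorphism n X, IsCanonicalLift e f ∧
          j (ConnectedComponents.mk e) = ConnectedComponents.mk f) ∧
      (∀ e : X ≃ₘ⟮𝓡 n, 𝓡 n⟯ X, ((I (ConnectedComponents.mk e)).symm :
          DeRhamH1 (𝓡 n) X →ₗ[ℝ] DeRhamH1 (𝓡 n) X) = DeRhamH1.map e.toContMDiffMap) ∧
      (∀ (f : Contactomorphism n X) (α : ContactForm n X),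
        act (ConnectedComponents.mk f) (Quot.mk _ α) = Quot.mk _ (f.pushforward α)) ∧
      (∀ α : ContactForm n X, Shape (Quot.mk _ α) = shape α.domain) ∧
      ∀ (u : MappingClassGroup n X) (a : ContactFormClass n X),
        Shape (act (j u) a) = I u '' Shape a := by
  obtain ⟨I, hI⟩ := exists_connectedComponents_lift
    (f := fun e : X ≃ₘ⟮𝓡 n, 𝓡 n⟯ X => (cohomologyEquiv e).symm)
    fun e e' h => congrArg LinearEquiv.symm (cohomologyEquiv_eq_of_mem_connectedComponent h)
  obtain ⟨act, hact⟩ := exists_connectedComponents_lift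
    (f := fun f : Contactomorphism n X => (Quot.lift
      (fun α => (Quot.mk _ (f.pushforward α) : ContactFormClass n X)) (by
        rintro α _ ⟨g, hg, rfl⟩
        exact mk_pushforward_pushforward hg f α) : ContactFormClass n X → ContactFormClass n X))
    fun f g h => funext fun a => by
      induction a using Quot.ind with
      | mk α => exact mk_pushforward_eq_of_mem_connectedComponent h α
  obtain ⟨j, hj⟩ := exists_connectedComponents_lift
    (f := fun e : X ≃ₘ⟮𝓡 n, 𝓡 n⟯ X =>
      (ConnectedComponents.mk (canonicalLift e) : ContactMappingClassGroup n X))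
    fun e e' h => ConnectedComponents.coe_eq_coe'.2
      (continuous_canonicalLift.mapsTo_connectedComponent e h)
  let Shape : ContactFormClass n X → Set (DeRhamH1 (𝓡 n) X) :=
    Quot.lift (fun α => shape α.domain) (by
      rintro α _ ⟨g, hg, rfl⟩
      exact (shape_domain_pushforward hg α).symm)
  refine ⟨j, I, act, Shape, fun e => ⟨_, isCanonicalLift_canonicalLift e, hj e⟩, fun e => ?_,
    fun f α => ?_, fun α => rfl, fun u a => ?_⟩
  · rw [hI]
    rfl
  · rw [hact]
  · induction a using Quot.ind with
    | mk α =>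
    obtain ⟨e, rfl⟩ := ConnectedComponents.surjective_coe u
    rw [hj, hact, hI]
    exact shape_domain_canonicalLift e α

end Groups

end SymplecticShape

end

theorem proposition3p2 {n : ℕ} {X : Type*} [TopologicalSpace X]
    [ChartedSpace (EuclideanSpace ℝ (Fin n)) X] [IsManifold (𝓡 n) ∞ X]
    [CompactSpace X] [T2Space X] :
    ∃ (j : SymplecticShape.MappingClassGroup n X → SymplecticShape.ContactMappingClassGroup n X)
      (I : SymplecticShape.MappingClassGroup n X →
        (SymplecticShape.DeRhamH1 (𝓡 n) X ≃ₗ[ℝ] SymplecticShape.DeRhamH1 (𝓡 n) X))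
      (act : SymplecticShape.ContactMappingClassGroup n X →
        SymplecticShape.ContactFormClass n X → SymplecticShape.ContactFormClass n X)
      (Shape : SymplecticShape.ContactFormClass n X → Set (SymplecticShape.DeRhamH1 (𝓡 n) X)),
      (∀ e : X ≃ₘ⟮𝓡 n, 𝓡 n⟯ X, ∃ f : SymplecticShape.Contactomorphism n X,
        SymplecticShape.IsCanonicalLift e f ∧
          j (ConnectedComponents.mk e) = ConnectedComponents.mk f) ∧
      (∀ e : X ≃ₘ⟮𝓡 n, 𝓡 n⟯ X, ((I (ConnectedComponents.mk e)).symm :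
          SymplecticShape.DeRhamH1 (𝓡 n) X →ₗ[ℝ] SymplecticShape.DeRhamH1 (𝓡 n) X) =
        SymplecticShape.DeRhamH1.map e.toContMDiffMap) ∧
      (∀ (f : SymplecticShape.Contactomorphism n X) (α : SymplecticShape.ContactForm n X),
        act (ConnectedComponents.mk f) (Quot.mk _ α) = Quot.mk _ (f.pushforward α)) ∧
      (∀ α : SymplecticShape.ContactForm n X,
        Shape (Quot.mk _ α) = SymplecticShape.shape α.domain) ∧
      ∀ (u : SymplecticShape.MappingClassGroup n X) (a : SymplecticShape.ContactFormClass n X),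
        Shape (act (j u) a) = I u '' Shape a := SymplecticShape.exists_shape_equivariance
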